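/- Let $V$ be a complete discrete valuation ring with uniformizer $\pi$ and algebraically closed residue field $k$, let $n\ge 0$, and let $P\in\mathbb{P}^n(k)$, regarded as a closed point of $\mathbb{P}^n_V$ with ideal sheaf $I_P\subset\mathcal{O}_{\mathbb{P}^n_V}$. Let $\Gamma(I_P(2))=H^0(\mathbb{P}^n_V,I_P(2))$, the $V$-module of quadratic forms over $V$ vanishing at $P$, and let $\Gamma(I_P(2)\cdot\mathcal{O}_{\mathbb{P}^n_k})$ be the $k$-vector space of quadratic forms over $k$ vanishing at $P$. For a module $M$ write $\mathbb{P}(M)=\operatorname{Proj}(\operatorname{Sym}M)$; a linear subvariety of $\mathbb{P}(M)\otimes_V k$ is a closed subscheme of the form $\mathbb{P}(Q)$ with $Q$ a quotient $k$-vector space of $M\otimes_V k$ (possibly $Q=0$, when $\mathbb{P}(Q)=\emptyset$). Reduction of coefficients is a surjection $\Gamma(I_P(2))\to\Gamma(I_P(2)\cdot\mathcal{O}_{\mathbb{P}^n_k})$, and so defines a closed immersion $\mathbb{P}(\Gamma(I_P(2)\cdot\mathcal{O}_{\mathbb{P}^n_k}))\hookrightarrow\mathbb{P}(\Gamma(I_P(2)))$.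 On $\mathbb{P}^n_V\setminus\{P\}$ the sections in $\Gamma(I_P(2))$ generate $\mathcal{O}(2)$, and thus define a canonical morphism $\phi_0:\mathbb{P}^n_V\setminus\{P\}\to\mathbb{P}(\Gamma(I_P(2)))$. **(A)** Let $f:\tilde{\mathbb{P}}\to\mathbb{P}^n_V$ be the blow-up of $\mathbb{P}^n_V$ at $P$ (it exists), and let $E\subset\tilde{\mathbb{P}}$ be the exceptional divisor. 1. There is a unique morphism $\phi:\tilde{\mathbb{P}}\to\mathbb{P}(\Gamma(I_P(2)))$ extending $\phi_0$, and $\phi$ is a closed immersion. 2. The scheme-theoretic intersection of $\phi(\tilde{\mathbb{P}})$ with $\mathbb{P}(\Gamma(I_P(2)\cdot\mathcal{O}_{\mathbb{P}^n_k}))$ is isomorphic to the blow-up of $\mathbb{P}^n_k$ at $P$, compatibly with the maps to $\mathbb{P}^n_V$. 3. $\phi(E)$ is a linear subvariety of $\mathbb{P}(\Gamma(I_P(2)))\otimes_V k$. **(B)** Let $i:X\hookrightarrow\mathbb{P}^n_V$ be an immersion, let $x$ be a closed point of the special fibre $X_k$, and let $P\in\mathbb{P}^n(k)$ be the point $i(x)$.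 Let $f:\tilde X\to X$ be the blow-up of $X$ at $x$ (it exists). There is a unique morphism $\phi:\tilde X\to\mathbb{P}(\Gamma(I_P(2)))$ extending the composite $X\setminus\{x\}\to\mathbb{P}^n_V\setminus\{P\}\xrightarrow{\phi_0}\mathbb{P}(\Gamma(I_P(2)))$, and $\phi$ is an immersion. If moreover $X$ is regular at $x$, then the image under $\phi$ of the exceptional divisor of $\tilde X$ is a linear subvariety of $\mathbb{P}(\Gamma(I_P(2)))\otimes_V k$. -/

import Mathlib

open CategoryTheory Limits AlgebraicGeometry
open scoped TensorProduct HomogeneousIdeal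

universe u

noncomputable section

namespace PointBlowup

/-! ### Projective space -/

section ProjectiveSpace

variable (n : ℕ) (R : Type u) [CommRing R]

/-- The standard grading of `R[x_0, …, x_n]` by the degree. -/
abbrev grading : ℕ → Submodule R (MvPolynomial (Fin (n + 1)) R) :=
  MvPolynomial.homogeneousSubmodule (Fin (n + 1)) R

instance gradingGradedAlgebra : GradedAlgebra (grading n R) := MvPolynomial.gradedAlgebra

/-- Projective space `ℙⁿ_R = Proj R[x_0, …, x_n]`. -/
abbrev ProjSpace : Scheme.{u} := Proj (grading n R)

/-- The structure morphism `ℙⁿ_R ⟶ Spec R`. -/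
def ProjSpace.toSpec : ProjSpace n R ⟶ Spec (.of R) :=
  Proj.toSpecZero (grading n R) ≫
    Spec.map (CommRingCat.ofHom (algebraMap R (grading n R 0)))

/-- The standard affine open `D₊(x_i)` of `ℙⁿ_R`. -/
def ProjSpace.chart (i : Fin (n + 1)) : (ProjSpace n R).affineOpens :=
  ⟨Proj.basicOpen (grading n R) (MvPolynomial.X i),
    Proj.isAffineOpen_basicOpen (grading n R) (MvPolynomial.X i)
      (MvPolynomial.isHomogeneous_X R i) one_pos⟩

/-- Dehomogenization with respect to a linear form `s`: the ring homomorphism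
`R[x_0, …, x_n] → Γ(ℙⁿ_R, D₊(s))`, `F ↦ F(x_0/s, …, x_n/s)`. -/
def ProjSpace.dehomAt (s : MvPolynomial (Fin (n + 1)) R) (hs : s ∈ grading n R 1) :
    MvPolynomial (Fin (n + 1)) R →+* Γ(ProjSpace n R, Proj.basicOpen (grading n R) s) :=
  (Proj.awayToSection (grading n R) s).hom.comp
    (MvPolynomial.eval₂Hom
      ((HomogeneousLocalization.fromZeroRingHom (grading n R) _).comp
        (algebraMap R (grading n R 0)))
      (fun j => HomogeneousLocalization.Away.mk (grading n R) (d := 1) hs 1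
        (MvPolynomial.X j) (by simpa using MvPolynomial.isHomogeneous_X R j)))

/-- Dehomogenization with respect to `x_i`. For `F` homogeneous of degree `d` this is
`F / x_i^d`, the function describing the section `F` of `𝒪(d)` in the trivialization of
`𝒪(d)` on `D₊(x_i)` by `x_i^d`. -/
def ProjSpace.dehom (i : Fin (n + 1)) :
    MvPolynomial (Fin (n + 1)) R →+* Γ(ProjSpace n R, (ProjSpace.chart n R i).1) :=
  ProjSpace.dehomAt n R (MvPolynomial.X i) (MvPolynomial.isHomogeneous_X R i)

variable {n R}

/-- The global sections `Γ(ℙⁿ_R, ℐ(d))` of the twist of an ideal sheaf `ℐ` of `ℙⁿ_R`, as a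
submodule of `Γ(ℙⁿ_R, 𝒪(d)) = R[x_0, …, x_n]_d`: the forms `F` of degree `d` such that
`F / x_i^d` is a section of `ℐ` on `D₊(x_i)` for every `i`. -/
def twistedSections (I : (ProjSpace n R).IdealSheafData) (d : ℕ) :
    Submodule R (MvPolynomial (Fin (n + 1)) R) where
  carrier := {F | F.IsHomogeneous d ∧
    ∀ i, ProjSpace.dehom n R i F ∈ I.ideal (ProjSpace.chart n R i)}
  add_mem' := fun ha hb => ⟨ha.1.add hb.1, fun i => by
    rw [map_add]; exact add_mem (ha.2 i) (hb.2 i)⟩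
  zero_mem' := ⟨MvPolynomial.isHomogeneous_zero _ _ _, fun i => by
    rw [map_zero]; exact zero_mem _⟩
  smul_mem' := fun c F hF => ⟨(grading n R d).smul_mem c hF.1, fun i => by
    rw [MvPolynomial.smul_eq_C_mul, map_mul]; exact Ideal.mul_mem_left _ _ (hF.2 i)⟩

end ProjectiveSpace

section ProjectiveSpaceMap

variable (n : ℕ) (R S : Type u) [CommRing R] [CommRing S] [Algebra R S]

/-- The base change homomorphism `R[x_0, …, x_n] → S[x_0, …, x_n]` on coefficients. -/
def coeffMap : grading n R →+*ᵍ grading n S where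
  toRingHom := MvPolynomial.map (algebraMap R S)
  map_mem := fun {_ _} hx => MvPolynomial.IsHomogeneous.map hx _

lemma irrelevant_le_coeffMap :
    (grading n S)₊ ≤ (grading n R)₊.map (coeffMap n R S) := by
  rw [HomogeneousIdeal.irrelevant_le]
  intro d hd F hF
  change F ∈ Ideal.map (coeffMap n R S) (HomogeneousIdeal.irrelevant (grading n R)).toIdeal
  have hX : ∀ j, (MvPolynomial.X j : MvPolynomial (Fin (n + 1)) S) ∈
      Ideal.map (coeffMap n R S) (HomogeneousIdeal.irrelevant (grading n R)).toIdeal := by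
    intro j
    have h : (coeffMap n R S) (MvPolynomial.X j) = MvPolynomial.X j := MvPolynomial.map_X _ j
    rw [← h]
    exact Ideal.mem_map_of_mem _ (HomogeneousIdeal.mem_irrelevant_of_mem _ one_pos
      (MvPolynomial.isHomogeneous_X R j))
  rw [F.as_sum]
  refine Ideal.sum_mem _ fun m hm => ?_
  have hm' : m.degree = d := by
    have := hF (MvPolynomial.mem_support_iff.mp hm)
    rwa [Finsupp.degree_eq_weight_one]
  obtain ⟨j, hj⟩ : ∃ j, m j ≠ 0 := by
    by_contra! h
    have : m = 0 := Finsupp.ext h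
    subst this
    simp at hm'
    omega
  rw [MvPolynomial.monomial_eq, Finsupp.prod, ← Finset.mul_prod_erase _ _ (Finsupp.mem_support_iff.mpr hj)]
  refine Ideal.mul_mem_left _ _ (Ideal.mul_mem_right _ _ ?_)
  exact Ideal.pow_mem_of_mem _ (hX j) _ (Nat.pos_of_ne_zero hj)

/-- The canonical morphism `ℙⁿ_S ⟶ ℙⁿ_R` for an `R`-algebra `S`. -/
def ProjSpace.map : ProjSpace n S ⟶ ProjSpace n R :=
  Proj.map (coeffMap n R S) (irrelevant_le_coeffMap n R S)

end ProjectiveSpaceMap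

/-! ### The projective space `ℙ(M) = Proj Sym M` of a module -/

section ProjModule

variable (R : Type u) [CommRing R] (M : Type u) [AddCommGroup M] [Module R M]

/-- The grading of the symmetric algebra by the powers of the image of `M`. -/
abbrev symGrading : ℕ → Submodule R (SymmetricAlgebra R M) :=
  fun d => LinearMap.range (SymmetricAlgebra.ι R M) ^ d

/-- Auxiliary map used to provide the grading of the symmetric algebra. -/
def symGradingι : M →ₗ[R] DirectSum ℕ fun d => symGrading R M d :=
  DirectSum.lof R ℕ (fun d => symGrading R M d) 1 ∘ₗ
    (SymmetricAlgebra.ι R M).codRestrict _ fun m => by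
      simpa only [pow_one] using LinearMap.mem_range_self _ m

lemma symGradingι_apply (m : M) : symGradingι R M m =
    DirectSum.of (fun d => symGrading R M d) 1 ⟨SymmetricAlgebra.ι R M m, by
      simpa only [pow_one] using LinearMap.mem_range_self _ m⟩ := rfl

instance symGradedAlgebra : GradedAlgebra (symGrading R M) :=
  GradedAlgebra.ofAlgHom _ (SymmetricAlgebra.lift (symGradingι R M))
    (by
      ext m
      change DirectSum.coeAlgHom (symGrading R M)
        (SymmetricAlgebra.lift (symGradingι R M) (SymmetricAlgebra.ι R M m)) =
          SymmetricAlgebra.ι R M m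
      rw [SymmetricAlgebra.lift_ι_apply, symGradingι_apply, DirectSum.coeAlgHom_of,
        Subtype.coe_mk])
    fun i x => by
    obtain ⟨x, hx⟩ := x
    dsimp only [Subtype.coe_mk, DirectSum.lof_eq_of]
    induction hx using Submodule.pow_induction_on_left' with
    | algebraMap r =>
      rw [AlgHom.commutes, DirectSum.algebraMap_apply]; rfl
    | add x y i hx hy ihx ihy =>
      rw [map_add, ihx, ihy, ← map_add]
      rfl
    | mem_mul m hm i x hx ih =>
      obtain ⟨_, rfl⟩ := hm
      rw [map_mul, ih, SymmetricAlgebra.lift_ι_apply, symGradingι_apply, DirectSum.of_mul_of]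
      exact DirectSum.of_eq_of_gradedMonoid_eq (Sigma.subtype_ext (add_comm _ _) rfl)

/-- The projective space `ℙ(M) = Proj Sym_R M` of an `R`-module `M`, parametrizing the
invertible quotients of `M`. -/
abbrev ProjModule : Scheme.{u} := Proj (symGrading R M)

end ProjModule

section ProjModuleMap

variable {R S : Type u} [CommRing R] [CommRing S] [Algebra R S]
  {M N : Type u} [AddCommGroup M] [Module R M] [AddCommGroup N] [Module R N] [Module S N]
  [IsScalarTower R S N]

/-- The homomorphism `Sym_R M → Sym_S N` induced by an `R`-linear map `M → N`. -/
def symMap (q : M →ₗ[R] N) : SymmetricAlgebra R M →+* SymmetricAlgebra S N :=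
  letI : Algebra R (SymmetricAlgebra S N) :=
    ((algebraMap S (SymmetricAlgebra S N)).comp (algebraMap R S)).toAlgebra
  (SymmetricAlgebra.lift
    { toFun := fun m => SymmetricAlgebra.ι S N (q m)
      map_add' := fun a b => by rw [map_add, map_add]
      map_smul' := fun r a => by
        rw [map_smul, RingHom.id_apply, ← algebraMap_smul S r (q a), map_smul, Algebra.smul_def]
        exact (Algebra.smul_def r (SymmetricAlgebra.ι S N (q a))).symm } :
    SymmetricAlgebra R M →ₐ[R] SymmetricAlgebra S N).toRingHom

lemma symMap_ι (q : M →ₗ[R] N) (m : M) :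
    symMap (S := S) q (SymmetricAlgebra.ι R M m) = SymmetricAlgebra.ι S N (q m) := by
  let : Algebra R (SymmetricAlgebra S N) :=
    ((algebraMap S (SymmetricAlgebra S N)).comp (algebraMap R S)).toAlgebra
  exact SymmetricAlgebra.lift_ι_apply _ m

lemma symMap_algebraMap (q : M →ₗ[R] N) (r : R) :
    symMap (S := S) q (algebraMap R _ r) = algebraMap S _ (algebraMap R S r) := by
  let : Algebra R (SymmetricAlgebra S N) :=
    ((algebraMap S (SymmetricAlgebra S N)).comp (algebraMap R S)).toAlgebra
  exact AlgHom.commutes _ r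

/-- `symMap` as a homomorphism of graded rings. -/
def symMapGraded (q : M →ₗ[R] N) : symGrading R M →+*ᵍ symGrading S N where
  toRingHom := symMap q
  map_mem := fun {d x} hx => by
    change symMap q x ∈ symGrading S N d
    induction hx using Submodule.pow_induction_on_left' with
    | algebraMap r =>
      rw [symMap_algebraMap]
      exact SetLike.algebraMap_mem_graded (symGrading S N) _
    | add x y i hx hy ihx ihy => rw [map_add]; exact add_mem ihx ihy
    | mem_mul m hm i x hx ih =>
      obtain ⟨m, rfl⟩ := hm
      rw [map_mul, symMap_ι]
      change _ ∈ LinearMap.range (SymmetricAlgebra.ι S N) ^ (i + 1)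
      rw [pow_succ']
      exact Submodule.mul_mem_mul (LinearMap.mem_range_self _ _) ih

lemma irrelevant_le_symMap (q : M →ₗ[R] N) (hq : Function.Surjective q) :
    (symGrading S N)₊ ≤ (symGrading R M)₊.map (symMapGraded (S := S) q) := by
  rw [HomogeneousIdeal.irrelevant_le]
  intro d hd x hx
  change x ∈ Ideal.map (symMapGraded (S := S) q) (HomogeneousIdeal.irrelevant (symGrading R M)).toIdeal
  obtain ⟨d, rfl⟩ := Nat.exists_eq_succ_of_ne_zero hd.ne'
  change x ∈ LinearMap.range (SymmetricAlgebra.ι S N) ^ (d + 1) at hx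
  rw [pow_succ'] at hx
  refine Submodule.mul_induction_on hx (fun a ha b _ => ?_) fun a b ha hb => add_mem ha hb
  obtain ⟨y, rfl⟩ := ha
  obtain ⟨m, rfl⟩ := hq y
  refine Ideal.mul_mem_right _ _ ?_
  have h : symMapGraded (S := S) q (SymmetricAlgebra.ι R M m) = SymmetricAlgebra.ι S N (q m) :=
    symMap_ι q m
  rw [← h]
  refine Ideal.mem_map_of_mem _ (HomogeneousIdeal.mem_irrelevant_of_mem _ one_pos ?_)
  change _ ∈ LinearMap.range (SymmetricAlgebra.ι R M) ^ 1
  rw [pow_one]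
  exact LinearMap.mem_range_self _ _

variable (S) in
/-- The closed immersion `ℙ_S(N) ⟶ ℙ_R(M)` induced by a surjective `R`-linear map `M → N`
onto an `S`-module `N`, for an `R`-algebra `S`. -/
def ProjModule.map (q : M →ₗ[R] N) (hq : Function.Surjective q) :
    ProjModule S N ⟶ ProjModule R M :=
  Proj.map (symMapGraded q) (irrelevant_le_symMap q hq)

end ProjModuleMap

/-! ### Linear subvarieties -/

section Linear

open IsLocalRing

variable {V : Type u} [CommRing V] [IsLocalRing V] {M : Type u} [AddCommGroup M] [Module V M]

/-- The quotient map `M → M ⊗ k → (M ⊗ k) / N`, for `k` the residue field of `V` and a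
subspace `N` of `M ⊗ k`. -/
def residueQuotient (N : Submodule (ResidueField V) (ResidueField V ⊗[V] M)) :
    M →ₗ[V] (ResidueField V ⊗[V] M) ⧸ N :=
  (N.mkQ.restrictScalars V) ∘ₗ TensorProduct.mk V (ResidueField V) M 1

lemma residueQuotient_surjective (N : Submodule (ResidueField V) (ResidueField V ⊗[V] M)) :
    Function.Surjective (residueQuotient N) :=
  (Submodule.mkQ_surjective N).comp
    (TensorProduct.mk_surjective V M (ResidueField V) residue_surjective)

/-- The inclusion of the linear subvariety `ℙ((M ⊗ k) / N)` of `ℙ(M) ⊗ k = ℙ(M ⊗ k)`, as a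
closed subscheme of `ℙ(M)`: it is cut out in `ℙ(M) ⊗ k` by the linear forms in `N`. -/
def linearSubvariety (N : Submodule (ResidueField V) (ResidueField V ⊗[V] M)) :
    ProjModule (ResidueField V) ((ResidueField V ⊗[V] M) ⧸ N) ⟶ ProjModule V M :=
  ProjModule.map (ResidueField V) (residueQuotient N) (residueQuotient_surjective N)

/-- The morphism `z : Z ⟶ ℙ(M)` is an isomorphism of `Z` onto a linear subvariety of
`ℙ(M) ⊗ k`. -/
def IsLinearSubvariety {Z : Scheme.{u}} (z : Z ⟶ ProjModule V M) : Prop :=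
  ∃ (N : Submodule (ResidueField V) (ResidueField V ⊗[V] M))
    (e : Z ≅ ProjModule (ResidueField V) ((ResidueField V ⊗[V] M) ⧸ N)),
    e.hom ≫ linearSubvariety N = z

end Linear

/-! ### Morphisms to `ℙ(M)` given by forms -/

section GivenByForms

variable {n : ℕ} {R : Type u} [CommRing R]

/-- Let `M` be a module of forms of degree `d` in `x_0, …, x_n`, let `h : Y ⟶ ℙⁿ_R` be a
morphism, and let `W` be an open subset of `Y` mapped into `D₊(x_i)` by `h`. This is the
homomorphism `Sym_R M → Γ(W, 𝒪)` extending `M → Γ(W, 𝒪)`, `F ↦ h^*(F / x_i^d)`, i.e. the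
map `M → Γ(W, h^*𝒪(d))` in the trivialization of `h^*𝒪(d)` by `x_i^d`. -/
def formsHom (M : Submodule R (MvPolynomial (Fin (n + 1)) R)) {Y : Scheme.{u}}
    (h : Y ⟶ ProjSpace n R) (i : Fin (n + 1)) (W : Y.Opens)
    (hW : W ≤ h ⁻¹ᵁ (ProjSpace.chart n R i).1) :
    SymmetricAlgebra R M →+* Γ(W.toScheme, ⊤) :=
  (W.topIso.inv.hom.comp (h.appLE _ W hW).hom).comp
    ((ProjSpace.dehom n R i).comp (SymmetricAlgebra.lift M.subtype).toRingHom)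

/-- The forms in `M` generate `h^*𝒪(d)` and `g : Y ⟶ ℙ(M)` is the morphism corresponding to
the invertible quotient `M ⊗ 𝒪_Y → h^*𝒪(d)`. That is, on each affine open subset `W` of `Y`
lying over some `D₊(x_i)`, the functions `h^*(F / x_i^d)`, for `F` in `M`, generate the unit
ideal and `g` is there the morphism with these homogeneous coordinates. -/
def IsGivenByForms (M : Submodule R (MvPolynomial (Fin (n + 1)) R)) {Y : Scheme.{u}}
    (h : Y ⟶ ProjSpace n R) (g : Y ⟶ ProjModule R M) : Prop :=
  ∀ (i : Fin (n + 1)) (W : Y.affineOpens) (hW : W.1 ≤ h ⁻¹ᵁ (ProjSpace.chart n R i).1),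
    ∃ hgen : (symGrading R M)₊.toIdeal.map (formsHom M h i W.1 hW) = ⊤,
      W.1.ι ≫ g = Proj.fromOfGlobalSections (symGrading R M) (formsHom M h i W.1 hW) hgen

end GivenByForms

/-! ### Blow-ups -/

section Blowup

/-- An ideal sheaf is invertible if it is locally generated by a nonzerodivisor. -/
def IsInvertibleIdeal {X : Scheme.{u}} (I : X.IdealSheafData) : Prop :=
  ∀ x : X, ∃ U : X.affineOpens, x ∈ U.1 ∧
    ∃ a ∈ nonZeroDivisors Γ(X, U.1), I.ideal U = Ideal.span {a}

/-- `f : B ⟶ X` is the blow-up of `X` along the closed subscheme with ideal sheaf `I`: the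
inverse image ideal sheaf `I·𝒪_B` is invertible, and `f` is universal with this property. -/
structure IsBlowup {X B : Scheme.{u}} (f : B ⟶ X) (I : X.IdealSheafData) : Prop where
  isInvertibleIdeal : IsInvertibleIdeal (I.comap f)
  existsUnique_lift : ∀ {Y : Scheme.{u}} (g : Y ⟶ X), IsInvertibleIdeal (I.comap g) →
    ∃! h : Y ⟶ B, h ≫ f = g

/-- The inclusion of the exceptional divisor of a blow-up `f : B ⟶ X` along `I`: the closed
subscheme of `B` defined by `I·𝒪_B`. -/
def exceptionalDivisor {X B : Scheme.{u}} (f : B ⟶ X) (I : X.IdealSheafData) :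
    (I.comap f).subscheme ⟶ B :=
  (I.comap f).subschemeι

/-- Given an open `U` of `X` and `φ₀ : U ⟶ Z`, the morphism `φ : B ⟶ Z` agrees with
`f⁻¹(U) ⟶ U ⟶ Z` on the open subscheme `f⁻¹(U) = B ×_X U` of `B`. -/
def Extends {X B Z : Scheme.{u}} (f : B ⟶ X) {U : X.Opens} (φ₀ : U.toScheme ⟶ Z)
    (φ : B ⟶ Z) : Prop :=
  pullback.fst f U.ι ≫ φ = pullback.snd f U.ι ≫ φ₀

end Blowup

/-! ### Quadrics through a point of the special fibre -/

section SpecialPoint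

open IsLocalRing

variable {V : Type u} [CommRing V] [IsLocalRing V] {n : ℕ}

/-- The ideal sheaf `ℐ_P` of `P ∈ ℙⁿ(k)` in `ℙⁿ_V`, for `k` the residue field of `V`. -/
def idealOfPoint (P : Spec (.of (ResidueField V)) ⟶ ProjSpace n (ResidueField V)) :
    (ProjSpace n V).IdealSheafData :=
  (P ≫ ProjSpace.map n V (ResidueField V)).ker

/-- The open complement `ℙⁿ_V ∖ {P}`. -/
def complPoint (P : Spec (.of (ResidueField V)) ⟶ ProjSpace n (ResidueField V)) :
    (ProjSpace n V).Opens :=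
  (idealOfPoint P).support.compl

/-- `Γ(ℐ_P(2))`: the quadratic forms over `V` vanishing at `P`. -/
abbrev quadrics (P : Spec (.of (ResidueField V)) ⟶ ProjSpace n (ResidueField V)) :
    Submodule V (MvPolynomial (Fin (n + 1)) V) :=
  twistedSections (idealOfPoint P) 2

/-- `Γ(ℐ_P(2)·𝒪_{ℙⁿ_k})`: the quadratic forms over `k` vanishing at `P`. Here
`ℐ_P·𝒪_{ℙⁿ_k}`, which is the ideal sheaf of `P` in `ℙⁿ_k`, is given as the kernel of
`𝒪_{ℙⁿ_k} → P_*𝒪`. -/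
abbrev specialQuadrics (P : Spec (.of (ResidueField V)) ⟶ ProjSpace n (ResidueField V)) :
    Submodule (ResidueField V) (MvPolynomial (Fin (n + 1)) (ResidueField V)) :=
  twistedSections P.ker 2

lemma map_dehomAt (R S : Type u) [CommRing R] [CommRing S] [Algebra R S] (n : ℕ)
    (s : MvPolynomial (Fin (n + 1)) R) (hs : s ∈ grading n R 1)
    (t : MvPolynomial (Fin (n + 1)) S) (ht : t ∈ grading n S 1) (hst : coeffMap n R S s = t)
    (F : MvPolynomial (Fin (n + 1)) R)
    (h : Proj.basicOpen (grading n S) t ≤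
      ProjSpace.map n R S ⁻¹ᵁ Proj.basicOpen (grading n R) s) :
    ((ProjSpace.map n R S).appLE _ _ h).hom (ProjSpace.dehomAt n R s hs F) =
      ProjSpace.dehomAt n S t ht (MvPolynomial.map (algebraMap R S) F) := by
  subst hst
  have key := Proj.awayToSection_comp_appLE (coeffMap n R S) (irrelevant_le_coeffMap n R S) hs
  have key' : ∀ a, ((ProjSpace.map n R S).appLE _ _ h).hom
      ((Proj.awayToSection (grading n R) s).hom a) =
      (Proj.awayToSection (grading n S) (coeffMap n R S s)).hom
        (HomogeneousLocalization.Away.map (coeffMap n R S) s a) := fun a =>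
    congr($(key).hom a)
  rw [ProjSpace.dehomAt, ProjSpace.dehomAt, RingHom.comp_apply, key', RingHom.comp_apply]
  congr 1
  simp only [← RingHom.comp_apply]
  congr 1
  ext a
  · simp only [RingHom.comp_apply, MvPolynomial.eval₂Hom_C, MvPolynomial.map_C]
    change Localization.mk (coeffMap n R S (MvPolynomial.C a)) ⟨coeffMap n R S 1, _⟩ =
      Localization.mk (MvPolynomial.C (algebraMap R S a)) ⟨1, _⟩
    have h1 : coeffMap n R S (MvPolynomial.C a) = MvPolynomial.C (algebraMap R S a) :=
      MvPolynomial.map_C _ a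
    simp only [h1, map_one]
  · simp only [RingHom.comp_apply, MvPolynomial.eval₂Hom_X', MvPolynomial.map_X]
    rw [HomogeneousLocalization.Away.map_mk]
    have h1 : coeffMap n R S (MvPolynomial.X a) = MvPolynomial.X a := MvPolynomial.map_X _ a
    simp only [h1]

lemma map_dehom (R S : Type u) [CommRing R] [CommRing S] [Algebra R S] (n : ℕ)
    (i : Fin (n + 1)) (F : MvPolynomial (Fin (n + 1)) R)
    (h : (ProjSpace.chart n S i).1 ≤ ProjSpace.map n R S ⁻¹ᵁ (ProjSpace.chart n R i).1) :
    ((ProjSpace.map n R S).appLE _ _ h).hom (ProjSpace.dehom n R i F) =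
      ProjSpace.dehom n S i (MvPolynomial.map (algebraMap R S) F) :=
  map_dehomAt R S n _ (MvPolynomial.isHomogeneous_X R i) _ (MvPolynomial.isHomogeneous_X S i)
    (MvPolynomial.map_X _ i) F h

lemma map_preimage_chart (R S : Type u) [CommRing R] [CommRing S] [Algebra R S] (n : ℕ)
    (i : Fin (n + 1)) :
    ProjSpace.map n R S ⁻¹ᵁ (ProjSpace.chart n R i).1 = (ProjSpace.chart n S i).1 := by
  change Proj.basicOpen (grading n S) (coeffMap n R S (MvPolynomial.X i)) =
    Proj.basicOpen (grading n S) (MvPolynomial.X i)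
  congr 1
  exact MvPolynomial.map_X _ i

lemma comp_app_eq_zero_iff {X Y Z : Scheme.{u}} (f : X ⟶ Y) (g : Y ⟶ Z) (U : Z.Opens)
    (W : Y.Opens) (hW : g ⁻¹ᵁ U = W) (hle : W ≤ g ⁻¹ᵁ U) (a : Γ(Z, U)) :
    ((f ≫ g).app U).hom a = 0 ↔ (f.app W).hom ((g.appLE U W hle).hom a) = 0 := by
  subst hW
  rw [Scheme.Hom.appLE_eq_app, Scheme.Hom.comp_app]
  rfl

lemma dehom_mem_iff (P : Spec (.of (ResidueField V)) ⟶ ProjSpace n (ResidueField V))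
    (i : Fin (n + 1)) (F : MvPolynomial (Fin (n + 1)) V) :
    ProjSpace.dehom n V i F ∈ (idealOfPoint P).ideal (ProjSpace.chart n V i) ↔
    ProjSpace.dehom n (ResidueField V) i (MvPolynomial.map (algebraMap V (ResidueField V)) F) ∈
      P.ker.ideal (ProjSpace.chart n (ResidueField V) i) := by
  have hle := (map_preimage_chart V (ResidueField V) n i).ge
  rw [idealOfPoint, Scheme.Hom.ker_apply, Scheme.Hom.ker_apply, RingHom.mem_ker, RingHom.mem_ker,
    ← map_dehom V (ResidueField V) n i F hle]
  exact comp_app_eq_zero_iff P _ _ _ (map_preimage_chart V (ResidueField V) n i) hle _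

lemma map_mem_specialQuadrics
    (P : Spec (.of (ResidueField V)) ⟶ ProjSpace n (ResidueField V))
    (F : MvPolynomial (Fin (n + 1)) V) (hF : F ∈ quadrics P) :
    MvPolynomial.map (algebraMap V (ResidueField V)) F ∈ specialQuadrics P :=
  ⟨hF.1.map _, fun i => (dehom_mem_iff P i F).mp (hF.2 i)⟩

/-- The restriction map `Γ(ℐ_P(2)) → Γ(ℐ_P(2)·𝒪_{ℙⁿ_k})`, i.e. reduction of coefficients. -/
def reduction (P : Spec (.of (ResidueField V)) ⟶ ProjSpace n (ResidueField V)) :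
    quadrics P →ₗ[V] specialQuadrics P where
  toFun F := ⟨_, map_mem_specialQuadrics P F.1 F.2⟩
  map_add' a b := Subtype.ext (map_add _ a.1 b.1)
  map_smul' c a := Subtype.ext (by
    change MvPolynomial.map (algebraMap V (ResidueField V)) (c • a.1) = 
      c • MvPolynomial.map (algebraMap V (ResidueField V)) a.1
    rw [MvPolynomial.smul_eq_C_mul, map_mul, MvPolynomial.map_C,
      ← algebraMap_smul (ResidueField V) c, MvPolynomial.smul_eq_C_mul])

lemma reduction_surjective (P : Spec (.of (ResidueField V)) ⟶ ProjSpace n (ResidueField V)) :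
    Function.Surjective (reduction P) := by
  rintro ⟨G, hG⟩
  obtain ⟨F, hF⟩ := MvPolynomial.map_surjective (σ := Fin (n + 1))
    (algebraMap V (ResidueField V)) residue_surjective G
  have hF' : MvPolynomial.map (algebraMap V (ResidueField V))
      (MvPolynomial.homogeneousComponent 2 F) = G := by
    rw [← (MvPolynomial.homogeneousComponent_of_mem hG.1).trans (if_pos rfl)]
    ext m
    rw [MvPolynomial.coeff_map, MvPolynomial.coeff_homogeneousComponent,
      MvPolynomial.coeff_homogeneousComponent, ← hF, MvPolynomial.coeff_map]
    split_ifs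
    · rfl
    · exact map_zero _
  refine ⟨⟨MvPolynomial.homogeneousComponent 2 F,
    MvPolynomial.homogeneousComponent_isHomogeneous 2 F, fun i => ?_⟩, Subtype.ext hF'⟩
  rw [dehom_mem_iff, hF']
  exact hG.2 i

/-- The closed immersion `ℙ(Γ(ℐ_P(2)·𝒪_{ℙⁿ_k})) ⟶ ℙ(Γ(ℐ_P(2)))`. -/
def specialHyperplane (P : Spec (.of (ResidueField V)) ⟶ ProjSpace n (ResidueField V)) :
    ProjModule (ResidueField V) (specialQuadrics P) ⟶ ProjModule V (quadrics P) :=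
  ProjModule.map (ResidueField V) (reduction P) (reduction_surjective P)

end SpecialPoint

end PointBlowup

end

/-! Write `I` for the ideal sheaf of `P`, `M` for the module of quadrics through `P`, and `ℓ` for a
linear form through `P`; the forms `r x_i` with `r` in the maximal ideal of `V` are among the `ℓ`.
The blow-up is realized as the scheme-theoretic image of `φ₀` in `ℙ(M)`.

`M` is spanned by the products `ℓ x_i` (`IsPointIdeal.twistedSections_two_eq_span`), so the opens
`D₊(ℓ x_i)` cover `ℙ(M)`. On the part of the image in `D₊(ℓ x_i)` the ratios `(ℓ x_j)/(ℓ x_i) =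
x_j/x_i` recover the point of `ℙⁿ`, which gives `f` from the image to `ℙⁿ`. The relation `(ℓ ℓ')(ℓ
x_i) = (ℓ' x_i) ℓ²` between quadrics shows that `I` becomes principal there, with generator `ℓ²/(ℓ
x_i)` (`IsQuadricModel.comap_ideal`). Conversely, if `I` becomes invertible on `Y`, with local
generator `a`, then the quotients `F/a`, for `F` in `M`, are homogeneous coordinates of a morphism
`Y ⟶ ℙ(M)` extending `φ₀` (`IsPointIdeal.exists_isQuotientBy`). The complement of an invertible
ideal is scheme-theoretically dense and `ℙ(M)` is separated, so extensions are unique and factor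
through the image. This is the universal property (`isBlowup_of_image`). For an immersed `X` the
blow-up is the strict transform, closed in the fibre product of `X` with the blow-up of `ℙⁿ`
(`exists_strictTransform`); hence its map to `ℙ(M)` is an immersion.

Exceptional divisor `E`: if `F` lies in the square of the ideal of the point, then `F/a` is a
multiple of `a` and vanishes on `E`. So `E` lies in `ℙ(Q)`, where `Q` is the quotient of `M ⊗ k` by
those quadrics. If the local ring at the point is regular, every rational point of `ℙ(Q)` is
attained: a functional on `Q` gives a hyperplane in the cotangent space, and fewer equations than
the dimension lift this hyperplane. A minimal prime over them is not maximal by Krull's height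
theorem, and its quotient is a local domain `C` with principal maximal ideal (`exists_curve`). The
curve `Spec C` lifts to the blow-up, and its closed point goes to the chosen point of `ℙ(Q)`
(`IsPointIdeal.exists_point`). As `k` is infinite, a closed subscheme through all rational points of
`ℙ(Q)` is everything (`isIso_of_forall_exists_point`).

Special hyperplane section: let `ϖ` be a uniformizer. On `D₊(ℓ x_i)` put `b = ℓ²/(ℓ x_i)` and `w = ϖ
x_i²/(ℓ x_i)`, so that `w b = ϖ`. The special hyperplane is cut out on the blow-up by `w`, and `E`
by `b`. Since `E` is linear, functions modulo `b` have no zero divisors, and `w` is nonzero there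
unless that part of `E` is empty. Hence `b` stays a nonzerodivisor modulo `w`, so the ideal of `P`
is invertible on the section (`IsQuadricModel.isInvertibleIdeal_pullback`). The universal property
over `ℙⁿ_k` is inherited from the one over `ℙⁿ_V`. -/

noncomputable section

namespace PointBlowup

/-! ### Inverse images of ideal sheaves, invertible ideals and scheme-theoretic density -/

section IdealSheaf

/-- Two morphisms to a separated scheme which agree after precomposition with a
scheme-theoretically dominant morphism are equal. -/
lemma hom_ext_of_ker_eq_bot {Y₀ Y Z : Scheme.{u}} [Z.IsSeparated] (j : Y₀ ⟶ Y)
    [IsSchemeTheoreticallyDominant j] {h₁ h₂ : Y ⟶ Z} (h : j ≫ h₁ = j ≫ h₂) : h₁ = h₂ := by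
  -- The equalizer is a closed subscheme because `Z` is separated, and `j` factors through it, so
  -- its ideal is contained in `j.ker`.
  have hk : (equalizer.ι h₁ h₂).ker = ⊥ := by
    rw [← le_bot_iff, ← j.ker_eq_bot, ← equalizer.lift_ι j h]
    exact Scheme.Hom.le_ker_comp _ _
  have : IsIso (equalizer.ι h₁ h₂) := IsClosedImmersion.isIso_iff_ker_eq_bot.mpr hk
  rw [← cancel_epi (equalizer.ι h₁ h₂), equalizer.condition]

/-- Both sides are determined by the ideals containing them. The adjunction between inverse and
direct image of ideal sheaves becomes, on global sections, the adjunction between `Ideal.map` and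
`Ideal.comap`. -/
lemma comap_ideal_of_isAffine {X Y : Scheme.{u}} [IsAffine X] [IsAffine Y] (g : Y ⟶ X)
    (I : X.IdealSheafData) :
    (I.comap g).ideal ⟨⊤, isAffineOpen_top Y⟩ =
      (I.ideal ⟨⊤, isAffineOpen_top X⟩).map g.appTop.hom := by
  have key : ∀ J : Y.IdealSheafData, I.comap g ≤ J ↔
      (I.ideal ⟨⊤, isAffineOpen_top X⟩).map g.appTop.hom ≤ J.ideal ⟨⊤, isAffineOpen_top Y⟩ := by
    intro J
    rw [← Scheme.IdealSheafData.le_map_iff_comap_le, Ideal.map_le_iff_le_comap]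
    constructor
    · intro h
      exact (h ⟨⊤, isAffineOpen_top X⟩).trans
        (Scheme.IdealSheafData.ideal_map_of_isAffineHom J g ⟨⊤, isAffineOpen_top X⟩).le
    · intro h
      refine Scheme.IdealSheafData.le_of_iSup_eq_top (ι := Unit)
        (fun _ => ⟨⊤, isAffineOpen_top X⟩) (by simp) fun _ => ?_
      exact h.trans
        (Scheme.IdealSheafData.ideal_map_of_isAffineHom J g ⟨⊤, isAffineOpen_top X⟩).ge
  let J₀ : Y.IdealSheafData := Scheme.IdealSheafData.equivOfIsAffine.symm
    ((I.ideal ⟨⊤, isAffineOpen_top X⟩).map g.appTop.hom)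
  have hJ₀ : J₀.ideal ⟨⊤, isAffineOpen_top Y⟩ =
      (I.ideal ⟨⊤, isAffineOpen_top X⟩).map g.appTop.hom :=
    Scheme.IdealSheafData.equivOfIsAffine.apply_symm_apply _
  exact le_antisymm (((key J₀).mpr hJ₀.ge _).trans hJ₀.le) ((key _).mp le_rfl)

lemma comap_ideal_of_isOpenImmersion {X Y : Scheme.{u}} (I : X.IdealSheafData) (f : Y ⟶ X)
    [IsOpenImmersion f] (W : Y.affineOpens) (D : X.affineOpens) (h : f ''ᵁ W.1 = D.1)
    (e : W.1 ≤ f ⁻¹ᵁ D.1) :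
    (I.comap f).ideal W = (I.ideal D).map (f.appLE D.1 W.1 e).hom := by
  obtain ⟨D, hD⟩ := D
  dsimp at h
  subst h
  rw [Scheme.IdealSheafData.ideal_comap_of_isOpenImmersion]
  have : f.appLE (f ''ᵁ W.1) W.1 e = (f.appIso W.1).hom := by
    rw [Scheme.Hom.appIso_hom', Scheme.Hom.appLE]
  rw [this]
  exact Ideal.comap_symm (f.appIso W.1).commRingCatIsoToRingEquiv

lemma appLE_ι_eq_topIso_inv {Y : Scheme.{u}} (W : Y.Opens) :
    W.ι.appLE W ⊤ (by simp) = W.topIso.inv := by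
  simp only [Scheme.Hom.appLE, Scheme.Opens.ι_app, Scheme.Opens.topIso]
  exact (Y.presheaf.map_comp _ _).symm

lemma map_topIso_inv_injective {Y : Scheme.{u}} (W : Y.Opens) :
    Function.Injective (Ideal.map W.topIso.inv.hom) := by
  intro a b hab
  have := congrArg (Ideal.map W.topIso.hom.hom) hab
  simpa only [Ideal.map_map, ← CommRingCat.hom_comp, Iso.inv_hom_id, CommRingCat.hom_id,
    Ideal.map_id] using this

/-- The inverse image ideal sheaf is, on affine opens, the extension of ideals. -/
lemma comap_ideal {X Y : Scheme.{u}} (I : X.IdealSheafData) (g : Y ⟶ X)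
    (D : X.affineOpens) (W : Y.affineOpens) (e : W.1 ≤ g ⁻¹ᵁ D.1) :
    (I.comap g).ideal W = (I.ideal D).map (g.appLE D.1 W.1 e).hom := by
  have : IsAffine W.1.toScheme := W.2
  have : IsAffine D.1.toScheme := D.2
  have h1 : (I.comap (W.1.ι ≫ g)).ideal ⟨⊤, isAffineOpen_top _⟩ =
      ((I.comap g).ideal W).map (W.1.ι.appLE W.1 ⊤ (by simp)).hom := by
    rw [Scheme.IdealSheafData.comap_comp]
    exact comap_ideal_of_isOpenImmersion _ _ _ _ (by simp) _
  -- This factorization reduces to the affine case, the two inclusions being open immersions.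
  have h2 : W.1.ι ≫ g = g.resLE D.1 W.1 e ≫ D.1.ι := by simp
  have h3 := comap_ideal_of_isAffine (g.resLE D.1 W.1 e) (I.comap D.1.ι)
  rw [← Scheme.IdealSheafData.comap_comp, ← h2, h1, comap_ideal_of_isOpenImmersion I D.1.ι
    ⟨⊤, isAffineOpen_top _⟩ D (by simp) (by simp), Ideal.map_map, ← CommRingCat.hom_comp] at h3
  have h4 : D.1.ι.appLE D.1 ⊤ (by simp) ≫ (g.resLE D.1 W.1 e).appTop =
      g.appLE D.1 W.1 e ≫ W.1.ι.appLE W.1 ⊤ (by simp) := by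
    have h5 : (g.resLE D.1 W.1 e).appTop = (g.resLE D.1 W.1 e).appLE ⊤ ⊤ (by simp) :=
      Scheme.Hom.app_eq_appLE _
    rw [h5, Scheme.Hom.appLE_comp_appLE]
    refine (Scheme.Hom.appLE_comp_appLE (g.resLE D.1 W.1 e) D.1.ι D.1 ⊤ ⊤ _ _).trans ?_
    simp only [h2]
  rw [h4, CommRingCat.hom_comp, ← Ideal.map_map] at h3
  rw [appLE_ι_eq_topIso_inv] at h3
  exact map_topIso_inv_injective _ h3

lemma ideal_eq_bot_of_comap_ι {Y : Scheme.{u}} (J : Y.IdealSheafData) (V : Y.affineOpens)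
    (h : J.comap V.1.ι = ⊥) : J.ideal V = ⊥ := by
  have : IsAffine V.1.toScheme := V.2
  have h1 := comap_ideal_of_isOpenImmersion J V.1.ι ⟨⊤, isAffineOpen_top _⟩ V (by simp) (by simp)
  rw [h, appLE_ι_eq_topIso_inv, Scheme.IdealSheafData.ideal_bot, Pi.bot_apply] at h1
  apply map_topIso_inv_injective
  rw [Ideal.map_bot]
  exact h1.symm

/-- Vanishing of an ideal sheaf is local. -/
lemma eq_bot_of_forall_comap_ι_eq_bot {Y : Scheme.{u}} (J : Y.IdealSheafData)
    (h : ∀ y : Y, ∃ W : Y.Opens, y ∈ W ∧ J.comap W.ι = ⊥) : J = ⊥ := by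
  choose W hyW hW using h
  have h1 : ∀ y : Y, ∃ V : Y.affineOpens, y ∈ V.1 ∧ V.1 ≤ W y := fun y => by
    obtain ⟨_, ⟨V, hV, rfl⟩, hyV, hVW⟩ :=
      Y.isBasis_affineOpens.exists_subset_of_mem_open (hyW y) (W y).isOpen
    exact ⟨⟨V, hV⟩, hyV, hVW⟩
  choose V hyV hVW using h1
  refine Scheme.IdealSheafData.ext_of_iSup_eq_top V
    (top_le_iff.mp fun y _ => TopologicalSpace.Opens.mem_iSup.mpr ⟨y, hyV y⟩) fun y => ?_
  rw [ideal_eq_bot_of_comap_ι J (V y)]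
  · rfl
  · rw [← Scheme.homOfLE_ι _ (hVW y), Scheme.IdealSheafData.comap_comp, hW,
      Scheme.IdealSheafData.comap_bot]

lemma IsInvertibleIdeal.top (X : Scheme.{u}) : IsInvertibleIdeal (⊤ : X.IdealSheafData) := by
  intro x
  obtain ⟨_, ⟨U, hU, rfl⟩, hx, -⟩ :=
    X.isBasis_affineOpens.exists_subset_of_mem_open (Set.mem_univ x) isOpen_univ
  exact ⟨⟨U, hU⟩, hx, 1, one_mem _, by simp⟩

lemma comap_eq_top_of_disjoint {X Y : Scheme.{u}} (I : X.IdealSheafData) (g : Y ⟶ X)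
    (h : ∀ y, g y ∉ I.support) : I.comap g = ⊤ := by
  rw [← Scheme.IdealSheafData.support_eq_bot_iff, Scheme.IdealSheafData.support_comap]
  ext y
  simpa using h y

/-- The open complement of the support of an ideal sheaf. -/
abbrev suppCompl {X : Scheme.{u}} (I : X.IdealSheafData) : X.Opens := I.support.compl

lemma comap_ι_suppCompl {X : Scheme.{u}} (I : X.IdealSheafData) :
    I.comap (suppCompl I).ι = ⊤ :=
  comap_eq_top_of_disjoint I _ fun y => y.2

lemma ideal_eq_span_map {Y : Scheme.{u}} (J : Y.IdealSheafData) {W W' : Y.affineOpens}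
    (h : W' ≤ W) {a : Γ(Y, W.1)} (ha : J.ideal W = Ideal.span {a}) :
    J.ideal W' = Ideal.span {(Y.presheaf.map (homOfLE h).op).hom a} := by
  rw [← J.map_ideal h, ha, Ideal.map_span, Set.image_singleton]

/-- An invertible ideal sheaf has local generators on arbitrarily small affine opens. -/
lemma IsInvertibleIdeal.exists_le {Y : Scheme.{u}} {J : Y.IdealSheafData}
    (hJ : IsInvertibleIdeal J) {U : Y.Opens} {y : Y} (hy : y ∈ U) :
    ∃ W : Y.affineOpens, y ∈ W.1 ∧ W.1 ≤ U ∧ ∃ a ∈ nonZeroDivisors Γ(Y, W.1),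
      J.ideal W = Ideal.span {a} := by
  obtain ⟨W, hyW, a, ha, hJW⟩ := hJ y
  obtain ⟨g, hgU, hyg⟩ := W.2.exists_basicOpen_le ⟨y, hy⟩ hyW
  have := W.2.isLocalization_basicOpen g
  refine ⟨Y.affineBasicOpen g, hyg, hgU, _, ?_,
    ideal_eq_span_map J (Y.affineBasicOpen_le g) hJW⟩
  exact IsLocalization.map_nonZeroDivisors_le (.powers g) Γ(Y, Y.basicOpen g)
    ⟨a, ha, rfl⟩

/-- A generator of an invertible ideal sheaf on an affine open is a nonzerodivisor. -/
lemma IsInvertibleIdeal.mem_nonZeroDivisors {Y : Scheme.{u}} {J : Y.IdealSheafData}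
    (hJ : IsInvertibleIdeal J) {W : Y.affineOpens} {b : Γ(Y, W.1)}
    (hb : J.ideal W = Ideal.span {b}) : b ∈ nonZeroDivisors Γ(Y, W.1) := by
  rw [mem_nonZeroDivisors_iff_right]
  intro s hs
  refine Y.IsSheaf.section_ext fun y hy => ?_
  obtain ⟨W', hyW', hW', a, ha, hJa⟩ := hJ.exists_le hy
  refine ⟨W'.1, hW', hyW', ?_⟩
  have hb' := ideal_eq_span_map J (show W' ≤ W from hW') hb
  set ρ := (Y.presheaf.map (homOfLE hW').op).hom
  change ρ s = ρ 0
  have hs' : ρ s * ρ b = 0 := by rw [← map_mul, hs, map_zero]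
  -- Both elements generate the ideal on `W'`, and a divisor of a nonzerodivisor is a
  -- nonzerodivisor.
  obtain ⟨v, hv⟩ : ρ b ∣ a := by
    rw [← Ideal.mem_span_singleton]
    exact hb' ▸ hJa ▸ Ideal.mem_span_singleton_self a
  rw [map_zero]
  refine mem_nonZeroDivisors_iff_right.mp ha _ ?_
  rw [hv, ← mul_assoc, hs', zero_mul]

lemma map_eq_zero_of_ι_app_eq_zero {Y : Scheme.{u}} {O U D : Y.Opens} {s : Γ(Y, U)}
    (hs : (O.ι.app U).hom s = 0) (hO : D ≤ O) (hU : D ≤ U) :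
    (Y.presheaf.map (homOfLE hU).op).hom s = 0 := by
  have h1 : D ≤ O.ι ''ᵁ (O.ι ⁻¹ᵁ U) := by
    rw [Scheme.Hom.image_preimage_eq_opensRange_inf, Scheme.Opens.opensRange_ι]
    exact le_inf hO hU
  have h2 : Y.presheaf.map (homOfLE hU).op = O.ι.app U ≫ Y.presheaf.map (homOfLE h1).op := by
    rw [Scheme.Opens.ι_app]
    exact Y.presheaf.map_comp _ _
  rw [h2]
  exact (congrArg (Y.presheaf.map (homOfLE h1).op).hom hs).trans (map_zero _)

/-- The complement of the support of an invertible ideal sheaf is scheme-theoretically dense. -/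
lemma IsInvertibleIdeal.isSchemeTheoreticallyDominant_ι {Y : Scheme.{u}} {J : Y.IdealSheafData}
    (hJ : IsInvertibleIdeal J) : IsSchemeTheoreticallyDominant (suppCompl J).ι := by
  constructor
  rw [← le_bot_iff]
  intro U s hs
  have hs' : ((suppCompl J).ι.app U.1).hom s = 0 := Scheme.Hom.ideal_ker_le _ _ hs
  rw [Scheme.IdealSheafData.ideal_bot, Pi.bot_apply, Ideal.mem_bot]
  refine Y.IsSheaf.section_ext fun y hyU => ?_
  obtain ⟨W, hyW, hWU, a, ha, hJW⟩ := hJ.exists_le hyU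
  refine ⟨W.1, hWU, hyW, ?_⟩
  set t := (Y.presheaf.map (homOfLE hWU).op).hom s with ht
  change t = (Y.presheaf.map (homOfLE hWU).op).hom 0
  rw [map_zero]
  -- The ideal is trivial where `a` is invertible, so `s` vanishes there. Hence a power of `a` kills
  -- it, and `a` is a nonzerodivisor.
  have hle : Y.basicOpen a ≤ suppCompl J := by
    intro z hz hz'
    have hzW : z ∈ W.1 := Y.basicOpen_le a hz
    rw [SetLike.mem_coe, Scheme.IdealSheafData.mem_support_iff_of_mem hzW, hJW,
      Scheme.mem_zeroLocus_iff] at hz'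
    exact hz' a (Ideal.mem_span_singleton_self a) hz
  have hle' : Y.basicOpen a ≤ U.1 := (Y.basicOpen_le a).trans hWU
  have h0 : t |_ (Y.basicOpen a) = 0 := by
    have h1 := map_eq_zero_of_ι_app_eq_zero hs' hle hle'
    rw [← h1, ht]
    change (Y.presheaf.map _).hom ((Y.presheaf.map _).hom s) = _
    rw [← CommRingCat.comp_apply, ← Functor.map_comp]
    rfl
  obtain ⟨n, hn⟩ := exists_pow_mul_eq_zero_of_res_basicOpen_eq_zero_of_isAffineOpen Y W.2 t a h0
  exact mem_nonZeroDivisors_iff_left.mp (pow_mem ha n) _ hn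

/-- Up to isomorphism this is the inclusion of the complement of the support of `I.comap f`, which
is dense because that ideal is invertible. -/
lemma pullback_fst_isSchemeTheoreticallyDominant {X Y : Scheme.{u}} (I : X.IdealSheafData)
    (f : Y ⟶ X) (hI : IsInvertibleIdeal (I.comap f)) :
    IsSchemeTheoreticallyDominant (pullback.fst f (suppCompl I).ι) := by
  have h1 : f ⁻¹ᵁ suppCompl I = suppCompl (I.comap f) := by
    ext y
    simp [suppCompl]
  have := hI.isSchemeTheoreticallyDominant_ι
  rw [← h1] at this
  rw [← pullbackRestrictIsoRestrict_hom_ι]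
  infer_instance

/-- Morphisms to a separated scheme can be extended locally along a scheme-theoretically
dominant quasi-compact morphism. -/
lemma exists_extension {Y₀ Y Z : Scheme.{u}} [Z.IsSeparated] (j : Y₀ ⟶ Y) [QuasiCompact j]
    [IsSchemeTheoreticallyDominant j] (h₀ : Y₀ ⟶ Z)
    (H : ∀ y : Y, ∃ (W : Y.Opens) (h : W.toScheme ⟶ Z), y ∈ W ∧
      pullback.snd j W.ι ≫ h = pullback.fst j W.ι ≫ h₀) :
    ∃ h : Y ⟶ Z, j ≫ h = h₀ := by
  choose W h hyW hh using H
  let 𝒰 := Y.openCoverOfIsOpenCover W (top_le_iff.mp fun y _ =>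
    TopologicalSpace.Opens.mem_iSup.mpr ⟨y, hyW y⟩)
  have hcompat : ∀ y z : Y, pullback.fst (W y).ι (W z).ι ≫ h y =
      pullback.snd (W y).ι (W z).ι ≫ h z := by
    intro y z
    let q := pullback.fst (W y).ι (W z).ι ≫ (W y).ι
    -- The base change of `j` along the open immersion `q` is still dominant, and after it both
    -- local extensions become `h₀`.
    refine hom_ext_of_ker_eq_bot (pullback.snd j q) ?_
    have h1 : pullback.snd j q ≫ pullback.fst (W y).ι (W z).ι =
        pullback.lift (pullback.fst j q) (pullback.snd j q ≫ pullback.fst (W y).ι (W z).ι)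
          (by rw [pullback.condition, Category.assoc]) ≫ pullback.snd j (W y).ι :=
      (pullback.lift_snd _ _ _).symm
    have h2 : pullback.snd j q ≫ pullback.snd (W y).ι (W z).ι =
        pullback.lift (pullback.fst j q) (pullback.snd j q ≫ pullback.snd (W y).ι (W z).ι)
          (by rw [pullback.condition, Category.assoc, ← pullback.condition (f := (W y).ι)]) ≫
            pullback.snd j (W z).ι := (pullback.lift_snd _ _ _).symm
    rw [← Category.assoc, h1, Category.assoc, hh, ← Category.assoc, pullback.lift_fst,
      ← Category.assoc, h2, Category.assoc, hh, ← Category.assoc, pullback.lift_fst]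
  refine ⟨𝒰.glueMorphisms h hcompat, ?_⟩
  refine Scheme.Cover.hom_ext (𝒰.pullback₁ j) _ _ fun y => ?_
  change pullback.fst j (W y).ι ≫ j ≫ _ = pullback.fst j (W y).ι ≫ h₀
  rw [← hh y, pullback.condition_assoc]
  congr 1
  exact 𝒰.ι_glueMorphisms h hcompat y

/-- An ideal sheaf is locally principal if it is locally generated by one element. -/
def IsLocallyPrincipal {X : Scheme.{u}} (I : X.IdealSheafData) : Prop :=
  ∀ x : X, ∃ U : X.affineOpens, x ∈ U.1 ∧ ∃ a, I.ideal U = Ideal.span {a}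

lemma IsInvertibleIdeal.isLocallyPrincipal {X : Scheme.{u}} {I : X.IdealSheafData}
    (h : IsInvertibleIdeal I) : IsLocallyPrincipal I := fun x =>
  let ⟨U, hx, a, _, ha⟩ := h x
  ⟨U, hx, a, ha⟩

lemma IsLocallyPrincipal.comap {X Y : Scheme.{u}} {I : X.IdealSheafData}
    (h : IsLocallyPrincipal I) (g : Y ⟶ X) : IsLocallyPrincipal (I.comap g) := by
  intro y
  obtain ⟨U, hy, a, ha⟩ := h (g y)
  obtain ⟨_, ⟨W, hW, rfl⟩, hyW, hWU⟩ :=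
    Y.isBasis_affineOpens.exists_subset_of_mem_open (show y ∈ g ⁻¹ᵁ U.1 from hy)
      (g ⁻¹ᵁ U.1).isOpen
  refine ⟨⟨W, hW⟩, hyW, (g.appLE U.1 W hWU).hom a, ?_⟩
  rw [comap_ideal I g U ⟨W, hW⟩ hWU, ha, Ideal.map_span, Set.image_singleton]

/-- A locally principal ideal sheaf which becomes trivial on a scheme-theoretically dense
subscheme is invertible. -/
lemma IsLocallyPrincipal.isInvertibleIdeal {U B : Scheme.{u}} {J : B.IdealSheafData}
    (h : IsLocallyPrincipal J) (j : U ⟶ B) [QuasiCompact j] [IsSchemeTheoreticallyDominant j]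
    (hj : J.comap j = ⊤) : IsInvertibleIdeal J := by
  intro x
  obtain ⟨W, hx, a, ha⟩ := h x
  refine ⟨W, hx, a, ?_, ha⟩
  rw [mem_nonZeroDivisors_iff_right]
  intro s hs
  -- Dominance makes pullback along `j` injective, so `a` may be cancelled on `U`, where it is a
  -- unit because the ideal becomes trivial.
  refine j.app_injective W.1 ?_
  refine U.IsSheaf.section_ext fun u hu => ?_
  obtain ⟨_, ⟨W', hW', rfl⟩, huW, hWU⟩ :=
    U.isBasis_affineOpens.exists_subset_of_mem_open hu (j ⁻¹ᵁ W.1).isOpen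
  refine ⟨W', hWU, huW, ?_⟩
  have h1 := comap_ideal J j W ⟨W', hW'⟩ hWU
  rw [hj, ha, Ideal.map_span, Set.image_singleton] at h1
  have h2 : IsUnit ((j.appLE W.1 W' hWU).hom a) := by
    rw [← Ideal.span_singleton_eq_top, ← h1]; rfl
  have h3 : (j.appLE W.1 W' hWU).hom s * (j.appLE W.1 W' hWU).hom a = 0 := by
    rw [← map_mul, hs, map_zero]
  rw [h2.mul_left_eq_zero] at h3
  rw [map_zero]
  change _ = (U.presheaf.map _).hom 0
  rw [map_zero]
  exact h3

end IdealSheaf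

/-! ### Blow-ups as scheme-theoretic images, and strict transforms -/

section BlowupConstruction

/-- The image is defined by the kernel of `f`, so a function on it that dies on `X` is already zero.
This is checked on the preimages of the affine opens of `Y`. -/
instance toImage_isSchemeTheoreticallyDominant {X Y : Scheme.{u}} (f : X ⟶ Y) [QuasiCompact f] :
    IsSchemeTheoreticallyDominant f.toImage := by
  constructor
  refine Scheme.IdealSheafData.ext_of_iSup_eq_top
    (fun U : Y.affineOpens => ⟨f.imageι ⁻¹ᵁ U.1, U.2.preimage f.imageι⟩) ?_ fun U => ?_
  · refine top_le_iff.mp fun x _ => TopologicalSpace.Opens.mem_iSup.mpr ?_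
    exact (TopologicalSpace.Opens.mem_iSup (x := f.imageι x)).mp
      (show f.imageι x ∈ ⨆ U : Y.affineOpens, U.1 from iSup_affineOpens_eq_top Y ▸ trivial)
  · rw [Scheme.Hom.ker_apply]
    exact (RingHom.injective_iff_ker_eq_bot _).mp (f.toImage_app_injective U)

lemma Extends.comp {X B Y Z : Scheme.{u}} {f : B ⟶ X} {U : X.Opens} {φ₀ : U.toScheme ⟶ Z}
    {φ : B ⟶ Z} (h : Extends f φ₀ φ) {g : Y ⟶ X} (k : Y ⟶ B) (hk : k ≫ f = g) :
    Extends g φ₀ (k ≫ φ) := by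
  subst hk
  have h1 : pullback.fst (k ≫ f) U.ι ≫ k =
      pullback.lift (pullback.fst (k ≫ f) U.ι ≫ k) (pullback.snd _ _)
        (by rw [Category.assoc, pullback.condition]) ≫ pullback.fst f U.ι :=
    (pullback.lift_fst _ _ _).symm
  rw [Extends, ← Category.assoc, h1, Category.assoc, h, pullback.lift_snd_assoc]

/-- The preimage of the complement of the centre is scheme-theoretically dense in `B`, and `Z` is
separated. This gives every uniqueness statement about `φ`. -/
lemma Extends.eq {X B Z : Scheme.{u}} [Z.IsSeparated] {I : X.IdealSheafData} {f : B ⟶ X}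
    (hI : IsInvertibleIdeal (I.comap f)) {φ₀ : (suppCompl I).toScheme ⟶ Z} {φ φ' : B ⟶ Z}
    (h : Extends f φ₀ φ) (h' : Extends f φ₀ φ') : φ' = φ := by
  have := pullback_fst_isSchemeTheoreticallyDominant I f hI
  exact hom_ext_of_ker_eq_bot (pullback.fst f (suppCompl I).ι) (h'.trans h.symm)

/-- Criterion for the scheme-theoretic image of a morphism `φ₀` on the complement of the centre
to be the blow-up. -/
theorem isBlowup_of_image {X Z : Scheme.{u}} [X.IsSeparated] [Z.IsSeparated]
    (I : X.IdealSheafData) (φ₀ : (suppCompl I).toScheme ⟶ Z) [QuasiCompact φ₀]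
    (hext : ∀ {Y : Scheme.{u}} (g : Y ⟶ X), IsInvertibleIdeal (I.comap g) →
      ∃ h : Y ⟶ Z, Extends g φ₀ h)
    (f : φ₀.image ⟶ X) (hf : φ₀.toImage ≫ f = (suppCompl I).ι)
    (hp : IsLocallyPrincipal (I.comap f)) :
    IsBlowup f I ∧ Extends f φ₀ φ₀.imageι := by
  have hE : Extends f φ₀ φ₀.imageι := by
    -- The map from the open part to its image remains dominant after restriction to the preimage of
    -- the complement. There its composite with `f` is the inclusion, which is a monomorphism.
    let p := pullback.snd φ₀.toImage (pullback.fst f (suppCompl I).ι)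
    refine hom_ext_of_ker_eq_bot p ?_
    have h1 : p ≫ pullback.snd f (suppCompl I).ι =
        pullback.fst φ₀.toImage (pullback.fst f (suppCompl I).ι) := by
      rw [← cancel_mono (suppCompl I).ι, Category.assoc, ← pullback.condition]
      refine Eq.trans ?_ (congrArg (_ ≫ ·) hf)
      rw [← Category.assoc, ← Category.assoc, pullback.condition]
    rw [← Category.assoc, ← Category.assoc, h1, ← pullback.condition, Category.assoc,
      Scheme.Hom.toImage_imageι]
  refine ⟨⟨?_, ?_⟩, hE⟩
  -- The ideal becomes trivial on the dense open part, which upgrades locally principal to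
  -- invertible.
  · refine hp.isInvertibleIdeal φ₀.toImage ?_
    rw [← Scheme.IdealSheafData.comap_comp, hf, comap_ι_suppCompl]
  · intro Y g hg
    have hdom := pullback_fst_isSchemeTheoreticallyDominant I g hg
    obtain ⟨h, hh⟩ := hext g hg
    -- The preimage of the complement is dense in `Y`, and `h` factors there through `φ₀`, so `h`
    -- kills the ideal of the image.
    have hker : φ₀.imageι.ker ≤ h.ker := by
      have h1 : h.ker = (pullback.fst g (suppCompl I).ι ≫ h).ker := by
        rw [Scheme.Hom.ker_comp, Scheme.Hom.ker_eq_bot (pullback.fst _ _), Scheme.IdealSheafData.map_bot]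
      rw [h1, hh]
      refine le_trans (le_of_eq ?_) (Scheme.Hom.le_ker_comp _ _)
      exact Scheme.IdealSheafData.ker_subschemeι _
    let k := IsClosedImmersion.lift φ₀.imageι h hker
    have hk : k ≫ φ₀.imageι = h := IsClosedImmersion.lift_fac _ _ _
    refine ⟨k, ?_, ?_⟩
    · refine hom_ext_of_ker_eq_bot (pullback.fst g (suppCompl I).ι) ?_
      have h1 : pullback.fst g (suppCompl I).ι ≫ k =
          pullback.snd g (suppCompl I).ι ≫ φ₀.toImage := by
        rw [← cancel_mono φ₀.imageι, Category.assoc, Category.assoc, hk,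
          Scheme.Hom.toImage_imageι]
        exact hh
      rw [← Category.assoc, h1, Category.assoc, hf, pullback.condition]
    · intro k' hk'
      rw [← cancel_mono φ₀.imageι, hk]
      exact Extends.eq hg hh (hE.comp k' hk')

/-- The strict transform: the blow-up of `X` along the inverse image of the centre of a blow-up
`f : B ⟶ P` exists and is a closed subscheme of `X ×_P B`. -/
theorem exists_strictTransform {X P B : Scheme.{u}} [X.IsSeparated] [B.IsSeparated]
    (I : P.IdealSheafData) (f : B ⟶ P) (hf : IsBlowup f I) (i : X ⟶ P)
    [QuasiCompact (suppCompl (I.comap i)).ι] :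
    ∃ (B' : Scheme.{u}) (t : B' ⟶ pullback i f), IsClosedImmersion t ∧
      IsBlowup (t ≫ pullback.fst i f) (I.comap i) := by
  have : (pullback i f).IsSeparated := by
    constructor
    rw [← terminal.comp_from (pullback.fst i f)]
    infer_instance
  have htop : ∀ {Y : Scheme.{u}} (g : Y ⟶ suppCompl (I.comap i)),
      IsInvertibleIdeal (I.comap (g ≫ (suppCompl (I.comap i)).ι ≫ i)) := by
    intro Y g
    rw [Scheme.IdealSheafData.comap_comp, Scheme.IdealSheafData.comap_comp, comap_ι_suppCompl,
      Scheme.IdealSheafData.comap_top]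
    exact IsInvertibleIdeal.top _
  -- Over the complement the inverse image ideal is the unit ideal, hence invertible, and the
  -- universal property of `B` gives the lift. The strict transform is the image of the resulting
  -- map to the fibre product.
  obtain ⟨σ, hσ, -⟩ := hf.existsUnique_lift ((suppCompl (I.comap i)).ι ≫ i)
    (by simpa using htop (𝟙 _))
  let φ₀ : (suppCompl (I.comap i)).toScheme ⟶ pullback i f :=
    pullback.lift (suppCompl (I.comap i)).ι σ hσ.symm
  have hφ₀ : φ₀ ≫ pullback.fst i f = (suppCompl (I.comap i)).ι := pullback.lift_fst _ _ _
  have : QuasiCompact φ₀ := by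
    have : QuasiCompact (φ₀ ≫ pullback.fst i f) := hφ₀ ▸ inferInstance
    exact QuasiCompact.of_comp φ₀ (pullback.fst i f)
  refine ⟨φ₀.image, φ₀.imageι, inferInstance, (isBlowup_of_image (I.comap i) φ₀ ?_ _ ?_ ?_).1⟩
  · intro Y g hg
    rw [← Scheme.IdealSheafData.comap_comp] at hg
    obtain ⟨k, hk, -⟩ := hf.existsUnique_lift (g ≫ i) hg
    refine ⟨pullback.lift g k hk.symm, ?_⟩
    apply pullback.hom_ext
    · rw [Category.assoc, Category.assoc, hφ₀, pullback.lift_fst, pullback.condition]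
    · have h1 := htop (pullback.snd g (suppCompl (I.comap i)).ι)
      refine (hf.existsUnique_lift _ h1).unique ?_ ?_
      · rw [Category.assoc, Category.assoc, pullback.lift_snd_assoc, hk, pullback.condition_assoc]
      · rw [Category.assoc, Category.assoc, pullback.lift_snd_assoc, hσ]
  · rw [Scheme.Hom.toImage_imageι_assoc, hφ₀]
  -- The ideal is also the inverse image of an invertible ideal on `B`, and local principality
  -- survives pullback.
  · rw [← Scheme.IdealSheafData.comap_comp, Category.assoc, pullback.condition, ← Category.assoc,
      Scheme.IdealSheafData.comap_comp]
    exact hf.isInvertibleIdeal.isLocallyPrincipal.comap _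

end BlowupConstruction

section

/-! ### Morphisms to `Proj` and their homogeneous coordinates -/

section ProjMorphisms

variable {σ A : Type u} [CommRing A] [SetLike σ A] [AddSubgroupClass σ A]
  (𝒜 : ℕ → σ) [GradedRing 𝒜]

/-- Pullback of functions on `D₊(t)` along a morphism to `Proj 𝒜` landing in `D₊(t)`. -/
def evalAt {Y : Scheme.{u}} (g : Y ⟶ Proj 𝒜) (t : A) (h : ⊤ ≤ g ⁻¹ᵁ Proj.basicOpen 𝒜 t) :
    HomogeneousLocalization.Away 𝒜 t →+* Γ(Y, ⊤) :=
  (Proj.awayToSection 𝒜 t ≫ g.appLE _ ⊤ h).hom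

variable {𝒜}

lemma evalAt_comp {Y Y' : Scheme.{u}} (g : Y ⟶ Proj 𝒜) (t : A)
    (h : ⊤ ≤ g ⁻¹ᵁ Proj.basicOpen 𝒜 t) (u : Y' ⟶ Y)
    (h' : ⊤ ≤ (u ≫ g) ⁻¹ᵁ Proj.basicOpen 𝒜 t) :
    evalAt 𝒜 (u ≫ g) t h' = u.appTop.hom.comp (evalAt 𝒜 g t h) := by
  rw [evalAt, evalAt, ← CommRingCat.hom_comp, Category.assoc]
  congr 2
  exact (Scheme.Hom.appLE_comp_appLE u g _ ⊤ ⊤ h le_top).symm.trans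
    (congrArg (_ ≫ ·) (Scheme.Hom.app_eq_appLE u (U := ⊤)).symm)

/-- `D₊(t)` is the spectrum of the degree-zero part of `A_t`, so a morphism landing in it is the
same as the ring homomorphism `evalAt`. -/
lemma eq_toSpecΓ_comp_awayι {Y : Scheme.{u}} (g : Y ⟶ Proj 𝒜) {t : A} {m : ℕ} (ht : t ∈ 𝒜 m)
    (hm : 0 < m) (h : ⊤ ≤ g ⁻¹ᵁ Proj.basicOpen 𝒜 t) :
    g = Y.toSpecΓ ≫ Spec.map (CommRingCat.ofHom (evalAt 𝒜 g t h)) ≫ Proj.awayι 𝒜 t ht hm := by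
  have hr : Set.range g ⊆ Set.range (Proj.basicOpen 𝒜 t).ι := by
    rintro _ ⟨y, rfl⟩
    simpa using h (Set.mem_univ y)
  let g' := IsOpenImmersion.lift (Proj.basicOpen 𝒜 t).ι g hr
  have hg' : g' ≫ (Proj.basicOpen 𝒜 t).ι = g := IsOpenImmersion.lift_fac _ _ _
  have h1 : (Proj.basicOpen 𝒜 t).topIso.inv ≫ g'.appTop = g.appLE _ ⊤ h := by
    rw [← appLE_ι_eq_topIso_inv]
    refine (congrArg (_ ≫ ·) (Scheme.Hom.app_eq_appLE g' (U := ⊤))).trans ?_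
    refine (Scheme.Hom.appLE_comp_appLE g' _ _ ⊤ ⊤ _ le_top).trans ?_
    simp only [hg']
  have h2 : g' ≫ (Proj.basicOpenIsoSpec 𝒜 t ht hm).hom =
      Y.toSpecΓ ≫ Spec.map (CommRingCat.ofHom (evalAt 𝒜 g t h)) := by
    rw [Proj.basicOpenIsoSpec_hom, Proj.basicOpenToSpec, Scheme.Opens.toSpecΓ, evalAt, ← h1,
      Category.assoc, Scheme.toSpecΓ_naturality_assoc, ← Spec.map_comp, ← Spec.map_comp]
    rfl
  rw [← Category.assoc, ← h2, Proj.awayι, Category.assoc, Iso.hom_inv_id_assoc, hg']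

lemma toSpecΓ_comp_map_injective {Y : Scheme.{u}} {R : CommRingCat.{u}} {χ χ' : R ⟶ Γ(Y, ⊤)}
    (h : Y.toSpecΓ ≫ Spec.map χ = Y.toSpecΓ ≫ Spec.map χ') : χ = χ' := by
  have := congrArg Scheme.Hom.appTop h
  rw [Scheme.Hom.comp_appTop, Scheme.Hom.comp_appTop, Scheme.toSpecΓ_appTop,
    Scheme.ΓSpecIso_naturality, Scheme.ΓSpecIso_naturality] at this
  exact (cancel_epi _).mp this

lemma evalAt_toSpecΓ_comp_awayι {Y : Scheme.{u}} {t : A} {m : ℕ} (ht : t ∈ 𝒜 m)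
    (hm : 0 < m) (χ : HomogeneousLocalization.Away 𝒜 t →+* Γ(Y, ⊤))
    (h : ⊤ ≤ (Y.toSpecΓ ≫ Spec.map (CommRingCat.ofHom χ) ≫ Proj.awayι 𝒜 t ht hm) ⁻¹ᵁ
      Proj.basicOpen 𝒜 t) :
    evalAt 𝒜 (Y.toSpecΓ ≫ Spec.map (CommRingCat.ofHom χ) ≫ Proj.awayι 𝒜 t ht hm) t h = χ := by
  have h1 := (Category.assoc _ _ _).trans ((eq_toSpecΓ_comp_awayι _ ht hm h).trans
    (Category.assoc _ _ _).symm)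
  exact congrArg CommRingCat.Hom.hom
    (toSpecΓ_comp_map_injective ((cancel_mono _).mp h1)).symm

lemma toSpecΓ_comp_awayι_preimage {Y : Scheme.{u}} {t : A} {m : ℕ} (ht : t ∈ 𝒜 m)
    (hm : 0 < m) (χ : HomogeneousLocalization.Away 𝒜 t →+* Γ(Y, ⊤)) :
    ⊤ ≤ (Y.toSpecΓ ≫ Spec.map (CommRingCat.ofHom χ) ≫ Proj.awayι 𝒜 t ht hm) ⁻¹ᵁ
      Proj.basicOpen 𝒜 t := by
  intro y _
  rw [← Category.assoc]
  change (Proj.awayι 𝒜 t ht hm) _ ∈ Proj.basicOpen 𝒜 t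
  rw [← Proj.opensRange_awayι 𝒜 t ht hm]
  exact ⟨_, rfl⟩

lemma eq_of_evalAt_eq {Y : Scheme.{u}} (g g' : Y ⟶ Proj 𝒜) {t : A} {m : ℕ} (ht : t ∈ 𝒜 m)
    (hm : 0 < m) (h : ⊤ ≤ g ⁻¹ᵁ Proj.basicOpen 𝒜 t) (h' : ⊤ ≤ g' ⁻¹ᵁ Proj.basicOpen 𝒜 t)
    (H : evalAt 𝒜 g t h = evalAt 𝒜 g' t h') : g = g' := by
  rw [eq_toSpecΓ_comp_awayι g ht hm h, eq_toSpecΓ_comp_awayι g' ht hm h', H]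

/-- The ring homomorphism `(A_t)₀ → S` induced by a homomorphism `ψ : A → S` with `ψ t` a unit. -/
def awayLift {S : Type*} [CommRing S] (ψ : A →+* S) (t : A) (h : IsUnit (ψ t)) :
    HomogeneousLocalization.Away 𝒜 t →+* S :=
  (IsLocalization.Away.lift (S := Localization.Away t) t h).comp
    (algebraMap (HomogeneousLocalization.Away 𝒜 t) (Localization.Away t))

lemma awayLift_mk {S : Type*} [CommRing S] (ψ : A →+* S) {t : A} (h : IsUnit (ψ t)) {m : ℕ}
    (ht : t ∈ 𝒜 m) (d : ℕ) (a : A) (ha : a ∈ 𝒜 (d • m)) :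
    awayLift ψ t h (HomogeneousLocalization.Away.mk 𝒜 ht d a ha) * ψ t ^ d = ψ a := by
  have h1 : ∀ a, IsLocalization.Away.lift (S := Localization.Away t) t h (algebraMap A _ a) =
      ψ a := IsLocalization.Away.lift_eq t h
  rw [awayLift, RingHom.comp_apply, HomogeneousLocalization.algebraMap_apply,
    HomogeneousLocalization.Away.val_mk, ← h1, ← h1, ← map_pow, ← map_mul]
  congr 1
  rw [Localization.mk_eq_mk', ← map_pow]
  exact IsLocalization.mk'_spec _ _ _

lemma awayLift_mk_of_eq_one {S : Type*} [CommRing S] (ψ : A →+* S) {t : A} (h : IsUnit (ψ t))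
    (h1 : ψ t = 1) {m : ℕ} (ht : t ∈ 𝒜 m) (d : ℕ) (a : A) (ha : a ∈ 𝒜 (d • m)) :
    awayLift ψ t h (HomogeneousLocalization.Away.mk 𝒜 ht d a ha) = ψ a := by
  simpa [h1] using awayLift_mk ψ h ht d a ha

lemma awayLift_eq_iff {S : Type*} [CommRing S] (ψ : A →+* S) {t : A}
    {m : ℕ} (ht : t ∈ 𝒜 m) (h : IsUnit (ψ t)) (χ : HomogeneousLocalization.Away 𝒜 t →+* S) :
    χ = awayLift ψ t h ↔ ∀ (d : ℕ) (a : A) (ha : a ∈ 𝒜 (d • m)),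
      χ (HomogeneousLocalization.Away.mk 𝒜 ht d a ha) * ψ t ^ d = ψ a := by
  refine ⟨fun H d a ha => by rw [H, awayLift_mk], fun H => ?_⟩
  ext x
  obtain ⟨d, a, ha, rfl⟩ := x.mk_surjective 𝒜 ht
  apply (h.pow d).mul_right_cancel
  rw [awayLift_mk, H]

/-- On the locus where `ψ t` is invertible the morphism with homogeneous coordinates `ψ` is given
by the homomorphism `a / t ^ d ↦ ψ a / ψ t ^ d`. -/
lemma comp_fromOfGlobalSections_eq {Y Y' : Scheme.{u}} (ψ : A →+* Γ(Y, ⊤))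
    (hψ : (HomogeneousIdeal.irrelevant 𝒜).toIdeal.map ψ = ⊤) (u : Y' ⟶ Y) {t : A} {m : ℕ}
    (ht : t ∈ 𝒜 m) (hm : 0 < m) (h : IsUnit ((u.appTop.hom.comp ψ) t)) :
    u ≫ Proj.fromOfGlobalSections 𝒜 ψ hψ = Y'.toSpecΓ ≫ Spec.map (CommRingCat.ofHom
      (awayLift (u.appTop.hom.comp ψ) t h)) ≫ Proj.awayι 𝒜 t ht hm := by
  have hu : Set.range u ⊆ Set.range (Y.basicOpen (ψ t)).ι := by
    rintro _ ⟨y, rfl⟩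
    have h0 : u ⁻¹ᵁ Y.basicOpen (ψ t) = ⊤ :=
      (Scheme.preimage_basicOpen_top u (ψ t)).trans (Y'.basicOpen_of_isUnit h)
    have h5 : y ∈ u ⁻¹ᵁ Y.basicOpen (ψ t) := h0.ge trivial
    rw [Scheme.Opens.range_ι]
    exact h5
  obtain ⟨v, rfl⟩ : ∃ v, v ≫ (Y.basicOpen (ψ t)).ι = u :=
    ⟨IsOpenImmersion.lift _ u hu, IsOpenImmersion.lift_fac _ _ _⟩
  -- The morphism is glued from pieces over the loci where some `ψ t` is invertible. The remaining
  -- steps identify the piece for `t` with the one given by `awayLift`.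
  have h1 : (Y.basicOpen (ψ t)).ι ≫ Proj.fromOfGlobalSections 𝒜 ψ hψ =
      Proj.toBasicOpenOfGlobalSections 𝒜 ψ rfl hm ht ≫ Scheme.Opens.ι _ :=
    (Proj.openCoverOfMapIrrelevantEqTop 𝒜 ψ hψ).ι_glueMorphisms _ _ ⟨m, t, hm, ht⟩
  rw [Category.assoc, h1, Proj.toBasicOpenOfGlobalSections]
  simp only [Category.assoc, Proj.basicOpenIsoSpec_inv_ι]
  have h2 : (Y.toSpecΓ ⁻¹ᵁ PrimeSpectrum.basicOpen (ψ t)).ι ≫ Y.toSpecΓ =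
    (Y.toSpecΓ ∣_ PrimeSpectrum.basicOpen (ψ t)) ≫ (basicOpenIsoSpecAway (ψ t)).hom ≫
      Spec.map (CommRingCat.ofHom (algebraMap Γ(Y, ⊤) (Localization.Away (ψ t)))) := by
    rw [basicOpenIsoSpecAway_hom_SpecMap]
    exact (morphismRestrict_ι _ _).symm
  obtain ⟨j, hj⟩ : ∃ j, j = v ≫ (Y.basicOpen (ψ t)).ι := ⟨_, rfl⟩
  simp only [← hj] at h ⊢
  have h3 : v ≫ (Y.isoOfEq (Y.toSpecΓ_preimage_basicOpen (ψ t))).inv ≫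
      (Y.toSpecΓ ∣_ PrimeSpectrum.basicOpen (ψ t)) ≫ (basicOpenIsoSpecAway (ψ t)).hom =
      Y'.toSpecΓ ≫ Spec.map (CommRingCat.ofHom
        (IsLocalization.Away.lift (S := Localization.Away (ψ t)) (ψ t)
          (g := j.appTop.hom) h)) := by
    rw [← cancel_mono (Spec.map (CommRingCat.ofHom
      (algebraMap Γ(Y, ⊤) (Localization.Away (ψ t)))))]
    simp only [Category.assoc]
    refine (congrArg (v ≫ (Y.isoOfEq _).inv ≫ ·) h2.symm).trans ?_
    rw [Scheme.isoOfEq_inv_ι_assoc, ← Category.assoc, ← hj, Scheme.toSpecΓ_naturality,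
      ← Spec.map_comp, ← CommRingCat.ofHom_comp]
    congr 2
    ext x
    exact (IsLocalization.Away.lift_eq (ψ t) h x).symm
  have h4 := congrArg (· ≫ Spec.map (CommRingCat.ofHom ((IsLocalization.map (M := .powers t)
    (T := .powers (ψ t)) (Localization.Away (ψ t)) ψ (by
      rw [← Submonoid.map_le_iff_le_comap, Submonoid.map_powers])).comp
        (algebraMap (HomogeneousLocalization.Away 𝒜 t) (Localization.Away t)))) ≫
          Proj.awayι 𝒜 t ht hm) h3
  simp only [Category.assoc] at h4
  refine h4.trans ?_
  rw [← Spec.map_comp_assoc, ← CommRingCat.ofHom_comp, awayLift, ← RingHom.comp_assoc]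
  congr 5
  refine IsLocalization.ringHom_ext (.powers t) ?_
  ext a
  simp only [RingHom.comp_apply, IsLocalization.map_eq, IsLocalization.Away.lift_eq]

lemma evalAt_fromOfGlobalSections {Y : Scheme.{u}} (ψ : A →+* Γ(Y, ⊤))
    (hψ : (HomogeneousIdeal.irrelevant 𝒜).toIdeal.map ψ = ⊤) {t : A} {m : ℕ} (ht : t ∈ 𝒜 m)
    (hm : 0 < m) (hu : IsUnit (ψ t))
    (h : ⊤ ≤ (Proj.fromOfGlobalSections 𝒜 ψ hψ) ⁻¹ᵁ Proj.basicOpen 𝒜 t) :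
    evalAt 𝒜 (Proj.fromOfGlobalSections 𝒜 ψ hψ) t h = awayLift ψ t hu := by
  have h2 := comp_fromOfGlobalSections_eq ψ hψ (𝟙 Y) ht hm (by simpa using hu)
  rw [Category.id_comp] at h2
  have h1 := evalAt_toSpecΓ_comp_awayι ht hm (awayLift (RingHom.comp (Scheme.Hom.appTop (𝟙 Y)).hom
    ψ) t (by simpa using hu)) (toSpecΓ_comp_awayι_preimage ht hm _)
  have h3 : awayLift (𝒜 := 𝒜) (RingHom.comp (Scheme.Hom.appTop (𝟙 Y)).hom ψ) t (by simpa using hu) =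
    awayLift ψ t hu := by congr 1
  rw [← h3, ← h1]
  congr 1

lemma le_fromOfGlobalSections_preimage {Y : Scheme.{u}} (ψ : A →+* Γ(Y, ⊤))
    (hψ : (HomogeneousIdeal.irrelevant 𝒜).toIdeal.map ψ = ⊤) {t : A} {m : ℕ} (ht : t ∈ 𝒜 m)
    (hm : 0 < m) (hu : IsUnit (ψ t)) :
    ⊤ ≤ (Proj.fromOfGlobalSections 𝒜 ψ hψ) ⁻¹ᵁ Proj.basicOpen 𝒜 t := by
  rw [Proj.fromOfGlobalSections_preimage_basicOpen 𝒜 ψ hψ hm ht, Y.basicOpen_of_isUnit hu]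

lemma exists_mem_basicOpen {Y : Scheme.{u}} (ψ : A →+* Γ(Y, ⊤))
    (hψ : (HomogeneousIdeal.irrelevant 𝒜).toIdeal.map ψ = ⊤) (y : Y) :
    ∃ (m : ℕ) (t : A), t ∈ 𝒜 m ∧ 0 < m ∧ y ∈ Y.basicOpen (ψ t) := by
  obtain ⟨⟨m, t, hm, ht⟩, z, hz⟩ := (Proj.openCoverOfMapIrrelevantEqTop 𝒜 ψ hψ).exists_eq y
  refine ⟨m, t, ht, hm, ?_⟩
  rw [← hz]
  exact z.2

lemma hom_ext_of_forall_exists {Y Z : Scheme.{u}} (g g' : Y ⟶ Z)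
    (H : ∀ y, ∃ W : Y.Opens, y ∈ W ∧ W.ι ≫ g = W.ι ≫ g') : g = g' := by
  choose W hW h using H
  refine (Y.openCoverOfIsOpenCover W ?_).hom_ext _ _ h
  exact TopologicalSpace.IsOpenCover.mk (top_le_iff.mp fun y _ =>
    TopologicalSpace.Opens.mem_iSup.mpr ⟨y, hW y⟩)

lemma isUnit_appTop_ι {Y : Scheme.{u}} (s : Γ(Y, ⊤)) {W : Y.Opens} (hW : W ≤ Y.basicOpen s) :
    IsUnit (W.ι.appTop.hom s) := by
  have h0 : W.ι ⁻¹ᵁ Y.basicOpen s = ⊤ := by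
    exact top_le_iff.mp fun y _ => hW y.2
  rw [Scheme.preimage_basicOpen_top] at h0
  have h1 := RingedSpace.isUnit_res_basicOpen W.toScheme.toRingedSpace (W.ι.appTop.hom s)
  have h2 : IsIso (W.toScheme.presheaf.map (homOfLE (W.toScheme.basicOpen_le
      (W.ι.appTop.hom s))).op) := by
    rw [show homOfLE (W.toScheme.basicOpen_le (W.ι.appTop.hom s)) = eqToHom h0 from
      Subsingleton.elim _ _]
    infer_instance
  exact (isUnit_map_iff (W.toScheme.presheaf.map (homOfLE (W.toScheme.basicOpen_le
      (W.ι.appTop.hom s))).op).hom _).mp h1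

/-- A local criterion for a morphism to be the one with homogeneous coordinates `ψ`. -/
lemma eq_fromOfGlobalSections_of_forall_exists {Y : Scheme.{u}} (g : Y ⟶ Proj 𝒜)
    (ψ : A →+* Γ(Y, ⊤)) (hψ : (HomogeneousIdeal.irrelevant 𝒜).toIdeal.map ψ = ⊤)
    (H : ∀ (m : ℕ) (t : A) (ht : t ∈ 𝒜 m) (hm : 0 < m)
      (hu : IsUnit (((Y.basicOpen (ψ t)).ι.appTop.hom.comp ψ) t)),
      (Y.basicOpen (ψ t)).ι ≫ g = Scheme.toSpecΓ _ ≫ Spec.map (CommRingCat.ofHom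
        (awayLift ((Y.basicOpen (ψ t)).ι.appTop.hom.comp ψ) t hu)) ≫ Proj.awayι 𝒜 t ht hm) :
    g = Proj.fromOfGlobalSections 𝒜 ψ hψ := by
  refine hom_ext_of_forall_exists _ _ fun y => ?_
  obtain ⟨m, t, ht, hm, hy⟩ := exists_mem_basicOpen ψ hψ y
  refine ⟨_, hy, ?_⟩
  have hu : IsUnit (((Y.basicOpen (ψ t)).ι.appTop.hom.comp ψ) t) := isUnit_appTop_ι _ le_rfl
  rw [H m t ht hm hu, comp_fromOfGlobalSections_eq ψ hψ _ ht hm hu]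

lemma comp_fromOfGlobalSections {Y Y' : Scheme.{u}} (ψ : A →+* Γ(Y, ⊤))
    (hψ : (HomogeneousIdeal.irrelevant 𝒜).toIdeal.map ψ = ⊤) (u : Y' ⟶ Y)
    (hψ' : (HomogeneousIdeal.irrelevant 𝒜).toIdeal.map (u.appTop.hom.comp ψ) = ⊤) :
    u ≫ Proj.fromOfGlobalSections 𝒜 ψ hψ =
      Proj.fromOfGlobalSections 𝒜 (u.appTop.hom.comp ψ) hψ' := by
  refine eq_fromOfGlobalSections_of_forall_exists _ _ _ fun m t ht hm hu => ?_
  have h : IsUnit (((((Y'.basicOpen ((u.appTop.hom.comp ψ) t)).ι ≫ u).appTop).hom.comp ψ) t) := by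
    rw [Scheme.Hom.comp_appTop]
    exact hu
  rw [← Category.assoc, comp_fromOfGlobalSections_eq ψ hψ _ ht hm h]
  congr 4

lemma map_comp_eq_top {S T : Type*} [CommRing S] [CommRing T] (θ : S →+* T) {ψ : A →+* S}
    {J : Ideal A} (h : J.map ψ = ⊤) : J.map (θ.comp ψ) = ⊤ := by
  rw [← Ideal.map_map, h, Ideal.map_top]

/-- In a fraction of degree zero the numerator and the denominator acquire the same power of `v`. -/
lemma awayLift_smul {S : Type*} [CommRing S] (ψ ψ' : A →+* S) (v : S)
    (H : ∀ d, ∀ a ∈ 𝒜 d, ψ' a = v ^ d * ψ a) {t : A} {m : ℕ} (ht : t ∈ 𝒜 m)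
    (h : IsUnit (ψ t)) (h' : IsUnit (ψ' t)) :
    awayLift (𝒜 := 𝒜) ψ t h = awayLift ψ' t h' := by
  rw [awayLift_eq_iff _ ht]
  intro d a ha
  rw [H _ _ ha, H _ _ ht, mul_pow, mul_left_comm, awayLift_mk, ← pow_mul, mul_comm m d,
    smul_eq_mul]

/-- Proportional coordinates define the same morphism. The factor `v` need not be assumed a unit: it
is one wherever some `ψ' t` of positive degree is. Changes of chart, and division of all quadrics by
a common factor, are both instances of this. -/
lemma fromOfGlobalSections_smul {Y : Scheme.{u}} (ψ ψ' : A →+* Γ(Y, ⊤))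
    (hψ : (HomogeneousIdeal.irrelevant 𝒜).toIdeal.map ψ = ⊤)
    (hψ' : (HomogeneousIdeal.irrelevant 𝒜).toIdeal.map ψ' = ⊤) (v : Γ(Y, ⊤))
    (H : ∀ d, ∀ a ∈ 𝒜 d, ψ' a = v ^ d * ψ a) :
    Proj.fromOfGlobalSections 𝒜 ψ hψ = Proj.fromOfGlobalSections 𝒜 ψ' hψ' := by
  refine eq_fromOfGlobalSections_of_forall_exists _ _ _ fun m t ht hm hu => ?_
  have H' : ∀ d, ∀ a ∈ 𝒜 d, ((Y.basicOpen (ψ' t)).ι.appTop.hom.comp ψ') a =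
      ((Y.basicOpen (ψ' t)).ι.appTop.hom v) ^ d *
        ((Y.basicOpen (ψ' t)).ι.appTop.hom.comp ψ) a := fun d a ha => by
    rw [RingHom.comp_apply, H d a ha, map_mul, map_pow]
    rfl
  have h : IsUnit (((Y.basicOpen (ψ' t)).ι.appTop.hom.comp ψ) t) := by
    rw [H' m t ht] at hu
    exact isUnit_of_mul_isUnit_right hu
  rw [comp_fromOfGlobalSections_eq ψ hψ _ ht hm h, awayLift_smul _ _ _ H' ht h hu]

lemma eq_fromOfGlobalSections {Y : Scheme.{u}} (g : Y ⟶ Proj 𝒜) (ψ : A →+* Γ(Y, ⊤))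
    (hψ : (HomogeneousIdeal.irrelevant 𝒜).toIdeal.map ψ = ⊤) {t : A} {m : ℕ} (ht : t ∈ 𝒜 m)
    (hm : 0 < m) (hu : IsUnit (ψ t)) (h : ⊤ ≤ g ⁻¹ᵁ Proj.basicOpen 𝒜 t)
    (H : evalAt 𝒜 g t h = awayLift ψ t hu) : g = Proj.fromOfGlobalSections 𝒜 ψ hψ :=
  eq_of_evalAt_eq _ _ ht hm h (le_fromOfGlobalSections_preimage ψ hψ ht hm hu)
    (H.trans (evalAt_fromOfGlobalSections ψ hψ ht hm hu _).symm)

variable {B τ : Type u} [CommRing B] [SetLike τ B] [AddSubgroupClass τ B]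
  {ℬ : ℕ → τ} [GradedRing ℬ]

lemma awayLift_comp_awayMap {S : Type*} [CommRing S] (ψ : B →+* S) (f : 𝒜 →+*ᵍ ℬ) {t : A} {m : ℕ}
    (ht : t ∈ 𝒜 m) (h : IsUnit (ψ (f t))) (h' : IsUnit ((ψ.comp f.toRingHom) t)) :
    (awayLift ψ (f t) h).comp (HomogeneousLocalization.Away.map f t) =
      awayLift (𝒜 := 𝒜) (ψ.comp f.toRingHom) t h' := by
  rw [awayLift_eq_iff _ ht]
  intro d a ha
  rw [RingHom.comp_apply, HomogeneousLocalization.Away.map_mk]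
  exact awayLift_mk ψ h (f.2 ht) d _ _

lemma fromOfGlobalSections_comp_map {Y : Scheme.{u}} (ψ : B →+* Γ(Y, ⊤))
    (hψ : (HomogeneousIdeal.irrelevant ℬ).toIdeal.map ψ = ⊤) (f : 𝒜 →+*ᵍ ℬ)
    (hf : ℬ₊ ≤ 𝒜₊.map f)
    (hψf : (HomogeneousIdeal.irrelevant 𝒜).toIdeal.map (ψ.comp f.toRingHom) = ⊤) :
    Proj.fromOfGlobalSections ℬ ψ hψ ≫ Proj.map f hf =
      Proj.fromOfGlobalSections 𝒜 (ψ.comp f.toRingHom) hψf := by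
  refine eq_fromOfGlobalSections_of_forall_exists _ _ _ fun m t ht hm hu => ?_
  have h1 := comp_fromOfGlobalSections_eq ψ hψ (Y.basicOpen ((ψ.comp f.toRingHom) t)).ι
    (f.2 ht) hm hu
  rw [← Category.assoc, h1, Category.assoc, Category.assoc]
  erw [Proj.awayι_comp_map f hf hm t ht]
  rw [← Spec.map_comp_assoc, ← CommRingCat.ofHom_comp]
  congr 4
  exact awayLift_comp_awayMap _ f ht _ _

lemma isClosedImmersion_of_iSup_eq_top {X Y : Scheme.{u}} (f : X ⟶ Y) {ι : Type*}
    (U : ι → Y.Opens) (hU : ⨆ i, U i = ⊤) (hY : ∀ i, IsAffineOpen (U i))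
    (hX : ∀ i, IsAffineOpen (f ⁻¹ᵁ U i)) (h : ∀ i, Function.Surjective (f.app (U i)).hom) :
    IsClosedImmersion f := by
  rw [IsZariskiLocalAtTarget.iff_of_iSup_eq_top (P := @IsClosedImmersion) U hU]
  intro i
  have := hX i
  have := hY i
  have : IsAffine (U i).toScheme := hY i
  have : IsAffine (f ⁻¹ᵁ U i).toScheme := hX i
  apply IsClosedImmersion.of_surjective_of_isAffine
  have h1 := h i
  rw [Scheme.Hom.app_eq_appLE] at h1
  change Function.Surjective ((f ∣_ U i).app ⊤).hom
  rw [morphismRestrict_app']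
  exact (Scheme.Hom.appLE_congr f le_rfl (Scheme.Opens.ι_image_top _).symm
    (Scheme.Opens.ι_image_top _).symm
    (fun φ => Function.Surjective φ.hom)).mp h1

lemma iSup_basicOpen_homogeneous :
    ⨆ i : Σ i : PNat, 𝒜 i, Proj.basicOpen 𝒜 i.2.1 = ⊤ := by
  refine top_le_iff.mp fun y _ => ?_
  obtain ⟨i, z, rfl⟩ := (Proj.affineOpenCover 𝒜).openCover.exists_eq y
  refine TopologicalSpace.Opens.mem_iSup.mpr ⟨i, ?_⟩
  rw [← Proj.opensRange_awayι 𝒜 _ i.2.2 i.1.2]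
  exact ⟨z, rfl⟩

/-- Over `D₊(t)` the map on rings sends `a / t ^ d` to `f a / f t ^ d`, and every numerator lifts in
its own degree. -/
lemma isClosedImmersion_map_of_surjective (f : 𝒜 →+*ᵍ ℬ) (hf : ℬ₊ ≤ 𝒜₊.map f)
    (hs : ∀ d, ∀ b ∈ ℬ d, ∃ a ∈ 𝒜 d, f a = b) : IsClosedImmersion (Proj.map f hf) := by
  refine isClosedImmersion_of_iSup_eq_top _ _ iSup_basicOpen_homogeneous
    (fun i => Proj.isAffineOpen_basicOpen 𝒜 _ i.2.2 i.1.2)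
    (fun i => Proj.isAffineOpen_basicOpen ℬ (f i.2.1) (f.2 i.2.2) i.1.2) ?_
  rintro ⟨i, t, ht⟩ y
  have h2 := (congrArg (Proj.awayToSection 𝒜 t ≫ ·) (Scheme.Hom.app_eq_appLE _)).trans
    (Proj.awayToSection_comp_appLE f hf ht)
  obtain ⟨z, rfl⟩ := (ConcreteCategory.bijective_of_isIso
    (Proj.basicOpenIsoAway ℬ (f t) (f.2 ht) i.2).hom).2 y
  obtain ⟨d, b, hb, rfl⟩ := z.mk_surjective ℬ (f.2 ht)
  obtain ⟨a, ha, rfl⟩ := hs _ b hb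
  refine ⟨(Proj.awayToSection 𝒜 t).hom (HomogeneousLocalization.Away.mk 𝒜 ht d a ha), ?_⟩
  refine congr($(h2).hom (HomogeneousLocalization.Away.mk 𝒜 ht d a ha)).trans ?_
  change (Proj.awayToSection ℬ (f t)).hom (HomogeneousLocalization.Away.map f t _) = _
  rw [HomogeneousLocalization.Away.map_mk]
  rfl

end ProjMorphisms

section GeneratedInDegreeOne

variable {R A : Type u} [CommRing R] [CommRing A] [Algebra R A] {𝒜 : ℕ → Submodule R A}
  [GradedAlgebra 𝒜]

/-- The scalars in `(A_t)₀`. -/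
def awayScalar (𝒜 : ℕ → Submodule R A) [GradedAlgebra 𝒜] (t : A) :
    R →+* HomogeneousLocalization.Away 𝒜 t :=
  (HomogeneousLocalization.fromZeroRingHom 𝒜 _).comp (algebraMap R (𝒜 0))

lemma val_awayScalar (t : A) (r : R) :
    (awayScalar 𝒜 t r).val = algebraMap A (Localization.Away t) (algebraMap R A r) :=
  Localization.mk_one_eq_algebraMap _

end GeneratedInDegreeOne

end

section

/-! ### Coordinates normalized by an element of degree one -/

section Coordinates

variable {R A : Type u} [CommRing R] [CommRing A] [Algebra R A] {𝒜 : ℕ → Submodule R A}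
  [GradedAlgebra 𝒜]

/-- Division of the forms of degree `d` by `t ^ d`, for all `d`. -/
def awayMkHom {t : A} (ht : t ∈ 𝒜 1) (d : ℕ) : 𝒜 d →+ HomogeneousLocalization.Away 𝒜 t where
  toFun a := HomogeneousLocalization.Away.mk 𝒜 ht d a.1 (by simp)
  map_zero' := by
    apply HomogeneousLocalization.val_injective
    simp [HomogeneousLocalization.Away.val_mk, Localization.mk_zero]
  map_add' a b := by
    apply HomogeneousLocalization.val_injective
    simp [HomogeneousLocalization.Away.val_mk, Localization.add_mk_self]

lemma val_awayMkHom {t : A} (ht : t ∈ 𝒜 1) (d : ℕ) (a : 𝒜 d) : (awayMkHom ht d a).val =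
    Localization.mk a.1 (⟨t ^ d, d, rfl⟩ : Submonoid.powers t) :=
  HomogeneousLocalization.Away.val_mk _ _ ht _ _

/-- Dehomogenization with respect to an element `t` of degree one. -/
def dehomogenize {t : A} (ht : t ∈ 𝒜 1) : A →+* HomogeneousLocalization.Away 𝒜 t :=
  (DirectSum.toSemiring (awayMkHom ht) (by
    apply HomogeneousLocalization.val_injective
    rw [HomogeneousLocalization.val_one, val_awayMkHom]
    refine Eq.trans ?_ (Localization.mk_self (1 : Submonoid.powers t))
    congr 1
    ext
    exact pow_zero t) (fun {i j} a b => by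
    apply HomogeneousLocalization.val_injective
    rw [HomogeneousLocalization.val_mul, val_awayMkHom, val_awayMkHom, val_awayMkHom,
      Localization.mk_mul]
    congr 1
    ext
    exact pow_add t i j)).comp (DirectSum.decomposeRingEquiv 𝒜).toRingHom

lemma dehomogenize_of_mem {t : A} (ht : t ∈ 𝒜 1) {d : ℕ} {a : A} (ha : a ∈ 𝒜 d) :
    dehomogenize ht a = HomogeneousLocalization.Away.mk 𝒜 ht d a (by simpa using ha) := by
  rw [dehomogenize, RingHom.comp_apply]
  change DirectSum.toSemiring _ _ _ (DirectSum.decompose 𝒜 a) = _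
  rw [DirectSum.decompose_of_mem 𝒜 ha]
  exact DirectSum.toSemiring_of _ _ _ _ _

/-- The homogeneous coordinates of `g : Y ⟶ Proj 𝒜`, normalized by `t = 1`. -/
def coords {Y : Scheme.{u}} (g : Y ⟶ Proj 𝒜) {t : A} (ht : t ∈ 𝒜 1)
    (h : ⊤ ≤ g ⁻¹ᵁ Proj.basicOpen 𝒜 t) : A →+* Γ(Y, ⊤) :=
  (evalAt 𝒜 g t h).comp (dehomogenize ht)

lemma coords_of_mem {Y : Scheme.{u}} (g : Y ⟶ Proj 𝒜) {t : A} (ht : t ∈ 𝒜 1)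
    (h : ⊤ ≤ g ⁻¹ᵁ Proj.basicOpen 𝒜 t) {d : ℕ} {a : A} (ha : a ∈ 𝒜 d) :
    coords g ht h a = evalAt 𝒜 g t h (HomogeneousLocalization.Away.mk 𝒜 ht d a
      (by simpa using ha)) := by
  rw [coords, RingHom.comp_apply, dehomogenize_of_mem ht ha]

lemma coords_self {Y : Scheme.{u}} (g : Y ⟶ Proj 𝒜) {t : A} (ht : t ∈ 𝒜 1)
    (h : ⊤ ≤ g ⁻¹ᵁ Proj.basicOpen 𝒜 t) : coords g ht h t = 1 := by
  rw [coords_of_mem g ht h ht]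
  convert! map_one (evalAt 𝒜 g t h)
  apply HomogeneousLocalization.val_injective
  rw [HomogeneousLocalization.Away.val_mk, HomogeneousLocalization.val_one]
  convert! Localization.mk_self (⟨t, Submonoid.mem_powers t⟩ : Submonoid.powers t)
  exact pow_one t

lemma coords_comp {Y Y' : Scheme.{u}} (g : Y ⟶ Proj 𝒜) {t : A} (ht : t ∈ 𝒜 1)
    (h : ⊤ ≤ g ⁻¹ᵁ Proj.basicOpen 𝒜 t) (u : Y' ⟶ Y)
    (h' : ⊤ ≤ (u ≫ g) ⁻¹ᵁ Proj.basicOpen 𝒜 t) :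
    coords (u ≫ g) ht h' = u.appTop.hom.comp (coords g ht h) := by
  rw [coords, evalAt_comp g t h, coords, RingHom.comp_assoc]

lemma evalAt_eq_awayLift {Y : Scheme.{u}} (g : Y ⟶ Proj 𝒜) {t : A} (ht : t ∈ 𝒜 1)
    (h : ⊤ ≤ g ⁻¹ᵁ Proj.basicOpen 𝒜 t) : evalAt 𝒜 g t h =
      awayLift (coords g ht h) t (by rw [coords_self]; exact isUnit_one) := by
  rw [awayLift_eq_iff _ ht]
  intro d a ha
  rw [coords_self, one_pow, mul_one, coords_of_mem g ht h (d := d) (by simpa using ha)]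

lemma irrelevant_map_eq_top {S : Type*} [CommRing S] (ψ : A →+* S) {t : A} {m : ℕ} (ht : t ∈ 𝒜 m)
    (hm : 0 < m) (hu : IsUnit (ψ t)) : (HomogeneousIdeal.irrelevant 𝒜).toIdeal.map ψ = ⊤ :=
  Ideal.eq_top_of_isUnit_mem _
    (Ideal.mem_map_of_mem _ (HomogeneousIdeal.mem_irrelevant_of_mem _ hm ht)) hu

lemma irrelevant_map_coords {Y : Scheme.{u}} (g : Y ⟶ Proj 𝒜) {t : A} (ht : t ∈ 𝒜 1)
    (h : ⊤ ≤ g ⁻¹ᵁ Proj.basicOpen 𝒜 t) :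
    (HomogeneousIdeal.irrelevant 𝒜).toIdeal.map (coords g ht h) = ⊤ :=
  irrelevant_map_eq_top _ ht one_pos (by rw [coords_self]; exact isUnit_one)

lemma eq_fromOfGlobalSections_coords {Y : Scheme.{u}} (g : Y ⟶ Proj 𝒜) {t : A} (ht : t ∈ 𝒜 1)
    (h : ⊤ ≤ g ⁻¹ᵁ Proj.basicOpen 𝒜 t) :
    g = Proj.fromOfGlobalSections 𝒜 (coords g ht h) (irrelevant_map_coords g ht h) :=
  eq_fromOfGlobalSections g _ _ ht one_pos _ h (evalAt_eq_awayLift g ht h)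

lemma coords_fromOfGlobalSections {Y : Scheme.{u}} (ψ : A →+* Γ(Y, ⊤))
    (hψ : (HomogeneousIdeal.irrelevant 𝒜).toIdeal.map ψ = ⊤) {t : A} (ht : t ∈ 𝒜 1)
    (hu : IsUnit (ψ t)) (h : ⊤ ≤ (Proj.fromOfGlobalSections 𝒜 ψ hψ) ⁻¹ᵁ Proj.basicOpen 𝒜 t)
    {d : ℕ} {a : A} (ha : a ∈ 𝒜 d) :
    coords (Proj.fromOfGlobalSections 𝒜 ψ hψ) ht h a * ψ t ^ d = ψ a := by
  rw [coords_of_mem _ ht h ha, evalAt_fromOfGlobalSections ψ hψ ht one_pos hu, awayLift_mk]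

lemma isUnit_of_le_preimage {Y : Scheme.{u}} (ψ : A →+* Γ(Y, ⊤))
    (hψ : (HomogeneousIdeal.irrelevant 𝒜).toIdeal.map ψ = ⊤) {t : A} {m : ℕ} (ht : t ∈ 𝒜 m)
    (hm : 0 < m) (h : ⊤ ≤ (Proj.fromOfGlobalSections 𝒜 ψ hψ) ⁻¹ᵁ Proj.basicOpen 𝒜 t) :
    IsUnit (ψ t) := by
  rw [Proj.fromOfGlobalSections_preimage_basicOpen 𝒜 ψ hψ hm ht] at h
  have h1 := RingedSpace.isUnit_res_basicOpen Y.toRingedSpace (ψ t)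
  have h2 : IsIso (Y.presheaf.map (homOfLE (Y.basicOpen_le (ψ t))).op) := by
    rw [show homOfLE (Y.basicOpen_le (ψ t)) = eqToHom (top_le_iff.mp h) from
      Subsingleton.elim _ _]
    infer_instance
  exact (isUnit_map_iff (Y.presheaf.map (homOfLE (Y.basicOpen_le (ψ t))).op).hom _).mp h1

lemma ringHom_eq_of_homogeneous {S : Type*} [CommRing S] (ψ ψ' : A →+* S)
    (H : ∀ d, ∀ a ∈ 𝒜 d, ψ a = ψ' a) : ψ = ψ' := by
  ext a
  classical
  rw [← DirectSum.sum_support_decompose 𝒜 a, map_sum, map_sum]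
  exact Finset.sum_congr rfl fun d _ => H d _ (SetLike.coe_mem _)

lemma coords_fromOfGlobalSections_of_eq_one {Y : Scheme.{u}} (ψ : A →+* Γ(Y, ⊤))
    (hψ : (HomogeneousIdeal.irrelevant 𝒜).toIdeal.map ψ = ⊤) {t : A} (ht : t ∈ 𝒜 1)
    (h1 : ψ t = 1) (h : ⊤ ≤ (Proj.fromOfGlobalSections 𝒜 ψ hψ) ⁻¹ᵁ Proj.basicOpen 𝒜 t) :
    coords (Proj.fromOfGlobalSections 𝒜 ψ hψ) ht h = ψ :=
  ringHom_eq_of_homogeneous (𝒜 := 𝒜) _ _ fun d a ha => by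
    simpa [h1] using coords_fromOfGlobalSections ψ hψ ht (by rw [h1]; exact isUnit_one) h ha

/-- Both normalizations describe the same morphism, so in degree `d` they differ by the `d`-th power
of the transition function `t'/t`. -/
lemma coords_mul_pow {Y : Scheme.{u}} (g : Y ⟶ Proj 𝒜) {t t' : A} (ht : t ∈ 𝒜 1)
    (h : ⊤ ≤ g ⁻¹ᵁ Proj.basicOpen 𝒜 t) (ht' : t' ∈ 𝒜 1) (h' : ⊤ ≤ g ⁻¹ᵁ Proj.basicOpen 𝒜 t')
    {d : ℕ} {a : A} (ha : a ∈ 𝒜 d) :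
    coords g ht' h' a * coords g ht h t' ^ d = coords g ht h a := by
  have h1 := eq_fromOfGlobalSections_coords g ht h
  have h2 : ⊤ ≤ (Proj.fromOfGlobalSections 𝒜 (coords g ht h) (irrelevant_map_coords g ht h)) ⁻¹ᵁ
    Proj.basicOpen 𝒜 t' := by rwa [← h1]
  rw [← coords_fromOfGlobalSections (coords g ht h) (irrelevant_map_coords g ht h) ht'
    (isUnit_of_le_preimage _ _ ht' one_pos h2) h2 ha]
  congr 2
  congr 1

end Coordinates

/-! ### Homogeneous coordinates on projective space -/

section ProjectiveSpaceCoordinates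

variable {n : ℕ} {R : Type u} [CommRing R]

lemma X_mem_grading (i : Fin (n + 1)) :
    (MvPolynomial.X i : MvPolynomial (Fin (n + 1)) R) ∈ grading n R 1 :=
  MvPolynomial.isHomogeneous_X R i

lemma C_mem_grading (r : R) :
    (MvPolynomial.C r : MvPolynomial (Fin (n + 1)) R) ∈ grading n R 0 :=
  MvPolynomial.isHomogeneous_C _ r

lemma dehom_eq (i : Fin (n + 1)) : ProjSpace.dehom n R i =
    (Proj.awayToSection (grading n R) (MvPolynomial.X i)).hom.comp
      (dehomogenize (𝒜 := grading n R) (X_mem_grading i)) := by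
  refine congrArg (RingHom.comp (Proj.awayToSection (grading n R) (MvPolynomial.X i)).hom)
    (?_ : MvPolynomial.eval₂Hom (awayScalar (grading n R) (MvPolynomial.X i))
      (fun j => HomogeneousLocalization.Away.mk (grading n R) (d := 1) (X_mem_grading i) 1
        (MvPolynomial.X j) (by simpa using MvPolynomial.isHomogeneous_X R j)) =
        dehomogenize (𝒜 := grading n R) (X_mem_grading i))
  refine MvPolynomial.ringHom_ext (fun r => ?_) fun j => ?_
  · rw [MvPolynomial.eval₂Hom_C, dehomogenize_of_mem _ (C_mem_grading r)]
    apply HomogeneousLocalization.val_injective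
    rw [HomogeneousLocalization.Away.val_mk, val_awayScalar, ← Localization.mk_one_eq_algebraMap]
    congr 1
  · rw [MvPolynomial.eval₂Hom_X', dehomogenize_of_mem _ (X_mem_grading j)]

/-- The homogeneous coordinates of a morphism to `D₊(x_i)`, normalized by `x_i = 1`. -/
def coordsX {Y : Scheme.{u}} (g : Y ⟶ ProjSpace n R) (i : Fin (n + 1))
    (h : ⊤ ≤ g ⁻¹ᵁ (ProjSpace.chart n R i).1) : MvPolynomial (Fin (n + 1)) R →+* Γ(Y, ⊤) :=
  coords (𝒜 := grading n R) g (X_mem_grading i) h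

lemma coordsX_self {Y : Scheme.{u}} (g : Y ⟶ ProjSpace n R) (i : Fin (n + 1))
    (h : ⊤ ≤ g ⁻¹ᵁ (ProjSpace.chart n R i).1) : coordsX g i h (MvPolynomial.X i) = 1 :=
  coords_self _ _ _

lemma coordsX_comp {Y Y' : Scheme.{u}} (g : Y ⟶ ProjSpace n R) (i : Fin (n + 1))
    (h : ⊤ ≤ g ⁻¹ᵁ (ProjSpace.chart n R i).1) (u : Y' ⟶ Y)
    (h' : ⊤ ≤ (u ≫ g) ⁻¹ᵁ (ProjSpace.chart n R i).1) :
    coordsX (u ≫ g) i h' = u.appTop.hom.comp (coordsX g i h) :=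
  coords_comp g _ h u h'

lemma irrelevant_map_coordsX {Y : Scheme.{u}} (g : Y ⟶ ProjSpace n R) (i : Fin (n + 1))
    (h : ⊤ ≤ g ⁻¹ᵁ (ProjSpace.chart n R i).1) :
    (HomogeneousIdeal.irrelevant (grading n R)).toIdeal.map (coordsX g i h) = ⊤ :=
  irrelevant_map_coords g _ h

lemma eq_fromOfGlobalSections_coordsX {Y : Scheme.{u}} (g : Y ⟶ ProjSpace n R) (i : Fin (n + 1))
    (h : ⊤ ≤ g ⁻¹ᵁ (ProjSpace.chart n R i).1) : g =
      Proj.fromOfGlobalSections (grading n R) (coordsX g i h) (irrelevant_map_coordsX g i h) :=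
  eq_fromOfGlobalSections_coords g _ h

lemma coordsX_fromOfGlobalSections {Y : Scheme.{u}} (ψ : MvPolynomial (Fin (n + 1)) R →+* Γ(Y, ⊤))
    (hψ : (HomogeneousIdeal.irrelevant (grading n R)).toIdeal.map ψ = ⊤) (i : Fin (n + 1))
    (hu : IsUnit (ψ (MvPolynomial.X i)))
    (h : ⊤ ≤ (Proj.fromOfGlobalSections (grading n R) ψ hψ) ⁻¹ᵁ (ProjSpace.chart n R i).1)
    {d : ℕ} {F : MvPolynomial (Fin (n + 1)) R} (hF : F.IsHomogeneous d) :
    coordsX (Proj.fromOfGlobalSections (grading n R) ψ hψ) i h F * ψ (MvPolynomial.X i) ^ d =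
      ψ F :=
  coords_fromOfGlobalSections ψ hψ _ hu h hF

lemma coordsX_fromOfGlobalSections_of_eq_one {Y : Scheme.{u}}
    (ψ : MvPolynomial (Fin (n + 1)) R →+* Γ(Y, ⊤))
    (hψ : (HomogeneousIdeal.irrelevant (grading n R)).toIdeal.map ψ = ⊤) (i : Fin (n + 1))
    (hu : ψ (MvPolynomial.X i) = 1)
    (h : ⊤ ≤ (Proj.fromOfGlobalSections (grading n R) ψ hψ) ⁻¹ᵁ (ProjSpace.chart n R i).1) :
    coordsX (Proj.fromOfGlobalSections (grading n R) ψ hψ) i h = ψ :=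
  coords_fromOfGlobalSections_of_eq_one ψ hψ _ hu h

lemma le_fromOfGlobalSections_preimage_chart {Y : Scheme.{u}}
    (ψ : MvPolynomial (Fin (n + 1)) R →+* Γ(Y, ⊤))
    (hψ : (HomogeneousIdeal.irrelevant (grading n R)).toIdeal.map ψ = ⊤) (i : Fin (n + 1))
    (hu : IsUnit (ψ (MvPolynomial.X i))) :
    ⊤ ≤ (Proj.fromOfGlobalSections (grading n R) ψ hψ) ⁻¹ᵁ (ProjSpace.chart n R i).1 :=
  le_fromOfGlobalSections_preimage ψ hψ (X_mem_grading i) one_pos hu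

lemma coordsX_mul_pow {Y : Scheme.{u}} (g : Y ⟶ ProjSpace n R) (i j : Fin (n + 1))
    (h : ⊤ ≤ g ⁻¹ᵁ (ProjSpace.chart n R i).1) (h' : ⊤ ≤ g ⁻¹ᵁ (ProjSpace.chart n R j).1)
    {d : ℕ} {F : MvPolynomial (Fin (n + 1)) R} (hF : F.IsHomogeneous d) :
    coordsX g j h' F * coordsX g i h (MvPolynomial.X j) ^ d = coordsX g i h F :=
  coords_mul_pow g _ h _ h' hF

lemma coordsX_eq_appLE_dehom {Y : Scheme.{u}} (g : Y ⟶ ProjSpace n R) (i : Fin (n + 1))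
    (h : ⊤ ≤ g ⁻¹ᵁ (ProjSpace.chart n R i).1) (F : MvPolynomial (Fin (n + 1)) R) :
    coordsX g i h F = (g.appLE _ ⊤ h).hom (ProjSpace.dehom n R i F) := by
  rw [dehom_eq]
  rfl

lemma dehom_surjective (i : Fin (n + 1)) : Function.Surjective (ProjSpace.dehom n R i) := by
  intro y
  obtain ⟨z, rfl⟩ := (ConcreteCategory.bijective_of_isIso
    (Proj.basicOpenIsoAway (grading n R) _ (X_mem_grading i) one_pos).hom).2 y
  obtain ⟨d, b, hb, rfl⟩ := z.mk_surjective (grading n R) (X_mem_grading i)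
  refine ⟨b, ?_⟩
  rw [dehom_eq]
  refine congrArg (Proj.awayToSection (grading n R) (MvPolynomial.X i)).hom
    (dehomogenize_of_mem (X_mem_grading i) (d := d) (by simpa using hb))

/-- In a monomial of degree `d` each of the `d` variables contributes one factor `v`, while the
constants agree. -/
lemma map_eq_pow_mul {S : Type*} [CommRing S] (ψ ψ' : MvPolynomial (Fin (n + 1)) R →+* S) (v : S)
    (hC : ∀ r, ψ (MvPolynomial.C r) = ψ' (MvPolynomial.C r))
    (hX : ∀ j, ψ' (MvPolynomial.X j) = v * ψ (MvPolynomial.X j)) {d : ℕ}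
    {F : MvPolynomial (Fin (n + 1)) R} (hF : F.IsHomogeneous d) : ψ' F = v ^ d * ψ F := by
  rw [F.as_sum, map_sum, map_sum, Finset.mul_sum]
  refine Finset.sum_congr rfl fun m hm => ?_
  have hm' : m.degree = d := by
    have := hF (MvPolynomial.mem_support_iff.mp hm)
    rwa [Finsupp.degree_eq_weight_one]
  rw [MvPolynomial.monomial_eq, map_mul, map_mul, ← hC, Finsupp.prod, map_prod, map_prod]
  simp only [map_pow, hX, mul_pow]
  rw [Finset.prod_mul_distrib, Finset.prod_pow_eq_pow_sum]
  have : ∑ j ∈ m.support, m j = d := hm'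
  rw [this]
  ring

/-- This restates the data of `IsGivenByForms` through `coordsX`, making the calculus of normalized
coordinates available for `φ₀`. -/
lemma formsHom_eq (M : Submodule R (MvPolynomial (Fin (n + 1)) R)) {Y : Scheme.{u}}
    (h : Y ⟶ ProjSpace n R) (i : Fin (n + 1)) (W : Y.Opens)
    (hW : W ≤ h ⁻¹ᵁ (ProjSpace.chart n R i).1)
    (hW' : ⊤ ≤ (W.ι ≫ h) ⁻¹ᵁ (ProjSpace.chart n R i).1) :
    formsHom M h i W hW =
      (coordsX (W.ι ≫ h) i hW').comp (SymmetricAlgebra.lift M.subtype).toRingHom := by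
  have h1 : (coordsX (W.ι ≫ h) i hW') = (W.topIso.inv.hom.comp (h.appLE _ W hW).hom).comp
      (ProjSpace.dehom n R i) := by
    refine RingHom.ext fun F => ?_
    rw [coordsX_eq_appLE_dehom, RingHom.comp_apply]
    refine congr($((?_ : Scheme.Hom.appLE (W.ι ≫ h) _ ⊤ hW' =
      h.appLE _ W hW ≫ W.topIso.inv)).hom _)
    rw [← appLE_ι_eq_topIso_inv]
    exact (Scheme.Hom.appLE_comp_appLE W.ι h _ W ⊤ _ _).symm
  rw [h1, formsHom, RingHom.comp_assoc, RingHom.comp_assoc, RingHom.comp_assoc]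

end ProjectiveSpaceCoordinates

end

section

open IsLocalRing

/-! ### The structure morphism of `ℙⁿ` and the covering by charts -/

section StructureMorphism

variable {n : ℕ} {R : Type u} [CommRing R]

lemma toSpecΓ_comp_map_appTop {Y : Scheme.{u}} {S : CommRingCat.{u}} (χ : S ⟶ Γ(Y, ⊤)) (r : S) :
    (Y.toSpecΓ ≫ Spec.map χ).appTop.hom ((Scheme.ΓSpecIso S).inv.hom r) = χ.hom r := by
  have h : (Scheme.ΓSpecIso S).inv ≫ (Y.toSpecΓ ≫ Spec.map χ).appTop = χ := by
    rw [Scheme.Hom.comp_appTop, Scheme.toSpecΓ_appTop, Scheme.ΓSpecIso_naturality,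
      Iso.inv_hom_id_assoc]
  exact congr($(h).hom r)

lemma toSpec_eq {Y : Scheme.{u}} (g : Y ⟶ ProjSpace n R) (i : Fin (n + 1))
    (h : ⊤ ≤ g ⁻¹ᵁ (ProjSpace.chart n R i).1) :
    g ≫ ProjSpace.toSpec n R = Y.toSpecΓ ≫ Spec.map (CommRingCat.ofHom
      ((coordsX g i h).comp MvPolynomial.C)) := by
  have h1 := eq_toSpecΓ_comp_awayι g (X_mem_grading i) one_pos h
  have h2 : g ≫ ProjSpace.toSpec n R = Y.toSpecΓ ≫ Spec.map (CommRingCat.ofHom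
      (evalAt (grading n R) g (MvPolynomial.X i) h)) ≫
        Proj.awayι (grading n R) (MvPolynomial.X i) (X_mem_grading i) one_pos ≫
          ProjSpace.toSpec n R := by
    conv_lhs => rw [h1]
    simp only [Category.assoc]
  rw [h2, ProjSpace.toSpec, Proj.awayι_toSpecZero_assoc, ← Spec.map_comp, ← Spec.map_comp]
  congr 2
  ext r
  change evalAt (grading n R) g (MvPolynomial.X i) h (awayScalar (grading n R) _ r) =
    evalAt (grading n R) g (MvPolynomial.X i) h (dehomogenize (X_mem_grading i) (MvPolynomial.C r))
  congr 1
  rw [dehomogenize_of_mem _ (C_mem_grading r)]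
  apply HomogeneousLocalization.val_injective
  rw [HomogeneousLocalization.Away.val_mk, val_awayScalar, ← Localization.mk_one_eq_algebraMap]
  congr 1

lemma coordsX_C {Y : Scheme.{u}} (g : Y ⟶ ProjSpace n R) (i : Fin (n + 1))
    (h : ⊤ ≤ g ⁻¹ᵁ (ProjSpace.chart n R i).1) (r : R) :
    coordsX g i h (MvPolynomial.C r) =
      (g ≫ ProjSpace.toSpec n R).appTop.hom ((Scheme.ΓSpecIso (.of R)).inv.hom r) := by
  rw [toSpec_eq g i h]
  exact (toSpecΓ_comp_map_appTop (CommRingCat.ofHom ((coordsX g i h).comp MvPolynomial.C)) r).symm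

lemma irrelevant_le_span_X : (HomogeneousIdeal.irrelevant (grading n R)).toIdeal ≤
    Ideal.span (Set.range (MvPolynomial.X : Fin (n + 1) → MvPolynomial (Fin (n + 1)) R)) := by
  intro F hF
  classical
  rw [← DirectSum.sum_support_decompose (grading n R) F]
  refine Ideal.sum_mem _ fun d hd => ?_
  by_cases hd0 : d = 0
  · subst hd0
    have h1 : ((DirectSum.decompose (grading n R) F 0 : grading n R 0) :
      MvPolynomial (Fin (n + 1)) R) = 0 := (HomogeneousIdeal.mem_irrelevant_iff _ _).mp hF
    rw [h1]
    exact zero_mem _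
  · obtain ⟨d, rfl⟩ := Nat.exists_eq_succ_of_ne_zero hd0
    have h1 : ((DirectSum.decompose (grading n R) F (d + 1) : grading n R (d + 1)) :
      MvPolynomial (Fin (n + 1)) R) ∈ MvPolynomial.homogeneousSubmodule (Fin (n + 1)) R (d + 1) :=
      SetLike.coe_mem _
    rw [← MvPolynomial.homogeneousSubmodule_one_pow, pow_succ',
      MvPolynomial.homogeneousSubmodule_one_eq_span_X] at h1
    refine Submodule.mul_induction_on h1 (fun a ha b _ => Ideal.mul_mem_right _ _ ?_)
      fun a b => add_mem
    exact Submodule.span_subset_span R _ _ ha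

lemma iSup_chart : ⨆ i, (ProjSpace.chart n R i).1 = ⊤ :=
  Proj.iSup_basicOpen_eq_top _ _ irrelevant_le_span_X

lemma exists_mem_chart (y : ProjSpace n R) : ∃ i, y ∈ (ProjSpace.chart n R i).1 :=
  TopologicalSpace.Opens.mem_iSup.mp ((iSup_chart (n := n) (R := R)).ge (Set.mem_univ y))

end StructureMorphism

/-! ### Linear and quadratic forms through a rational point of the special fibre -/

section Point

variable {V : Type u} [CommRing V] [IsLocalRing V] {n : ℕ}

/-- `I` is the ideal sheaf of the point of the special fibre with homogeneous coordinates
obtained by reducing `p`. -/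
structure IsPointIdeal (I : (ProjSpace n V).IdealSheafData) (p : Fin (n + 1) → V) : Prop where
  exists_eq_one : ∃ i, p i = 1
  -- If `p i` is not a unit the right-hand side is vacuous, as it should be: the point then lies
  -- outside the chart and the ideal is the unit ideal there.
  mem_iff : ∀ i F, ProjSpace.dehom n V i F ∈ I.ideal (ProjSpace.chart n V i) ↔
    ∀ u, u * p i = 1 → MvPolynomial.eval (fun j => u * p j) F ∈ maximalIdeal V

/-- `P` is a section of the structure morphism, so constants are mapped to themselves and the
coordinate homomorphism is evaluation at the images of the variables. -/
lemma coordsX_eq_eval {k : Type u} [Field k] (P : Spec (.of k) ⟶ ProjSpace n k)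
    (hP : P ≫ ProjSpace.toSpec n k = 𝟙 _) (i : Fin (n + 1))
    (h : ⊤ ≤ P ⁻¹ᵁ (ProjSpace.chart n k i).1) :
    coordsX P i h = (Scheme.ΓSpecIso (.of k)).inv.hom.comp (MvPolynomial.eval fun j =>
      (Scheme.ΓSpecIso (.of k)).hom.hom (coordsX P i h (MvPolynomial.X j))) := by
  refine MvPolynomial.ringHom_ext (fun r => ?_) fun j => ?_
  · rw [coordsX_C, hP, RingHom.comp_apply, MvPolynomial.eval_C]
    simp
  · rw [RingHom.comp_apply, MvPolynomial.eval_X]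
    simp

lemma exists_eq_fromOfGlobalSections {k : Type u} [Field k] (P : Spec (.of k) ⟶ ProjSpace n k)
    (hP : P ≫ ProjSpace.toSpec n k = 𝟙 _) : ∃ (q : Fin (n + 1) → k) (i : Fin (n + 1)) (_ : q i = 1)
      (h : (HomogeneousIdeal.irrelevant (grading n k)).toIdeal.map
        ((Scheme.ΓSpecIso (.of k)).inv.hom.comp (MvPolynomial.eval q)) = ⊤),
      P = Proj.fromOfGlobalSections (grading n k)
        ((Scheme.ΓSpecIso (.of k)).inv.hom.comp (MvPolynomial.eval q)) h := by
  obtain ⟨i, hi⟩ := exists_mem_chart (P (IsLocalRing.closedPoint k))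
  have h : ⊤ ≤ P ⁻¹ᵁ (ProjSpace.chart n k i).1 := fun y _ => by
    rw [Subsingleton.elim y (IsLocalRing.closedPoint k)]
    exact hi
  have h1 := eq_fromOfGlobalSections_coordsX P i h
  have h2 := coordsX_eq_eval P hP i h
  have h3 := irrelevant_map_coordsX P i h
  refine ⟨_, i, ?_, by rwa [← h2], h1.trans ?_⟩
  · rw [coordsX_self, map_one]
  · congr 1

lemma dehom_mem_ker_iff {k : Type u} [Field k] (P : Spec (.of k) ⟶ ProjSpace n k)
    (q : Fin (n + 1) → k) (h : (HomogeneousIdeal.irrelevant (grading n k)).toIdeal.map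
        ((Scheme.ΓSpecIso (.of k)).inv.hom.comp (MvPolynomial.eval q)) = ⊤)
    (hP : P = Proj.fromOfGlobalSections (grading n k)
      ((Scheme.ΓSpecIso (.of k)).inv.hom.comp (MvPolynomial.eval q)) h) (i : Fin (n + 1))
    (F : MvPolynomial (Fin (n + 1)) k) :
    ProjSpace.dehom n k i F ∈ P.ker.ideal (ProjSpace.chart n k i) ↔
      ∀ u, u * q i = 1 → MvPolynomial.eval (fun j => u * q j) F = 0 := by
  rw [Scheme.Hom.ker_apply, RingHom.mem_ker]
  have h0 : P ⁻¹ᵁ (ProjSpace.chart n k i).1 =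
      (Spec (.of k)).basicOpen ((Scheme.ΓSpecIso (.of k)).inv.hom (q i)) := by
    subst hP
    refine (Proj.fromOfGlobalSections_preimage_basicOpen _ _ h one_pos (X_mem_grading i)).trans ?_
    rw [RingHom.comp_apply, MvPolynomial.eval_X]
  -- If the coordinate vanishes, the preimage of the chart is empty and its ring of functions is
  -- zero. Otherwise the point lies in the chart and its coordinates are rescaled to make the `i`-th
  -- one equal to `1`.
  by_cases hq : q i = 0
  · rw [hq, map_zero, Scheme.basicOpen_zero] at h0
    have : Subsingleton Γ(Spec (.of k), P ⁻¹ᵁ (ProjSpace.chart n k i).1) := by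
      rw [h0]; infer_instance
    exact ⟨fun _ u hu => by simp [hq] at hu, fun _ => Subsingleton.elim _ _⟩
  · have hu : IsUnit (((Scheme.ΓSpecIso (.of k)).inv.hom.comp (MvPolynomial.eval q))
        (MvPolynomial.X i)) := by
      rw [RingHom.comp_apply, MvPolynomial.eval_X]
      exact (isUnit_iff_ne_zero.mpr hq).map _
    have h1 : ⊤ ≤ P ⁻¹ᵁ (ProjSpace.chart n k i).1 := by
      rw [h0, Scheme.basicOpen_of_isUnit]
      exact (isUnit_iff_ne_zero.mpr hq).map _
    have h2 : coordsX P i h1 = (Scheme.ΓSpecIso (.of k)).inv.hom.comp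
        (MvPolynomial.eval fun j => (q i)⁻¹ * q j) := by
      subst hP
      refine MvPolynomial.ringHom_ext (fun r => ?_) fun j => ?_
      · have := coordsX_fromOfGlobalSections _ h i hu h1 (MvPolynomial.isHomogeneous_C _ r)
        rw [pow_zero, mul_one] at this
        rw [this]
        simp
      · have := coordsX_fromOfGlobalSections _ h i hu h1 (MvPolynomial.isHomogeneous_X _ j)
        refine hu.mul_right_cancel ((congrArg (_ * ·) (pow_one _).symm).trans (this.trans ?_))
        rw [RingHom.comp_apply, RingHom.comp_apply, RingHom.comp_apply, ← map_mul]
        simp only [MvPolynomial.eval_X]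
        congr 1
        field_simp
    have h3 : (P.app (ProjSpace.chart n k i).1).hom (ProjSpace.dehom n k i F) = 0 ↔
        coordsX P i h1 F = 0 := by
      rw [coordsX_eq_appLE_dehom, Scheme.Hom.appLE, CommRingCat.hom_comp, RingHom.comp_apply]
      have : IsIso ((Spec (.of k)).presheaf.map (homOfLE h1).op) := by
        rw [show homOfLE h1 = eqToHom (top_le_iff.mp h1).symm from Subsingleton.elim _ _]
        infer_instance
      exact (map_eq_zero_iff _ (ConcreteCategory.bijective_of_isIso
        ((Spec (.of k)).presheaf.map (homOfLE h1).op)).1).symm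
    refine h3.trans ?_
    rw [h2, RingHom.comp_apply]
    have h4 : Function.Injective (Scheme.ΓSpecIso (.of k)).inv.hom :=
      (ConcreteCategory.bijective_of_isIso (Scheme.ΓSpecIso (.of k)).inv).1
    rw [map_eq_zero_iff _ h4]
    refine ⟨fun H u hu => ?_, fun H => H _ (inv_mul_cancel₀ hq)⟩
    rwa [eq_inv_of_mul_eq_one_left hu]

lemma exists_isPointIdeal
    (P : Spec (.of (ResidueField V)) ⟶ ProjSpace n (ResidueField V))
    (hP : P ≫ ProjSpace.toSpec n (ResidueField V) = 𝟙 _) :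
    ∃ p, IsPointIdeal (idealOfPoint P) p := by
  obtain ⟨q, i₀, hq, h, hPq⟩ := exists_eq_fromOfGlobalSections P hP
  -- The normalized coordinate is lifted to exactly `1`, as `IsPointIdeal` requires an equality in
  -- `V` and not just in the residue field.
  have : ∀ j, ∃ v : V, residue V v = q j ∧ (j = i₀ → v = 1) := fun j => by
    by_cases hj : j = i₀
    · exact ⟨1, by rw [hj, hq, map_one], fun _ => rfl⟩
    · obtain ⟨v, hv⟩ := residue_surjective (q j)
      exact ⟨v, hv, fun h => (hj h).elim⟩
  choose p hp hp1 using this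
  refine ⟨p, ⟨i₀, hp1 i₀ rfl⟩, fun i F => ?_⟩
  rw [dehom_mem_iff, dehom_mem_ker_iff P q h hPq]
  have key : ∀ u : V, MvPolynomial.eval (fun j => residue V u * q j)
      (MvPolynomial.map (algebraMap V (ResidueField V)) F) =
        residue V (MvPolynomial.eval (fun j => u * p j) F) := fun u => by
    rw [MvPolynomial.eval_map]
    change MvPolynomial.eval₂ (residue V) _ F = _
    rw [← MvPolynomial.eval₂_id, MvPolynomial.hom_eval₂, RingHom.comp_id]
    congr 1
    ext j
    rw [map_mul, hp]
  constructor
  · intro H u hu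
    rw [← residue_eq_zero_iff, ← key]
    exact H _ (by rw [← hp, ← map_mul, hu, map_one])
  · intro H u hu
    obtain ⟨u, rfl⟩ := residue_surjective u
    have h1 : IsUnit (p i) := by
      rw [← hp, ← map_mul] at hu
      by_contra hc
      rw [map_mul, (residue_eq_zero_iff _).mpr ((mem_maximalIdeal _).mpr hc), mul_zero] at hu
      exact zero_ne_one hu
    obtain ⟨w, hw⟩ := h1.exists_left_inv
    have h2 : residue V u = residue V w := by
      have hpi : q i ≠ 0 := fun hc => by simp [hc] at hu
      apply mul_right_cancel₀ hpi
      rw [hu, ← hp, ← map_mul, hw, map_one]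
    rw [h2, key, residue_eq_zero_iff]
    exact H w hw

lemma dehom_X_self {R : Type u} [CommRing R] (i : Fin (n + 1)) :
    ProjSpace.dehom n R i (MvPolynomial.X i) = 1 := by
  rw [dehom_eq]
  refine (congrArg (Proj.awayToSection (grading n R) (MvPolynomial.X i)).hom
    (?_ : dehomogenize (𝒜 := grading n R) (X_mem_grading i) (MvPolynomial.X i) = 1)).trans
      (map_one _)
  rw [dehomogenize_of_mem _ (X_mem_grading i)]
  apply HomogeneousLocalization.val_injective
  rw [HomogeneousLocalization.Away.val_mk, HomogeneousLocalization.val_one]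
  refine Eq.trans ?_ (Localization.mk_self (⟨MvPolynomial.X i, 1, pow_one _⟩ :
    Submonoid.powers (MvPolynomial.X i : MvPolynomial (Fin (n + 1)) R)))
  congr 1
  ext1
  exact pow_one _

/-- Modulo the elements `x_j - q_j` each variable becomes a constant, and so every polynomial
becomes its value at `q`. -/
lemma sub_C_eval_mem {R σ : Type*} [CommRing R] (q : σ → R) (F : MvPolynomial σ R) :
    F - MvPolynomial.C (MvPolynomial.eval q F) ∈
      Ideal.span (Set.range fun j => MvPolynomial.X j - MvPolynomial.C (q j)) := by
  set J := Ideal.span (Set.range fun j => (MvPolynomial.X j - MvPolynomial.C (q j) :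
    MvPolynomial σ R))
  have h : (Ideal.Quotient.mk J) =
      ((Ideal.Quotient.mk J).comp MvPolynomial.C).comp (MvPolynomial.eval q) := by
    refine MvPolynomial.ringHom_ext (fun r => by simp) fun j => ?_
    rw [RingHom.comp_apply, MvPolynomial.eval_X]
    exact Ideal.Quotient.eq.mpr (Ideal.subset_span ⟨j, rfl⟩)
  exact Ideal.Quotient.eq.mp congr($h F)

variable {I : (ProjSpace n V).IdealSheafData} {p : Fin (n + 1) → V}

lemma eval_mul_of_isHomogeneous {R : Type*} [CommRing R] (q : Fin (n + 1) → R) (u : R) {d : ℕ}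
    {F : MvPolynomial (Fin (n + 1)) R} (hF : F.IsHomogeneous d) :
    MvPolynomial.eval (fun j => u * q j) F = u ^ d * MvPolynomial.eval q F :=
  map_eq_pow_mul _ _ u (fun r => by simp) (fun j => by simp) hF

/-- Rescaling the coordinates multiplies the value of a form by a power of the scalar, so the one
evaluation at `p` controls all charts simultaneously. -/
lemma IsPointIdeal.mem_twistedSections_iff (hI : IsPointIdeal I p) {d : ℕ}
    {F : MvPolynomial (Fin (n + 1)) V} : F ∈ twistedSections I d ↔
      F.IsHomogeneous d ∧ MvPolynomial.eval p F ∈ maximalIdeal V := by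
  refine and_congr_right fun hF => ?_
  obtain ⟨i₀, hi₀⟩ := hI.exists_eq_one
  constructor
  · intro H
    have := (hI.mem_iff i₀ F).mp (H i₀) 1 (by rw [hi₀, one_mul])
    simpa only [one_mul] using this
  · intro H i
    rw [hI.mem_iff]
    intro u _
    rw [eval_mul_of_isHomogeneous p u hF]
    exact Ideal.mul_mem_left _ _ H

lemma IsPointIdeal.mul_mem (hI : IsPointIdeal I p) {d e : ℕ} {F G : MvPolynomial (Fin (n + 1)) V}
    (hF : F ∈ twistedSections I d) (hG : G.IsHomogeneous e) :
    F * G ∈ twistedSections I (d + e) := by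
  rw [hI.mem_twistedSections_iff] at hF ⊢
  exact ⟨hF.1.mul hG, by rw [map_mul]; exact Ideal.mul_mem_right _ _ hF.2⟩

lemma IsPointIdeal.C_mul_mem (hI : IsPointIdeal I p) {d : ℕ} {G : MvPolynomial (Fin (n + 1)) V}
    (hG : G.IsHomogeneous d) {r : V} (hr : r ∈ maximalIdeal V) :
    MvPolynomial.C r * G ∈ twistedSections I d := by
  rw [hI.mem_twistedSections_iff]
  refine ⟨hG.C_mul r, ?_⟩
  rw [map_mul, MvPolynomial.eval_C]
  exact Ideal.mul_mem_right _ _ hr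

lemma IsPointIdeal.X_sub_mem (hI : IsPointIdeal I p) {i : Fin (n + 1)} {u : V} (hu : u * p i = 1)
    (j : Fin (n + 1)) : MvPolynomial.X j - MvPolynomial.C (u * p j) * MvPolynomial.X i ∈
      twistedSections I 1 := by
  rw [hI.mem_twistedSections_iff]
  refine ⟨(MvPolynomial.isHomogeneous_X V j).sub
    (MvPolynomial.IsHomogeneous.C_mul (MvPolynomial.isHomogeneous_X V i) _), ?_⟩
  rw [map_sub, map_mul, MvPolynomial.eval_X, MvPolynomial.eval_X, MvPolynomial.eval_C,
    mul_right_comm, hu, one_mul, sub_self]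
  exact zero_mem _

/-- The linear forms through the point generate its ideal in each chart. If `u * p i = 1`, the ideal
is generated by the maximal ideal of `V` and by the functions `x_j - u p_j`, which come from the
forms `r x_i` and `x_j - u p_j x_i`. If `p i` is not a unit, then `x_i` itself passes through the
point and contributes `1`. -/
lemma IsPointIdeal.ideal_chart (hI : IsPointIdeal I p) (i : Fin (n + 1)) :
    I.ideal (ProjSpace.chart n V i) =
      Ideal.span (ProjSpace.dehom n V i '' (twistedSections I 1 : Set _)) := by
  refine le_antisymm (fun y hy => ?_) (Ideal.span_le.mpr ?_)
  · obtain ⟨F, rfl⟩ := dehom_surjective i y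
    by_cases hu : IsUnit (p i)
    · obtain ⟨u, hu⟩ := hu.exists_left_inv
      have h1 := (hI.mem_iff i F).mp hy u hu
      set q := fun j => u * p j
      have h2 : F = (F - MvPolynomial.C (MvPolynomial.eval q F)) +
        MvPolynomial.C (MvPolynomial.eval q F) := by ring
      rw [h2, map_add]
      refine add_mem ?_ (Ideal.subset_span ⟨_, hI.C_mul_mem (MvPolynomial.isHomogeneous_X V i) h1,
        by rw [map_mul, dehom_X_self, mul_one]⟩)
      refine (Ideal.mem_map_of_mem (ProjSpace.dehom n V i) (sub_C_eval_mem q F) : _ ∈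
        Ideal.map (ProjSpace.dehom n V i) _) |> (?_ : Ideal.map _ _ ≤ Ideal.span _)
      rw [Ideal.map_span, Ideal.span_le]
      rintro _ ⟨_, ⟨j, rfl⟩, rfl⟩
      refine Ideal.subset_span ⟨_, hI.X_sub_mem hu j, ?_⟩
      rw [map_sub, map_sub, map_mul, dehom_X_self, mul_one]
    · have h1 : MvPolynomial.X i ∈ twistedSections I 1 := by
        rw [hI.mem_twistedSections_iff, MvPolynomial.eval_X]
        exact ⟨MvPolynomial.isHomogeneous_X V i, (mem_maximalIdeal _).mpr hu⟩
      have h2 : ProjSpace.dehom n V i (MvPolynomial.X i) ∈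
          Ideal.span (ProjSpace.dehom n V i '' (twistedSections I 1 : Set _)) :=
        Ideal.subset_span ⟨_, h1, rfl⟩
      rw [dehom_X_self] at h2
      rw [(Ideal.eq_top_iff_one _).mpr h2]
      trivial
  · rintro _ ⟨F, hF, rfl⟩
    exact hF.2 i

/-- Take `i` with `p i = 1`. Modulo products of the required shape every quadratic form `G` is
congruent to `G(p) x_i²`. If `G(p)` lies in the maximal ideal, then `G(p) x_i` is a linear form
through the point and the remainder has the required shape as well. -/
lemma IsPointIdeal.twistedSections_two_eq_span (hI : IsPointIdeal I p) : twistedSections I 2 =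
    Submodule.span V {F | ∃ ℓ ∈ twistedSections I 1, ∃ i, F = ℓ * MvPolynomial.X i} := by
  refine le_antisymm (fun F hF => ?_) (Submodule.span_le.mpr ?_)
  · obtain ⟨i, hi⟩ := hI.exists_eq_one
    set S := Submodule.span V {F | ∃ ℓ ∈ twistedSections I 1, ∃ i, F = ℓ * MvPolynomial.X i}
    have hS : ∀ ℓ ∈ twistedSections I 1, ∀ i, ℓ * MvPolynomial.X i ∈ S := fun ℓ hℓ i =>
      Submodule.subset_span ⟨ℓ, hℓ, i, rfl⟩
    have hL : ∀ j, MvPolynomial.X j - MvPolynomial.C (p j) * MvPolynomial.X i ∈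
        twistedSections I 1 := fun j => by
      simpa using hI.X_sub_mem (i := i) (u := 1) (by rw [hi, one_mul]) j
    have h1 : ∀ G ∈ MvPolynomial.homogeneousSubmodule (Fin (n + 1)) V 2,
        G - MvPolynomial.C (MvPolynomial.eval p G) * (MvPolynomial.X i * MvPolynomial.X i) ∈ S := by
      intro G hG
      rw [← MvPolynomial.homogeneousSubmodule_one_pow, pow_two,
        MvPolynomial.homogeneousSubmodule_one_eq_span_X, Submodule.span_mul_span] at hG
      induction hG using Submodule.span_induction with
      | mem G hG =>
        obtain ⟨_, ⟨j, rfl⟩, _, ⟨l, rfl⟩, rfl⟩ := hG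
        -- The identity used is `x_j x_l - p_j p_l x_i² = (x_j - p_j x_i) x_l + p_j (x_l - p_l x_i)
        -- x_i`.
        have h2 := add_mem (hS _ (hL j) l) (S.smul_mem (p j) (hS _ (hL l) i))
        convert h2 using 1
        simp only [map_mul, MvPolynomial.eval_X, MvPolynomial.smul_eq_C_mul]
        ring
      | zero => simp
      | add G G' _ _ h h' =>
        convert add_mem h h' using 1
        rw [map_add, map_add]
        ring
      | smul r G _ h =>
        convert S.smul_mem r h using 1
        rw [MvPolynomial.smul_eq_C_mul, map_mul, MvPolynomial.eval_C, map_mul,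
          MvPolynomial.smul_eq_C_mul]
        ring
    have h2 := hI.mem_twistedSections_iff.mp hF
    have h3 := add_mem (h1 F h2.1) (hS _ (hI.C_mul_mem (MvPolynomial.isHomogeneous_X V i) h2.2) i)
    convert h3 using 1
    ring
  · rintro _ ⟨ℓ, hℓ, i, rfl⟩
    exact hI.mul_mem hℓ (MvPolynomial.isHomogeneous_X V i)

end Point

end

section

open IsLocalRing

/-! ### Gluing morphisms, and testing extensions on affine schemes -/

lemma exists_glue {Y Z : Scheme.{u}} {ι : Type u} (W : ι → Y.Opens) (hW : ∀ y, ∃ i, y ∈ W i)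
    (h : ∀ i, (W i).toScheme ⟶ Z) (H : ∀ i j {Q : Scheme.{u}} (a : Q ⟶ W i) (b : Q ⟶ W j),
      a ≫ (W i).ι = b ≫ (W j).ι → a ≫ h i = b ≫ h j) :
    ∃ φ : Y ⟶ Z, ∀ i, (W i).ι ≫ φ = h i := by
  have hc : TopologicalSpace.IsOpenCover W := TopologicalSpace.IsOpenCover.mk
    (top_le_iff.mp fun y _ => TopologicalSpace.Opens.mem_iSup.mpr (hW y))
  exact ⟨(Y.openCoverOfIsOpenCover W hc).glueMorphisms h fun i j => H i j _ _ pullback.condition,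
    fun i => (Y.openCoverOfIsOpenCover W hc).ι_glueMorphisms h _ i⟩

lemma exists_affine_nhd {Y : Scheme.{u}} {O : Y.Opens} {y : Y} (hy : y ∈ O) :
    ∃ W : Y.affineOpens, y ∈ W.1 ∧ W.1 ≤ O := by
  obtain ⟨W, hW, hyW, hWle⟩ := (TopologicalSpace.Opens.isBasis_iff_nbhd.mp
    Y.isBasis_affineOpens) hy
  exact ⟨⟨W, hW⟩, hyW, hWle⟩

lemma Extends.of_affine {X B Z : Scheme.{u}} {f : B ⟶ X} {U : X.Opens} {φ₀ : U.toScheme ⟶ Z}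
    {φ : B ⟶ Z} (H : ∀ (Q : Scheme.{u}) [IsAffine Q] (a : Q ⟶ B) (b : Q ⟶ U), a ≫ f = b ≫ U.ι →
      a ≫ φ = b ≫ φ₀) : Extends f φ₀ φ := by
  refine hom_ext_of_forall_exists _ _ fun y => ?_
  obtain ⟨⟨W, hW⟩, hy, -⟩ := exists_affine_nhd (TopologicalSpace.Opens.mem_top y)
  refine ⟨W, hy, ?_⟩
  have : IsAffine W := hW
  simpa only [Category.assoc] using H W (W.ι ≫ pullback.fst f U.ι) (W.ι ≫ pullback.snd f U.ι)
    (by rw [Category.assoc, Category.assoc, pullback.condition])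

lemma Extends.comp_eq {X B Z : Scheme.{u}} {f : B ⟶ X} {U : X.Opens} {φ₀ : U.toScheme ⟶ Z}
    {φ : B ⟶ Z} (h : Extends f φ₀ φ) {Q : Scheme.{u}} (a : Q ⟶ B) (b : Q ⟶ U)
    (hab : a ≫ f = b ≫ U.ι) : a ≫ φ = b ≫ φ₀ := by
  have h1 : pullback.lift a b hab ≫ pullback.fst f U.ι ≫ φ =
    pullback.lift a b hab ≫ pullback.snd f U.ι ≫ φ₀ := congrArg _ h
  rwa [pullback.lift_fst_assoc, pullback.lift_snd_assoc] at h1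

/-! ### Homomorphisms out of a symmetric algebra -/

section Sym

variable {R : Type u} [CommRing R] {M : Type u} [AddCommGroup M] [Module R M]

lemma ι_mem_symGrading (m : M) : SymmetricAlgebra.ι R M m ∈ symGrading R M 1 := by
  change _ ∈ LinearMap.range (SymmetricAlgebra.ι R M) ^ 1
  rw [pow_one]
  exact LinearMap.mem_range_self _ m

lemma algebraMap_mem_symGrading (r : R) :
    algebraMap R (SymmetricAlgebra R M) r ∈ symGrading R M 0 :=
  SetLike.algebraMap_mem_graded (symGrading R M) r

lemma sym_ringHom_ext {S : Type*} [CommRing S] {ψ ψ' : SymmetricAlgebra R M →+* S}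
    (h0 : ∀ r, ψ (algebraMap R _ r) = ψ' (algebraMap R _ r))
    (h1 : ∀ m, ψ (SymmetricAlgebra.ι R M m) = ψ' (SymmetricAlgebra.ι R M m)) : ψ = ψ' := by
  refine RingHom.ext fun x => ?_
  induction x using SymmetricAlgebra.induction with
  | algebraMap r => exact h0 r
  | ι m => exact h1 m
  | mul a b ha hb => rw [map_mul, map_mul, ha, hb]
  | add a b ha hb => rw [map_add, map_add, ha, hb]

lemma sym_map_eq_pow_mul {S : Type*} [CommRing S] (ψ ψ' : SymmetricAlgebra R M →+* S) (v : S)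
    (h0 : ∀ r, ψ (algebraMap R _ r) = ψ' (algebraMap R _ r))
    (h1 : ∀ m, ψ' (SymmetricAlgebra.ι R M m) = v * ψ (SymmetricAlgebra.ι R M m)) {d : ℕ}
    {x : SymmetricAlgebra R M} (hx : x ∈ symGrading R M d) : ψ' x = v ^ d * ψ x := by
  induction hx using Submodule.pow_induction_on_left' with
  | algebraMap r => rw [h0, pow_zero, one_mul]
  | add x y i hx hy ihx ihy => rw [map_add, map_add, ihx, ihy, mul_add]
  | mem_mul m hm i x hx ih =>
    obtain ⟨m, rfl⟩ := hm
    rw [map_mul, map_mul, h1, ih, pow_succ]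
    ring

/-- The ring homomorphism out of a symmetric algebra given by compatible maps on scalars and
on the module. -/
lemma exists_symLift {S : Type u} [CommRing S] (σ : R →+* S) (f : M → S)
    (hadd : ∀ a b, f (a + b) = f a + f b) (hsmul : ∀ r a, f (r • a) = σ r * f a) :
    ∃ θ : SymmetricAlgebra R M →+* S, (∀ r, θ (algebraMap R _ r) = σ r) ∧
      ∀ m, θ (SymmetricAlgebra.ι R M m) = f m := by
  let _ : Algebra R S := σ.toAlgebra
  refine ⟨(SymmetricAlgebra.lift (R := R) (A := S)
    { toFun := f, map_add' := hadd, map_smul' := fun r a => by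
        rw [hsmul, RingHom.id_apply, Algebra.smul_def]; rfl }).toRingHom, fun r => ?_, fun m => ?_⟩
  · exact AlgHom.commutes _ r
  · exact SymmetricAlgebra.lift_ι_apply _ m

lemma irrelevant_le_span_ι : (HomogeneousIdeal.irrelevant (symGrading R M)).toIdeal ≤
    Ideal.span (Set.range (SymmetricAlgebra.ι R M)) := by
  intro F hF
  classical
  rw [← DirectSum.sum_support_decompose (symGrading R M) F]
  refine Ideal.sum_mem _ fun d hd => ?_
  by_cases hd0 : d = 0
  · subst hd0
    have h1 : ((DirectSum.decompose (symGrading R M) F 0 : symGrading R M 0) :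
      SymmetricAlgebra R M) = 0 := (HomogeneousIdeal.mem_irrelevant_iff _ _).mp hF
    rw [h1]
    exact zero_mem _
  · obtain ⟨d, rfl⟩ := Nat.exists_eq_succ_of_ne_zero hd0
    have h1 : ((DirectSum.decompose (symGrading R M) F (d + 1) : symGrading R M (d + 1)) :
      SymmetricAlgebra R M) ∈ LinearMap.range (SymmetricAlgebra.ι R M) ^ (d + 1) :=
      SetLike.coe_mem _
    rw [pow_succ'] at h1
    refine Submodule.mul_induction_on h1 (fun a ha b _ => Ideal.mul_mem_right _ _ ?_)
      fun a b => add_mem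
    exact Ideal.subset_span ha

lemma sym_irrelevant_map_eq_top {S : Type*} [CommRing S] (ψ : SymmetricAlgebra R M →+* S)
    (h : Ideal.span (Set.range fun m => ψ (SymmetricAlgebra.ι R M m)) = ⊤) :
    (HomogeneousIdeal.irrelevant (symGrading R M)).toIdeal.map ψ = ⊤ := by
  rw [← top_le_iff, ← h, Ideal.span_le]
  rintro _ ⟨m, rfl⟩
  exact Ideal.mem_map_of_mem _ (HomogeneousIdeal.mem_irrelevant_of_mem _ one_pos
    (ι_mem_symGrading m))

end Sym

/-! ### Morphisms given by a module of forms -/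

section Forms

variable {V : Type u} [CommRing V] {n : ℕ}

/-- The homomorphism `Sym M → V[x_0, …, x_n]` for a module `M` of forms. -/
abbrev symToForms (M : Submodule V (MvPolynomial (Fin (n + 1)) V)) :
    SymmetricAlgebra V M →+* MvPolynomial (Fin (n + 1)) V :=
  (SymmetricAlgebra.lift M.subtype).toRingHom

lemma symToForms_ι (M : Submodule V (MvPolynomial (Fin (n + 1)) V)) (F : M) :
    symToForms M (SymmetricAlgebra.ι V M F) = F.1 :=
  SymmetricAlgebra.lift_ι_apply _ F

lemma symToForms_algebraMap (M : Submodule V (MvPolynomial (Fin (n + 1)) V)) (r : V) :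
    symToForms M (algebraMap V _ r) = MvPolynomial.C r :=
  AlgHom.commutes _ r

lemma symToForms_isHomogeneous {M : Submodule V (MvPolynomial (Fin (n + 1)) V)} {e : ℕ}
    (hM : ∀ F ∈ M, F.IsHomogeneous e) {d : ℕ} {a : SymmetricAlgebra V M}
    (ha : a ∈ symGrading V M d) : (symToForms M a).IsHomogeneous (d * e) := by
  induction ha using Submodule.pow_induction_on_left' with
  | algebraMap r =>
    rw [symToForms_algebraMap, zero_mul]
    exact MvPolynomial.isHomogeneous_C _ r
  | add x y i hx hy ihx ihy => rw [map_add]; exact ihx.add ihy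
  | mem_mul m hm i x hx ih =>
    obtain ⟨m, rfl⟩ := hm
    rw [map_mul, symToForms_ι, Nat.succ_mul, add_comm (i * e)]
    exact (hM m m.2).mul ih

/-- Replacing the trivialization `x_i ^ e` by `x_j ^ e` multiplies the coordinates of degree `d` by
the `d`-th power of the single function `(x_j/x_i) ^ e`. -/
lemma formsHom_change {M : Submodule V (MvPolynomial (Fin (n + 1)) V)} {e : ℕ}
    (hM : ∀ F ∈ M, F.IsHomogeneous e) {Y : Scheme.{u}} (g : Y ⟶ ProjSpace n V)
    (i j : Fin (n + 1)) (hi : ⊤ ≤ g ⁻¹ᵁ (ProjSpace.chart n V i).1)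
    (hj : ⊤ ≤ g ⁻¹ᵁ (ProjSpace.chart n V j).1)
    (hgi : (symGrading V M)₊.toIdeal.map ((coordsX g i hi).comp (symToForms M)) = ⊤)
    (hgj : (symGrading V M)₊.toIdeal.map ((coordsX g j hj).comp (symToForms M)) = ⊤) :
    Proj.fromOfGlobalSections _ _ hgi = Proj.fromOfGlobalSections _ _ hgj := by
  refine (fromOfGlobalSections_smul _ _ hgj hgi (coordsX g i hi (MvPolynomial.X j) ^ e)
    fun d a ha => ?_).symm
  rw [RingHom.comp_apply, RingHom.comp_apply, ← pow_mul, mul_comm e d, mul_comm,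
    coordsX_mul_pow g i j hi hj (symToForms_isHomogeneous hM ha)]

/-- The definition tests affine opens of `Y` only. Since normalized coordinates commute with
pullback, the description persists for every morphism to `Y` that lands over a chart. -/
lemma IsGivenByForms.comp_eq {M : Submodule V (MvPolynomial (Fin (n + 1)) V)}
    {Y Y' : Scheme.{u}} {h : Y ⟶ ProjSpace n V}
    {φ : Y ⟶ ProjModule V M} (hφ : IsGivenByForms M h φ) (u : Y' ⟶ Y) (i : Fin (n + 1))
    (hi : ⊤ ≤ (u ≫ h) ⁻¹ᵁ (ProjSpace.chart n V i).1)
    (hgen : (symGrading V M)₊.toIdeal.map ((coordsX (u ≫ h) i hi).comp (symToForms M)) = ⊤) :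
    u ≫ φ = Proj.fromOfGlobalSections _ _ hgen := by
  refine hom_ext_of_forall_exists _ _ fun y => ?_
  have hy : u y ∈ h ⁻¹ᵁ (ProjSpace.chart n V i).1 := hi (Set.mem_univ y)
  obtain ⟨⟨W, hW⟩, hyW, hWle⟩ := exists_affine_nhd hy
  refine ⟨u ⁻¹ᵁ W, hyW, ?_⟩
  obtain ⟨hg, hWφ⟩ := hφ i ⟨W, hW⟩ hWle
  have hW' : ⊤ ≤ (W.ι ≫ h) ⁻¹ᵁ (ProjSpace.chart n V i).1 := fun w _ => hWle w.2
  rw [← morphismRestrict_ι_assoc, hWφ,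
    comp_fromOfGlobalSections _ _ _ (map_comp_eq_top _ hg),
    comp_fromOfGlobalSections _ _ _ (map_comp_eq_top _ hgen)]
  congr 1
  rw [formsHom_eq M h i W hWle hW', ← RingHom.comp_assoc, ← RingHom.comp_assoc]
  congr 1
  have h1 : ⊤ ≤ ((u ∣_ W) ≫ W.ι ≫ h) ⁻¹ᵁ (ProjSpace.chart n V i).1 := fun w _ => hW' trivial
  have h2 : ⊤ ≤ ((u ⁻¹ᵁ W).ι ≫ u ≫ h) ⁻¹ᵁ (ProjSpace.chart n V i).1 := fun w _ => hi trivial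
  rw [← coordsX_comp _ i hW' _ h1, ← coordsX_comp _ i hi _ h2]
  congr 1
  exact morphismRestrict_ι_assoc u W h

end Forms

lemma isHomogeneous_of_mem_twistedSections {V : Type u} [CommRing V] {n : ℕ}
    {I : (ProjSpace n V).IdealSheafData} {d : ℕ} :
    ∀ F ∈ twistedSections I d, F.IsHomogeneous d := fun _ hF => hF.1

/-! ### The canonical morphism on the complement of the point -/

section PhiZero

variable {V : Type u} [CommRing V] [IsLocalRing V] {n : ℕ} {I : (ProjSpace n V).IdealSheafData}
  {p : Fin (n + 1) → V}

lemma IsPointIdeal.comap_ideal_top (hI : IsPointIdeal I p) {Y : Scheme.{u}} [IsAffine Y]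
    (g : Y ⟶ ProjSpace n V) (i : Fin (n + 1)) (hi : ⊤ ≤ g ⁻¹ᵁ (ProjSpace.chart n V i).1) :
    (I.comap g).ideal ⟨⊤, isAffineOpen_top Y⟩ =
      Ideal.span (coordsX g i hi '' (twistedSections I 1 : Set _)) := by
  rw [comap_ideal I g (ProjSpace.chart n V i) ⟨⊤, isAffineOpen_top Y⟩ hi, hI.ideal_chart,
    Ideal.map_span, Set.image_image]
  congr 1
  refine Set.image_congr fun F _ => ?_
  rw [coordsX_eq_appLE_dehom]

/-- Where `x_i = 1` the quadric `ℓ x_i` takes the same value as `ℓ`, so the quadrics generate at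
least as much as the linear forms. -/
lemma IsPointIdeal.span_forms_eq_top (hI : IsPointIdeal I p) {S : Type*} [CommRing S]
    (ψ : MvPolynomial (Fin (n + 1)) V →+* S) (i : Fin (n + 1)) (h1 : ψ (MvPolynomial.X i) = 1)
    (h : Ideal.span (ψ '' (twistedSections I 1 : Set _)) = ⊤) :
    (symGrading V (twistedSections I 2))₊.toIdeal.map
      (ψ.comp (symToForms (twistedSections I 2))) = ⊤ := by
  apply sym_irrelevant_map_eq_top
  rw [← top_le_iff, ← h, Ideal.span_le]
  rintro _ ⟨ℓ, hℓ, rfl⟩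
  refine Ideal.subset_span ⟨⟨ℓ * MvPolynomial.X i,
    hI.mul_mem hℓ (MvPolynomial.isHomogeneous_X V i)⟩, ?_⟩
  beta_reduce
  rw [RingHom.comp_apply, symToForms_ι, map_mul, h1, mul_one]

lemma IsPointIdeal.irrelevant_map_forms (hI : IsPointIdeal I p) {Y : Scheme.{u}} [IsAffine Y]
    (u : Y ⟶ suppCompl I) (i : Fin (n + 1))
    (hi : ⊤ ≤ (u ≫ (suppCompl I).ι) ⁻¹ᵁ (ProjSpace.chart n V i).1) :
    (symGrading V (twistedSections I 2))₊.toIdeal.map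
      ((coordsX (u ≫ (suppCompl I).ι) i hi).comp (symToForms (twistedSections I 2))) = ⊤ := by
  refine hI.span_forms_eq_top _ i (coordsX_self _ _ _) ?_
  rw [← hI.comap_ideal_top, comap_eq_top_of_disjoint I (u ≫ (suppCompl I).ι) fun y => (u y).2]
  rfl

lemma IsPointIdeal.exists_isGivenByForms (hI : IsPointIdeal I p) :
    ∃ φ₀ : (suppCompl I).toScheme ⟶ ProjModule V (twistedSections I 2),
      IsGivenByForms (twistedSections I 2) (suppCompl I).ι φ₀ := by
  -- The cover consists of all pairs of a chart and an affine open over it. Thus every open tested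
  -- by `IsGivenByForms` is one of the glued pieces, and the agreement of different charts is part
  -- of the gluing.
  let J := Σ i : ULift.{u} (Fin (n + 1)), {W : (suppCompl I).toScheme.affineOpens //
    W.1 ≤ (suppCompl I).ι ⁻¹ᵁ (ProjSpace.chart n V i.down).1}
  have hi : ∀ j : J, ⊤ ≤ (j.2.1.1.ι ≫ (suppCompl I).ι) ⁻¹ᵁ
      (ProjSpace.chart n V j.1.down).1 := fun j w _ => j.2.2 w.2
  have hJ : ∀ j : J, IsAffine j.2.1.1.toScheme := fun j => j.2.1.2
  have hgen := fun j : J => hI.irrelevant_map_forms j.2.1.1.ι j.1.down (hi j)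
  obtain ⟨φ, hφ⟩ := exists_glue (fun j : J => j.2.1.1) (fun y => by
    obtain ⟨i, hi⟩ := exists_mem_chart ((suppCompl I).ι y)
    obtain ⟨W, hyW, hWle⟩ := exists_affine_nhd
      (O := (suppCompl I).ι ⁻¹ᵁ (ProjSpace.chart n V i).1) hi
    exact ⟨⟨⟨i⟩, W, hWle⟩, hyW⟩)
    (fun j => Proj.fromOfGlobalSections _ _ (hgen j)) (fun j j' Q a b hab => by
      have h1 : ⊤ ≤ (a ≫ j.2.1.1.ι ≫ (suppCompl I).ι) ⁻¹ᵁ (ProjSpace.chart n V j.1.down).1 :=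
        fun w _ => hi j trivial
      have h2 : ⊤ ≤ (b ≫ j'.2.1.1.ι ≫ (suppCompl I).ι) ⁻¹ᵁ (ProjSpace.chart n V j'.1.down).1 :=
        fun w _ => hi j' trivial
      have h2' : ⊤ ≤ (a ≫ j.2.1.1.ι ≫ (suppCompl I).ι) ⁻¹ᵁ (ProjSpace.chart n V j'.1.down).1 := by
        rw [reassoc_of% hab]; exact h2
      have key : ∀ (i) (g g' : Q ⟶ ProjSpace n V) (h : ⊤ ≤ g ⁻¹ᵁ (ProjSpace.chart n V i).1)
        (h' : ⊤ ≤ g' ⁻¹ᵁ (ProjSpace.chart n V i).1), g = g' → coordsX g i h = coordsX g' i h' :=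
        fun i g g' h h' e => by subst e; rfl
      have e1 : a.appTop.hom.comp ((coordsX _ _ (hi j)).comp (symToForms (twistedSections I 2))) =
          (coordsX _ _ h1).comp (symToForms (twistedSections I 2)) := by
        rw [← RingHom.comp_assoc, coordsX_comp _ _ (hi j) a h1]
      have e2 : b.appTop.hom.comp ((coordsX _ _ (hi j')).comp (symToForms (twistedSections I 2))) =
          (coordsX _ _ h2').comp (symToForms (twistedSections I 2)) := by
        rw [← RingHom.comp_assoc, ← coordsX_comp _ _ (hi j') b h2,
          key _ _ _ h2 h2' (by rw [reassoc_of% hab])]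
      have g1 := map_comp_eq_top a.appTop.hom (hgen j)
      have g2 := map_comp_eq_top b.appTop.hom (hgen j')
      rw [comp_fromOfGlobalSections _ _ _ g1, comp_fromOfGlobalSections _ _ _ g2]
      have := formsHom_change isHomogeneous_of_mem_twistedSections _ _ _ h1 h2'
        (by rw [← e1]; exact g1) (by rw [← e2]; exact g2)
      convert this using 1
      · congr 1
      · congr 1)
  refine ⟨φ, fun i W hW => ?_⟩
  let j : J := ⟨⟨i⟩, W, hW⟩
  have h1 := formsHom_eq (twistedSections I 2) (suppCompl I).ι i W.1 hW (hi j)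
  refine ⟨by rw [h1]; exact hgen j, (hφ j).trans ?_⟩
  congr 1
  exact h1.symm

end PhiZero

end

section

open IsLocalRing

/-! ### Extending `φ₀` where the ideal of the point becomes invertible -/

lemma ideal_eq_span_of_comap_ι {Y : Scheme.{u}} {J : Y.IdealSheafData} {W : Y.affineOpens}
    {b : Γ(W.1.toScheme, ⊤)}
    (h : ∀ h', (J.comap W.1.ι).ideal ⟨⊤, h'⟩ = Ideal.span {b}) :
    J.ideal W = Ideal.span {W.1.topIso.hom.hom b} := by
  have : IsAffine W.1.toScheme := W.2
  have h1 := comap_ideal J W.1.ι W ⟨⊤, isAffineOpen_top _⟩ (by simp)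
  rw [h (isAffineOpen_top _), appLE_ι_eq_topIso_inv] at h1
  apply map_topIso_inv_injective
  rw [← h1, Ideal.map_span, Set.image_singleton]
  congr 2
  exact congr($(W.1.topIso.hom_inv_id).hom b).symm

lemma IsInvertibleIdeal.exists_generator {Y : Scheme.{u}} {J : Y.IdealSheafData}
    (hJ : IsInvertibleIdeal J) {O : Y.Opens} {y : Y} (hy : y ∈ O) :
    ∃ W : Y.affineOpens, y ∈ W.1 ∧ W.1 ≤ O ∧ ∃ a ∈ nonZeroDivisors Γ(W.1.toScheme, ⊤),
      ∀ h', (J.comap W.1.ι).ideal ⟨⊤, h'⟩ = Ideal.span {a} := by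
  obtain ⟨W, hyW, hWO, a, ha, haJ⟩ := hJ.exists_le hy
  refine ⟨W, hyW, hWO, W.1.topIso.inv.hom a, ?_, fun h' => ?_⟩
  · rw [mem_nonZeroDivisors_iff_right]
    intro c hc
    apply (ConcreteCategory.bijective_of_isIso W.1.topIso.hom).1
    rw [map_zero]
    refine (mem_nonZeroDivisors_iff_right.mp ha) _ ?_
    have h2 := congrArg W.1.topIso.hom.hom hc
    rw [map_mul, map_zero] at h2
    rwa [show W.1.topIso.hom.hom (W.1.topIso.inv.hom a) = a from
      congr($(W.1.topIso.inv_hom_id).hom a)] at h2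
  · have h1 := comap_ideal J W.1.ι W ⟨⊤, h'⟩ (by simp)
    rwa [appLE_ι_eq_topIso_inv, haJ, Ideal.map_span, Set.image_singleton] at h1

lemma eq_zero_of_forall_ι {Y : Scheme.{u}} (s : Γ(Y, ⊤))
    (h : ∀ y, ∃ W : Y.Opens, y ∈ W ∧ W.ι.appTop.hom s = 0) : s = 0 := by
  refine Y.IsSheaf.section_ext fun y _ => ?_
  obtain ⟨W, hy, hW⟩ := h y
  refine ⟨W, le_top, hy, ?_⟩
  refine (map_eq_zero_of_ι_app_eq_zero hW le_rfl le_top).trans (map_zero _).symm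

section LocalForm

variable {V : Type u} [CommRing V] [IsLocalRing V] {n : ℕ} {I : (ProjSpace n V).IdealSheafData}
  {p : Fin (n + 1) → V}

/-- `θ` gives the homogeneous coordinates `F ↦ g^* F / a`, for `F` in `Γ(I(2))`. -/
structure IsQuotientBy {Y : Scheme.{u}} (g : Y ⟶ ProjSpace n V) (i : Fin (n + 1))
    (hi : ⊤ ≤ g ⁻¹ᵁ (ProjSpace.chart n V i).1) (a : Γ(Y, ⊤))
    (θ : SymmetricAlgebra V (twistedSections I 2) →+* Γ(Y, ⊤)) : Prop where
  algebraMap_eq : ∀ r, θ (algebraMap V _ r) = coordsX g i hi (MvPolynomial.C r)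
  mul_eq : ∀ F : twistedSections I 2,
    θ (SymmetricAlgebra.ι V _ F) * a = coordsX g i hi F.1
  irrelevant_map : (symGrading V (twistedSections I 2))₊.toIdeal.map θ = ⊤

lemma IsQuotientBy.pow_mul_eq {R : Type u} [CommRing R] {I : (ProjSpace n R).IdealSheafData}
    {Y : Scheme.{u}} {g : Y ⟶ ProjSpace n R} {i : Fin (n + 1)}
    {hi : ⊤ ≤ g ⁻¹ᵁ (ProjSpace.chart n R i).1} {a : Γ(Y, ⊤)}
    {θ : SymmetricAlgebra R (twistedSections I 2) →+* Γ(Y, ⊤)} (h : IsQuotientBy g i hi a θ)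
    {d : ℕ} {x} (hx : x ∈ symGrading R (twistedSections I 2) d) :
    coordsX g i hi (symToForms _ x) = a ^ d * θ x :=
  sym_map_eq_pow_mul θ ((coordsX g i hi).comp (symToForms _)) a
    (fun r => by rw [RingHom.comp_apply, symToForms_algebraMap, h.algebraMap_eq])
    (fun F => by rw [RingHom.comp_apply, symToForms_ι, ← h.mul_eq, mul_comm]) hx

/-- Over the complement of the point `a` is a unit, so dividing all quadrics by `a` only rescales
the homogeneous coordinates of `φ₀`. -/
lemma IsPointIdeal.extends_of_isQuotientBy (hI : IsPointIdeal I p)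
    {φ₀ : (suppCompl I).toScheme ⟶ ProjModule V (twistedSections I 2)}
    (hφ₀ : IsGivenByForms (twistedSections I 2) (suppCompl I).ι φ₀) {Y : Scheme.{u}} [IsAffine Y]
    {g : Y ⟶ ProjSpace n V} {i : Fin (n + 1)} {hi : ⊤ ≤ g ⁻¹ᵁ (ProjSpace.chart n V i).1}
    {a : Γ(Y, ⊤)} {θ : SymmetricAlgebra V (twistedSections I 2) →+* Γ(Y, ⊤)}
    (h : IsQuotientBy g i hi a θ) (ha : ∀ h', (I.comap g).ideal ⟨⊤, h'⟩ = Ideal.span {a}) :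
    Extends g φ₀ (Proj.fromOfGlobalSections _ _ h.irrelevant_map) := by
  refine Extends.of_affine fun Q _ q b hqb => ?_
  have hiQ : ⊤ ≤ (q ≫ g) ⁻¹ᵁ (ProjSpace.chart n V i).1 := fun y _ => hi trivial
  have hiQ' : ⊤ ≤ (b ≫ (suppCompl I).ι) ⁻¹ᵁ (ProjSpace.chart n V i).1 := by
    rw [← hqb]; exact hiQ
  have hu : IsUnit (q.appTop.hom a) := by
    have h1 : I.comap (q ≫ g) = ⊤ := by
      rw [hqb]
      exact comap_eq_top_of_disjoint I _ fun y => (b y).2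
    rw [Scheme.IdealSheafData.comap_comp] at h1
    have h2 := comap_ideal (I.comap g) q ⟨⊤, isAffineOpen_top Y⟩ ⟨⊤, isAffineOpen_top Q⟩ le_top
    have h3 := (h2.trans (congrArg _ (ha (isAffineOpen_top Y)))).trans
      ((Ideal.map_span _ _).trans (congrArg Ideal.span Set.image_singleton))
    rw [h1] at h3
    rw [Scheme.Hom.appTop, Scheme.Hom.app_eq_appLE, ← Ideal.span_singleton_eq_top]
    exact h3.symm
  rw [hφ₀.comp_eq b i hiQ' (hI.irrelevant_map_forms b i hiQ'),
    comp_fromOfGlobalSections _ _ _ (map_comp_eq_top _ h.irrelevant_map)]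
  refine fromOfGlobalSections_smul _ _ _ _ (q.appTop.hom a) fun d x hx => ?_
  have h3 : coordsX (b ≫ (suppCompl I).ι) i hiQ' = q.appTop.hom.comp (coordsX g i hi) := by
    rw [← coordsX_comp g i hi q hiQ]
    congr 1
    exact hqb.symm
  rw [h3, RingHom.comp_apply, RingHom.comp_apply, h.pow_mul_eq hx, map_mul, map_pow]
  rfl

/-- Every quadric through the point pulls back to a multiple of `a`, and the quotient is unique,
hence linear in the quadric, because `a` is a nonzerodivisor. The quotients have no common zero
because the quadrics already generate the ideal of `a`. -/
lemma IsPointIdeal.exists_isQuotientBy (hI : IsPointIdeal I p) {Y : Scheme.{u}} [IsAffine Y]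
    (g : Y ⟶ ProjSpace n V) (i : Fin (n + 1)) (hi : ⊤ ≤ g ⁻¹ᵁ (ProjSpace.chart n V i).1)
    {a : Γ(Y, ⊤)} (ha₀ : a ∈ nonZeroDivisors Γ(Y, ⊤))
    (ha : ∀ h', (I.comap g).ideal ⟨⊤, h'⟩ = Ideal.span {a}) :
    ∃ θ : SymmetricAlgebra V (twistedSections I 2) →+* Γ(Y, ⊤), IsQuotientBy g i hi a θ := by
  have h1 : ∀ F : twistedSections I 2, ∃ c, c * a = coordsX g i hi F.1 := fun F => by
    have h2 := (ha (isAffineOpen_top Y)).symm.trans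
      (comap_ideal I g (ProjSpace.chart n V i) ⟨⊤, isAffineOpen_top Y⟩ hi)
    rw [← Ideal.mem_span_singleton', h2, coordsX_eq_appLE_dehom]
    exact Ideal.mem_map_of_mem _ (F.2.2 i)
  choose c hc using h1
  have hinj : ∀ x y : Γ(Y, ⊤), x * a = y * a → x = y := fun x y h =>
    (mul_cancel_right_mem_nonZeroDivisors ha₀).mp h
  obtain ⟨θ, hθ0, hθ⟩ := exists_symLift ((coordsX g i hi).comp MvPolynomial.C) c
    (fun x y => hinj _ _ (by rw [add_mul, hc, hc, hc, ← map_add]; rfl))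
    (fun r x => hinj _ _ (by
      rw [mul_assoc, hc, hc, RingHom.comp_apply, ← map_mul, ← MvPolynomial.smul_eq_C_mul]; rfl))
  refine ⟨θ, hθ0, fun F => by rw [hθ, hc], ?_⟩
  apply sym_irrelevant_map_eq_top
  set J := Ideal.span (Set.range fun m => θ (SymmetricAlgebra.ι V (twistedSections I 2) m)) with hJ
  -- The value of a linear form `ℓ` equals that of `ℓ x_i`, which is one of the quotients times `a`.
  -- As these values generate the ideal of `a`, cancelling `a` puts `1` in `J`.
  have h3 : a ∈ J * Ideal.span {a} := by
    have h4 : Ideal.span {a} ≤ J * Ideal.span {a} := by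
      conv_lhs => rw [← ha (isAffineOpen_top Y), hI.comap_ideal_top g i hi]
      rw [Ideal.span_le]
      rintro _ ⟨ℓ, hℓ, rfl⟩
      have h5 := hc ⟨ℓ * MvPolynomial.X i, hI.mul_mem hℓ (MvPolynomial.isHomogeneous_X V i)⟩
      rw [map_mul, coordsX_self, mul_one] at h5
      change coordsX g i hi ℓ ∈ J * Ideal.span {a}
      rw [← h5, ← hθ]
      exact Ideal.mul_mem_mul (Ideal.subset_span ⟨_, rfl⟩) (Ideal.mem_span_singleton_self a)
    exact h4 (Ideal.mem_span_singleton_self a)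
  obtain ⟨z, hz, hza⟩ := Ideal.mem_mul_span_singleton.mp h3
  rw [Ideal.eq_top_iff_one, ← hinj z 1 (by rw [hza, one_mul])]
  exact hz

/-- Local generators of the ideal give local extensions. They glue without further computation,
since extensions across a scheme-theoretically dense open are unique. -/
lemma IsPointIdeal.exists_extends (hI : IsPointIdeal I p)
    {φ₀ : (suppCompl I).toScheme ⟶ ProjModule V (twistedSections I 2)}
    (hφ₀ : IsGivenByForms (twistedSections I 2) (suppCompl I).ι φ₀)
    [QuasiCompact (suppCompl I).ι] {Y : Scheme.{u}} (g : Y ⟶ ProjSpace n V)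
    (hg : IsInvertibleIdeal (I.comap g)) :
    ∃ h : Y ⟶ ProjModule V (twistedSections I 2), Extends g φ₀ h := by
  have := pullback_fst_isSchemeTheoreticallyDominant I g hg
  refine exists_extension (pullback.fst g (suppCompl I).ι) _ fun y => ?_
  obtain ⟨i, hi⟩ := exists_mem_chart (g y)
  obtain ⟨W, hyW, hWO, a, ha₀, ha⟩ := hg.exists_generator
    (O := g ⁻¹ᵁ (ProjSpace.chart n V i).1) hi
  have : IsAffine W.1.toScheme := W.2
  rw [← Scheme.IdealSheafData.comap_comp] at ha
  obtain ⟨θ, hθ⟩ := hI.exists_isQuotientBy (W.1.ι ≫ g) i (fun w _ => hWO w.2) ha₀ ha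
  refine ⟨W.1, Proj.fromOfGlobalSections _ _ hθ.irrelevant_map, hyW, ?_⟩
  rw [← Category.assoc]
  refine (hI.extends_of_isQuotientBy hφ₀ hθ ha).comp_eq _ _ ?_
  rw [Category.assoc, ← pullback.condition (f := g), ← Category.assoc, ← Category.assoc,
    pullback.condition]

/-- A morphism extending `φ₀` is locally given by the quotients `g^* F / a`. -/
lemma IsPointIdeal.eq_of_extends (hI : IsPointIdeal I p)
    {φ₀ : (suppCompl I).toScheme ⟶ ProjModule V (twistedSections I 2)}
    (hφ₀ : IsGivenByForms (twistedSections I 2) (suppCompl I).ι φ₀) {Y B : Scheme.{u}} [IsAffine Y]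
    {g : B ⟶ ProjSpace n V} {φ : B ⟶ ProjModule V (twistedSections I 2)} (hφ : Extends g φ₀ φ)
    (u : Y ⟶ B) {i : Fin (n + 1)} {hi : ⊤ ≤ (u ≫ g) ⁻¹ᵁ (ProjSpace.chart n V i).1}
    {a : Γ(Y, ⊤)} (ha₀ : a ∈ nonZeroDivisors Γ(Y, ⊤))
    {θ : SymmetricAlgebra V (twistedSections I 2) →+* Γ(Y, ⊤)}
    (h : IsQuotientBy (u ≫ g) i hi a θ)
    (ha : ∀ h', (I.comap (u ≫ g)).ideal ⟨⊤, h'⟩ = Ideal.span {a}) :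
    u ≫ φ = Proj.fromOfGlobalSections _ _ h.irrelevant_map := by
  refine Extends.eq ?_ (hI.extends_of_isQuotientBy hφ₀ h ha) (hφ.comp u rfl)
  exact fun y => ⟨⟨⊤, isAffineOpen_top Y⟩, trivial, a, ha₀, ha _⟩

end LocalForm

end

section

open IsLocalRing

/-! ### Recovering a point of `ℙⁿ` from the quadrics `ℓ x_j` -/

section InverseMorphism

variable {V : Type u} [CommRing V] [IsLocalRing V] {n : ℕ} {I : (ProjSpace n V).IdealSheafData}
  {p : Fin (n + 1) → V}

/-- The product of a linear form vanishing at the point with another linear form. -/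
def IsPointIdeal.mulForm (hI : IsPointIdeal I p) (ℓ : twistedSections I 1)
    (F : MvPolynomial (Fin (n + 1)) V) (hF : F.IsHomogeneous 1) : twistedSections I 2 :=
  ⟨ℓ.1 * F, hI.mul_mem ℓ.2 hF⟩

/-- The product of a linear form vanishing at the point with a variable. -/
def IsPointIdeal.mulX (hI : IsPointIdeal I p) (ℓ : twistedSections I 1) (j : Fin (n + 1)) :
    twistedSections I 2 :=
  hI.mulForm ℓ (MvPolynomial.X j) (MvPolynomial.isHomogeneous_X V j)

/-- The homogeneous coordinates `x_j = (ℓ x_j) / (ℓ x_i)` on `D₊(ℓ x_i)`. -/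
def IsPointIdeal.inverseCoords (hI : IsPointIdeal I p) (ℓ : twistedSections I 1)
    (i : Fin (n + 1)) {Y : Scheme.{u}} (z : Y ⟶ ProjModule V (twistedSections I 2))
    (hz : ⊤ ≤ z ⁻¹ᵁ Proj.basicOpen _ (SymmetricAlgebra.ι V _ (hI.mulX ℓ i))) :
    MvPolynomial (Fin (n + 1)) V →+* Γ(Y, ⊤) :=
  MvPolynomial.eval₂Hom ((coords z (ι_mem_symGrading _) hz).comp (algebraMap V _))
    fun j => coords z (ι_mem_symGrading _) hz (SymmetricAlgebra.ι V _ (hI.mulX ℓ j))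

variable (hI : IsPointIdeal I p) (ℓ : twistedSections I 1)
    (i : Fin (n + 1)) {Y : Scheme.{u}} (z : Y ⟶ ProjModule V (twistedSections I 2))
    (hz : ⊤ ≤ z ⁻¹ᵁ Proj.basicOpen _ (SymmetricAlgebra.ι V _ (hI.mulX ℓ i)))

lemma IsPointIdeal.inverseCoords_C (r : V) : hI.inverseCoords ℓ i z hz (MvPolynomial.C r) =
    coords z (ι_mem_symGrading _) hz (algebraMap V _ r) :=
  MvPolynomial.eval₂Hom_C _ _ _

lemma IsPointIdeal.inverseCoords_X (j : Fin (n + 1)) :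
    hI.inverseCoords ℓ i z hz (MvPolynomial.X j) =
      coords z (ι_mem_symGrading _) hz (SymmetricAlgebra.ι V _ (hI.mulX ℓ j)) :=
  MvPolynomial.eval₂Hom_X' _ _ _

lemma IsPointIdeal.inverseCoords_X_self :
    hI.inverseCoords ℓ i z hz (MvPolynomial.X i) = 1 := by
  rw [IsPointIdeal.inverseCoords_X, coords_self]

lemma IsPointIdeal.irrelevant_map_inverseCoords :
    (HomogeneousIdeal.irrelevant (grading n V)).toIdeal.map (hI.inverseCoords ℓ i z hz) = ⊤ :=
  irrelevant_map_eq_top _ (X_mem_grading i) one_pos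
    (by rw [IsPointIdeal.inverseCoords_X_self]; exact isUnit_one)

lemma IsPointIdeal.inverseCoords_comp {Y' : Scheme.{u}} (u : Y' ⟶ Y)
    (hz' : ⊤ ≤ (u ≫ z) ⁻¹ᵁ Proj.basicOpen _ (SymmetricAlgebra.ι V _ (hI.mulX ℓ i))) :
    hI.inverseCoords ℓ i (u ≫ z) hz' = u.appTop.hom.comp (hI.inverseCoords ℓ i z hz) := by
  apply MvPolynomial.ringHom_ext
  · intro r
    rw [RingHom.comp_apply, IsPointIdeal.inverseCoords_C, IsPointIdeal.inverseCoords_C,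
      coords_comp z _ hz u hz', RingHom.comp_apply]
  · intro j
    rw [RingHom.comp_apply, IsPointIdeal.inverseCoords_X, IsPointIdeal.inverseCoords_X,
      coords_comp z _ hz u hz', RingHom.comp_apply]

lemma coords_ι_smul {R : Type u} [CommRing R] {M : Type u} [AddCommGroup M] [Module R M]
    {Y : Scheme.{u}} (z : Y ⟶ ProjModule R M) {t : SymmetricAlgebra R M}
    (ht : t ∈ symGrading R M 1) (h : ⊤ ≤ z ⁻¹ᵁ Proj.basicOpen _ t) (r : R) (m : M) :
    coords z ht h (SymmetricAlgebra.ι R M (r • m)) =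
      coords z ht h (algebraMap R _ r) * coords z ht h (SymmetricAlgebra.ι R M m) := by
  rw [map_smul, Algebra.smul_def, map_mul]

lemma IsPointIdeal.inverseCoords_linear {F : MvPolynomial (Fin (n + 1)) V}
    (hF : F.IsHomogeneous 1) : hI.inverseCoords ℓ i z hz F =
      coords z (ι_mem_symGrading _) hz (SymmetricAlgebra.ι V _ (hI.mulForm ℓ F hF)) := by
  have hmem : ∀ G ∈ Submodule.span V
      (Set.range (MvPolynomial.X : Fin (n + 1) → MvPolynomial _ V)), G.IsHomogeneous 1 :=
    fun G hG => (Submodule.span_le (p := grading n V 1)).mpr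
      (by rintro _ ⟨j, rfl⟩; exact MvPolynomial.isHomogeneous_X V j) hG
  suffices H : ∀ G (hG : G ∈ Submodule.span V
      (Set.range (MvPolynomial.X : Fin (n + 1) → MvPolynomial _ V))),
      hI.inverseCoords ℓ i z hz G = coords z (ι_mem_symGrading _) hz
        (SymmetricAlgebra.ι V _ (hI.mulForm ℓ G (hmem G hG))) from H F
      (by rw [← MvPolynomial.homogeneousSubmodule_one_eq_span_X]; exact hF)
  intro G hG
  induction hG using Submodule.span_induction with
  | mem x hx =>
    obtain ⟨j, rfl⟩ := hx
    exact hI.inverseCoords_X ℓ i z hz j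
  | zero =>
    rw [map_zero]
    have : hI.mulForm ℓ 0 (hmem 0 (zero_mem _)) = 0 := Subtype.ext (mul_zero _)
    rw [this, map_zero, map_zero]
  | add x y hx hy h1 h2 =>
    have : hI.mulForm ℓ (x + y) (hmem _ (add_mem hx hy)) =
      hI.mulForm ℓ x (hmem _ hx) + hI.mulForm ℓ y (hmem _ hy) := Subtype.ext (mul_add _ _ _)
    rw [this, map_add, map_add, map_add, h1, h2]
  | smul r x hx h1 =>
    have : hI.mulForm ℓ (r • x) (hmem _ (Submodule.smul_mem _ r hx)) =
      r • hI.mulForm ℓ x (hmem _ hx) := Subtype.ext (mul_smul_comm _ _ _)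
    rw [this, coords_ι_smul, ← h1, MvPolynomial.smul_eq_C_mul, map_mul, inverseCoords_C]

/-- The quadrics `ℓ x_i` define an open cover of `ℙ(Γ(I(2)))`. -/
lemma IsPointIdeal.exists_mem_basicOpen_mulX (y : ProjModule V (twistedSections I 2)) :
    ∃ ℓ i, y ∈ Proj.basicOpen (symGrading V (twistedSections I 2))
      (SymmetricAlgebra.ι V _ (hI.mulX ℓ i)) := by
  by_contra! H
  refine y.not_irrelevant_le (irrelevant_le_span_ι.trans (Ideal.span_le.mpr ?_))
  rintro _ ⟨F, rfl⟩
  have h1 : ∀ ℓ i, SymmetricAlgebra.ι V _ (hI.mulX ℓ i) ∈ y.asHomogeneousIdeal := fun ℓ i => by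
    have := H ℓ i
    rwa [Proj.mem_basicOpen, not_not] at this
  let N : Submodule V (twistedSections I 2) :=
    (y.asHomogeneousIdeal.toIdeal.restrictScalars V).comap (SymmetricAlgebra.ι V _)
  have h2 : twistedSections I 2 ≤ N.map (Submodule.subtype _) := by
    conv_lhs => rw [hI.twistedSections_two_eq_span]
    rw [Submodule.span_le]
    rintro _ ⟨ℓ, hℓ, i, rfl⟩
    exact ⟨hI.mulX ⟨ℓ, hℓ⟩ i, h1 _ _, rfl⟩
  obtain ⟨G, hG, hGF⟩ := h2 F.2
  exact (Subtype.ext hGF : G = F) ▸ hG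

variable {φ₀ : (suppCompl I).toScheme ⟶ ProjModule V (twistedSections I 2)}

/-- Two normalizations of the same coordinates are compared: by `T = 1` on the target, and by `x_j =
1` on the source. The factor between them is the value of `T` in the chart. -/
lemma IsPointIdeal.coords_mul_coordsX
    (hφ₀ : IsGivenByForms (twistedSections I 2) (suppCompl I).ι φ₀) (hI : IsPointIdeal I p)
    {Y : Scheme.{u}} [IsAffine Y]
    (u : Y ⟶ suppCompl I) {j : Fin (n + 1)}
    (hj : ⊤ ≤ (u ≫ (suppCompl I).ι) ⁻¹ᵁ (ProjSpace.chart n V j).1)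
    {z : Y ⟶ ProjModule V (twistedSections I 2)} (huz : u ≫ φ₀ = z) {T : twistedSections I 2}
    (hz : ⊤ ≤ z ⁻¹ᵁ Proj.basicOpen _ (SymmetricAlgebra.ι V _ T)) :
    IsUnit (coordsX (u ≫ (suppCompl I).ι) j hj T.1) ∧
    ∀ d, ∀ a ∈ symGrading V (twistedSections I 2) d, coords z (ι_mem_symGrading _) hz a *
      coordsX (u ≫ (suppCompl I).ι) j hj T.1 ^ d =
        coordsX (u ≫ (suppCompl I).ι) j hj (symToForms _ a) := by
  rw [hφ₀.comp_eq u j hj (hI.irrelevant_map_forms u j hj)] at huz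
  subst huz
  have hu := isUnit_of_le_preimage _ _ (ι_mem_symGrading T) one_pos hz
  have hT : ((coordsX (u ≫ (suppCompl I).ι) j hj).comp (symToForms (twistedSections I 2)))
      (SymmetricAlgebra.ι V _ T) = coordsX (u ≫ (suppCompl I).ι) j hj T.1 := by
    rw [RingHom.comp_apply, symToForms_ι]
  refine ⟨hT ▸ hu, fun d a ha => ?_⟩
  have := coords_fromOfGlobalSections _ (hI.irrelevant_map_forms u j hj) (ι_mem_symGrading T) hu
    hz ha
  rwa [hT] at this

end InverseMorphism

end

section

open IsLocalRing

/-! ### The image of `φ₀` as the blow-up -/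

section QuadricModel

variable {V : Type u} [CommRing V] [IsLocalRing V] {n : ℕ} {I : (ProjSpace n V).IdealSheafData}
  {p : Fin (n + 1) → V}

/-- `f` and `φ` are related by the equations satisfied by `φ₀`: on `D₊(ℓ x_i)` the point
`f(b)` has the homogeneous coordinates `(ℓ x_j) / (ℓ x_i)`, and the relations between the
quadrics vanish. -/
structure IsQuadricModel (hI : IsPointIdeal I p) {B : Scheme.{u}} (f : B ⟶ ProjSpace n V)
    (φ : B ⟶ ProjModule V (twistedSections I 2)) : Prop where
  fac : ∀ {Y : Scheme.{u}} (q : Y ⟶ B) (ℓ : twistedSections I 1) (i : Fin (n + 1))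
    (hz : ⊤ ≤ (q ≫ φ) ⁻¹ᵁ Proj.basicOpen _ (SymmetricAlgebra.ι V _ (hI.mulX ℓ i))),
    q ≫ f = Proj.fromOfGlobalSections _ _ (hI.irrelevant_map_inverseCoords ℓ i (q ≫ φ) hz)
  rel : ∀ {Y : Scheme.{u}} (q : Y ⟶ B) (T : twistedSections I 2)
    (hz : ⊤ ≤ (q ≫ φ) ⁻¹ᵁ Proj.basicOpen _ (SymmetricAlgebra.ι V _ T)) {d : ℕ}
    {x : SymmetricAlgebra V (twistedSections I 2)},
    x ∈ symGrading V (twistedSections I 2) d → symToForms _ x = 0 →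
      coords (q ≫ φ) (ι_mem_symGrading _) hz x = 0

lemma IsQuadricModel.comp {hI : IsPointIdeal I p} {B B' : Scheme.{u}} {f : B ⟶ ProjSpace n V}
    {φ : B ⟶ ProjModule V (twistedSections I 2)} (h : IsQuadricModel hI f φ) (e : B' ⟶ B) :
    IsQuadricModel hI (e ≫ f) (e ≫ φ) where
  fac q ℓ i hz := by
    simp only [← Category.assoc] at hz ⊢
    exact h.fac (q ≫ e) ℓ i hz
  rel q T hz d x hx h0 := by
    simp only [← Category.assoc] at hz ⊢
    exact h.rel (q ≫ e) T hz hx h0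

variable {φ₀ : (suppCompl I).toScheme ⟶ ProjModule V (twistedSections I 2)}

/-- In a chart the quadric `ℓ x_k` takes the value of `ℓ` times that of `x_k`, and the value of `ℓ`
is a unit because that of `ℓ x_i` is. Hence the ratios `(ℓ x_k)/(ℓ x_i)` are proportional to the
`x_k`. -/
lemma IsPointIdeal.comp_ι_eq
    (hφ₀ : IsGivenByForms (twistedSections I 2) (suppCompl I).ι φ₀) (hI : IsPointIdeal I p)
    {Y : Scheme.{u}} (u : Y ⟶ suppCompl I)
    {z : Y ⟶ ProjModule V (twistedSections I 2)} (huz : u ≫ φ₀ = z)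
    (ℓ : twistedSections I 1) (i : Fin (n + 1))
    (hz : ⊤ ≤ z ⁻¹ᵁ Proj.basicOpen _ (SymmetricAlgebra.ι V _ (hI.mulX ℓ i))) :
    u ≫ (suppCompl I).ι =
      Proj.fromOfGlobalSections _ _ (hI.irrelevant_map_inverseCoords ℓ i z hz) := by
  refine hom_ext_of_forall_exists _ _ fun y => ?_
  obtain ⟨j, hj⟩ := exists_mem_chart ((u ≫ (suppCompl I).ι) y)
  obtain ⟨W, hyW, hWO⟩ := exists_affine_nhd
    (O := (u ≫ (suppCompl I).ι) ⁻¹ᵁ (ProjSpace.chart n V j).1) hj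
  refine ⟨W.1, hyW, ?_⟩
  have : IsAffine W.1.toScheme := W.2
  have hjW : ⊤ ≤ ((W.1.ι ≫ u) ≫ (suppCompl I).ι) ⁻¹ᵁ (ProjSpace.chart n V j).1 :=
    fun w _ => hWO w.2
  have hzW : ⊤ ≤ (W.1.ι ≫ z) ⁻¹ᵁ Proj.basicOpen _ (SymmetricAlgebra.ι V _ (hI.mulX ℓ i)) :=
    fun w _ => hz trivial
  obtain ⟨hu, hc⟩ := hI.coords_mul_coordsX hφ₀ (W.1.ι ≫ u) hjW
    (by rw [Category.assoc, huz]) hzW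
  rw [comp_fromOfGlobalSections _ _ _
    (map_comp_eq_top _ (hI.irrelevant_map_inverseCoords ℓ i z hz)), ← Category.assoc,
    eq_fromOfGlobalSections_coordsX ((W.1.ι ≫ u) ≫ (suppCompl I).ι) j hjW]
  symm
  have h1 := hI.inverseCoords_comp ℓ i z hz W.1.ι hzW
  set c := coordsX ((W.1.ι ≫ u) ≫ (suppCompl I).ι) j hjW
  have hℓ : ∀ k, c (hI.mulX ℓ k).1 = c ℓ.1 * c (MvPolynomial.X k) := fun k => map_mul c _ _
  rw [hℓ] at hu hc
  refine fromOfGlobalSections_smul _ _ _ _ (c (MvPolynomial.X i)) fun d F hF => ?_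
  rw [← h1]
  refine map_eq_pow_mul _ _ _ (fun r => ?_) (fun k => ?_) hF
  · rw [IsPointIdeal.inverseCoords_C]
    have := hc 0 _ (algebraMap_mem_symGrading r)
    rwa [pow_zero, mul_one, symToForms_algebraMap] at this
  · rw [IsPointIdeal.inverseCoords_X]
    have := hc 1 _ (ι_mem_symGrading (hI.mulX ℓ k))
    rw [pow_one, symToForms_ι, hℓ] at this
    apply (isUnit_of_mul_isUnit_left hu).mul_left_cancel
    rw [← this]
    ring

/-- Up to a power of the value of `T`, which is a unit, the coordinate of `x` is the value of the
polynomial `symToForms _ x`. -/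
lemma IsPointIdeal.coords_eq_zero
    (hφ₀ : IsGivenByForms (twistedSections I 2) (suppCompl I).ι φ₀) (hI : IsPointIdeal I p)
    {Y : Scheme.{u}} (u : Y ⟶ suppCompl I)
    {z : Y ⟶ ProjModule V (twistedSections I 2)} (huz : u ≫ φ₀ = z) (T : twistedSections I 2)
    (hz : ⊤ ≤ z ⁻¹ᵁ Proj.basicOpen _ (SymmetricAlgebra.ι V _ T)) {d : ℕ}
    {x : SymmetricAlgebra V (twistedSections I 2)}
    (hx : x ∈ symGrading V (twistedSections I 2) d) (h0 : symToForms _ x = 0) :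
    coords z (ι_mem_symGrading _) hz x = 0 := by
  refine eq_zero_of_forall_ι _ fun y => ?_
  obtain ⟨j, hj⟩ := exists_mem_chart ((u ≫ (suppCompl I).ι) y)
  obtain ⟨W, hyW, hWO⟩ := exists_affine_nhd
    (O := (u ≫ (suppCompl I).ι) ⁻¹ᵁ (ProjSpace.chart n V j).1) hj
  refine ⟨W.1, hyW, ?_⟩
  have : IsAffine W.1.toScheme := W.2
  have hjW : ⊤ ≤ ((W.1.ι ≫ u) ≫ (suppCompl I).ι) ⁻¹ᵁ (ProjSpace.chart n V j).1 :=
    fun w _ => hWO w.2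
  have hzW : ⊤ ≤ (W.1.ι ≫ z) ⁻¹ᵁ Proj.basicOpen _ (SymmetricAlgebra.ι V _ T) :=
    fun w _ => hz trivial
  obtain ⟨hu, hc⟩ := hI.coords_mul_coordsX hφ₀ (W.1.ι ≫ u) hjW
    (by rw [Category.assoc, huz]) hzW
  have h1 := hc d x hx
  rw [h0, map_zero, (hu.pow d).mul_left_eq_zero, coords_comp z _ hz W.1.ι hzW] at h1
  exact h1

lemma coords_congr {R A : Type u} [CommRing R] [CommRing A] [Algebra R A] {𝒜 : ℕ → Submodule R A}
    [GradedAlgebra 𝒜] {Y : Scheme.{u}} {g g' : Y ⟶ Proj 𝒜} (hg : g = g') {t : A} (ht : t ∈ 𝒜 1)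
    (h : ⊤ ≤ g ⁻¹ᵁ Proj.basicOpen 𝒜 t) (h' : ⊤ ≤ g' ⁻¹ᵁ Proj.basicOpen 𝒜 t) :
    coords g ht h = coords g' ht h' := by
  subst hg; rfl

/-- An equality between products of two quadrics is a relation of degree two in the symmetric
algebra, which must vanish on the model. -/
lemma IsQuadricModel.coords_quadric {hI : IsPointIdeal I p} {B : Scheme.{u}}
    {f : B ⟶ ProjSpace n V} {φ : B ⟶ ProjModule V (twistedSections I 2)}
    (h : IsQuadricModel hI f φ) {Y : Scheme.{u}} (q : Y ⟶ B) (ℓ : twistedSections I 1)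
    (i : Fin (n + 1))
    (hz : ⊤ ≤ (q ≫ φ) ⁻¹ᵁ Proj.basicOpen _ (SymmetricAlgebra.ι V _ (hI.mulX ℓ i)))
    (F G F' G' : twistedSections I 2) (hFG : F.1 * G.1 = F'.1 * G'.1) :
    coords (q ≫ φ) (ι_mem_symGrading _) hz (SymmetricAlgebra.ι V _ F) *
      coords (q ≫ φ) (ι_mem_symGrading _) hz (SymmetricAlgebra.ι V _ G) =
    coords (q ≫ φ) (ι_mem_symGrading _) hz (SymmetricAlgebra.ι V _ F') *
      coords (q ≫ φ) (ι_mem_symGrading _) hz (SymmetricAlgebra.ι V _ G') := by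
  have h1 : ∀ F G : twistedSections I 2, SymmetricAlgebra.ι V _ F * SymmetricAlgebra.ι V _ G ∈
      symGrading V (twistedSections I 2) 2 := fun F G =>
    SetLike.GradedMul.mul_mem (A := symGrading V (twistedSections I 2)) (i := 1) (j := 1)
      (ι_mem_symGrading F) (ι_mem_symGrading G)
  have := h.rel q _ hz (sub_mem (h1 F G) (h1 F' G'))
    (by rw [map_sub, map_mul, map_mul, symToForms_ι, symToForms_ι, symToForms_ι, symToForms_ι,
      hFG, sub_self])
  rw [map_sub, sub_eq_zero, map_mul, map_mul] at this
  exact this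

lemma IsQuadricModel.comp_le_chart {hI : IsPointIdeal I p} {B : Scheme.{u}}
    {f : B ⟶ ProjSpace n V} {φ : B ⟶ ProjModule V (twistedSections I 2)}
    (h : IsQuadricModel hI f φ) {Y : Scheme.{u}} (q : Y ⟶ B) (ℓ : twistedSections I 1)
    (i : Fin (n + 1))
    (hz : ⊤ ≤ (q ≫ φ) ⁻¹ᵁ Proj.basicOpen _ (SymmetricAlgebra.ι V _ (hI.mulX ℓ i))) :
    ⊤ ≤ (q ≫ f) ⁻¹ᵁ (ProjSpace.chart n V i).1 := by
  rw [h.fac q ℓ i hz]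
  refine le_fromOfGlobalSections_preimage_chart _ _ _ ?_
  rw [IsPointIdeal.inverseCoords_X_self]
  exact isUnit_one

lemma IsQuadricModel.coordsX_eq {hI : IsPointIdeal I p} {B : Scheme.{u}}
    {f : B ⟶ ProjSpace n V} {φ : B ⟶ ProjModule V (twistedSections I 2)}
    (h : IsQuadricModel hI f φ) {Y : Scheme.{u}} (q : Y ⟶ B) (ℓ : twistedSections I 1)
    (i : Fin (n + 1))
    (hz : ⊤ ≤ (q ≫ φ) ⁻¹ᵁ Proj.basicOpen _ (SymmetricAlgebra.ι V _ (hI.mulX ℓ i)))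
    (hi : ⊤ ≤ (q ≫ f) ⁻¹ᵁ (ProjSpace.chart n V i).1) :
    coordsX (q ≫ f) i hi = hI.inverseCoords ℓ i (q ≫ φ) hz := by
  have h1 := h.fac q ℓ i hz
  have h2 := h1 ▸ hi
  refine (coords_congr h1 _ _ h2).trans
    (coordsX_fromOfGlobalSections_of_eq_one _ _ i ?_ h2)
  exact hI.inverseCoords_X_self ℓ i _ hz

/-- The ideal is generated by the values `(ℓ ℓ')/(ℓ x_i)` of the linear forms `ℓ'`. The relation
`(ℓ' x_i) ℓ² = (ℓ ℓ')(ℓ x_i)` exhibits each as a multiple of the one with `ℓ' = ℓ`. -/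
lemma IsQuadricModel.comap_ideal {hI : IsPointIdeal I p} {B : Scheme.{u}}
    {f : B ⟶ ProjSpace n V} {φ : B ⟶ ProjModule V (twistedSections I 2)}
    (h : IsQuadricModel hI f φ) {Y : Scheme.{u}} [IsAffine Y] (q : Y ⟶ B)
    (ℓ : twistedSections I 1) (i : Fin (n + 1))
    (hz : ⊤ ≤ (q ≫ φ) ⁻¹ᵁ Proj.basicOpen _ (SymmetricAlgebra.ι V _ (hI.mulX ℓ i)))
    (h' : ⊤ ∈ Y.affineOpens) :
    (I.comap (q ≫ f)).ideal ⟨⊤, h'⟩ = Ideal.span {coords (q ≫ φ) (ι_mem_symGrading _) hz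
      (SymmetricAlgebra.ι V _ (hI.mulForm ℓ ℓ.1 ℓ.2.1))} := by
  have hi := h.comp_le_chart q ℓ i hz
  refine (hI.comap_ideal_top (q ≫ f) i hi).trans ?_
  rw [h.coordsX_eq q ℓ i hz hi]
  apply le_antisymm
  · rw [Ideal.span_le]
    rintro _ ⟨ℓ', hℓ', rfl⟩
    rw [SetLike.mem_coe, hI.inverseCoords_linear ℓ i _ hz hℓ'.1, Ideal.mem_span_singleton']
    refine ⟨coords (q ≫ φ) (ι_mem_symGrading _) hz (SymmetricAlgebra.ι V _
      (hI.mulX ⟨ℓ', hℓ'⟩ i)), ?_⟩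
    rw [h.coords_quadric q ℓ i hz _ _ (hI.mulForm ℓ ℓ' hℓ'.1) (hI.mulX ℓ i), coords_self, mul_one]
    simp only [IsPointIdeal.mulForm, IsPointIdeal.mulX]
    ring
  · rw [Ideal.span_le, Set.singleton_subset_iff, ← hI.inverseCoords_linear ℓ i _ hz ℓ.2.1]
    exact Ideal.subset_span ⟨ℓ.1, ℓ.2, rfl⟩

/-- The blow-up of the point is the scheme-theoretic image of `φ₀`. -/
theorem IsPointIdeal.exists_isBlowup_image
    (hφ₀ : IsGivenByForms (twistedSections I 2) (suppCompl I).ι φ₀) (hI : IsPointIdeal I p)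
    [QuasiCompact (suppCompl I).ι]
    [QuasiCompact φ₀] : ∃ f : φ₀.image ⟶ ProjSpace n V, IsBlowup f I ∧
      Extends f φ₀ φ₀.imageι ∧ IsQuadricModel hI f φ₀.imageι := by
  have hcov : ∀ y : φ₀.image, ∃ (ℓ : twistedSections I 1) (i : Fin (n + 1)) (W : φ₀.image.Opens),
      y ∈ W ∧ ⊤ ≤ (W.ι ≫ φ₀.imageι) ⁻¹ᵁ
        Proj.basicOpen _ (SymmetricAlgebra.ι V _ (hI.mulX ℓ i)) := fun y => by
    obtain ⟨ℓ, i, h⟩ := hI.exists_mem_basicOpen_mulX (φ₀.imageι y)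
    exact ⟨ℓ, i, φ₀.imageι ⁻¹ᵁ Proj.basicOpen _ (SymmetricAlgebra.ι V _ (hI.mulX ℓ i)), h,
      fun w _ => w.2⟩
  have key : ∀ {W : φ₀.image.Opens} (ℓ : twistedSections I 1) (i : Fin (n + 1))
      (hz : ⊤ ≤ (W.ι ≫ φ₀.imageι) ⁻¹ᵁ
        Proj.basicOpen _ (SymmetricAlgebra.ι V _ (hI.mulX ℓ i))),
      pullback.snd φ₀.toImage W.ι ≫ Proj.fromOfGlobalSections _ _
        (hI.irrelevant_map_inverseCoords ℓ i (W.ι ≫ φ₀.imageι) hz) =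
      pullback.fst φ₀.toImage W.ι ≫ (suppCompl I).ι := by
    intro W ℓ i hz
    have huz : pullback.fst φ₀.toImage W.ι ≫ φ₀ =
        pullback.snd φ₀.toImage W.ι ≫ W.ι ≫ φ₀.imageι := by
      rw [← pullback.condition_assoc, Scheme.Hom.toImage_imageι]
    have hz' : ⊤ ≤ (pullback.snd φ₀.toImage W.ι ≫ W.ι ≫ φ₀.imageι) ⁻¹ᵁ
        Proj.basicOpen _ (SymmetricAlgebra.ι V _ (hI.mulX ℓ i)) := fun w _ => hz trivial
    rw [hI.comp_ι_eq hφ₀ _ huz ℓ i hz', comp_fromOfGlobalSections _ _ _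
      (map_comp_eq_top _ (hI.irrelevant_map_inverseCoords ℓ i _ hz))]
    congr 1
    exact (hI.inverseCoords_comp ℓ i _ hz _ hz').symm
  -- The local inverses agree with the inclusion of the complement on a dense part, and therefore
  -- glue.
  obtain ⟨f, hf⟩ := exists_extension φ₀.toImage (suppCompl I).ι fun y => by
    obtain ⟨ℓ, i, W, hy, hz⟩ := hcov y
    exact ⟨W, Proj.fromOfGlobalSections _ _ (hI.irrelevant_map_inverseCoords ℓ i _ hz), hy,
      key ℓ i hz⟩
  have hmodel : IsQuadricModel hI f φ₀.imageι := by
    constructor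
    · intro Y q ℓ i hz
      let W : φ₀.image.Opens := φ₀.imageι ⁻¹ᵁ
        Proj.basicOpen _ (SymmetricAlgebra.ι V _ (hI.mulX ℓ i))
      have hzW : ⊤ ≤ (W.ι ≫ φ₀.imageι) ⁻¹ᵁ
        Proj.basicOpen _ (SymmetricAlgebra.ι V _ (hI.mulX ℓ i)) := fun w _ => w.2
      obtain ⟨q, rfl⟩ : ∃ q' : Y ⟶ W, q' ≫ W.ι = q :=
        ⟨IsOpenImmersion.lift W.ι q (by
          rintro _ ⟨y, rfl⟩; rw [Scheme.Opens.range_ι]; exact hz (x := y) trivial),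
          IsOpenImmersion.lift_fac _ _ _⟩
      have h1 : W.ι ≫ f = Proj.fromOfGlobalSections _ _
          (hI.irrelevant_map_inverseCoords ℓ i (W.ι ≫ φ₀.imageι) hzW) := by
        refine hom_ext_of_ker_eq_bot (pullback.snd φ₀.toImage W.ι) ?_
        rw [key, ← pullback.condition_assoc, hf]
      have hz1 : ⊤ ≤ (q ≫ W.ι ≫ φ₀.imageι) ⁻¹ᵁ
        Proj.basicOpen _ (SymmetricAlgebra.ι V _ (hI.mulX ℓ i)) := fun w _ => hz trivial
      rw [Category.assoc, h1, comp_fromOfGlobalSections _ _ _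
        (map_comp_eq_top _ (hI.irrelevant_map_inverseCoords ℓ i _ hzW))]
      congr 1
      exact (hI.inverseCoords_comp ℓ i _ hzW _ hz1).symm
    · intro Y q T hz d x hx h0
      let W : φ₀.image.Opens := φ₀.imageι ⁻¹ᵁ Proj.basicOpen _ (SymmetricAlgebra.ι V _ T)
      have hzW : ⊤ ≤ (W.ι ≫ φ₀.imageι) ⁻¹ᵁ
        Proj.basicOpen _ (SymmetricAlgebra.ι V _ T) := fun w _ => w.2
      obtain ⟨q, rfl⟩ : ∃ q' : Y ⟶ W, q' ≫ W.ι = q :=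
        ⟨IsOpenImmersion.lift W.ι q (by
          rintro _ ⟨y, rfl⟩; rw [Scheme.Opens.range_ι]; exact hz (x := y) trivial),
          IsOpenImmersion.lift_fac _ _ _⟩
      have hz1 : ⊤ ≤ (q ≫ W.ι ≫ φ₀.imageι) ⁻¹ᵁ
        Proj.basicOpen _ (SymmetricAlgebra.ι V _ T) := fun w _ => hz trivial
      have h1 : coords (W.ι ≫ φ₀.imageι) (ι_mem_symGrading _) hzW x = 0 := by
        -- A relation between the quadrics holds on the complement of the point, hence by density on
        -- the whole image.
        apply (pullback.snd φ₀.toImage W.ι).app_injective ⊤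
        rw [map_zero]
        have huz : pullback.fst φ₀.toImage W.ι ≫ φ₀ =
            pullback.snd φ₀.toImage W.ι ≫ W.ι ≫ φ₀.imageι := by
          rw [← pullback.condition_assoc, Scheme.Hom.toImage_imageι]
        have hz' : ⊤ ≤ (pullback.snd φ₀.toImage W.ι ≫ W.ι ≫ φ₀.imageι) ⁻¹ᵁ
            Proj.basicOpen _ (SymmetricAlgebra.ι V _ T) := fun w _ => hzW trivial
        have h2 := hI.coords_eq_zero hφ₀ _ huz T hz' hx h0
        rw [coords_comp _ _ hzW _ hz'] at h2
        exact h2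
      refine (congr($(coords_congr (Category.assoc _ _ _) (ι_mem_symGrading T) hz hz1) x)).trans ?_
      rw [coords_comp _ _ hzW _ hz1, RingHom.comp_apply, h1, map_zero]
  have hp : IsLocallyPrincipal (I.comap f) := fun y => by
    obtain ⟨ℓ, i, h⟩ := hI.exists_mem_basicOpen_mulX (φ₀.imageι y)
    obtain ⟨W, hyW, hWO⟩ := exists_affine_nhd (O := φ₀.imageι ⁻¹ᵁ
      Proj.basicOpen _ (SymmetricAlgebra.ι V _ (hI.mulX ℓ i))) h
    have : IsAffine W.1.toScheme := W.2
    have h1 := fun h' => hmodel.comap_ideal W.1.ι ℓ i (fun w _ => hWO w.2) h'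
    simp only [Scheme.IdealSheafData.comap_comp] at h1
    exact ⟨W, hyW, _, ideal_eq_span_of_comap_ι h1⟩
  obtain ⟨h1, h2⟩ := isBlowup_of_image I φ₀ (fun g hg => hI.exists_extends hφ₀ g hg) f hf hp
  exact ⟨f, h1, h2, hmodel⟩

end QuadricModel

end

section

open IsLocalRing

/-! ### Curves with a prescribed tangent direction in a regular local ring -/

section Curve

/-- A proper subspace of the cotangent space of a Noetherian local ring is spanned by fewer
elements than the dimension. -/
lemma exists_finset_of_lt_maximalIdeal {A : Type*} [CommRing A] [IsLocalRing A] [IsNoetherianRing A]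
    (H : Ideal A) (h2 : maximalIdeal A ^ 2 ≤ H) (hH : H < maximalIdeal A) :
    ∃ S : Finset A, (S : Set A) ⊆ H ∧ H ≤ Ideal.span S ⊔ maximalIdeal A ^ 2 ∧
      S.card < Module.finrank (ResidueField A) (CotangentSpace A) := by
  classical
  -- `W` is the image of `H` in the cotangent space. It is proper because `H` contains the square of
  -- the maximal ideal, and lifts of a basis of `W` form the desired set.
  let W : Submodule (ResidueField A) (CotangentSpace A) :=
    { carrier := (maximalIdeal A).toCotangent '' {h | h.1 ∈ H}
      add_mem' := by
        rintro _ _ ⟨a, ha, rfl⟩ ⟨b, hb, rfl⟩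
        exact ⟨a + b, H.add_mem ha hb, map_add _ _ _⟩
      zero_mem' := ⟨0, H.zero_mem, map_zero _⟩
      smul_mem' := by
        rintro c _ ⟨a, ha, rfl⟩
        obtain ⟨c, rfl⟩ := residue_surjective c
        exact ⟨c • a, H.mul_mem_left c ha, by rw [map_smul]; rfl⟩ }
  have hW : W < ⊤ := by
    rw [lt_top_iff_ne_top]
    intro htop
    obtain ⟨t, ht, htH⟩ := SetLike.exists_of_lt hH
    obtain ⟨h, hh, hht⟩ := (htop ▸ Submodule.mem_top : (maximalIdeal A).toCotangent ⟨t, ht⟩ ∈ W)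
    rw [Ideal.toCotangent_eq] at hht
    have h3 := H.sub_mem hh (h2 hht)
    rw [sub_sub_cancel] at h3
    exact htH h3
  let b := Module.finBasis (ResidueField A) W
  have hb : ∀ j, ∃ h : maximalIdeal A, h.1 ∈ H ∧ (maximalIdeal A).toCotangent h = (b j).1 :=
    fun j => (b j).2
  choose h hhH hhb using hb
  refine ⟨Finset.univ.image fun j => (h j).1, ?_, ?_, ?_⟩
  · intro x hx
    simp only [Finset.coe_image, Finset.coe_univ, Set.image_univ, Set.mem_range] at hx
    obtain ⟨j, rfl⟩ := hx
    exact hhH j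
  · intro x hx
    have hxm := hH.le hx
    obtain ⟨c, hc⟩ : ∃ c : Fin (Module.finrank (ResidueField A) W) → ResidueField A,
        ∑ j, c j • b j = ⟨(maximalIdeal A).toCotangent ⟨x, hxm⟩, ⟨x, hxm⟩, hx, rfl⟩ :=
      ⟨_, b.sum_repr _⟩
    choose a ha using fun j => residue_surjective (c j)
    have h4 : (maximalIdeal A).toCotangent ⟨x, hxm⟩ =
        (maximalIdeal A).toCotangent (∑ j, a j • h j) := by
      refine (congrArg Subtype.val hc).symm.trans ?_
      rw [map_sum]
      simp only [Submodule.coe_sum, Submodule.coe_smul, map_smul, hhb]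
      refine Finset.sum_congr rfl fun j _ => ?_
      rw [← ha j]
      rfl
    rw [Ideal.toCotangent_eq] at h4
    have h5 : x = (∑ j, a j • h j : maximalIdeal A).1 + (x - (∑ j, a j • h j : maximalIdeal A).1) :=
      by ring
    rw [h5]
    refine Submodule.add_mem_sup ?_ h4
    rw [Submodule.coe_sum]
    exact Ideal.sum_mem _ fun j _ => Ideal.mul_mem_left _ _ (Ideal.subset_span (by simp))
  · refine lt_of_le_of_lt Finset.card_image_le ?_
    rw [Finset.card_univ, Fintype.card_fin]
    exact Submodule.finrank_lt hW.ne

/-- In a regular local ring there is a smooth curve with a given tangent direction. -/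
lemma exists_curve_of_isRegularLocalRing {A : Type u} [CommRing A] [IsRegularLocalRing A]
    (H : Ideal A) (t : A) (h2 : maximalIdeal A ^ 2 ≤ H) (hH : H < maximalIdeal A)
    (ht : maximalIdeal A ≤ Ideal.span {t} ⊔ H) :
    ∃ p : Ideal A, p.IsPrime ∧ p < maximalIdeal A ∧ maximalIdeal A ≤ Ideal.span {t} ⊔ p ∧
      H ≤ maximalIdeal A ^ 2 ⊔ p := by
  obtain ⟨S, hSH, hHS, hS⟩ := exists_finset_of_lt_maximalIdeal H h2 hH
  have hSm : Ideal.span (S : Set A) ≤ maximalIdeal A := (Ideal.span_le.mpr hSH).trans hH.le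
  -- By Krull's height theorem a minimal prime over `S` has height at most the cardinality of `S`.
  -- This is less than the embedding dimension, which is the dimension of `A` by regularity; so `p`
  -- is not the maximal ideal.
  obtain ⟨p, hp, hpm⟩ := Ideal.exists_minimalPrimes_le hSm
  have hpp : p.IsPrime := hp.1.1
  have hHp : H ≤ maximalIdeal A ^ 2 ⊔ p :=
    hHS.trans (sup_le (hp.1.2.trans le_sup_right) le_sup_left)
  refine ⟨p, hpp, lt_of_le_of_ne hpm ?_, ?_, hHp⟩
  · rintro rfl
    have h3 := Ideal.height_le_card_of_mem_minimalPrimes_span_finset hp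
    have h4 := (IsRegularLocalRing.iff_finrank_cotangentSpace A).mp inferInstance
    rw [← IsLocalRing.maximalIdeal_height_eq_ringKrullDim] at h4
    have h5 : ((Module.finrank (ResidueField A) (CotangentSpace A) : ℕ) : ℕ∞) =
      (maximalIdeal A).height := by exact_mod_cast h4
    rw [← h5] at h3
    exact absurd (by exact_mod_cast h3) (not_le.mpr hS)
  -- Nakayama: modulo its own square, the maximal ideal is generated by `t` and `p`.
  · refine Submodule.le_of_le_smul_of_le_jacobson_bot (I := maximalIdeal A)
      (IsNoetherian.noetherian _) (IsLocalRing.maximalIdeal_le_jacobson ⊥) ?_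
    refine ht.trans (sup_le (le_sup_left.trans le_sup_left) (hHp.trans (sup_le ?_ ?_)))
    · rw [sq]; exact le_sup_right
    · exact le_sup_right.trans le_sup_left

/-- `C` is the quotient of the localization at `n` by the prime of the previous lemma. Since `n ^ 2
≤ H ≤ n`, the ideal `H` is `n`-primary, so its extension to the localization contracts back to `H`;
this keeps `t` outside `H` after localizing. Modulo the prime, `H` falls into the square of the
maximal ideal, that is into the ideal of `t ^ 2`. -/
lemma exists_curve {T : Type u} [CommRing T] (n : Ideal T) [n.IsMaximal]
    [IsRegularLocalRing (Localization.AtPrime n)] (H : Ideal T) (t : T) (h2 : n ^ 2 ≤ H)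
    (hHn : H ≤ n) (htn : t ∈ n) (htH : t ∉ H) (ht : n ≤ Ideal.span {t} ⊔ H) :
    ∃ (C : Type u) (_ : CommRing C) (_ : IsDomain C) (_ : IsLocalRing C) (χ : T →+* C),
      χ t ≠ 0 ∧ χ t ∈ maximalIdeal C ∧ n.map χ = Ideal.span {χ t} ∧
        H.map χ ≤ Ideal.span {χ t ^ 2} := by
  let A := Localization.AtPrime n
  have hmap : n.map (algebraMap T A) = maximalIdeal A := Localization.AtPrime.map_eq_maximalIdeal
  have hrad : H.radical = n := le_antisymm
    ((Ideal.IsPrime.radical_le_iff inferInstance).mpr hHn) fun x hx => ⟨2, h2 (Ideal.pow_mem_pow hx 2)⟩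
  have hprim : H.IsPrimary := Ideal.isPrimary_of_isMaximal_radical (hrad.symm ▸ inferInstance)
  have hdisj : Disjoint (n.primeCompl : Set T) H :=
    Set.disjoint_left.mpr fun x hx hxH => hx (hHn hxH)
  have hcomap : (H.map (algebraMap T A)).comap (algebraMap T A) = H :=
    IsLocalization.under_map_of_isPrimary_disjoint n.primeCompl A hprim hdisj
  have h2' : maximalIdeal A ^ 2 ≤ H.map (algebraMap T A) := by
    rw [← hmap, ← Ideal.map_pow]
    exact Ideal.map_mono h2
  have hH' : H.map (algebraMap T A) < maximalIdeal A := by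
    rw [← hmap]
    refine lt_of_le_of_ne (Ideal.map_mono hHn) fun h => htH ?_
    rw [← hcomap, h]
    exact Ideal.mem_map_of_mem _ htn
  obtain ⟨p, hp, hpm, hp1, hp2⟩ := exists_curve_of_isRegularLocalRing
    (H.map (algebraMap T A)) (algebraMap T A t) h2' hH' (by
      rw [← hmap]
      refine (Ideal.map_mono ht).trans (le_of_eq ?_)
      rw [Ideal.map_sup, Ideal.map_span, Set.image_singleton])
  have : Nontrivial (A ⧸ p) := Ideal.Quotient.nontrivial_iff.mpr hp.ne_top
  have hloc : IsLocalRing (A ⧸ p) :=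
    IsLocalRing.of_surjective' (Ideal.Quotient.mk p) Ideal.Quotient.mk_surjective
  have hm : (maximalIdeal A).map (Ideal.Quotient.mk p) =
      Ideal.span {Ideal.Quotient.mk p (algebraMap T A t)} := by
    apply le_antisymm
    · refine (Ideal.map_mono hp1).trans (le_of_eq ?_)
      rw [Ideal.map_sup, Ideal.map_span, Set.image_singleton, Ideal.map_quotient_self, sup_bot_eq]
    · rw [Ideal.span_singleton_le_iff_mem, ← hmap]
      exact Ideal.mem_map_of_mem _ (Ideal.mem_map_of_mem _ htn)
  have hn : n.map ((Ideal.Quotient.mk p).comp (algebraMap T A)) =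
      Ideal.span {Ideal.Quotient.mk p (algebraMap T A t)} := by
    rw [← Ideal.map_map, hmap, hm]
  refine ⟨A ⧸ p, inferInstance, inferInstance, hloc,
    (Ideal.Quotient.mk p).comp (algebraMap T A), fun h0 => ?_, ?_, hn, ?_⟩
  · rw [RingHom.comp_apply] at h0
    rw [h0, Ideal.span_singleton_zero, Ideal.map_eq_bot_iff_le_ker, Ideal.mk_ker] at hm
    exact hpm.not_ge hm
  · rw [mem_maximalIdeal, mem_nonunits_iff, RingHom.comp_apply]
    intro hu
    have h3 : IsUnit (algebraMap T A t) := by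
      by_contra h4
      have h5 := Ideal.mem_map_of_mem (Ideal.Quotient.mk p) ((mem_maximalIdeal _).mpr h4)
      rw [← Ideal.span_singleton_eq_top, ← hm] at hu
      have h6 : maximalIdeal A = ⊤ := by
        rw [Ideal.eq_top_iff_one]
        have h7 : (1 : A ⧸ p) ∈ (maximalIdeal A).map (Ideal.Quotient.mk p) :=
          hu ▸ Submodule.mem_top
        obtain ⟨a, ha, ha1⟩ :=
          (Ideal.mem_map_iff_of_surjective _ Ideal.Quotient.mk_surjective).mp h7
        rw [← map_one (Ideal.Quotient.mk p), Ideal.Quotient.eq] at ha1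
        have := sub_mem ha (hpm.le ha1)
        rwa [sub_sub_cancel] at this
      exact (maximalIdeal.isMaximal A).ne_top h6
    have h4 : algebraMap T A t ∈ maximalIdeal A := hmap ▸ Ideal.mem_map_of_mem _ htn
    exact h4 h3
  · rw [← Ideal.map_map]
    refine (Ideal.map_mono hp2).trans (le_of_eq ?_)
    rw [Ideal.map_sup, Ideal.map_quotient_self, sup_bot_eq, Ideal.map_pow, hm,
      Ideal.span_singleton_pow]
    rfl

end Curve

end

section

open IsLocalRing

/-! ### Factoring morphisms through `ℙ(N)` inside `ℙ(M)` -/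

section SymMap

variable {R S : Type u} [CommRing R] [CommRing S] [Algebra R S]
  {M N : Type u} [AddCommGroup M] [Module R M] [AddCommGroup N] [Module R N] [Module S N]
  [IsScalarTower R S N]

lemma exists_comp_symMap_eq (hRS : Function.Surjective (algebraMap R S)) (q : M →ₗ[R] N)
    (hq : Function.Surjective q) {T : Type u} [CommRing T] (θ : SymmetricAlgebra R M →+* T)
    (h0 : ∀ r, algebraMap R S r = 0 → θ (algebraMap R _ r) = 0)
    (h1 : ∀ m, q m = 0 → θ (SymmetricAlgebra.ι R M m) = 0) :
    ∃ θ' : SymmetricAlgebra S N →+* T, θ'.comp (symMap (S := S) q) = θ := by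
  have hf : ∀ a b, q a = q b → θ (SymmetricAlgebra.ι R M a) = θ (SymmetricAlgebra.ι R M b) :=
    fun a b hab => by
      rw [← sub_eq_zero, ← map_sub, ← map_sub]
      exact h1 _ (by rw [map_sub, hab, sub_self])
  let σ : S →+* T := RingHom.liftOfSurjective (algebraMap R S) hRS
    ⟨θ.comp (algebraMap R _), fun r hr => h0 r hr⟩
  have hσ : ∀ r, σ (algebraMap R S r) = θ (algebraMap R _ r) := fun r =>
    RingHom.liftOfRightInverse_comp_apply _ _ (Function.rightInverse_surjInv hRS)
      ⟨θ.comp (algebraMap R _), fun r hr => h0 r hr⟩ r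
  let f : N → T := fun x => θ (SymmetricAlgebra.ι R M (Function.surjInv hq x))
  have hfq : ∀ m, f (q m) = θ (SymmetricAlgebra.ι R M m) := fun m =>
    hf _ _ (Function.surjInv_eq hq _)
  obtain ⟨θ', h0', h1'⟩ := exists_symLift σ f
    (fun a b => by
      obtain ⟨a, rfl⟩ := hq a
      obtain ⟨b, rfl⟩ := hq b
      rw [← map_add, hfq, hfq, hfq, map_add, map_add])
    (fun r a => by
      obtain ⟨r, rfl⟩ := hRS r
      obtain ⟨a, rfl⟩ := hq a
      rw [algebraMap_smul, ← map_smul, hfq, hfq, hσ, map_smul, Algebra.smul_def, map_mul])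
  refine ⟨θ', sym_ringHom_ext (fun r => ?_) fun m => ?_⟩
  · rw [RingHom.comp_apply, symMap_algebraMap, h0', hσ]
  · rw [RingHom.comp_apply, symMap_ι, h1', hfq]

/-- A morphism to `ℙ(M)` whose coordinates vanish on the kernels of `R → S` and `M → N`
factors through `ℙ(N)`. -/
lemma exists_comp_projModuleMap_eq (hRS : Function.Surjective (algebraMap R S)) (q : M →ₗ[R] N)
    (hq : Function.Surjective q) {Y : Scheme.{u}} (θ : SymmetricAlgebra R M →+* Γ(Y, ⊤))
    (hθ : (symGrading R M)₊.toIdeal.map θ = ⊤)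
    (h0 : ∀ r, algebraMap R S r = 0 → θ (algebraMap R _ r) = 0)
    (h1 : ∀ m, q m = 0 → θ (SymmetricAlgebra.ι R M m) = 0) :
    ∃ g : Y ⟶ ProjModule S N, g ≫ ProjModule.map S q hq = Proj.fromOfGlobalSections _ θ hθ := by
  obtain ⟨θ', rfl⟩ := exists_comp_symMap_eq hRS q hq θ h0 h1
  have hθ' : (symGrading S N)₊.toIdeal.map θ' = ⊤ := by
    apply sym_irrelevant_map_eq_top
    rw [← top_le_iff, ← hθ, Ideal.map_le_iff_le_comap]
    refine irrelevant_le_span_ι.trans (Ideal.span_le.mpr ?_)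
    rintro _ ⟨m, rfl⟩
    change θ' (symMap q _) ∈ Ideal.span (Set.range fun m => θ' (SymmetricAlgebra.ι S N m))
    rw [symMap_ι]
    exact Ideal.subset_span ⟨q m, rfl⟩
  exact ⟨Proj.fromOfGlobalSections _ θ' hθ', fromOfGlobalSections_comp_map θ' hθ'
    (symMapGraded (S := S) q) (irrelevant_le_symMap q hq) hθ⟩

lemma isClosedImmersion_projModuleMap (hRS : Function.Surjective (algebraMap R S)) (q : M →ₗ[R] N)
    (hq : Function.Surjective q) : IsClosedImmersion (ProjModule.map S q hq) := by
  refine isClosedImmersion_map_of_surjective _ _ fun d b hb => ?_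
  induction hb using Submodule.pow_induction_on_left' with
  | algebraMap r =>
    obtain ⟨r, rfl⟩ := hRS r
    exact ⟨algebraMap R _ r, algebraMap_mem_symGrading r, symMap_algebraMap q r⟩
  | add x y i hx hy ihx ihy =>
    obtain ⟨a, ha, rfl⟩ := ihx
    obtain ⟨b, hb, rfl⟩ := ihy
    exact ⟨a + b, add_mem ha hb, map_add _ _ _⟩
  | mem_mul m hm i x hx ih =>
    obtain ⟨y, rfl⟩ := hm
    obtain ⟨m, rfl⟩ := hq y
    obtain ⟨a, ha, rfl⟩ := ih
    refine ⟨SymmetricAlgebra.ι R M m * a, ?_, ?_⟩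
    · change _ ∈ LinearMap.range (SymmetricAlgebra.ι R M) ^ (i + 1)
      rw [pow_succ']
      exact Submodule.mul_mem_mul (LinearMap.mem_range_self _ _) ha
    · rw [map_mul]
      congr 1
      exact symMap_ι q m

end SymMap

lemma comap_ker_comp_eq_bot {E L Z : Scheme.{u}} (g : E ⟶ L) (ℓ : L ⟶ Z) :
    ℓ.ker.comap (g ≫ ℓ) = ⊥ := by
  have h : ℓ.ker ≤ Scheme.IdealSheafData.map ⊥ (g ≫ ℓ) :=
    (Scheme.Hom.le_ker_comp g ℓ).trans (Scheme.IdealSheafData.map_bot _).ge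
  exact le_bot_iff.mp (Scheme.IdealSheafData.le_map_iff_comap_le.mp h)

lemma exists_lift_of_comap_ker_eq_bot {E L Z : Scheme.{u}} (ℓ : L ⟶ Z) [IsClosedImmersion ℓ]
    (z : E ⟶ Z) (h : ℓ.ker.comap z = ⊥) : ∃ g : E ⟶ L, g ≫ ℓ = z := by
  have hker : ℓ.ker ≤ z.ker := by
    rw [← Scheme.IdealSheafData.map_bot z, Scheme.IdealSheafData.le_map_iff_comap_le]
    exact h.le
  exact ⟨IsClosedImmersion.lift ℓ z hker, IsClosedImmersion.lift_fac _ _ _⟩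

/-- Factoring through a closed immersion means that the inverse image of its ideal vanishes, which
is a local condition. The local lifts need not be compared. -/
lemma exists_lift_of_forall_exists {E L Z : Scheme.{u}} (ℓ : L ⟶ Z) [IsClosedImmersion ℓ]
    (z : E ⟶ Z) (H : ∀ e : E, ∃ W : E.Opens, e ∈ W ∧ ∃ g : W.toScheme ⟶ L, g ≫ ℓ = W.ι ≫ z) :
    ∃ g : E ⟶ L, g ≫ ℓ = z := by
  refine exists_lift_of_comap_ker_eq_bot ℓ z (eq_bot_of_forall_comap_ι_eq_bot _ fun e => ?_)
  obtain ⟨W, he, g, hg⟩ := H e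
  refine ⟨W, he, ?_⟩
  have h := comap_ker_comp_eq_bot g ℓ
  rw [hg] at h
  exact (Scheme.IdealSheafData.comap_comp _ _ _).symm.trans h

/-! ### Linear subvarieties cut out by a submodule of `M` -/

section ResidueQuotient

variable {V : Type u} [CommRing V] [IsLocalRing V] {M : Type u} [AddCommGroup M] [Module V M]

/-- The subspace of `M ⊗ k` spanned by the image of a submodule of `M`. -/
def residueSpan (K : Submodule V M) : Submodule (ResidueField V) (ResidueField V ⊗[V] M) :=
  Submodule.span _ ((fun m => 1 ⊗ₜ[V] m) '' (K : Set M))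

lemma residueQuotient_eq_zero_of_mem {K : Submodule V M} {m : M} (hm : m ∈ K) :
    residueQuotient (residueSpan K) m = 0 :=
  (Submodule.Quotient.mk_eq_zero _).mpr (Submodule.subset_span ⟨m, hm, rfl⟩)

/-- `V` surjects onto its residue field, so the span of the image of `K` in `M ⊗ k` is just that
image. The kernel of `M → M ⊗ k` is the maximal ideal times `M`, which lies in `K` by `hK`. -/
lemma mem_of_residueQuotient_eq_zero {K : Submodule V M}
    (hK : ∀ r ∈ maximalIdeal V, ∀ m : M, r • m ∈ K) {m : M}
    (hm : residueQuotient (residueSpan K) m = 0) : m ∈ K := by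
  have h1 : (1 : ResidueField V) ⊗ₜ[V] m ∈ residueSpan K :=
    (Submodule.Quotient.mk_eq_zero _).mp hm
  have h2 : ∃ m' ∈ K, (1 : ResidueField V) ⊗ₜ[V] m = 1 ⊗ₜ m' := by
    generalize (1 : ResidueField V) ⊗ₜ[V] m = x at h1 ⊢
    induction h1 using Submodule.span_induction with
    | mem x hx =>
      obtain ⟨a, ha, rfl⟩ := hx
      exact ⟨a, ha, rfl⟩
    | zero => exact ⟨0, K.zero_mem, (TensorProduct.tmul_zero _ _).symm⟩
    | add x y _ _ hx hy =>
      obtain ⟨a, ha, rfl⟩ := hx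
      obtain ⟨b, hb, rfl⟩ := hy
      exact ⟨a + b, K.add_mem ha hb, (TensorProduct.tmul_add _ _ _).symm⟩
    | smul c x _ hx =>
      obtain ⟨a, ha, rfl⟩ := hx
      obtain ⟨c, rfl⟩ := residue_surjective c
      refine ⟨c • a, K.smul_mem c ha, ?_⟩
      rw [TensorProduct.tmul_smul, TensorProduct.smul_tmul', TensorProduct.smul_tmul']
      rfl
  obtain ⟨m', hm', h⟩ := h2
  have h3 := congrArg (TensorProduct.quotTensorEquivQuotSMul M (maximalIdeal V)) h
  have h4 : ∀ a : M, TensorProduct.quotTensorEquivQuotSMul M (maximalIdeal V)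
      ((1 : ResidueField V) ⊗ₜ[V] a) = Submodule.Quotient.mk a := fun a => by
    have := TensorProduct.quotTensorEquivQuotSMul_mk_tmul (M := M) (maximalIdeal V) 1 a
    rw [one_smul] at this
    exact this
  replace h3 := (h4 m).symm.trans (h3.trans (h4 m'))
  rw [Submodule.Quotient.eq] at h3
  have h5 : maximalIdeal V • (⊤ : Submodule V M) ≤ K :=
    Submodule.smul_le.mpr fun r hr a _ => hK r hr a
  have := K.add_mem (h5 h3) hm'
  rwa [sub_add_cancel] at this

instance (N : Submodule (ResidueField V) (ResidueField V ⊗[V] M)) :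
    IsClosedImmersion (linearSubvariety N) :=
  isClosedImmersion_projModuleMap residue_surjective _ _

end ResidueQuotient

end

section

/-! ### Closed subschemes of `ℙ(Q)` containing all rational points -/

section PointsOfProjModule

variable {k : Type u} [Field k] {Q : Type u} [AddCommGroup Q] [Module k Q]

/-- Over an infinite field a nonzero element of the symmetric algebra is a nonzero polynomial
function on the dual space. -/
lemma exists_symmetricAlgebra_lift_ne_zero [Infinite k] {s : SymmetricAlgebra k Q} (hs : s ≠ 0) :
    ∃ q : Q →ₗ[k] k, SymmetricAlgebra.lift q s ≠ 0 := by
  let b := Module.Basis.ofVectorSpace k Q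
  have h1 : SymmetricAlgebra.equivMvPolynomial b s ≠ 0 := by simpa using hs
  obtain ⟨x, hx⟩ : ∃ x : _ → k, MvPolynomial.eval x (SymmetricAlgebra.equivMvPolynomial b s) ≠ 0 := by
    by_contra! h
    exact h1 (MvPolynomial.funext fun x => by rw [h, map_zero])
  refine ⟨b.constr k x, ?_⟩
  have h2 : SymmetricAlgebra.lift (b.constr k x) =
      (MvPolynomial.aeval x).comp (SymmetricAlgebra.equivMvPolynomial b).toAlgHom := by
    apply SymmetricAlgebra.algHom_ext
    refine b.ext fun j => ?_
    simp [SymmetricAlgebra.equivMvPolynomial_ι_apply]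
  rw [h2]
  simpa [MvPolynomial.aeval_eq_eval] using hx

lemma iSup_basicOpen_ι {R : Type u} [CommRing R] {M : Type u} [AddCommGroup M] [Module R M] :
    ⨆ x, Proj.basicOpen (symGrading R M) (SymmetricAlgebra.ι R M x) = ⊤ := by
  refine top_le_iff.mp fun y _ => ?_
  rw [TopologicalSpace.Opens.mem_iSup]
  by_contra! H
  refine y.not_irrelevant_le (irrelevant_le_span_ι.trans (Ideal.span_le.mpr ?_))
  rintro _ ⟨x, rfl⟩
  have := H x
  rwa [Proj.mem_basicOpen, not_not] at this

/-- A closed subscheme of `ℙ(Q)` containing all rational points is everything. -/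
theorem isIso_of_forall_exists_point [Infinite k] {E : Scheme.{u}} (z : E ⟶ ProjModule k Q)
    [IsClosedImmersion z]
    (H : ∀ q : Q →ₗ[k] k, q ≠ 0 → ∃ (Y : Scheme.{u}) (_ : Nontrivial Γ(Y, ⊤)) (η : Y ⟶ E)
      (σ : k →+* Γ(Y, ⊤)) (ψ : SymmetricAlgebra k Q →+* Γ(Y, ⊤))
      (hψ : (symGrading k Q)₊.toIdeal.map ψ = ⊤), (∀ r, ψ (algebraMap k _ r) = σ r) ∧
        (∀ x, ψ (SymmetricAlgebra.ι k Q x) = σ (q x)) ∧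
        η ≫ z = Proj.fromOfGlobalSections _ ψ hψ) : IsIso z := by
  rw [IsClosedImmersion.isIso_iff_ker_eq_bot]
  refine Scheme.IdealSheafData.ext_of_iSup_eq_top
    (fun x : Q => ⟨Proj.basicOpen (symGrading k Q) (SymmetricAlgebra.ι k Q x),
      Proj.isAffineOpen_basicOpen _ _ (ι_mem_symGrading x) one_pos⟩) iSup_basicOpen_ι fun x => ?_
  rw [Scheme.IdealSheafData.ideal_bot, Pi.bot_apply, eq_bot_iff]
  intro y hy
  rw [Scheme.Hom.ker_apply, RingHom.mem_ker] at hy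
  obtain ⟨y, rfl⟩ := (ConcreteCategory.bijective_of_isIso (Proj.basicOpenIsoAway
    (symGrading k Q) _ (ι_mem_symGrading x) one_pos).hom).2 y
  obtain ⟨d, s, hs, rfl⟩ := HomogeneousLocalization.Away.mk_surjective _ (ι_mem_symGrading x) y
  have hs' : s ∈ symGrading k Q d := by simpa using hs
  set t := SymmetricAlgebra.ι k Q x with ht
  by_cases hts : t * s = 0
  · have h0 : HomogeneousLocalization.Away.mk (symGrading k Q) (ι_mem_symGrading x) d s hs = 0 := by
      apply HomogeneousLocalization.val_injective
      rw [HomogeneousLocalization.Away.val_mk, HomogeneousLocalization.val_zero,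
        Localization.mk_eq_mk', IsLocalization.mk'_eq_zero_iff]
      exact ⟨⟨t, 1, pow_one t⟩, hts⟩
    rw [h0]
    exact map_zero (Proj.awayToSection (symGrading k Q) t).hom
  -- The product `t * s` is used, not `s` alone, so that the rational point `q` lies in `D₊(t)` and
  -- the function `s / t ^ d` is nonzero there. This contradicts its vanishing on `E`, through which
  -- the point factors.
  · obtain ⟨q, hq⟩ := exists_symmetricAlgebra_lift_ne_zero hts
    rw [map_mul] at hq
    have hqx : q x ≠ 0 := by
      have := left_ne_zero_of_mul hq
      rwa [ht, SymmetricAlgebra.lift_ι_apply] at this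
    obtain ⟨Y, _, η, σ, ψ, hψ, h0, h1, h2⟩ := H q (fun h => hqx (by rw [h]; rfl))
    have hψq : ψ = σ.comp (SymmetricAlgebra.lift q).toRingHom := by
      refine sym_ringHom_ext (fun r => ?_) fun m => ?_
      · rw [h0]
        exact congrArg σ (AlgHom.commutes (SymmetricAlgebra.lift q) r).symm
      · rw [h1]
        exact congrArg σ (SymmetricAlgebra.lift_ι_apply q m).symm
    have hu : IsUnit (ψ t) := by
      rw [ht, h1]
      exact (IsUnit.mk0 _ hqx).map σ
    have hle := le_fromOfGlobalSections_preimage ψ hψ (ι_mem_symGrading x) one_pos hu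
    have h3 := coords_fromOfGlobalSections ψ hψ (ι_mem_symGrading x) hu hle hs'
    have hle' : ⊤ ≤ (η ≫ z) ⁻¹ᵁ Proj.basicOpen (symGrading k Q) t := h2 ▸ hle
    rw [coords_congr h2.symm _ hle hle', coords_of_mem _ _ _ hs'] at h3
    have h4 : evalAt (symGrading k Q) (η ≫ z) t hle'
        (HomogeneousLocalization.Away.mk (symGrading k Q) (ι_mem_symGrading x) d s hs) = 0 := by
      have hle2 : ⊤ ≤ η ⁻¹ᵁ (z ⁻¹ᵁ Proj.basicOpen (symGrading k Q) t) := hle'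
      have h5 : (η ≫ z).appLE (Proj.basicOpen (symGrading k Q) t) ⊤ hle' =
          z.app _ ≫ η.appLE _ ⊤ hle2 := by
        rw [Scheme.Hom.app_eq_appLE, Scheme.Hom.appLE_comp_appLE]
      rw [evalAt, h5]
      exact (congrArg (η.appLE _ ⊤ hle2).hom hy).trans (map_zero _)
    rw [h4, zero_mul] at h3
    have h6 : ψ s = σ (SymmetricAlgebra.lift q s) := by rw [hψq]; rfl
    rw [h6] at h3
    have h7 := σ.injective (h3.symm.trans (map_zero σ).symm)
    exact absurd h7 (right_ne_zero_of_mul hq)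

end PointsOfProjModule

end

section

open IsLocalRing

/-! ### The exceptional divisor lies in a linear subvariety -/

section Exceptional

variable {V : Type u} [CommRing V] [IsLocalRing V] {n : ℕ} {I : (ProjSpace n V).IdealSheafData}
  {p : Fin (n + 1) → V}

/-- The ideal generated by the equations of the point in a chart. -/
abbrev chartIdeal (I : (ProjSpace n V).IdealSheafData) {S : Type*} [CommRing S]
    (c : MvPolynomial (Fin (n + 1)) V →+* S) : Ideal S :=
  Ideal.span (c '' (twistedSections I 1 : Set _))

lemma IsPointIdeal.map_C_mem (hI : IsPointIdeal I p) {S : Type*} [CommRing S]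
    {c : MvPolynomial (Fin (n + 1)) V →+* S} {i : Fin (n + 1)} (h1 : c (MvPolynomial.X i) = 1)
    {r : V} (hr : r ∈ maximalIdeal V) : c (MvPolynomial.C r) ∈ chartIdeal I c := by
  have := Ideal.subset_span (s := c '' (twistedSections I 1 : Set _))
    ⟨_, hI.C_mul_mem (MvPolynomial.isHomogeneous_X V i) hr, rfl⟩
  rwa [map_mul, h1, mul_one] at this

lemma IsPointIdeal.map_quadric_mem (hI : IsPointIdeal I p) {S : Type*} [CommRing S]
    (c : MvPolynomial (Fin (n + 1)) V →+* S) {F : MvPolynomial (Fin (n + 1)) V}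
    (hF : F ∈ twistedSections I 2) : c F ∈ chartIdeal I c := by
  rw [hI.twistedSections_two_eq_span] at hF
  induction hF using Submodule.span_induction with
  | mem x hx =>
    obtain ⟨ℓ, hℓ, j, rfl⟩ := hx
    rw [map_mul]
    exact Ideal.mul_mem_right _ _ (Ideal.subset_span ⟨ℓ, hℓ, rfl⟩)
  | zero => rw [map_zero]; exact zero_mem _
  | add x y _ _ hx hy => rw [map_add]; exact add_mem hx hy
  | smul r x _ hx =>
    rw [MvPolynomial.smul_eq_C_mul, map_mul]
    exact Ideal.mul_mem_left _ _ hx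

/-- The quadrics with vanishing differential at the point. -/
def singularQuadrics (I : (ProjSpace n V).IdealSheafData) {S : Type*} [CommRing S]
    (c : MvPolynomial (Fin (n + 1)) V →+* S) : Submodule V (twistedSections I 2) where
  carrier := {F | c F.1 ∈ chartIdeal I c ^ 2}
  add_mem' {a b} ha hb := by
    change c (a.1 + b.1) ∈ chartIdeal I c ^ 2
    rw [map_add]; exact add_mem ha hb
  zero_mem' := by
    change c 0 ∈ chartIdeal I c ^ 2
    rw [map_zero]; exact zero_mem _
  smul_mem' r F hF := by
    change c (r • F.1) ∈ chartIdeal I c ^ 2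
    rw [MvPolynomial.smul_eq_C_mul, map_mul]; exact Ideal.mul_mem_left _ _ hF

/-- The scalar and the quadric both lie in the ideal of the point. Consequently the quadrics modulo
this submodule form a vector space over the residue field. -/
lemma IsPointIdeal.smul_mem_singularQuadrics (hI : IsPointIdeal I p) {S : Type*} [CommRing S]
    {c : MvPolynomial (Fin (n + 1)) V →+* S} {i : Fin (n + 1)} (h1 : c (MvPolynomial.X i) = 1)
    {r : V} (hr : r ∈ maximalIdeal V) (F : twistedSections I 2) :
    r • F ∈ singularQuadrics I c := by
  change c (r • F.1) ∈ chartIdeal I c ^ 2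
  rw [MvPolynomial.smul_eq_C_mul, map_mul, sq]
  exact Ideal.mul_mem_mul (hI.map_C_mem h1 hr) (hI.map_quadric_mem c F.2)

variable {φ₀ : (suppCompl I).toScheme ⟶ ProjModule V (twistedSections I 2)}

lemma IsPointIdeal.comap_ideal_comp (hI : IsPointIdeal I p) {X' Q : Scheme.{u}} [IsAffine Q]
    {g : X' ⟶ ProjSpace n V} {i : Fin (n + 1)} (hi : ⊤ ≤ g ⁻¹ᵁ (ProjSpace.chart n V i).1)
    (u : Q ⟶ X') (h' : ⊤ ∈ Q.affineOpens) : (I.comap (u ≫ g)).ideal ⟨⊤, h'⟩ =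
      (chartIdeal I (coordsX g i hi)).map u.appTop.hom := by
  have hiQ : ⊤ ≤ (u ≫ g) ⁻¹ᵁ (ProjSpace.chart n V i).1 := fun y _ => hi trivial
  refine (hI.comap_ideal_top (u ≫ g) i hiQ).trans ?_
  rw [coordsX_comp g i hi u hiQ, Ideal.map_span, ← Set.image_comp]
  rfl

/-- The homogeneous coordinates of the extension of `φ₀` at a point with values in an affine
scheme lying over a chart. -/
lemma IsPointIdeal.exists_local_coords (hI : IsPointIdeal I p)
    (hφ₀ : IsGivenByForms (twistedSections I 2) (suppCompl I).ι φ₀) {B : Scheme.{u}}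
    {g' : B ⟶ ProjSpace n V} {φ : B ⟶ ProjModule V (twistedSections I 2)}
    (hφ : Extends g' φ₀ φ) {X' Q : Scheme.{u}} [IsAffine Q] {g : X' ⟶ ProjSpace n V}
    {i : Fin (n + 1)} (hi : ⊤ ≤ g ⁻¹ᵁ (ProjSpace.chart n V i).1) (q : Q ⟶ B) (u : Q ⟶ X')
    (hqu : q ≫ g' = u ≫ g) {a : Γ(Q, ⊤)} (ha₀ : a ∈ nonZeroDivisors Γ(Q, ⊤))
    (ha : (chartIdeal I (coordsX g i hi)).map u.appTop.hom = Ideal.span {a}) :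
    ∃ (θ : SymmetricAlgebra V (twistedSections I 2) →+* Γ(Q, ⊤))
      (hθ : (symGrading V (twistedSections I 2))₊.toIdeal.map θ = ⊤),
      q ≫ φ = Proj.fromOfGlobalSections _ θ hθ ∧
      (∀ r, θ (algebraMap V _ r) = u.appTop.hom (coordsX g i hi (MvPolynomial.C r))) ∧
      ∀ F : twistedSections I 2, θ (SymmetricAlgebra.ι V _ F) * a =
        u.appTop.hom (coordsX g i hi F.1) := by
  have hiQ : ⊤ ≤ (u ≫ g) ⁻¹ᵁ (ProjSpace.chart n V i).1 := fun y _ => hi trivial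
  have hiq : ⊤ ≤ (q ≫ g') ⁻¹ᵁ (ProjSpace.chart n V i).1 := hqu ▸ hiQ
  have haI : ∀ h', (I.comap (q ≫ g')).ideal ⟨⊤, h'⟩ = Ideal.span {a} := fun h' => by
    rw [hqu]
    exact (hI.comap_ideal_comp hi u h').trans ha
  obtain ⟨θ, hθ⟩ := hI.exists_isQuotientBy (q ≫ g') i hiq ha₀ haI
  have hc : coordsX (q ≫ g') i hiq = u.appTop.hom.comp (coordsX g i hi) := by
    rw [← coordsX_comp g i hi u hiQ]
    exact coords_congr hqu _ _ _
  refine ⟨θ, hθ.irrelevant_map, hI.eq_of_extends hφ₀ hφ q ha₀ hθ haI, fun r => ?_, fun F => ?_⟩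
  · rw [hθ.algebraMap_eq, hc, RingHom.comp_apply]
  · rw [hθ.mul_eq, hc, RingHom.comp_apply]

lemma appTop_eq_zero_of_comap_eq_bot {Q W : Scheme.{u}} [IsAffine Q] [IsAffine W]
    {J : W.IdealSheafData} (u : Q ⟶ W) (h : J.comap u = ⊥) {a : Γ(W, ⊤)}
    (ha : ∀ h', J.ideal ⟨⊤, h'⟩ = Ideal.span {a}) : u.appTop.hom a = 0 := by
  have h1 := comap_ideal J u ⟨⊤, isAffineOpen_top W⟩ ⟨⊤, isAffineOpen_top Q⟩ le_top
  have h2 := h1.trans (congrArg _ (ha (isAffineOpen_top W)))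
  rw [h, Ideal.map_span, Set.image_singleton] at h2
  rw [Scheme.Hom.appTop, Scheme.Hom.app_eq_appLE, ← Ideal.span_singleton_eq_bot]
  exact h2.symm

/-- The exceptional divisor is mapped to the linear subvariety cut out by the quadrics with
vanishing differential. -/
lemma IsPointIdeal.exists_factor_linearSubvariety (hI : IsPointIdeal I p)
    (hφ₀ : IsGivenByForms (twistedSections I 2) (suppCompl I).ι φ₀) {X X' B : Scheme.{u}}
    {i : X ⟶ ProjSpace n V} {f : B ⟶ X} (hinv : IsInvertibleIdeal ((I.comap i).comap f))
    {φ : B ⟶ ProjModule V (twistedSections I 2)} (hφ : Extends (f ≫ i) φ₀ φ) (v : X' ⟶ X)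
    [IsOpenImmersion v] (hv : ∀ b ∈ ((I.comap i).comap f).support, f b ∈ v.opensRange)
    {j : Fin (n + 1)} (hj : ⊤ ≤ (v ≫ i) ⁻¹ᵁ (ProjSpace.chart n V j).1) :
    ∃ z, z ≫ linearSubvariety (residueSpan (singularQuadrics I (coordsX (v ≫ i) j hj))) =
      ((I.comap i).comap f).subschemeι ≫ φ := by
  set ε := ((I.comap i).comap f).subschemeι with hε
  refine exists_lift_of_forall_exists _ _ fun e => ?_
  have he : ε e ∈ ((I.comap i).comap f).support := by
    have := Set.mem_range_self (f := ε) e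
    rwa [hε, Scheme.IdealSheafData.range_subschemeι] at this
  obtain ⟨W, heW, hWO, a, ha₀, ha⟩ := hinv.exists_generator (O := f ⁻¹ᵁ v.opensRange) (hv _ he)
  have : IsAffine W.1.toScheme := W.2
  obtain ⟨u, hu⟩ : ∃ u : W.1.toScheme ⟶ X', u ≫ v = W.1.ι ≫ f :=
    ⟨IsOpenImmersion.lift v (W.1.ι ≫ f) (by rintro _ ⟨w, rfl⟩; exact hWO w.2),
      IsOpenImmersion.lift_fac _ _ _⟩
  have hqu : W.1.ι ≫ f ≫ i = u ≫ v ≫ i := by rw [← Category.assoc, ← hu, Category.assoc]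
  have hmap : (chartIdeal I (coordsX (v ≫ i) j hj)).map u.appTop.hom = Ideal.span {a} := by
    rw [← ha (isAffineOpen_top _), ← hI.comap_ideal_comp hj u (isAffineOpen_top _), ← hqu,
      Scheme.IdealSheafData.comap_comp, Scheme.IdealSheafData.comap_comp]
  obtain ⟨θ, hθ, hφθ, hθ0, hθ1⟩ := hI.exists_local_coords hφ₀ hφ hj W.1.ι u hqu ha₀ hmap
  let D : ((I.comap i).comap f).subscheme.Opens := ε ⁻¹ᵁ W.1
  have : IsAffine D.toScheme := W.2.preimage ε
  let w : D.toScheme ⟶ W.1 := ε ∣_ W.1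
  have hw : w ≫ W.1.ι = D.ι ≫ ε := morphismRestrict_ι _ _
  -- The exceptional divisor is by definition the zero scheme of the local generator `a`.
  have hwa : w.appTop.hom a = 0 := by
    refine appTop_eq_zero_of_comap_eq_bot w ?_ ha
    have hk : ε.ker = (I.comap i).comap f := Scheme.IdealSheafData.ker_subschemeι _
    have h := comap_ker_comp_eq_bot D.ι ε
    rw [hk] at h
    exact (Scheme.IdealSheafData.comap_comp _ _ _).symm.trans ((congrArg _ hw).trans h)
  have hc1 := coordsX_self (v ≫ i) j hj
  have hwn : ∀ s ∈ chartIdeal I (coordsX (v ≫ i) j hj), w.appTop.hom (u.appTop.hom s) = 0 := by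
    intro s hs
    have h1 := Ideal.mem_map_of_mem u.appTop.hom hs
    rw [hmap] at h1
    obtain ⟨y, hy⟩ := Ideal.mem_span_singleton'.mp h1
    rw [← hy, map_mul, hwa, mul_zero]
  obtain ⟨γ, hγ⟩ := exists_comp_projModuleMap_eq residue_surjective
    (residueQuotient (residueSpan (singularQuadrics I (coordsX (v ≫ i) j hj))))
    (residueQuotient_surjective _) (w.appTop.hom.comp θ) (map_comp_eq_top _ hθ)
    (fun r hr => by
      rw [RingHom.comp_apply, hθ0]
      exact hwn _ (hI.map_C_mem hc1 ((residue_eq_zero_iff r).mp hr)))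
    -- The value of `F` lies in the square of the ideal, so it is `y a²`. Hence the coordinate `F/a`
    -- is `y a`, which vanishes on the exceptional divisor.
    (fun F hF => by
      have h1 : coordsX (v ≫ i) j hj F.1 ∈ chartIdeal I (coordsX (v ≫ i) j hj) ^ 2 :=
        mem_of_residueQuotient_eq_zero
          (fun r hr m => hI.smul_mem_singularQuadrics hc1 hr m) hF
      have h2 := Ideal.mem_map_of_mem u.appTop.hom h1
      rw [Ideal.map_pow, hmap, Ideal.span_singleton_pow] at h2
      obtain ⟨y, hy⟩ := Ideal.mem_span_singleton'.mp h2
      rw [← hθ1, sq, ← mul_assoc] at hy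
      rw [RingHom.comp_apply, ← (mul_cancel_right_mem_nonZeroDivisors ha₀).mp hy, map_mul, hwa,
        mul_zero])
  refine ⟨D, heW, γ, ?_⟩
  rw [← Category.assoc, ← hw, Category.assoc, hφθ, comp_fromOfGlobalSections]
  exact hγ

end Exceptional

end

section

open IsLocalRing

/-! ### Rational points of the linear subvariety as tangent directions -/

section PointOverTangent

variable {V : Type u} [CommRing V] [IsLocalRing V] {n : ℕ} {I : (ProjSpace n V).IdealSheafData}
  {p : Fin (n + 1) → V}

lemma apply_residueQuotient_smul {M : Type u} [AddCommGroup M] [Module V M]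
    {N : Submodule (ResidueField V) (ResidueField V ⊗[V] M)}
    (q : (ResidueField V ⊗[V] M) ⧸ N →ₗ[ResidueField V] ResidueField V) (r : V) (m : M) :
    q (residueQuotient N (r • m)) = residue V r * q (residueQuotient N m) := by
  rw [map_smul, ← algebraMap_smul (ResidueField V) r, map_smul, smul_eq_mul]
  rfl

/-- Tangent vectors at the point on which the quadrics in a hyperplane vanish define a proper
ideal. -/
lemma IsPointIdeal.exists_tangentIdeal (hI : IsPointIdeal I p) {T : Type u} [CommRing T]
    {c : MvPolynomial (Fin (n + 1)) V →+* T} {j : Fin (n + 1)} (h1 : c (MvPolynomial.X j) = 1)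
    (e : T →+* ResidueField V) (hker : RingHom.ker e = chartIdeal I c)
    (he : ∀ r, e (c (MvPolynomial.C r)) = residue V r)
    (q : (ResidueField V ⊗[V] twistedSections I 2) ⧸ residueSpan (singularQuadrics I c)
      →ₗ[ResidueField V] ResidueField V) {F₀ : twistedSections I 2}
    (hF₀ : q (residueQuotient _ F₀) = 1) :
    ∃ H : Ideal T, chartIdeal I c ^ 2 ≤ H ∧ H ≤ chartIdeal I c ∧ c F₀.1 ∉ H ∧
      chartIdeal I c ≤ Ideal.span {c F₀.1} ⊔ H ∧
      ∀ G : twistedSections I 2, q (residueQuotient _ G) = 0 → c G.1 ∈ H := by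
  set S : Set T := {s | ∃ G : twistedSections I 2, q (residueQuotient _ G) = 0 ∧ c G.1 = s}
  -- Modulo the square of the ideal, multiplication by `a` is multiplication by a constant `r` with
  -- the same residue. So up to that square the ideal generated by the values of the quadrics killed
  -- by `q` consists of such values.
  have hS : ∀ s ∈ Ideal.span S, ∃ G : twistedSections I 2, q (residueQuotient _ G) = 0 ∧
      s - c G.1 ∈ chartIdeal I c ^ 2 := by
    intro s hs
    induction hs using Submodule.span_induction with
    | mem x hx =>
      obtain ⟨G, hG, rfl⟩ := hx
      exact ⟨G, hG, by rw [sub_self]; exact zero_mem _⟩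
    | zero => exact ⟨0, by rw [map_zero, map_zero], by
        have : (0 : T) - c (0 : twistedSections I 2).1 = 0 := by
          rw [Submodule.coe_zero, map_zero, sub_zero]
        rw [this]; exact zero_mem _⟩
    | add x y _ _ hx hy =>
      obtain ⟨G, hG, hxG⟩ := hx
      obtain ⟨G', hG', hyG⟩ := hy
      refine ⟨G + G', by rw [map_add, map_add, hG, hG', add_zero], ?_⟩
      have := add_mem hxG hyG
      rwa [sub_add_sub_comm, ← map_add] at this
    | smul a s _ hs =>
      obtain ⟨G, hG, hsG⟩ := hs
      obtain ⟨r, hr⟩ := residue_surjective (e a)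
      refine ⟨r • G, by rw [apply_residueQuotient_smul, hG, mul_zero], ?_⟩
      have hs' : s ∈ chartIdeal I c := by
        have := add_mem (Ideal.pow_le_self two_ne_zero hsG) (hI.map_quadric_mem c G.2)
        rwa [sub_add_cancel] at this
      have ha : a - c (MvPolynomial.C r) ∈ chartIdeal I c := by
        rw [← hker, RingHom.mem_ker, map_sub, he, hr, sub_self]
      have h2 : a • s - c (r • G : twistedSections I 2).1 =
          (a - c (MvPolynomial.C r)) * s + c (MvPolynomial.C r) * (s - c G.1) := by
        rw [Submodule.coe_smul, MvPolynomial.smul_eq_C_mul, map_mul, smul_eq_mul]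
        ring
      rw [h2]
      refine add_mem ?_ (Ideal.mul_mem_left _ _ hsG)
      rw [sq]
      exact Ideal.mul_mem_mul ha hs'
  refine ⟨Ideal.span S ⊔ chartIdeal I c ^ 2, le_sup_right,
    sup_le (Ideal.span_le.mpr ?_) (Ideal.pow_le_self two_ne_zero), fun hF => ?_, ?_,
    fun G hG => Ideal.mem_sup_left (Ideal.subset_span ⟨G, hG, rfl⟩)⟩
  · rintro _ ⟨G, -, rfl⟩
    exact hI.map_quadric_mem c G.2
  -- Otherwise `F₀` would differ by a singular quadric from some `G` killed by `q`, contradicting `q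
  -- = 1` on `F₀`.
  · obtain ⟨s, hs, w, hw, hsw⟩ := Submodule.mem_sup.mp hF
    obtain ⟨G, hG, hsG⟩ := hS s hs
    have h3 : c (F₀ - G).1 ∈ chartIdeal I c ^ 2 := by
      have := add_mem hsG hw
      rwa [sub_add_eq_add_sub, hsw, ← map_sub] at this
    have h4 := residueQuotient_eq_zero_of_mem (K := singularQuadrics I c) (m := F₀ - G) h3
    rw [map_sub, sub_eq_zero] at h4
    rw [h4, hG] at hF₀
    exact zero_ne_one hF₀
  · rw [Ideal.span_le]
    rintro _ ⟨ℓ, hℓ, rfl⟩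
    let F : twistedSections I 2 := hI.mulX ⟨ℓ, hℓ⟩ j
    have hcF : c F.1 = c ℓ := by
      change c (ℓ * MvPolynomial.X j) = c ℓ
      rw [map_mul, h1, mul_one]
    -- Subtracting the multiple `r F₀` moves `F` into the kernel of `q`.
    obtain ⟨r, hr⟩ := residue_surjective (q (residueQuotient _ F))
    have hG : q (residueQuotient _ (F - r • F₀)) = 0 := by
      rw [map_sub, map_sub, apply_residueQuotient_smul, hF₀, mul_one, hr, sub_self]
    have h5 : c ℓ = c (MvPolynomial.C r) * c F₀.1 + c (F - r • F₀).1 := by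
      rw [← hcF, Submodule.coe_sub, Submodule.coe_smul, MvPolynomial.smul_eq_C_mul, map_sub,
        map_mul]
      ring
    rw [h5]
    exact Submodule.add_mem_sup (Ideal.mul_mem_left _ _ (Ideal.mem_span_singleton_self _))
      (Ideal.mem_sup_left (Ideal.subset_span ⟨_, hG, rfl⟩))

lemma appTop_map_isoSpec_inv {X' : Scheme.{u}} [IsAffine X'] {C : CommRingCat.{u}}
    (χ : Γ(X', ⊤) ⟶ C) :
    (Spec.map χ ≫ X'.isoSpec.inv).appTop = χ ≫ (Scheme.ΓSpecIso C).inv := by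
  have h1 : X'.isoSpec.inv.appTop = (Scheme.ΓSpecIso Γ(X', ⊤)).inv := by
    have h2 := congrArg Scheme.Hom.appTop (Scheme.isoSpec_inv_toSpecΓ X')
    rw [Scheme.Hom.comp_appTop, Scheme.toSpecΓ_appTop, Scheme.Hom.id_appTop] at h2
    rw [← cancel_epi (Scheme.ΓSpecIso Γ(X', ⊤)).hom, h2, Iso.hom_inv_id]
  rw [Scheme.Hom.comp_appTop, h1, Scheme.ΓSpecIso_inv_naturality]

variable {φ₀ : (suppCompl I).toScheme ⟶ ProjModule V (twistedSections I 2)}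

set_option maxHeartbeats 1600000 in
/-- Every point of the linear subvariety is the image of a point of the exceptional divisor,
namely of the tangent direction of a regular curve. -/
lemma IsPointIdeal.exists_point (hI : IsPointIdeal I p)
    (hφ₀ : IsGivenByForms (twistedSections I 2) (suppCompl I).ι φ₀) {X X' B : Scheme.{u}}
    [IsAffine X'] {i : X ⟶ ProjSpace n V} {f : B ⟶ X} (hf : IsBlowup f (I.comap i))
    {φ : B ⟶ ProjModule V (twistedSections I 2)} (hφ : Extends (f ≫ i) φ₀ φ) (v : X' ⟶ X)
    {j : Fin (n + 1)} (hj : ⊤ ≤ (v ≫ i) ⁻¹ᵁ (ProjSpace.chart n V j).1)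
    {c : MvPolynomial (Fin (n + 1)) V →+* Γ(X', ⊤)} (hc : coordsX (v ≫ i) j hj = c)
    (e : Γ(X', ⊤) →+* ResidueField V)
    (hker : RingHom.ker e = chartIdeal I c)
    (he : ∀ r, e (c (MvPolynomial.C r)) = residue V r)
    [(chartIdeal I c).IsMaximal]
    [IsRegularLocalRing (Localization.AtPrime (chartIdeal I c))]
    (q : (ResidueField V ⊗[V] twistedSections I 2) ⧸
        residueSpan (singularQuadrics I c) →ₗ[ResidueField V] ResidueField V)
    (hq : q ≠ 0) : ∃ (Y : Scheme.{u}) (_ : Nontrivial Γ(Y, ⊤))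
      (η : Y ⟶ ((I.comap i).comap f).subscheme) (σ : ResidueField V →+* Γ(Y, ⊤))
      (ψ : SymmetricAlgebra (ResidueField V) _ →+* Γ(Y, ⊤))
      (hψ : (symGrading (ResidueField V) _)₊.toIdeal.map ψ = ⊤),
        (∀ r, ψ (algebraMap (ResidueField V) _ r) = σ r) ∧
        (∀ x, ψ (SymmetricAlgebra.ι (ResidueField V) _ x) = σ (q x)) ∧
        η ≫ ((I.comap i).comap f).subschemeι ≫ φ = Proj.fromOfGlobalSections _ ψ hψ ≫
          linearSubvariety (residueSpan (singularQuadrics I c)) := by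
  have h1 : c (MvPolynomial.X j) = 1 := hc ▸ coordsX_self _ _ _
  -- The value of this quadric will be the parameter generating the maximal ideal of the curve.
  obtain ⟨F₀, hF₀⟩ : ∃ F₀, q (residueQuotient _ F₀) = 1 := by
    obtain ⟨x, hx⟩ : ∃ x, q x ≠ 0 := by
      by_contra! h
      exact hq (LinearMap.ext h)
    obtain ⟨F₀, hF₀⟩ := residueQuotient_surjective _ ((q x)⁻¹ • x)
    exact ⟨F₀, by rw [hF₀, map_smul, smul_eq_mul, inv_mul_cancel₀ hx]⟩
  obtain ⟨H, hH2, hHn, hFH, hnH, hGH⟩ := hI.exists_tangentIdeal h1 e hker he q hF₀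
  obtain ⟨C, _, _, _, χ, hχ0, hχm, hχn, hχH⟩ := exists_curve (chartIdeal I c) H (c F₀.1) hH2 hHn
    (hI.map_quadric_mem c F₀.2) hFH hnH
  let u : Spec (.of C) ⟶ X' := Spec.map (CommRingCat.ofHom χ) ≫ X'.isoSpec.inv
  let γ : C ≃+* Γ(Spec (.of C), ⊤) := (Scheme.ΓSpecIso (.of C)).symm.commRingCatIsoToRingEquiv
  have hu : ∀ s, u.appTop.hom s = γ (χ s) := fun s =>
    congr($(appTop_map_isoSpec_inv (CommRingCat.ofHom χ)).hom s)
  clear_value u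
  have hdom : IsDomain Γ(Spec (.of C), ⊤) := γ.symm.toMulEquiv.isDomain C
  set a := γ (χ (c F₀.1)) with ha
  have ha₀ : a ∈ nonZeroDivisors Γ(Spec (.of C), ⊤) :=
    mem_nonZeroDivisors_of_ne_zero (by simpa [ha] using hχ0)
  have hmap : (chartIdeal I c).map u.appTop.hom = Ideal.span {a} := by
    have : u.appTop.hom = γ.toRingHom.comp χ := RingHom.ext hu
    rw [this, ← Ideal.map_map, hχn, Ideal.map_span, Set.image_singleton]
    rfl
  have hinv : IsInvertibleIdeal ((I.comap i).comap (u ≫ v)) := by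
    rw [← Scheme.IdealSheafData.comap_comp, Category.assoc]
    exact fun y => ⟨⟨⊤, isAffineOpen_top _⟩, trivial, a, ha₀,
      (hI.comap_ideal_comp hj u _).trans (hc ▸ hmap)⟩
  -- On the curve the ideal of the point is generated by the nonzero element `a` of a domain, so the
  -- curve lifts to the blow-up.
  obtain ⟨β, hβ, -⟩ := hf.existsUnique_lift (u ≫ v) hinv
  have hqu : β ≫ f ≫ i = u ≫ v ≫ i := by rw [← Category.assoc, hβ, Category.assoc]
  obtain ⟨θ, hθ, hφθ, hθ0, hθ1⟩ := hI.exists_local_coords hφ₀ hφ hj β u hqu ha₀ (hc ▸ hmap)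
  rw [hc] at hθ0 hθ1
  let ρ : Spec (.of (ResidueField C)) ⟶ Spec (.of C) :=
    Spec.map (CommRingCat.ofHom (residue C))
  let δ : ResidueField C ≃+* Γ(Spec (.of (ResidueField C)), ⊤) :=
    (Scheme.ΓSpecIso (.of (ResidueField C))).symm.commRingCatIsoToRingEquiv
  have hρ : ∀ s, ρ.appTop.hom (γ s) = δ (residue C s) := fun s =>
    congr($(Scheme.ΓSpecIso_inv_naturality (CommRingCat.ofHom (residue C))).hom s).symm
  have hρa : ρ.appTop.hom a = 0 := by
    rw [ha, hρ, (residue_eq_zero_iff _).mpr hχm, map_zero]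
  have hnt : Nontrivial Γ(Spec (.of (ResidueField C)), ⊤) := δ.symm.toEquiv.nontrivial
  -- The parameter `a` dies in the residue field of `C`, so the closed point of the lifted curve
  -- lies on the exceptional divisor.
  have hbot : ((I.comap i).comap f).comap (ρ ≫ β) = ⊥ := by
    refine Scheme.IdealSheafData.ext_of_isAffine ?_
    have h2 : ((I.comap i).comap f).comap (ρ ≫ β) = I.comap ((ρ ≫ u) ≫ v ≫ i) := by
      rw [← Scheme.IdealSheafData.comap_comp, ← Scheme.IdealSheafData.comap_comp]
      simp only [Category.assoc, hqu]
    rw [h2]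
    refine (hI.comap_ideal_comp hj (ρ ≫ u) (isAffineOpen_top _)).trans ?_
    rw [hc, Scheme.Hom.comp_appTop, CommRingCat.hom_comp, ← Ideal.map_map, hmap, Ideal.map_span,
      Set.image_singleton, hρa, Ideal.span_singleton_zero]
    rfl
  obtain ⟨η, hη⟩ := exists_lift_of_comap_ker_eq_bot ((I.comap i).comap f).subschemeι (ρ ≫ β) (by
    rw [Scheme.IdealSheafData.ker_subschemeι]; exact hbot)
  have hρn : ∀ s ∈ chartIdeal I c, ρ.appTop.hom (u.appTop.hom s) = 0 := fun s hs => by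
    have h3 := Ideal.mem_map_of_mem u.appTop.hom hs
    rw [hmap] at h3
    obtain ⟨y, hy⟩ := Ideal.mem_span_singleton'.mp h3
    rw [← hy, map_mul, hρa, mul_zero]
  set θ' := ρ.appTop.hom.comp θ with hθ'
  have hθ'0 : ∀ r, residue V r = 0 → θ' (algebraMap V _ r) = 0 := fun r hr => by
    rw [hθ', RingHom.comp_apply, hθ0]
    exact hρn _ (hI.map_C_mem h1 ((residue_eq_zero_iff r).mp hr))
  have hθ'F₀ : θ' (SymmetricAlgebra.ι V _ F₀) = 1 := by
    have h3 := hθ1 F₀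
    rw [hu, ← ha, ← one_mul a, ← mul_assoc, mul_one] at h3
    rw [hθ', RingHom.comp_apply, (mul_cancel_right_mem_nonZeroDivisors ha₀).mp h3, map_one]
  -- A quadric killed by `q` has value `y a²` on the curve, so its coordinate `y a` vanishes at the
  -- closed point. The coordinate of `F₀` is `1`.
  have hθ'G : ∀ G, q (residueQuotient _ G) = 0 → θ' (SymmetricAlgebra.ι V _ G) = 0 := by
    intro G hG
    have h3 := hχH (Ideal.mem_map_of_mem χ (hGH G hG))
    obtain ⟨y, hy⟩ := Ideal.mem_span_singleton'.mp h3
    have h4 := hθ1 G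
    rw [hu, ← hy, map_mul, map_pow, ← ha, sq, ← mul_assoc] at h4
    rw [hθ', RingHom.comp_apply, (mul_cancel_right_mem_nonZeroDivisors ha₀).mp h4, map_mul, hρa,
      mul_zero]
  let σ : ResidueField V →+* Γ(Spec (.of (ResidueField C)), ⊤) :=
    RingHom.liftOfSurjective (residue V) residue_surjective
      ⟨θ'.comp (algebraMap V _), fun r hr => hθ'0 r hr⟩
  have hσ : ∀ r, σ (residue V r) = θ' (algebraMap V _ r) := fun r =>
    RingHom.liftOfRightInverse_comp_apply _ _ (Function.rightInverse_surjInv residue_surjective)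
      ⟨θ'.comp (algebraMap V _), fun r hr => hθ'0 r hr⟩ r
  obtain ⟨ψ, hψ0, hψ1⟩ := exists_symLift σ (fun x => σ (q x))
    (fun a b => by rw [map_add, map_add]) (fun r a => by rw [map_smul, smul_eq_mul, map_mul])
  have hψθ : ψ.comp (symMapGraded (residueQuotient
      (residueSpan (singularQuadrics I c)))).toRingHom = θ' := by
    refine sym_ringHom_ext (fun r => ?_) fun F => ?_
    · refine (congrArg ψ (symMap_algebraMap _ r)).trans ?_
      rw [hψ0]
      exact hσ r
    · refine (congrArg ψ (symMap_ι _ F)).trans ?_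
      rw [hψ1]
      -- The coordinates at the closed point annihilate the kernel of `q` and equal `1` on `F₀`.
      -- Writing `F` as `r F₀` plus an element of the kernel shows that they are given by `q`.
      obtain ⟨r, hr⟩ := residue_surjective (q (residueQuotient _ F))
      have hG : q (residueQuotient _ (F - r • F₀)) = 0 := by
        rw [map_sub, map_sub, apply_residueQuotient_smul, hF₀, mul_one, hr, sub_self]
      have h6 := hθ'G _ hG
      rw [map_sub, map_sub, sub_eq_zero, map_smul, Algebra.smul_def, map_mul, hθ'F₀, mul_one] at h6
      rw [h6, ← hr, hσ]
  have hψt : (symGrading (ResidueField V) _)₊.toIdeal.map ψ = ⊤ :=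
    irrelevant_map_eq_top ψ (ι_mem_symGrading (residueQuotient _ F₀)) one_pos (by
      rw [hψ1, hF₀, map_one]; exact isUnit_one)
  refine ⟨_, hnt, η, σ, ψ, hψt, hψ0, hψ1, ?_⟩
  have hθ't : (symGrading V (twistedSections I 2))₊.toIdeal.map θ' = ⊤ := map_comp_eq_top _ hθ
  have h7 := fromOfGlobalSections_comp_map ψ hψt
    (symMapGraded (residueQuotient (residueSpan (singularQuadrics I c))))
    (irrelevant_le_symMap _ (residueQuotient_surjective _)) (by rw [hψθ]; exact hθ't)
  refine Eq.trans ?_ h7.symm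
  rw [← Category.assoc, hη, Category.assoc, hφθ, comp_fromOfGlobalSections _ _ _ hθ't]
  congr 1
  exact hψθ.symm

/-- The exceptional divisor of the blow-up at a regular point is a linear subvariety. -/
theorem IsPointIdeal.isLinearSubvariety [Infinite (ResidueField V)] (hI : IsPointIdeal I p)
    (hφ₀ : IsGivenByForms (twistedSections I 2) (suppCompl I).ι φ₀) {X X' B : Scheme.{u}}
    [IsAffine X'] {i : X ⟶ ProjSpace n V} {f : B ⟶ X} (hf : IsBlowup f (I.comap i))
    {φ : B ⟶ ProjModule V (twistedSections I 2)} (hφ : Extends (f ≫ i) φ₀ φ) (v : X' ⟶ X)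
    [IsOpenImmersion v] (hv : ∀ b ∈ ((I.comap i).comap f).support, f b ∈ v.opensRange)
    {j : Fin (n + 1)} (hj : ⊤ ≤ (v ≫ i) ⁻¹ᵁ (ProjSpace.chart n V j).1)
    (e : Γ(X', ⊤) →+* ResidueField V)
    (hker : RingHom.ker e = chartIdeal I (coordsX (v ≫ i) j hj))
    (he : ∀ r, e (coordsX (v ≫ i) j hj (MvPolynomial.C r)) = residue V r)
    [(chartIdeal I (coordsX (v ≫ i) j hj)).IsMaximal]
    [IsRegularLocalRing (Localization.AtPrime (chartIdeal I (coordsX (v ≫ i) j hj)))]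
    [IsClosedImmersion (((I.comap i).comap f).subschemeι ≫ φ)] :
    IsLinearSubvariety (((I.comap i).comap f).subschemeι ≫ φ) := by
  obtain ⟨z, hz⟩ := hI.exists_factor_linearSubvariety hφ₀ hf.isInvertibleIdeal hφ v hv hj
  set ℓ := linearSubvariety (residueSpan (singularQuadrics I (coordsX (v ≫ i) j hj))) with hℓ
  have : IsClosedImmersion (z ≫ ℓ) := hz ▸ inferInstance
  -- The exceptional divisor is now a closed subscheme of the linear subvariety, so it only remains
  -- to reach all rational points.
  have : IsClosedImmersion z := IsClosedImmersion.of_comp z ℓ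
  have : IsIso z := isIso_of_forall_exists_point z fun q hq => by
    obtain ⟨Y, hY, η, σ, ψ, hψ, h0, h1, h2⟩ := hI.exists_point hφ₀ hf hφ v hj rfl e hker he q hq
    refine ⟨Y, hY, η, σ, ψ, hψ, h0, h1, ?_⟩
    rw [← cancel_mono ℓ, Category.assoc, hz]
    exact h2
  exact ⟨_, asIso z, hz⟩

end PointOverTangent

end

section

open IsLocalRing

/-! ### Finite type, compactness and the Noetherian property of `ℙⁿ` -/

section FiniteType

variable (n : ℕ) (R : Type u) [CommRing R]

lemma algebraMap_grading_zero_surjective :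
    Function.Surjective (algebraMap R (grading n R 0)) := by
  rintro ⟨F, hF⟩
  refine ⟨MvPolynomial.coeff 0 F, Subtype.ext ?_⟩
  exact (MvPolynomial.totalDegree_eq_zero_iff_eq_C.mp
    (MvPolynomial.IsHomogeneous.totalDegree_le hF |> Nat.le_zero.mp)).symm

instance toSpec_locallyOfFiniteType : LocallyOfFiniteType (ProjSpace.toSpec n R) := by
  have : Algebra.FiniteType (grading n R 0) (MvPolynomial (Fin (n + 1)) R) :=
    have : IsScalarTower R (grading n R 0) (MvPolynomial (Fin (n + 1)) R) :=
      ⟨fun r a b => smul_mul_assoc r (a : MvPolynomial (Fin (n + 1)) R) b⟩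
    Algebra.FiniteType.of_restrictScalars_finiteType R _ _
  have : LocallyOfFiniteType
      (Spec.map (CommRingCat.ofHom (algebraMap R (grading n R 0)))) := by
    rw [HasRingHomProperty.Spec_iff (P := @LocallyOfFiniteType)]
    exact RingHom.FiniteType.of_surjective _ (algebraMap_grading_zero_surjective n R)
  rw [ProjSpace.toSpec]
  infer_instance

instance projSpace_compactSpace : CompactSpace (ProjSpace n R) := by
  rw [← isCompact_univ_iff]
  have h1 : (Set.univ : Set (ProjSpace n R)) =
      ⋃ i, ((ProjSpace.chart n R i).1 : Set (ProjSpace n R)) := by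
    rw [← TopologicalSpace.Opens.coe_iSup, iSup_chart]
    rfl
  rw [h1]
  exact isCompact_iUnion fun i => (ProjSpace.chart n R i).2.isCompact

instance projSpace_isLocallyNoetherian [IsNoetherianRing R] :
    IsLocallyNoetherian (ProjSpace n R) := by
  exact LocallyOfFiniteType.isLocallyNoetherian (ProjSpace.toSpec n R)

instance projSpace_isNoetherian [IsNoetherianRing R] : IsNoetherian (ProjSpace n R) where

lemma projSpaceMap_isClosedImmersion {S : Type u} [CommRing S] [Algebra R S]
    (hRS : Function.Surjective (algebraMap R S)) : IsClosedImmersion (ProjSpace.map n R S) := by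
  refine isClosedImmersion_map_of_surjective _ _ fun d G hG => ?_
  obtain ⟨F, hF⟩ := MvPolynomial.map_surjective (σ := Fin (n + 1)) (algebraMap R S) hRS G
  refine ⟨MvPolynomial.homogeneousComponent d F,
    MvPolynomial.homogeneousComponent_isHomogeneous d F, ?_⟩
  change MvPolynomial.map (algebraMap R S) (MvPolynomial.homogeneousComponent d F) = G
  rw [← (MvPolynomial.homogeneousComponent_of_mem hG).trans (if_pos rfl)]
  ext m
  rw [MvPolynomial.coeff_map, MvPolynomial.coeff_homogeneousComponent,
    MvPolynomial.coeff_homogeneousComponent, ← hF, MvPolynomial.coeff_map]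
  split_ifs
  · rfl
  · exact map_zero _

end FiniteType

/-- The ideal sheaf of a point of a monomorphism pulls back to the ideal sheaf of the point. -/
lemma comap_ker_of_mono {S X Z : Scheme.{u}} (κ : S ⟶ X) (g : X ⟶ Z) [Mono g]
    [IsClosedImmersion (κ ≫ g)] : (κ ≫ g).ker.comap g = κ.ker := by
  have hpb : IsPullback κ (𝟙 S) g (κ ≫ g) :=
    ⟨⟨by rw [Category.id_comp]⟩, ⟨PullbackCone.IsLimit.mk _ (fun s => s.snd)
      (fun s => by rw [← cancel_mono g, Category.assoc, s.condition]) (fun s => Category.comp_id _)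
      (fun s m _ h => by rw [← h, Category.comp_id])⟩⟩
  rw [← Scheme.IdealSheafData.ker_fst_of_isClosedImmersion, ← hpb.isoPullback_inv_fst]
  exact Scheme.Hom.ker_comp_of_isIso _ _

/-! ### Closed points of the special fibre are rational -/

section ClosedPoint

variable {V : Type u} [CommRing V] [IsLocalRing V] {n : ℕ}

lemma isClosedImmersion_point
    (P : Spec (.of (ResidueField V)) ⟶ ProjSpace n (ResidueField V))
    (hP : P ≫ ProjSpace.toSpec n (ResidueField V) = 𝟙 _) :
    IsClosedImmersion (P ≫ ProjSpace.map n V (ResidueField V)) := by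
  have := isClosedImmersion_of_comp_eq_id _ _ hP
  have := projSpaceMap_isClosedImmersion n V (S := ResidueField V) residue_surjective
  infer_instance

/-- A closed point of the special fibre is rational. -/
lemma exists_point_of_isClosed [IsAlgClosed (ResidueField V)] {X : Scheme.{u}}
    (s : X ⟶ Spec (.of V)) [LocallyOfFiniteType s] (x : X) (hx : IsClosed ({x} : Set X))
    (hs : s x = closedPoint V) :
    ∃ a : Spec (.of (ResidueField V)) ≅ Spec (X.residueField x),
      a.hom ≫ X.fromSpecResidueField x ≫ s =
        Spec.map (CommRingCat.ofHom (residue V)) := by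
  rw [isClosed_singleton_iff_isClosedImmersion] at hx
  let ψ : CommRingCat.of V ⟶ X.residueField x := Spec.preimage (X.fromSpecResidueField x ≫ s)
  have hψ : Spec.map ψ = X.fromSpecResidueField x ≫ s := Spec.map_preimage _
  -- As `x` lies over the closed point, `V` maps to the residue field of `x` through its own residue
  -- field.
  have hψm : ∀ r ∈ maximalIdeal V, ψ.hom r = 0 := by
    intro r hr
    have h1 : (Spec.map ψ) (closedPoint (X.residueField x)) = closedPoint V := by
      rw [hψ]
      exact (congrArg s (Scheme.fromSpecResidueField_apply x _)).trans hs
    have h2 : r ∈ ((Spec.map ψ) (closedPoint (X.residueField x))).asIdeal := by rw [h1]; exact hr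
    have h3 : ψ.hom r ∈ maximalIdeal (X.residueField x) := h2
    rwa [IsLocalRing.maximalIdeal_eq_bot, Ideal.mem_bot] at h3
  let ψ' : CommRingCat.of (ResidueField V) ⟶ X.residueField x :=
    CommRingCat.ofHom (Ideal.Quotient.lift (maximalIdeal V) ψ.hom hψm)
  have hψ' : CommRingCat.ofHom (residue V) ≫ ψ' = ψ := by
    ext r
    exact Ideal.Quotient.lift_mk (maximalIdeal V) ψ.hom hψm
  have h4 : Spec.map ψ' ≫ Spec.map (CommRingCat.ofHom (residue V)) =
      X.fromSpecResidueField x ≫ s := by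
    rw [← Spec.map_comp, hψ', hψ]
  have : LocallyOfFiniteType (Spec.map ψ') := by
    have : LocallyOfFiniteType (Spec.map ψ' ≫ Spec.map (CommRingCat.ofHom (residue V))) := by
      rw [h4]; infer_instance
    exact locallyOfFiniteType_of_comp _ (Spec.map (CommRingCat.ofHom (residue V)))
  -- Nullstellensatz: an extension field of finite type is finite. Over an algebraically closed
  -- field it is therefore trivial.
  have : IsFinite (Spec.map ψ') := by
    rw [isFinite_iff_locallyOfFiniteType_of_jacobsonSpace]
    infer_instance
  have : IsIso ψ' := by
    rw [ConcreteCategory.isIso_iff_bijective]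
    refine IsAlgClosed.ringHom_bijective_of_isIntegral _ ?_
    rw [← IsIntegralHom.SpecMap_iff]
    infer_instance
  refine ⟨(asIso (Spec.map ψ')).symm, ?_⟩
  rw [← h4]
  exact IsIso.inv_hom_id_assoc _ _

/-- A morphism from the closed point of the base to `ℙⁿ` comes from a rational point. -/
lemma exists_rationalPoint (g : Spec (.of (ResidueField V)) ⟶ ProjSpace n V)
    (hg : g ≫ ProjSpace.toSpec n V = Spec.map (CommRingCat.ofHom (residue V))) :
    ∃ P : Spec (.of (ResidueField V)) ⟶ ProjSpace n (ResidueField V),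
      P ≫ ProjSpace.toSpec n (ResidueField V) = 𝟙 _ ∧
      P ≫ ProjSpace.map n V (ResidueField V) = g := by
  obtain ⟨j, hj⟩ := exists_mem_chart (g (closedPoint (ResidueField V)))
  have hj' : ⊤ ≤ g ⁻¹ᵁ (ProjSpace.chart n V j).1 := fun y _ => by
    rw [Subsingleton.elim y (closedPoint (ResidueField V))]
    exact hj
  let γ : ResidueField V →+* Γ(Spec (.of (ResidueField V)), ⊤) :=
    (Scheme.ΓSpecIso (.of (ResidueField V))).inv.hom
  have hC : ∀ r, coordsX g j hj' (MvPolynomial.C r) = γ (residue V r) := fun r => by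
    rw [coordsX_C, hg]
    exact congr($(Scheme.ΓSpecIso_inv_naturality (CommRingCat.ofHom (residue V))).hom r).symm
  let ψ : MvPolynomial (Fin (n + 1)) (ResidueField V) →+* Γ(Spec (.of (ResidueField V)), ⊤) :=
    MvPolynomial.eval₂Hom γ fun l => coordsX g j hj' (MvPolynomial.X l)
  have hψX : ∀ l, ψ (MvPolynomial.X l) = coordsX g j hj' (MvPolynomial.X l) := fun l =>
    MvPolynomial.eval₂Hom_X' _ _ _
  have hψ : (HomogeneousIdeal.irrelevant (grading n (ResidueField V))).toIdeal.map ψ = ⊤ :=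
    irrelevant_map_eq_top ψ (X_mem_grading j) one_pos (by
      rw [hψX, coordsX_self]; exact isUnit_one)
  have hψg : ψ.comp (coeffMap n V (ResidueField V)).toRingHom = coordsX g j hj' := by
    apply MvPolynomial.ringHom_ext
    · intro r
      refine (congrArg ψ (MvPolynomial.map_C _ r)).trans ?_
      rw [hC]
      exact MvPolynomial.eval₂Hom_C _ _ _
    · intro l
      exact (congrArg ψ (MvPolynomial.map_X _ l)).trans (hψX l)
  refine ⟨Proj.fromOfGlobalSections _ ψ hψ, ?_, ?_⟩
  · have hjP := le_fromOfGlobalSections_preimage_chart ψ hψ j (by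
      rw [hψX, coordsX_self]; exact isUnit_one)
    rw [toSpec_eq _ j hjP, coordsX_fromOfGlobalSections_of_eq_one ψ hψ j
      (by rw [hψX, coordsX_self]) hjP]
    have h1 : CommRingCat.ofHom (ψ.comp MvPolynomial.C) =
        (Scheme.ΓSpecIso (.of (ResidueField V))).inv := by
      ext r
      exact MvPolynomial.eval₂Hom_C _ _ _
    rw [h1]
    exact toSpecΓ_SpecMap_ΓSpecIso_inv _
  · have hψg' := irrelevant_map_coordsX g j hj'
    rw [← hψg] at hψg'
    refine (fromOfGlobalSections_comp_map ψ hψ _ (irrelevant_le_coeffMap n V _) hψg').trans ?_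
    refine Eq.trans ?_ (eq_fromOfGlobalSections_coordsX g j hj').symm
    congr 1

end ClosedPoint

end

section

open IsLocalRing

/-! ### Linearity of the exceptional divisor at a regular rational point -/

lemma isLocalization_stalk_of_maximal {X : Scheme.{u}} [IsAffine X] (x : X) (J : Ideal Γ(X, ⊤))
    [hJ : J.IsMaximal] (h : ∀ f ∈ J, x ∉ X.basicOpen f) :
    @IsLocalization.AtPrime Γ(X, ⊤) _ (X.presheaf.stalk x) _
      (X.presheaf.germ ⊤ x trivial).hom.toAlgebra J _ := by
  let : Algebra Γ(X, ⊤) (X.presheaf.stalk x) := (X.presheaf.germ ⊤ x trivial).hom.toAlgebra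
  let hU := isAffineOpen_top X
  have h1 := hU.isLocalization_stalk ⟨x, trivial⟩
  have h2 : J = (hU.primeIdealOf ⟨x, trivial⟩).asIdeal := by
    refine hJ.eq_of_le (hU.primeIdealOf ⟨x, trivial⟩).isPrime.ne_top fun f hf => ?_
    by_contra h3
    have h4 := IsLocalization.map_units (X.presheaf.stalk x)
      (⟨f, h3⟩ : (hU.primeIdealOf ⟨x, trivial⟩).asIdeal.primeCompl)
    exact h f hf ((X.mem_basicOpen f x trivial).mpr h4)
  have h3 : ∀ (J' : Ideal Γ(X, ⊤)) [J'.IsPrime], J = J' →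
      IsLocalization.AtPrime (X.presheaf.stalk x) J' → IsLocalization.AtPrime (X.presheaf.stalk x) J := by
    intro J' _ e h
    subst e
    exact h
  exact h3 _ h2 h1

lemma coordsX_comp_map {n : ℕ} {R S : Type u} [CommRing R] [CommRing S] [Algebra R S]
    {Y : Scheme.{u}} (g : Y ⟶ ProjSpace n S) (i : Fin (n + 1))
    (h : ⊤ ≤ g ⁻¹ᵁ (ProjSpace.chart n S i).1)
    (h' : ⊤ ≤ (g ≫ ProjSpace.map n R S) ⁻¹ᵁ (ProjSpace.chart n R i).1) :
    coordsX (g ≫ ProjSpace.map n R S) i h' =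
      (coordsX g i h).comp (MvPolynomial.map (algebraMap R S)) := by
  have h1 : ((coordsX g i h).comp (coeffMap n R S).toRingHom) (MvPolynomial.X i) = 1 :=
    (congrArg (coordsX g i h) (MvPolynomial.map_X _ i)).trans (coordsX_self g i h)
  have h2 : (HomogeneousIdeal.irrelevant (grading n R)).toIdeal.map
      ((coordsX g i h).comp (coeffMap n R S).toRingHom) = ⊤ :=
    irrelevant_map_eq_top _ (X_mem_grading i) one_pos (by rw [h1]; exact isUnit_one)
  have h3 : g ≫ ProjSpace.map n R S = Proj.fromOfGlobalSections _ _ h2 :=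
    (congrArg (· ≫ ProjSpace.map n R S) (eq_fromOfGlobalSections_coordsX g i h)).trans
      (fromOfGlobalSections_comp_map _ _ _ (irrelevant_le_coeffMap n R S) h2)
  have h4 : ⊤ ≤ (Proj.fromOfGlobalSections _ _ h2) ⁻¹ᵁ (ProjSpace.chart n R i).1 := by
    rw [← h3]; exact h'
  exact (coords_congr h3 (X_mem_grading i) h' h4).trans
    (coordsX_fromOfGlobalSections_of_eq_one _ h2 i h1 h4)

section Pointed

/-- A rational point of the special fibre lies over the closed point. -/
lemma point_comp_toSpec {V : Type u} [CommRing V] [IsLocalRing V] {n : ℕ}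
    (P : Spec (.of (ResidueField V)) ⟶ ProjSpace n (ResidueField V))
    (hP : P ≫ ProjSpace.toSpec n (ResidueField V) = 𝟙 _) :
    (P ≫ ProjSpace.map n V (ResidueField V)) ≫ ProjSpace.toSpec n V =
      Spec.map (CommRingCat.ofHom (residue V)) := by
  obtain ⟨j, hj⟩ := exists_mem_chart (P (closedPoint (ResidueField V)))
  have h : ⊤ ≤ P ⁻¹ᵁ (ProjSpace.chart n (ResidueField V) j).1 := fun y _ => by
    rw [Subsingleton.elim y (closedPoint (ResidueField V))]
    exact hj
  have h' : ⊤ ≤ (P ≫ ProjSpace.map n V (ResidueField V)) ⁻¹ᵁ (ProjSpace.chart n V j).1 := by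
    rw [← map_preimage_chart V] at h
    exact h
  have h1 : CommRingCat.ofHom ((coordsX (P ≫ ProjSpace.map n V (ResidueField V)) j h').comp
      MvPolynomial.C) = CommRingCat.ofHom (residue V) ≫
        CommRingCat.ofHom ((coordsX P j h).comp MvPolynomial.C) := by
    ext r
    have h2 := congr($(coordsX_comp_map P j h h') (MvPolynomial.C r))
    exact h2.trans (congrArg (coordsX P j h) (MvPolynomial.map_C _ r))
  rw [toSpec_eq _ j h', h1, Spec.map_comp, ← Category.assoc, ← toSpec_eq P j h, hP,
    Category.id_comp]

variable {V : Type u} [CommRing V] [IsLocalRing V] {n : ℕ}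
  {p : Fin (n + 1) → V}
  {P : Spec (.of (ResidueField V)) ⟶ ProjSpace n (ResidueField V)}

/-- The exceptional divisor of the blow-up at a regular rational point is mapped onto a linear
subvariety. -/
theorem IsPointIdeal.isLinearSubvariety_of_isRegularLocalRing [Infinite (ResidueField V)]
    (hP : P ≫ ProjSpace.toSpec n (ResidueField V) = 𝟙 _)
    (hI : IsPointIdeal (idealOfPoint P) p)
    {φ₀ : (suppCompl (idealOfPoint P)).toScheme ⟶ ProjModule V (quadrics P)}
    (hφ₀ : IsGivenByForms (quadrics P) (suppCompl (idealOfPoint P)).ι φ₀)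
    {X B : Scheme.{u}} {i : X ⟶ ProjSpace n V} [Mono i]
    (κ : Spec (.of (ResidueField V)) ⟶ X) (hκ : κ ≫ i = P ≫ ProjSpace.map n V (ResidueField V))
    [IsRegularLocalRing (X.presheaf.stalk (κ (closedPoint (ResidueField V))))]
    {f : B ⟶ X} (hf : IsBlowup f ((idealOfPoint P).comap i))
    {φ : B ⟶ ProjModule V (quadrics P)} (hφ : Extends (f ≫ i) φ₀ φ)
    [IsClosedImmersion ((((idealOfPoint P).comap i).comap f).subschemeι ≫ φ)] :
    IsLinearSubvariety ((((idealOfPoint P).comap i).comap f).subschemeι ≫ φ) := by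
  have hcl := isClosedImmersion_point P hP
  have hκi : IsClosedImmersion (κ ≫ i) := by rw [hκ]; exact hcl
  have hκc : IsClosedImmersion κ := IsClosedImmersion.of_comp κ i
  obtain ⟨j, hj⟩ := exists_mem_chart (i (κ (closedPoint (ResidueField V))))
  obtain ⟨W, hxW, hWj⟩ := exists_affine_nhd
    (O := i ⁻¹ᵁ (ProjSpace.chart n V j).1) (y := κ (closedPoint (ResidueField V))) hj
  have hrange : ∀ y, κ y = κ (closedPoint (ResidueField V)) := fun y =>
    congrArg κ (Subsingleton.elim y _)
  have : IsAffine W.1.toScheme := W.2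
  have hj' : ⊤ ≤ (W.1.ι ≫ i) ⁻¹ᵁ (ProjSpace.chart n V j).1 := by
    intro y _
    exact hWj y.2
  let κ' : Spec (.of (ResidueField V)) ⟶ W.1.toScheme := IsOpenImmersion.lift W.1.ι κ (by
    rintro _ ⟨y, rfl⟩
    rw [hrange y, Scheme.Opens.range_ι]
    exact hxW)
  have hκ' : κ' ≫ W.1.ι = κ := IsOpenImmersion.lift_fac _ _ _
  have hκ'i : κ' ≫ W.1.ι ≫ i = P ≫ ProjSpace.map n V (ResidueField V) := by
    rw [← Category.assoc, hκ', hκ]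
  let e : Γ(W.1.toScheme, ⊤) →+* ResidueField V :=
    (Scheme.ΓSpecIso (.of (ResidueField V))).hom.hom.comp κ'.appTop.hom
  have hker0 : RingHom.ker e = RingHom.ker κ'.appTop.hom := by
    ext y
    simp only [RingHom.mem_ker, e, RingHom.comp_apply]
    exact map_eq_zero_iff _
      (ConcreteCategory.bijective_of_isIso (Scheme.ΓSpecIso (.of (ResidueField V))).hom).1
  have hcomap : (idealOfPoint P).comap (W.1.ι ≫ i) = κ'.ker := by
    have : IsClosedImmersion (κ' ≫ W.1.ι ≫ i) := by rw [hκ'i]; exact hcl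
    rw [← comap_ker_of_mono κ' (W.1.ι ≫ i)]
    congr 1
    rw [hκ'i, idealOfPoint]
  -- The composite of the point with the monomorphism to `ℙⁿ` is `P`, so the ideal of `P` restricts
  -- on `W` to the ideal of functions killed by evaluation at the point.
  have hker : RingHom.ker e = chartIdeal (idealOfPoint P) (coordsX (W.1.ι ≫ i) j hj') := by
    rw [hker0]
    refine Eq.trans ?_ (hI.comap_ideal_top (W.1.ι ≫ i) j hj')
    rw [hcomap]
    exact (Scheme.Hom.ker_apply κ' ⟨⊤, isAffineOpen_top _⟩).symm
  have hC : ∀ r, e (coordsX (W.1.ι ≫ i) j hj' (MvPolynomial.C r)) = residue V r := by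
    intro r
    have h1 : κ'.appTop.hom (coordsX (W.1.ι ≫ i) j hj' (MvPolynomial.C r)) =
        (κ' ≫ (W.1.ι ≫ i) ≫ ProjSpace.toSpec n V).appTop.hom
          ((Scheme.ΓSpecIso (.of V)).inv.hom r) := by
      rw [coordsX_C, Scheme.Hom.comp_appTop κ']
      rfl
    have h2 : κ' ≫ (W.1.ι ≫ i) ≫ ProjSpace.toSpec n V =
        Spec.map (CommRingCat.ofHom (residue V)) := by
      rw [← Category.assoc, hκ'i, point_comp_toSpec P hP]
    change (Scheme.ΓSpecIso (.of (ResidueField V))).hom.hom (κ'.appTop.hom _) = _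
    rw [h1, h2]
    have h3 := Scheme.ΓSpecIso_inv_naturality (CommRingCat.ofHom (residue V))
    have h4 := congr((Scheme.ΓSpecIso (.of (ResidueField V))).hom.hom ($(h3).hom r))
    refine Eq.trans h4.symm ?_
    exact congr($((Scheme.ΓSpecIso (.of (ResidueField V))).inv_hom_id).hom _)
  have hsurj : Function.Surjective e := fun y => by
    obtain ⟨r, rfl⟩ := residue_surjective y
    exact ⟨_, hC r⟩
  have hmax : (chartIdeal (idealOfPoint P) (coordsX (W.1.ι ≫ i) j hj')).IsMaximal := by
    rw [← hker]
    exact RingHom.ker_isMaximal_of_surjective e hsurj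
  let x' : W.1.toScheme := κ' (closedPoint (ResidueField V))
  have hloc := isLocalization_stalk_of_maximal x'
    (chartIdeal (idealOfPoint P) (coordsX (W.1.ι ≫ i) j hj')) fun s hs hx => by
      have h0 : κ'.appTop.hom s = 0 := by
        rw [← hker, hker0] at hs
        exact hs
      have h1 : closedPoint (ResidueField V) ∈ κ' ⁻¹ᵁ W.1.toScheme.basicOpen s := hx
      rw [Scheme.preimage_basicOpen] at h1
      have h2 : (κ'.app ⊤).hom s = 0 := h0
      rw [h2, Scheme.basicOpen_zero] at h1
      exact h1
  -- The localization at the chart ideal is the stalk of `W` at the point, which is the stalk of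
  -- `X`.
  have hreg : IsRegularLocalRing
      (Localization.AtPrime (chartIdeal (idealOfPoint P) (coordsX (W.1.ι ≫ i) j hj'))) := by
    let : Algebra Γ(W.1.toScheme, ⊤) (W.1.toScheme.presheaf.stalk x') :=
      (W.1.toScheme.presheaf.germ ⊤ x' trivial).hom.toAlgebra
    have hx' : W.1.ι x' = κ (closedPoint (ResidueField V)) := by
      rw [← hκ']; rfl
    have : IsRegularLocalRing (X.presheaf.stalk (W.1.ι x')) := by
      rw [hx']; infer_instance
    have e1 : X.presheaf.stalk (W.1.ι x') ≃+* W.1.toScheme.presheaf.stalk x' :=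
      (asIso (W.1.ι.stalkMap x')).commRingCatIsoToRingEquiv
    have e2 := (IsLocalization.algEquiv
      (chartIdeal (idealOfPoint P) (coordsX (W.1.ι ≫ i) j hj')).primeCompl
      (W.1.toScheme.presheaf.stalk x') (Localization.AtPrime (chartIdeal (idealOfPoint P) (coordsX (W.1.ι ≫ i) j hj')))).toRingEquiv
    exact IsRegularLocalRing.of_ringEquiv (e1.trans e2)
  -- The exceptional divisor lies over the centre, which is the single closed point contained in
  -- `W`.
  have hv : ∀ b ∈ (((idealOfPoint P).comap i).comap f).support, f b ∈ W.1.ι.opensRange := by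
    intro b hb
    rw [Scheme.IdealSheafData.support_comap] at hb
    have h1 : f b ∈ ((idealOfPoint P).comap i).support := hb
    have h2 : (idealOfPoint P).comap i = κ.ker := by
      rw [← comap_ker_of_mono κ i]
      congr 1
      rw [hκ, idealOfPoint]
    rw [h2] at h1
    have h3 : f b ∈ (κ.ker.support : Set X) := h1
    rw [Scheme.Hom.support_ker, κ.isClosedEmbedding.isClosed_range.closure_eq] at h3
    obtain ⟨y, hy⟩ := h3
    rw [← hy, hrange y, Scheme.Opens.opensRange_ι]
    exact hxW
  exact hI.isLinearSubvariety hφ₀ hf hφ W.1.ι hv hj' e hker hC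

end Pointed

end

section

open IsLocalRing

/-! ### Existence of the blow-ups and their immersions into `ℙ(M)` -/

lemma isSeparated_of_isSeparated {X Y : Scheme.{u}} (f : X ⟶ Y) [IsSeparated f] [Y.IsSeparated] :
    X.IsSeparated := by
  rw [Scheme.isSeparated_iff, ← terminal.comp_from f]
  infer_instance

/-- If `B` and `B'` are blow-ups along the same ideal, then they are isomorphic. -/
lemma IsBlowup.exists_iso {X B B' : Scheme.{u}} {I : X.IdealSheafData} {f : B ⟶ X} {f' : B' ⟶ X}
    (hf : IsBlowup f I) (hf' : IsBlowup f' I) : ∃ e : B ≅ B', e.hom ≫ f' = f := by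
  obtain ⟨a, ha, -⟩ := hf'.existsUnique_lift f hf.isInvertibleIdeal
  obtain ⟨b, hb, -⟩ := hf.existsUnique_lift f' hf'.isInvertibleIdeal
  refine ⟨⟨a, b, ?_, ?_⟩, ha⟩
  · refine (hf.existsUnique_lift f hf.isInvertibleIdeal).unique ?_ (Category.id_comp f)
    rw [Category.assoc, hb, ha]
  · refine (hf'.existsUnique_lift f' hf'.isInvertibleIdeal).unique ?_ (Category.id_comp f')
    rw [Category.assoc, ha, hb]

/-- Let `i : X ⟶ Y` be a monomorphism and `κ` a closed immersion onto the centre of the blow-up.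
If `t : B ⟶ X ×_Y B₀` is a closed immersion, then the exceptional divisor of `B` is
closed in `B₀`. -/
lemma isClosedImmersion_exceptional {S X Y B B₀ : Scheme.{u}} {i : X ⟶ Y} {f₀ : B₀ ⟶ Y}
    (κ : S ⟶ X) [IsClosedImmersion κ] [IsClosedImmersion (κ ≫ i)] (t : B ⟶ pullback i f₀)
    [IsClosedImmersion t] {E : Scheme.{u}} (ε : E ⟶ B) [IsClosedImmersion ε] (k : E ⟶ S)
    (hk : k ≫ κ = ε ≫ t ≫ pullback.fst i f₀) :
    IsClosedImmersion (ε ≫ t ≫ pullback.snd i f₀) := by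
  obtain ⟨w, hw₁, hw₂⟩ : ∃ w : E ⟶ pullback (κ ≫ i) f₀, w ≫ pullback.fst _ _ = k ∧
      w ≫ pullback.snd _ _ = ε ≫ t ≫ pullback.snd i f₀ :=
    ⟨pullback.lift k (ε ≫ t ≫ pullback.snd i f₀) (by
      rw [← Category.assoc, hk]
      simp only [Category.assoc, pullback.condition]),
      pullback.lift_fst _ _ _, pullback.lift_snd _ _ _⟩
  obtain ⟨m, hm₁, hm₂⟩ : ∃ m : pullback (κ ≫ i) f₀ ⟶ pullback i f₀,
      m ≫ pullback.fst _ _ = pullback.fst _ _ ≫ κ ∧ m ≫ pullback.snd _ _ = pullback.snd _ _ :=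
    ⟨pullback.lift (pullback.fst _ _ ≫ κ) (pullback.snd _ _) (by
      rw [Category.assoc, pullback.condition]),
      pullback.lift_fst _ _ _, pullback.lift_snd _ _ _⟩
  have hm : Mono m := by
    refine ⟨fun a b h => pullback.hom_ext ?_ ?_⟩
    · rw [← cancel_mono κ, Category.assoc, Category.assoc, ← hm₁, ← Category.assoc, h,
        Category.assoc]
    · rw [← hm₂, ← Category.assoc, h, Category.assoc]
  have hwm : w ≫ m = ε ≫ t := by
    apply pullback.hom_ext
    · rw [Category.assoc, hm₁, ← Category.assoc, hw₁, hk, Category.assoc]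
    · rw [Category.assoc, hm₂, hw₂, Category.assoc]
  -- `E` factors by `w` through the fibre of `B₀` over the centre. As `w ≫ m` is a closed immersion
  -- and `m` a monomorphism, `w` is a closed immersion; and that fibre is closed in `B₀`.
  have : IsClosedImmersion (w ≫ m) := by
    rw [hwm]; infer_instance
  have : IsClosedImmersion w := IsClosedImmersion.of_comp w m
  rw [← hw₂]
  infer_instance

lemma noetherianSpace_of_isImmersion {n : ℕ} {R : Type u} [CommRing R] [IsNoetherianRing R]
    {X : Scheme.{u}} (i : X ⟶ ProjSpace n R) [IsImmersion i] : TopologicalSpace.NoetherianSpace X :=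
  i.isEmbedding.isInducing.noetherianSpace

section Blowup

variable {V : Type u} [CommRing V] [IsLocalRing V] {n : ℕ} {p : Fin (n + 1) → V}
  {P : Spec (.of (ResidueField V)) ⟶ ProjSpace n (ResidueField V)}

/-- The blow-up of `ℙⁿ` at a point of the special fibre, as a closed subscheme of `ℙ(M)`. -/
theorem IsPointIdeal.exists_isBlowup_isClosedImmersion [IsNoetherianRing V]
    {I : (ProjSpace n V).IdealSheafData} (hI : IsPointIdeal I p)
    {φ₀ : (suppCompl I).toScheme ⟶ ProjModule V (twistedSections I 2)}
    (hφ₀ : IsGivenByForms (twistedSections I 2) (suppCompl I).ι φ₀) :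
    ∃ (B : Scheme.{u}) (f : B ⟶ ProjSpace n V) (φ : B ⟶ ProjModule V (twistedSections I 2)),
      IsBlowup f I ∧ Extends f φ₀ φ ∧ IsQuadricModel hI f φ ∧ IsClosedImmersion φ := by
  have : TopologicalSpace.NoetherianSpace (suppCompl I).toScheme :=
    (suppCompl I).ι.isOpenEmbedding.isInducing.noetherianSpace
  obtain ⟨f, h1, h2, h3⟩ := hI.exists_isBlowup_image hφ₀
  exact ⟨_, f, _, h1, h2, h3, inferInstance⟩

/-- The blow-up of a subscheme of `ℙⁿ` at a point exists. -/
theorem IsPointIdeal.exists_isBlowup_comap [IsNoetherianRing V]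
    {I : (ProjSpace n V).IdealSheafData} (hI : IsPointIdeal I p)
    {φ₀ : (suppCompl I).toScheme ⟶ ProjModule V (twistedSections I 2)}
    (hφ₀ : IsGivenByForms (twistedSections I 2) (suppCompl I).ι φ₀) {X : Scheme.{u}}
    (i : X ⟶ ProjSpace n V) [IsImmersion i] :
    ∃ (B₀ : Scheme.{u}) (f₀ : B₀ ⟶ ProjSpace n V)
      (ψ : B₀ ⟶ ProjModule V (twistedSections I 2)), IsBlowup f₀ I ∧ Extends f₀ φ₀ ψ ∧
        IsQuadricModel hI f₀ ψ ∧ IsClosedImmersion ψ ∧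
      ∃ (B : Scheme.{u}) (t : B ⟶ pullback i f₀), IsClosedImmersion t ∧
        IsBlowup (t ≫ pullback.fst i f₀) (I.comap i) := by
  obtain ⟨B₀, f₀, ψ, h1, h2, h3, h4⟩ := hI.exists_isBlowup_isClosedImmersion hφ₀
  have := isSeparated_of_isSeparated i
  have := isSeparated_of_isSeparated ψ
  have := noetherianSpace_of_isImmersion i
  have : TopologicalSpace.NoetherianSpace (suppCompl (I.comap i)).toScheme :=
    (suppCompl (I.comap i)).ι.isOpenEmbedding.isInducing.noetherianSpace
  exact ⟨B₀, f₀, ψ, h1, h2, h3, h4, exists_strictTransform I f₀ h1 i⟩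

/-- The immersion of the blow-up of a subscheme of `ℙⁿ` at a point into `ℙ(M)`. -/
theorem IsPointIdeal.exists_immersion [IsNoetherianRing V]
    (hP : P ≫ ProjSpace.toSpec n (ResidueField V) = 𝟙 _)
    (hI : IsPointIdeal (idealOfPoint P) p)
    {φ₀ : (suppCompl (idealOfPoint P)).toScheme ⟶ ProjModule V (quadrics P)}
    (hφ₀ : IsGivenByForms (quadrics P) (suppCompl (idealOfPoint P)).ι φ₀) {X : Scheme.{u}}
    (i : X ⟶ ProjSpace n V) [IsImmersion i]
    (κ : Spec (.of (ResidueField V)) ⟶ X) (hκ : κ ≫ i = P ≫ ProjSpace.map n V (ResidueField V))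
    {B : Scheme.{u}} (f : B ⟶ X) (hf : IsBlowup f ((idealOfPoint P).comap i)) :
    ∃ φ : B ⟶ ProjModule V (quadrics P), IsImmersion φ ∧
      (IsClosedImmersion i → IsClosedImmersion φ) ∧ Extends (f ≫ i) φ₀ φ ∧
      IsQuadricModel hI (f ≫ i) φ ∧
      IsClosedImmersion ((((idealOfPoint P).comap i).comap f).subschemeι ≫ φ) := by
  obtain ⟨B₀, f₀, ψ, h1, h2, h3, h4, B', t, ht, ht'⟩ := hI.exists_isBlowup_comap hφ₀ i
  obtain ⟨e, he⟩ := hf.exists_iso ht'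
  have hcl := isClosedImmersion_point P hP
  have hκi : IsClosedImmersion (κ ≫ i) := by rw [hκ]; exact hcl
  have hκc : IsClosedImmersion κ := IsClosedImmersion.of_comp κ i
  have hf₀ : ((e.hom ≫ t) ≫ pullback.snd i f₀) ≫ f₀ = f ≫ i := by
    rw [← he]
    simp only [Category.assoc, pullback.condition]
  have hker : (idealOfPoint P).comap i = κ.ker := by
    rw [← comap_ker_of_mono κ i]
    congr 1
    rw [hκ, idealOfPoint]
  -- A closed immersion into the fibre product, a base change of `i`, and the closed immersion of
  -- the blow-up of `ℙⁿ`; the middle factor determines whether the composite is closed.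
  refine ⟨((e.hom ≫ t) ≫ pullback.snd i f₀) ≫ ψ, inferInstance, fun _ => inferInstance,
    h2.comp _ hf₀, ?_, ?_⟩
  · rw [← hf₀]
    exact h3.comp _
  -- Even when `i` is not closed, the exceptional divisor is closed in `ℙ(M)`, because its centre is
  -- a closed point of `ℙⁿ`.
  · obtain ⟨k, hk⟩ := exists_lift_of_comap_ker_eq_bot κ
      ((((idealOfPoint P).comap i).comap f).subschemeι ≫ f) (by
        rw [← hker, Scheme.IdealSheafData.comap_comp]
        have := comap_ker_comp_eq_bot (𝟙 _) ((((idealOfPoint P).comap i).comap f).subschemeι)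
        rwa [Scheme.IdealSheafData.ker_subschemeι, Category.id_comp] at this)
    have := isClosedImmersion_exceptional κ (e.hom ≫ t)
      ((((idealOfPoint P).comap i).comap f).subschemeι) k (by
        rw [hk, Category.assoc, he])
    rw [← Category.assoc]
    exact inferInstanceAs (IsClosedImmersion (_ ≫ ψ))

end Blowup

end

section

open IsLocalRing

/-! ### Regularity of projective space over a regular ring -/

section Regular

variable (n : ℕ) (R : Type u) [CommRing R]

/-- The coordinate ring of `D₊(x_j)` is a polynomial ring in `n` variables. -/
lemma exists_chart_ringEquiv (j : Fin (n + 1)) :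
    Nonempty (MvPolynomial {l : Fin (n + 1) // l ≠ j} R ≃+*
      Γ(ProjSpace n R, (ProjSpace.chart n R j).1)) := by
  let α := (ProjSpace.dehom n R j).comp
    (MvPolynomial.rename (R := R) (Subtype.val : {l : Fin (n + 1) // l ≠ j} → _)).toRingHom
  let ψ : MvPolynomial (Fin (n + 1)) R →+* MvPolynomial {l : Fin (n + 1) // l ≠ j} R :=
    MvPolynomial.eval₂Hom MvPolynomial.C
      fun l => if h : l ≠ j then MvPolynomial.X ⟨l, h⟩ else 1
  have hψj : ψ (MvPolynomial.X j) = 1 := by simp [ψ]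
  have hψ : ∀ l (h : l ≠ j), ψ (MvPolynomial.X l) = MvPolynomial.X ⟨l, h⟩ := fun l h => by
    simp [ψ, h]
  have hu : IsUnit (ψ (MvPolynomial.X j)) := by rw [hψj]; exact isUnit_one
  let β : Γ(ProjSpace n R, (ProjSpace.chart n R j).1) →+*
      MvPolynomial {l : Fin (n + 1) // l ≠ j} R :=
    (awayLift (𝒜 := grading n R) ψ (MvPolynomial.X j) hu).comp
      (Proj.basicOpenIsoAway (grading n R) _ (X_mem_grading j) one_pos).inv.hom
  have hβ : ∀ {d : ℕ} {F : MvPolynomial (Fin (n + 1)) R}, F ∈ grading n R d →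
      β (ProjSpace.dehom n R j F) = ψ F := by
    intro d F hF
    have h1 : ProjSpace.dehom n R j F =
        (Proj.basicOpenIsoAway (grading n R) _ (X_mem_grading j) one_pos).hom.hom
          (HomogeneousLocalization.Away.mk (grading n R) (X_mem_grading j) d F
            (by simpa using hF)) := by
      rw [dehom_eq]
      exact congrArg (Proj.awayToSection (grading n R) (MvPolynomial.X j)).hom
        (dehomogenize_of_mem (X_mem_grading j) hF)
    have h2 := congr($((Proj.basicOpenIsoAway (grading n R) _ (X_mem_grading j)
      one_pos).hom_inv_id).hom (HomogeneousLocalization.Away.mk (grading n R) (X_mem_grading j) d F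
            (by simpa using hF)))
    rw [h1]
    exact (congrArg (awayLift (𝒜 := grading n R) ψ (MvPolynomial.X j) hu) h2).trans
      (awayLift_mk_of_eq_one (𝒜 := grading n R) ψ hu hψj (X_mem_grading j) d F (by simpa using hF))
  have hβα : β.comp α = RingHom.id _ := by
    refine MvPolynomial.ringHom_ext (fun r => ?_) fun l => ?_
    · refine (congrArg (fun z => β (ProjSpace.dehom n R j z)) (MvPolynomial.rename_C _ r)).trans ?_
      refine (hβ (C_mem_grading r)).trans ?_
      exact MvPolynomial.eval₂Hom_C _ _ _
    · refine (congrArg (fun z => β (ProjSpace.dehom n R j z)) (MvPolynomial.rename_X _ l)).trans ?_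
      refine (hβ (X_mem_grading _)).trans ?_
      exact hψ l.1 l.2
  have hαψ : α.comp ψ = ProjSpace.dehom n R j := by
    refine MvPolynomial.ringHom_ext (fun r => ?_) fun l => ?_
    · refine (congrArg α (MvPolynomial.eval₂Hom_C _ _ r)).trans ?_
      exact congrArg (ProjSpace.dehom n R j) (MvPolynomial.rename_C _ r)
    · by_cases h : l = j
      · subst h
        rw [RingHom.comp_apply, hψj, map_one, dehom_X_self]
      · rw [RingHom.comp_apply, hψ l h]
        exact congrArg (ProjSpace.dehom n R j) (MvPolynomial.rename_X _ _)
  refine ⟨RingEquiv.ofBijective α ⟨?_, ?_⟩⟩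
  · exact Function.LeftInverse.injective (g := β) fun x => congr($hβα x)
  · intro y
    obtain ⟨F, rfl⟩ := dehom_surjective j y
    exact ⟨ψ F, congr($hαψ F)⟩

/-- The stalk is a localization of a polynomial ring over `R` at a prime, and both operations
preserve regularity. -/
instance isRegularLocalRing_stalk_projSpace [IsRegularRing R] (x : ProjSpace n R) :
    IsRegularLocalRing ((ProjSpace n R).presheaf.stalk x) := by
  obtain ⟨j, hj⟩ := exists_mem_chart x
  obtain ⟨e⟩ := exists_chart_ringEquiv n R j
  have : IsRegularRing Γ(ProjSpace n R, (ProjSpace.chart n R j).1) := IsRegularRing.of_ringEquiv e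
  let hU := (ProjSpace.chart n R j).2
  let : Algebra Γ(ProjSpace n R, (ProjSpace.chart n R j).1) ((ProjSpace n R).presheaf.stalk x) :=
    ((ProjSpace n R).presheaf.germ _ x hj).hom.toAlgebra
  have h1 : IsLocalization (hU.primeIdealOf ⟨x, hj⟩).asIdeal.primeCompl
    ((ProjSpace n R).presheaf.stalk x) := hU.isLocalization_stalk ⟨x, hj⟩
  exact IsRegularLocalRing.of_ringEquiv (IsLocalization.algEquiv
    (hU.primeIdealOf ⟨x, hj⟩).asIdeal.primeCompl
    (Localization.AtPrime (hU.primeIdealOf ⟨x, hj⟩).asIdeal)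
    ((ProjSpace n R).presheaf.stalk x)).toRingEquiv

end Regular

end

section

open IsLocalRing

/-! ### The special hyperplane and the special fibre -/

lemma coords_comp_projModuleMap {R S : Type u} [CommRing R] [CommRing S] [Algebra R S]
    {M N : Type u} [AddCommGroup M] [Module R M] [AddCommGroup N] [Module R N] [Module S N]
    [IsScalarTower R S N] (q : M →ₗ[R] N) (hq : Function.Surjective q) {Y : Scheme.{u}}
    (g : Y ⟶ ProjModule S N) (m : M)
    (h : ⊤ ≤ (g ≫ ProjModule.map S q hq) ⁻¹ᵁ Proj.basicOpen _ (SymmetricAlgebra.ι R M m)) :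
    ∃ h' : ⊤ ≤ g ⁻¹ᵁ Proj.basicOpen _ (SymmetricAlgebra.ι S N (q m)),
      coords (g ≫ ProjModule.map S q hq) (ι_mem_symGrading m) h =
        (coords g (ι_mem_symGrading (q m)) h').comp (symMap q) := by
  have h' : ⊤ ≤ g ⁻¹ᵁ Proj.basicOpen _ (SymmetricAlgebra.ι S N (q m)) := by
    rw [← symMap_ι q m]
    exact h
  refine ⟨h', ?_⟩
  have h1 : ((coords g (ι_mem_symGrading (q m)) h').comp (symMapGraded (S := S) q).toRingHom)
      (SymmetricAlgebra.ι R M m) = 1 :=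
    (congrArg (coords g (ι_mem_symGrading (q m)) h') (symMap_ι q m)).trans (coords_self _ _ _)
  have h2 : (HomogeneousIdeal.irrelevant (symGrading R M)).toIdeal.map
      ((coords g (ι_mem_symGrading (q m)) h').comp (symMapGraded (S := S) q).toRingHom) = ⊤ :=
    irrelevant_map_eq_top _ (ι_mem_symGrading m) one_pos (by rw [h1]; exact isUnit_one)
  have h3 : g ≫ ProjModule.map S q hq = Proj.fromOfGlobalSections _ _ h2 :=
    (congrArg (· ≫ ProjModule.map S q hq) (eq_fromOfGlobalSections_coords g _ h')).trans
      (fromOfGlobalSections_comp_map _ _ _ (irrelevant_le_symMap q hq) h2)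
  have h4 : ⊤ ≤ (Proj.fromOfGlobalSections _ _ h2) ⁻¹ᵁ
      Proj.basicOpen _ (SymmetricAlgebra.ι R M m) := by
    rw [← h3]; exact h
  exact (coords_congr h3 (ι_mem_symGrading m) h h4).trans
    (coords_fromOfGlobalSections_of_eq_one _ h2 (ι_mem_symGrading m) h1 h4)

lemma fromOfGlobalSections_congr {R A : Type u} [CommRing R] [CommRing A] [Algebra R A]
    {𝒜 : ℕ → Submodule R A} [GradedAlgebra 𝒜] {Y : Scheme.{u}} {ψ ψ' : A →+* Γ(Y, ⊤)}
    (h : ψ = ψ') (hψ : (HomogeneousIdeal.irrelevant 𝒜).toIdeal.map ψ = ⊤)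
    (hψ' : (HomogeneousIdeal.irrelevant 𝒜).toIdeal.map ψ' = ⊤) :
    Proj.fromOfGlobalSections 𝒜 ψ hψ = Proj.fromOfGlobalSections 𝒜 ψ' hψ' := by
  subst h
  rfl

lemma X_mem_irrelevant {n : ℕ} {R : Type u} [CommRing R] (l : Fin (n + 1)) :
    MvPolynomial.X l ∈ (HomogeneousIdeal.irrelevant (grading n R)).toIdeal :=
  HomogeneousIdeal.mem_irrelevant_of_mem _ one_pos (X_mem_grading l)

lemma eval₂Hom_mem_symGrading {n : ℕ} {V M : Type u} [CommRing V] [AddCommGroup M] [Module V M] (m : Fin (n + 1) → M)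
    {d : ℕ} {F : MvPolynomial (Fin (n + 1)) V} (hF : F.IsHomogeneous d) :
    MvPolynomial.eval₂Hom (algebraMap V (SymmetricAlgebra V M))
      (fun j => SymmetricAlgebra.ι V M (m j)) F ∈ symGrading V M d := by
  rw [F.as_sum, map_sum]
  refine sum_mem fun c hc => ?_
  have hc' : c.degree = d := by
    have := hF (MvPolynomial.mem_support_iff.mp hc)
    rwa [Finsupp.degree_eq_weight_one]
  rw [MvPolynomial.coe_eval₂Hom, MvPolynomial.eval₂_monomial, ← Algebra.smul_def]
  refine Submodule.smul_mem _ _ ?_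
  have h1 := SetLike.prod_pow_mem_graded (symGrading V M) (fun _ => 1)
    (fun j => SymmetricAlgebra.ι V M (m j)) (F := c.support) c fun j _ => ι_mem_symGrading (m j)
  rw [← hc']
  simp only [smul_eq_mul, mul_one] at h1
  exact h1

section Special

variable {V : Type u} [CommRing V] [IsLocalRing V] {n : ℕ}

lemma exists_comp_projSpaceMap_eq {Y : Scheme.{u}}
    (ψ : MvPolynomial (Fin (n + 1)) V →+* Γ(Y, ⊤))
    (hψ : (HomogeneousIdeal.irrelevant (grading n V)).toIdeal.map ψ = ⊤)
    (h0 : ∀ r ∈ maximalIdeal V, ψ (MvPolynomial.C r) = 0) :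
    ∃ g : Y ⟶ ProjSpace n (ResidueField V),
      g ≫ ProjSpace.map n V (ResidueField V) = Proj.fromOfGlobalSections _ ψ hψ := by
  obtain ⟨σ, hσ⟩ : ∃ σ : ResidueField V →+* Γ(Y, ⊤),
      ∀ r, σ (algebraMap V (ResidueField V) r) = ψ (MvPolynomial.C r) :=
    ⟨Ideal.Quotient.lift (maximalIdeal V) (ψ.comp MvPolynomial.C) h0,
      fun r => Ideal.Quotient.lift_mk (maximalIdeal V) (ψ.comp MvPolynomial.C) h0⟩
  obtain ⟨ψ', hC, hX⟩ : ∃ ψ' : MvPolynomial (Fin (n + 1)) (ResidueField V) →+* Γ(Y, ⊤),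
      (∀ r, ψ' (MvPolynomial.C r) = σ r) ∧
      ∀ l, ψ' (MvPolynomial.X l) = ψ (MvPolynomial.X l) :=
    ⟨MvPolynomial.eval₂Hom σ fun l => ψ (MvPolynomial.X l), MvPolynomial.eval₂Hom_C _ _,
      MvPolynomial.eval₂Hom_X' _ _⟩
  have h1 : ψ'.comp (coeffMap n V (ResidueField V)).toRingHom = ψ := by
    refine MvPolynomial.ringHom_ext (fun r => ?_) fun l => ?_
    · exact (congrArg ψ' (MvPolynomial.map_C _ r)).trans ((hC _).trans (hσ r))
    · exact (congrArg ψ' (MvPolynomial.map_X _ l)).trans (hX l)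
  have h2 : (HomogeneousIdeal.irrelevant (grading n (ResidueField V))).toIdeal.map ψ' = ⊤ := by
    rw [eq_top_iff, ← hψ]
    refine (Ideal.map_mono irrelevant_le_span_X).trans ?_
    rw [Ideal.map_span, Ideal.span_le]
    rintro _ ⟨_, ⟨l, rfl⟩, rfl⟩
    exact hX l ▸ Ideal.mem_map_of_mem ψ' (X_mem_irrelevant l)
  have hψ' := hψ
  rw [← h1] at hψ'
  refine ⟨Proj.fromOfGlobalSections _ ψ' h2,
    (fromOfGlobalSections_comp_map ψ' h2 _ (irrelevant_le_coeffMap n V _) hψ').trans ?_⟩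
  exact fromOfGlobalSections_congr h1 _ _

variable {P : Spec (.of (ResidueField V)) ⟶ ProjSpace n (ResidueField V)}
  {p : Fin (n + 1) → V} {hI : IsPointIdeal (idealOfPoint P) p}

lemma coords_specialHyperplane {Y : Scheme.{u}}
    (g : Y ⟶ ProjModule (ResidueField V) (specialQuadrics P)) (T : quadrics P)
    (hz : ⊤ ≤ (g ≫ specialHyperplane P) ⁻¹ᵁ Proj.basicOpen _ (SymmetricAlgebra.ι V _ T)) :
    (∀ r ∈ maximalIdeal V, coords (g ≫ specialHyperplane P) (ι_mem_symGrading _) hz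
      (algebraMap V _ r) = 0) ∧
    ∀ F, reduction P F = 0 → coords (g ≫ specialHyperplane P) (ι_mem_symGrading _) hz
      (SymmetricAlgebra.ι V _ F) = 0 := by
  obtain ⟨h2, h3⟩ := coords_comp_projModuleMap (reduction P) (reduction_surjective P) g T hz
  constructor
  · intro r hr
    have h4 : algebraMap V (ResidueField V) r = 0 := (residue_eq_zero_iff r).mpr hr
    have h5 : symMap (S := ResidueField V) (reduction P) (algebraMap V _ r) = 0 := by
      rw [symMap_algebraMap, h4, map_zero]
    refine (RingHom.congr_fun h3 _).trans ?_
    rw [RingHom.comp_apply, h5, map_zero]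
  · intro F hF
    have h5 : symMap (S := ResidueField V) (reduction P) (SymmetricAlgebra.ι V _ F) = 0 := by
      rw [symMap_ι, hF, map_zero]
    refine (RingHom.congr_fun h3 _).trans ?_
    rw [RingHom.comp_apply, h5, map_zero]

lemma IsQuadricModel.exists_comp_projSpaceMap_eq_of_le {B : Scheme.{u}} {f : B ⟶ ProjSpace n V}
    {φ : B ⟶ ProjModule V (quadrics P)} (h : IsQuadricModel hI f φ) {Z : Scheme.{u}}
    (q : Z ⟶ B) (g : Z ⟶ ProjModule (ResidueField V) (specialQuadrics P))
    (hg : g ≫ specialHyperplane P = q ≫ φ) (ℓ : twistedSections (idealOfPoint P) 1)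
    (i : Fin (n + 1))
    (hz : ⊤ ≤ (q ≫ φ) ⁻¹ᵁ Proj.basicOpen _ (SymmetricAlgebra.ι V _ (hI.mulX ℓ i))) :
    ∃ b : Z ⟶ ProjSpace n (ResidueField V), b ≫ ProjSpace.map n V (ResidueField V) = q ≫ f := by
  rw [h.fac q ℓ i hz]
  refine PointBlowup.exists_comp_projSpaceMap_eq _ _ fun r hr => ?_
  rw [hI.inverseCoords_C]
  have hz' := hz
  rw [← hg] at hz'
  exact (RingHom.congr_fun (coords_congr hg.symm (ι_mem_symGrading _) hz hz') _).trans
    ((coords_specialHyperplane g _ hz').1 r hr)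

/-- The part of the blow-up in the special hyperplane lies over the special fibre. -/
lemma IsQuadricModel.exists_comp_projSpaceMap_eq {B : Scheme.{u}} {f : B ⟶ ProjSpace n V}
    {φ : B ⟶ ProjModule V (quadrics P)} (h : IsQuadricModel hI f φ) {Z : Scheme.{u}}
    (q : Z ⟶ B) (g : Z ⟶ ProjModule (ResidueField V) (specialQuadrics P))
    (hg : g ≫ specialHyperplane P = q ≫ φ) :
    ∃ b : Z ⟶ ProjSpace n (ResidueField V), b ≫ ProjSpace.map n V (ResidueField V) = q ≫ f := by
  have := projSpaceMap_isClosedImmersion n V (S := ResidueField V) residue_surjective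
  refine exists_lift_of_forall_exists _ _ fun z => ?_
  obtain ⟨ℓ, i, hz⟩ := hI.exists_mem_basicOpen_mulX ((q ≫ φ) z)
  obtain ⟨W, hW⟩ : ∃ W : Z.Opens, W = (q ≫ φ) ⁻¹ᵁ Proj.basicOpen _
    (SymmetricAlgebra.ι V _ (hI.mulX ℓ i)) := ⟨_, rfl⟩
  have hzW : z ∈ W := hW ▸ hz
  refine ⟨W, hzW, ?_⟩
  rw [← Category.assoc]
  refine h.exists_comp_projSpaceMap_eq_of_le (W.ι ≫ q) (W.ι ≫ g)
    (by rw [Category.assoc, Category.assoc, hg]) ℓ i fun y _ => ?_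
  exact hW.le y.2

/-- A morphism over the special fibre to the blow-up factors through the special hyperplane. -/
lemma IsPointIdeal.exists_comp_specialHyperplane_eq (hI : IsPointIdeal (idealOfPoint P) p)
    {φ₀ : (suppCompl (idealOfPoint P)).toScheme ⟶ ProjModule V (quadrics P)}
    (hφ₀ : IsGivenByForms (quadrics P) (suppCompl (idealOfPoint P)).ι φ₀)
    {B : Scheme.{u}} {f : B ⟶ ProjSpace n V}
    {φ : B ⟶ ProjModule V (quadrics P)} (hφ : Extends f φ₀ φ) {Y : Scheme.{u}} (u : Y ⟶ B)
    (g : Y ⟶ ProjSpace n (ResidueField V)) (hg : g ≫ ProjSpace.map n V (ResidueField V) = u ≫ f)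
    (hu : IsInvertibleIdeal ((idealOfPoint P).comap (u ≫ f))) :
    ∃ z, z ≫ specialHyperplane P = u ≫ φ := by
  have : IsClosedImmersion (specialHyperplane P) :=
    isClosedImmersion_projModuleMap residue_surjective _ _
  refine exists_lift_of_forall_exists _ _ fun y => ?_
  obtain ⟨j, hj⟩ := exists_mem_chart ((u ≫ f) y)
  obtain ⟨W, hyW, hWj, a, ha₀, ha⟩ := hu.exists_generator
    (O := (u ≫ f) ⁻¹ᵁ (ProjSpace.chart n V j).1) (y := y) hj
  refine ⟨W.1, hyW, ?_⟩
  have : IsAffine W.1.toScheme := W.2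
  have hi : ⊤ ≤ ((W.1.ι ≫ u) ≫ f) ⁻¹ᵁ (ProjSpace.chart n V j).1 := fun y _ => hWj y.2
  have ha' : ∀ h', ((idealOfPoint P).comap ((W.1.ι ≫ u) ≫ f)).ideal ⟨⊤, h'⟩ =
      Ideal.span {a} := by
    rw [Category.assoc, Scheme.IdealSheafData.comap_comp]
    exact ha
  obtain ⟨θ, hθ⟩ := hI.exists_isQuotientBy _ j hi ha₀ ha'
  rw [← Category.assoc, hI.eq_of_extends hφ₀ hφ (W.1.ι ≫ u) ha₀ hθ ha']
  have h1 : (W.1.ι ≫ u) ≫ f = (W.1.ι ≫ g) ≫ ProjSpace.map n V (ResidueField V) := by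
    rw [Category.assoc, Category.assoc, hg]
  have hi' := hi
  rw [h1] at hi'
  have hi'' : ⊤ ≤ (W.1.ι ≫ g) ⁻¹ᵁ (ProjSpace.chart n (ResidueField V) j).1 := by
    rw [← map_preimage_chart V]
    exact hi'
  have h2 : coordsX ((W.1.ι ≫ u) ≫ f) j hi =
      (coordsX (W.1.ι ≫ g) j hi'').comp (MvPolynomial.map (algebraMap V (ResidueField V))) :=
    (coords_congr h1 (X_mem_grading j) hi hi').trans (coordsX_comp_map _ j hi'' hi')
  refine exists_comp_projModuleMap_eq residue_surjective (reduction P) (reduction_surjective P)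
    θ hθ.irrelevant_map (fun r hr => ?_) fun F hF => ?_
  · rw [hθ.algebraMap_eq, h2, RingHom.comp_apply, MvPolynomial.map_C, hr, map_zero, map_zero]
  -- Over the special fibre a quadric with zero reduction pulls back to zero, and `a` is a
  -- nonzerodivisor, so its coordinate vanishes.
  · have h3 := hθ.mul_eq F
    have h4 : MvPolynomial.map (algebraMap V (ResidueField V)) F.1 = 0 := congrArg Subtype.val hF
    rw [h2, RingHom.comp_apply, h4, map_zero] at h3
    exact mem_nonZeroDivisors_iff_right.mp ha₀ _ h3

/-- The product of an element of the maximal ideal and a quadratic form. -/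
def IsPointIdeal.mulC {I : (ProjSpace n V).IdealSheafData} (hI : IsPointIdeal I p) {r : V}
    (hr : r ∈ maximalIdeal V) (G : MvPolynomial (Fin (n + 1)) V) (hG : G.IsHomogeneous 2) :
    twistedSections I 2 :=
  ⟨MvPolynomial.C r * G, hI.C_mul_mem hG hr⟩

/-- Substituting the quadrics `ℓ x_j` for the variables of `G` gives an element of degree two in the
symmetric algebra mapping to `ℓ² G`. The claim is the cubic relation `(r G)(ℓ x_i)² = (r x_i²)(ℓ²
G)`, normalized by `ℓ x_i = 1`. -/
lemma IsQuadricModel.coords_mulC {I : (ProjSpace n V).IdealSheafData} {hI : IsPointIdeal I p}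
    {B : Scheme.{u}} {f : B ⟶ ProjSpace n V}
    {φ : B ⟶ ProjModule V (twistedSections I 2)} (h : IsQuadricModel hI f φ) {Y : Scheme.{u}}
    (q : Y ⟶ B) (ℓ : twistedSections I 1) (i : Fin (n + 1))
    (hz : ⊤ ≤ (q ≫ φ) ⁻¹ᵁ Proj.basicOpen _ (SymmetricAlgebra.ι V _ (hI.mulX ℓ i)))
    {r : V} (hr : r ∈ maximalIdeal V) (G : MvPolynomial (Fin (n + 1)) V) (hG : G.IsHomogeneous 2) :
    coords (q ≫ φ) (ι_mem_symGrading _) hz (SymmetricAlgebra.ι V _ (hI.mulC hr G hG)) =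
      coords (q ≫ φ) (ι_mem_symGrading _) hz (SymmetricAlgebra.ι V _
        (hI.mulC hr (MvPolynomial.X i ^ 2) (MvPolynomial.isHomogeneous_X_pow i 2))) *
      hI.inverseCoords ℓ i (q ≫ φ) hz G := by
  let ev : MvPolynomial (Fin (n + 1)) V →+* SymmetricAlgebra V (twistedSections I 2) :=
    MvPolynomial.eval₂Hom (algebraMap V _) fun j => SymmetricAlgebra.ι V _ (hI.mulX ℓ j)
  have hevC : ∀ r, ev (MvPolynomial.C r) = algebraMap V _ r := fun r =>
    MvPolynomial.eval₂Hom_C _ _ _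
  have hevX : ∀ j, ev (MvPolynomial.X j) = SymmetricAlgebra.ι V _ (hI.mulX ℓ j) := fun j =>
    MvPolynomial.eval₂Hom_X' _ _ _
  have h1 : (coords (q ≫ φ) (ι_mem_symGrading _) hz).comp ev =
      hI.inverseCoords ℓ i (q ≫ φ) hz := by
    refine MvPolynomial.ringHom_ext (fun r => ?_) fun j => ?_
    · rw [RingHom.comp_apply, hevC, hI.inverseCoords_C]
    · rw [RingHom.comp_apply, hevX, hI.inverseCoords_X]
  have h2 : symToForms _ (ev G) = ℓ.1 ^ 2 * G :=
    map_eq_pow_mul (RingHom.id _) ((symToForms (twistedSections I 2)).comp ev) ℓ.1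
      (fun r => by
        rw [RingHom.comp_apply, hevC, symToForms_algebraMap]; rfl)
      (fun j => by
        rw [RingHom.comp_apply, hevX, symToForms_ι]; rfl) hG
  have hι : ∀ F : twistedSections I 2,
      SymmetricAlgebra.ι V _ F ∈ symGrading V (twistedSections I 2) 1 := ι_mem_symGrading
  have h3 : SymmetricAlgebra.ι V _ (hI.mulC hr G hG) *
      (SymmetricAlgebra.ι V _ (hI.mulX ℓ i) * SymmetricAlgebra.ι V _ (hI.mulX ℓ i)) ∈
        symGrading V (twistedSections I 2) 3 :=
    SetLike.GradedMul.mul_mem (A := symGrading V (twistedSections I 2)) (i := 1) (j := 2) (hι _)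
      (SetLike.GradedMul.mul_mem (A := symGrading V (twistedSections I 2)) (i := 1) (j := 1)
        (hι _) (hι _))
  have h4 : SymmetricAlgebra.ι V _
      (hI.mulC hr (MvPolynomial.X i ^ 2) (MvPolynomial.isHomogeneous_X_pow i 2)) * ev G ∈
        symGrading V (twistedSections I 2) 3 :=
    SetLike.GradedMul.mul_mem (A := symGrading V (twistedSections I 2)) (i := 1) (j := 2) (hι _)
      (eval₂Hom_mem_symGrading _ hG)
  have h5 := h.rel q _ hz (sub_mem h3 h4) (by
    rw [map_sub, map_mul, map_mul, map_mul, symToForms_ι, symToForms_ι, symToForms_ι, h2]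
    change MvPolynomial.C r * G * (ℓ.1 * MvPolynomial.X i * (ℓ.1 * MvPolynomial.X i)) -
      MvPolynomial.C r * MvPolynomial.X i ^ 2 * (ℓ.1 ^ 2 * G) = 0
    ring)
  rw [map_sub, sub_eq_zero, map_mul, map_mul, map_mul, coords_self, mul_one, mul_one] at h5
  exact h5.trans (congrArg (_ * ·) congr($h1 G))

end Special

end

section

open IsLocalRing

/-! ### Coordinate rings of open parts of a linear subvariety -/

section Domain

variable {R A : Type u} [CommRing R] [CommRing A] [Algebra R A] {𝒜 : ℕ → Submodule R A}
  [GradedAlgebra 𝒜]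

lemma evalAt_bijective {Y : Scheme.{u}} (g : Y ⟶ Proj 𝒜) [IsOpenImmersion g] {t : A}
    (ht : t ∈ 𝒜 1) (hg : g.opensRange = Proj.basicOpen 𝒜 t)
    (h : ⊤ ≤ g ⁻¹ᵁ Proj.basicOpen 𝒜 t) : Function.Bijective (evalAt 𝒜 g t h) := by
  have h1 : Set.range g = Set.range (Proj.awayι 𝒜 t ht one_pos) := by
    rw [← Scheme.Hom.coe_opensRange, ← Scheme.Hom.coe_opensRange, hg, Proj.opensRange_awayι]
  have h2 : Y.toSpecΓ ≫ Spec.map (CommRingCat.ofHom (evalAt 𝒜 g t h)) =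
      (IsOpenImmersion.isoOfRangeEq g (Proj.awayι 𝒜 t ht one_pos) h1).hom := by
    rw [← cancel_mono (Proj.awayι 𝒜 t ht one_pos), IsOpenImmersion.isoOfRangeEq_hom_fac,
      Category.assoc]
    exact (eq_toSpecΓ_comp_awayι g ht one_pos h).symm
  have key : ∀ k : Y ⟶ Spec (.of (HomogeneousLocalization.Away 𝒜 t)), IsIso k →
      Function.Bijective fun r => k.appTop.hom
        ((Scheme.ΓSpecIso (.of (HomogeneousLocalization.Away 𝒜 t))).inv.hom r) := fun k _ =>
    have : IsIso k.appTop := inferInstanceAs (IsIso (k.app ⊤))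
    (ConcreteCategory.bijective_of_isIso k.appTop).comp (ConcreteCategory.bijective_of_isIso
      (Scheme.ΓSpecIso (.of (HomogeneousLocalization.Away 𝒜 t))).inv)
  have h4 := key (Y.toSpecΓ ≫ Spec.map (CommRingCat.ofHom (evalAt 𝒜 g t h))) (by
    rw [h2]; infer_instance)
  refine (congrArg Function.Bijective (funext fun r => ?_)).mp h4
  exact toSpecΓ_comp_map_appTop (CommRingCat.ofHom (evalAt 𝒜 g t h)) r

/-- The coordinate ring of a basic open subset of `Proj` of a domain has no zero divisors, and a
homogeneous element which vanishes there is zero. -/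
lemma noZeroDivisors_of_opensRange_eq_basicOpen [IsDomain A] {Y : Scheme.{u}} (g : Y ⟶ Proj 𝒜)
    [IsOpenImmersion g] {t : A} (ht : t ∈ 𝒜 1) (hg : g.opensRange = Proj.basicOpen 𝒜 t)
    (h : ⊤ ≤ g ⁻¹ᵁ Proj.basicOpen 𝒜 t) :
    NoZeroDivisors Γ(Y, ⊤) ∧ ∀ a ∈ 𝒜 1, coords g ht h a = 0 → a = 0 ∨ t = 0 := by
  have hbij := evalAt_bijective g ht hg h
  let e := RingEquiv.ofBijective _ hbij
  have hinj := (HomogeneousLocalization.val_injective (𝒜 := 𝒜) (Submonoid.powers t))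
  have hloc : t ≠ 0 → IsDomain (Localization.Away t) := fun h0 =>
    IsLocalization.isDomain_localization (powers_le_nonZeroDivisors_of_noZeroDivisors h0)
  have hsub : t = 0 → Subsingleton (Localization.Away t) := fun h0 =>
    IsLocalization.subsingleton (M := Submonoid.powers t) ⟨1, by simp [h0]⟩
  constructor
  · have : NoZeroDivisors (Localization.Away t) := by
      by_cases h0 : t = 0
      · have := hsub h0
        exact ⟨fun _ => Or.inl (Subsingleton.elim _ _)⟩
      · have := hloc h0
        infer_instance
    have h1 : NoZeroDivisors (HomogeneousLocalization.Away 𝒜 t) :=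
      hinj.noZeroDivisors _ (HomogeneousLocalization.val_zero)
        (fun _ _ => HomogeneousLocalization.val_mul _ _)
    exact e.symm.injective.noZeroDivisors _ (map_zero _) (map_mul _)
  · intro a ha h0
    by_cases ht0 : t = 0
    · exact Or.inr ht0
    have := hloc ht0
    rw [coords_of_mem g ht h ha] at h0
    have h1 := hbij.1 (h0.trans (map_zero _).symm)
    have h2 := congrArg HomogeneousLocalization.val h1
    rw [HomogeneousLocalization.Away.val_mk, HomogeneousLocalization.val_zero,
      Localization.mk_eq_mk', IsLocalization.mk'_eq_zero_iff] at h2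
    obtain ⟨⟨_, k, rfl⟩, hm⟩ := h2
    exact Or.inl ((mul_eq_zero.mp hm).resolve_left (pow_ne_zero k ht0))

instance {k : Type u} [Field k] {M : Type u} [AddCommGroup M] [Module k M] :
    IsDomain (SymmetricAlgebra k M) :=
  (SymmetricAlgebra.equivMvPolynomial (Module.Basis.ofVectorSpace k M)).toMulEquiv.isDomain _

variable {V : Type u} [CommRing V] [IsLocalRing V] {M : Type u} [AddCommGroup M] [Module V M]

/-- A linear subvariety is `Proj` of a polynomial ring over a field, which is a domain. So functions
on the part where `T` is nonzero have no zero divisors, and a linear form vanishing there vanishes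
everywhere unless that part is empty. -/
lemma IsLinearSubvariety.noZeroDivisors {E : Scheme.{u}} {ζ : E ⟶ ProjModule V M}
    (hζ : IsLinearSubvariety ζ) (T S : M) {Y : Scheme.{u}} (j : Y ⟶ E) [IsOpenImmersion j]
    (hj : j.opensRange = ζ ⁻¹ᵁ Proj.basicOpen _ (SymmetricAlgebra.ι V M T))
    (hz : ⊤ ≤ (j ≫ ζ) ⁻¹ᵁ Proj.basicOpen _ (SymmetricAlgebra.ι V M T)) :
    NoZeroDivisors Γ(Y, ⊤) ∧
      (coords (j ≫ ζ) (ι_mem_symGrading T) hz (SymmetricAlgebra.ι V M S) = 0 →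
        Subsingleton Γ(Y, ⊤) ∨ ∀ y, ζ y ∉ Proj.basicOpen _ (SymmetricAlgebra.ι V M S)) := by
  obtain ⟨N, e, rfl⟩ := hζ
  have hpre : ∀ m : M, linearSubvariety N ⁻¹ᵁ Proj.basicOpen _ (SymmetricAlgebra.ι V M m) =
      Proj.basicOpen (symGrading (ResidueField V) ((ResidueField V ⊗[V] M) ⧸ N))
        (SymmetricAlgebra.ι (ResidueField V) _ (residueQuotient N m)) := fun m => by
    rw [← symMap_ι (residueQuotient N) m]
    rfl
  have h0 : (j ≫ e.hom) ≫ linearSubvariety N = j ≫ e.hom ≫ linearSubvariety N :=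
    Category.assoc _ _ _
  have hz' := hz
  rw [← h0] at hz'
  obtain ⟨h1, h2⟩ := coords_comp_projModuleMap (residueQuotient N) (residueQuotient_surjective N)
    (j ≫ e.hom) T hz'
  have h3 : (j ≫ e.hom).opensRange =
      Proj.basicOpen (symGrading (ResidueField V) ((ResidueField V ⊗[V] M) ⧸ N))
        (SymmetricAlgebra.ι (ResidueField V) _ (residueQuotient N T)) := by
    rw [Scheme.Hom.opensRange_comp, hj, Scheme.Hom.comp_preimage, hpre,
      Scheme.Hom.image_preimage_eq_opensRange_inf, Scheme.Hom.opensRange_of_isIso, top_inf_eq]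
  obtain ⟨h4, h5⟩ := noZeroDivisors_of_opensRange_eq_basicOpen (j ≫ e.hom)
    (ι_mem_symGrading _) h3 h1
  refine ⟨h4, fun h6 => ?_⟩
  have h7 : coords (j ≫ e.hom) (ι_mem_symGrading _) h1 (SymmetricAlgebra.ι (ResidueField V) _
      (residueQuotient N S)) = 0 := by
    rw [← symMap_ι (residueQuotient N) S]
    refine Eq.trans ?_ h6
    exact (RingHom.congr_fun h2 _).symm.trans
      (RingHom.congr_fun (coords_congr h0 (ι_mem_symGrading T) hz' hz) _)
  rcases h5 _ (ι_mem_symGrading _) h7 with h8 | h8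
  · right
    intro y hy
    have h9 : e.hom y ∈ linearSubvariety N ⁻¹ᵁ Proj.basicOpen _ (SymmetricAlgebra.ι V M S) := hy
    rw [hpre, h8, Proj.basicOpen_zero] at h9
    exact h9
  · left
    rw [h8, Proj.basicOpen_zero] at h1
    have : IsEmpty Y := ⟨fun y => h1 (show y ∈ (⊤ : Y.Opens) from trivial)⟩
    infer_instance

end Domain

end

section

open IsLocalRing

/-! ### Local equations of the special hyperplane on the blow-up -/

section HyperplaneSection

variable {V : Type u} [CommRing V] [IsLocalRing V] {n : ℕ} {p : Fin (n + 1) → V}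

/-- On `D₊(ℓ x_i)` the product of `ϖ x_i²/(ℓ x_i)` and `ℓ²/(ℓ x_i)` is `ϖ`. -/
lemma IsQuadricModel.coords_mulC_mul {I : (ProjSpace n V).IdealSheafData} {hI : IsPointIdeal I p}
    {B : Scheme.{u}} {f : B ⟶ ProjSpace n V}
    {φ : B ⟶ ProjModule V (twistedSections I 2)} (h : IsQuadricModel hI f φ) {Y : Scheme.{u}}
    (q : Y ⟶ B) (ℓ : twistedSections I 1) (i : Fin (n + 1))
    (hz : ⊤ ≤ (q ≫ φ) ⁻¹ᵁ Proj.basicOpen _ (SymmetricAlgebra.ι V _ (hI.mulX ℓ i)))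
    {r : V} (hr : r ∈ maximalIdeal V) :
    coords (q ≫ φ) (ι_mem_symGrading _) hz (SymmetricAlgebra.ι V _
        (hI.mulC hr (MvPolynomial.X i ^ 2) (MvPolynomial.isHomogeneous_X_pow i 2))) *
      coords (q ≫ φ) (ι_mem_symGrading _) hz
        (SymmetricAlgebra.ι V _ (hI.mulForm ℓ ℓ.1 ℓ.2.1)) =
      coords (q ≫ φ) (ι_mem_symGrading _) hz (algebraMap V _ r) := by
  rw [h.coords_quadric q ℓ i hz _ _ (hI.mulX ℓ i) (r • hI.mulX ℓ i), coords_self, one_mul,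
    coords_ι_smul, coords_self, mul_one]
  change MvPolynomial.C r * MvPolynomial.X i ^ 2 * (ℓ.1 * ℓ.1) =
    ℓ.1 * MvPolynomial.X i * (r • (ℓ.1 * MvPolynomial.X i))
  rw [MvPolynomial.smul_eq_C_mul]
  ring

/-- A quadratic form with vanishing reduction is divisible by the uniformizer. -/
lemma exists_eq_C_mul_of_map_eq_zero {ϖ : V} (hϖ : maximalIdeal V = Ideal.span {ϖ})
    {F : MvPolynomial (Fin (n + 1)) V} {d : ℕ} (hF : F.IsHomogeneous d)
    (h0 : MvPolynomial.map (algebraMap V (ResidueField V)) F = 0) :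
    ∃ G : MvPolynomial (Fin (n + 1)) V, G.IsHomogeneous d ∧ F = MvPolynomial.C ϖ * G := by
  have h1 : MvPolynomial.C ϖ ∣ F := by
    rw [MvPolynomial.C_dvd_iff_dvd_coeff]
    intro m
    have h2 : residue V (F.coeff m) = 0 := by
      have := congrArg (MvPolynomial.coeff m) h0
      rwa [MvPolynomial.coeff_map, MvPolynomial.coeff_zero] at this
    rw [residue_eq_zero_iff, hϖ, Ideal.mem_span_singleton] at h2
    exact h2
  obtain ⟨G, rfl⟩ := h1
  refine ⟨MvPolynomial.homogeneousComponent d G,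
    MvPolynomial.homogeneousComponent_isHomogeneous d G, ?_⟩
  rw [← MvPolynomial.homogeneousComponent_C_mul]
  exact ((MvPolynomial.homogeneousComponent_of_mem hF).trans (if_pos rfl)).symm

variable {P : Spec (.of (ResidueField V)) ⟶ ProjSpace n (ResidueField V)}
  {hI : IsPointIdeal (idealOfPoint P) p}

/-- On `D₊(ℓ x_i)` the special hyperplane is cut out by `ϖ x_i²/(ℓ x_i)`. -/
lemma IsQuadricModel.exists_comp_specialHyperplane_eq {B : Scheme.{u}} {f : B ⟶ ProjSpace n V}
    {φ : B ⟶ ProjModule V (quadrics P)} (h : IsQuadricModel hI f φ) {Y : Scheme.{u}}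
    (q : Y ⟶ B) (ℓ : twistedSections (idealOfPoint P) 1) (i : Fin (n + 1))
    (hz : ⊤ ≤ (q ≫ φ) ⁻¹ᵁ Proj.basicOpen _ (SymmetricAlgebra.ι V _ (hI.mulX ℓ i)))
    {ϖ : V} (hϖ : maximalIdeal V = Ideal.span {ϖ}) (hr : ϖ ∈ maximalIdeal V)
    (hw : coords (q ≫ φ) (ι_mem_symGrading _) hz (SymmetricAlgebra.ι V _
      (hI.mulC hr (MvPolynomial.X i ^ 2) (MvPolynomial.isHomogeneous_X_pow i 2))) = 0) :
    ∃ g, g ≫ specialHyperplane P = q ≫ φ := by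
  rw [eq_fromOfGlobalSections_coords (q ≫ φ) (ι_mem_symGrading _) hz]
  refine exists_comp_projModuleMap_eq residue_surjective (reduction P) (reduction_surjective P)
    _ _ (fun r hr' => ?_) fun F hF => ?_
  · have h1 : r ∈ maximalIdeal V := (residue_eq_zero_iff r).mp hr'
    rw [hϖ, Ideal.mem_span_singleton] at h1
    obtain ⟨s, rfl⟩ := h1
    -- The scalar `ϖ` is the product of the vanishing coordinate with `ℓ²/(ℓ x_i)`, so it vanishes
    -- as well.
    rw [map_mul, map_mul, ← h.coords_mulC_mul q ℓ i hz hr, hw, zero_mul, zero_mul]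
  · obtain ⟨G, hG, hFG⟩ := exists_eq_C_mul_of_map_eq_zero hϖ F.2.1 (congrArg Subtype.val hF)
    have h2 : F = hI.mulC hr G hG := Subtype.ext hFG
    rw [h2, h.coords_mulC q ℓ i hz hr G hG, hw, zero_mul]

lemma mem_support_of_ideal_eq_span {X : Scheme.{u}} {J : X.IdealSheafData}
    (h : ⊤ ∈ X.affineOpens) {a : Γ(X, ⊤)} (ha : J.ideal ⟨⊤, h⟩ = Ideal.span {a}) {x : X}
    (hx : x ∉ X.basicOpen a) : x ∈ J.support := by
  rw [Scheme.IdealSheafData.mem_support_iff_of_mem (U := ⟨⊤, h⟩) trivial, ha, Scheme.zeroLocus_span,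
    Scheme.mem_zeroLocus_iff]
  rintro _ rfl
  exact hx

lemma isInvertibleIdeal_of_isAffine {X : Scheme.{u}} {J : X.IdealSheafData} (h : ⊤ ∈ X.affineOpens)
    {a : Γ(X, ⊤)} (ha₀ : a ∈ nonZeroDivisors Γ(X, ⊤)) (ha : J.ideal ⟨⊤, h⟩ = Ideal.span {a}) :
    IsInvertibleIdeal J := fun _ => ⟨⟨⊤, h⟩, trivial, a, ha₀, ha⟩

/-- The quadric `ϖ x_i²` does not vanish identically on the exceptional divisor if `x_i` does not
vanish at the point. -/
lemma IsPointIdeal.exists_mem_support_mem_basicOpen [IsDomain V]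
    {I : (ProjSpace n V).IdealSheafData} (hI : IsPointIdeal I p)
    {φ₀ : (suppCompl I).toScheme ⟶ ProjModule V (twistedSections I 2)}
    (hφ₀ : IsGivenByForms (twistedSections I 2) (suppCompl I).ι φ₀)
    {B : Scheme.{u}} {f : B ⟶ ProjSpace n V} (hf : IsBlowup f I)
    {φ : B ⟶ ProjModule V (twistedSections I 2)} (hφ : Extends f φ₀ φ)
    {ϖ : V} (hϖ : maximalIdeal V = Ideal.span {ϖ}) (hϖ0 : ϖ ≠ 0) (hr : ϖ ∈ maximalIdeal V)
    {i : Fin (n + 1)} (hi : IsUnit (p i)) :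
    ∃ b ∈ (I.comap f).support, φ b ∈ Proj.basicOpen _ (SymmetricAlgebra.ι V _
      (hI.mulC hr (MvPolynomial.X i ^ 2) (MvPolynomial.isHomogeneous_X_pow i 2))) := by
  obtain ⟨u, hu⟩ := hi.exists_left_inv
  let γ : V →+* Γ(Spec (.of V), ⊤) := (Scheme.ΓSpecIso (.of V)).inv.hom
  have hγ : Function.Bijective γ :=
    ConcreteCategory.bijective_of_isIso (Scheme.ΓSpecIso (.of V)).inv
  -- The section `Spec V ⟶ ℙⁿ` with the lifted coordinates passes through the point, and the ideal
  -- of the point pulls back to the one generated by `ϖ`. Its lift to the blow-up provides the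
  -- desired point of the exceptional divisor.
  let ψ : MvPolynomial (Fin (n + 1)) V →+* Γ(Spec (.of V), ⊤) :=
    γ.comp (MvPolynomial.eval fun j => u * p j)
  have hψC : ∀ r, ψ (MvPolynomial.C r) = γ r := fun r => congrArg γ (MvPolynomial.eval_C r)
  have hψi : ψ (MvPolynomial.X i) = 1 := by
    refine (congrArg γ (MvPolynomial.eval_X i)).trans ?_
    rw [hu, map_one]
  obtain ⟨σ, hσi, hσ⟩ : ∃ (σ : Spec (.of V) ⟶ ProjSpace n V)
      (hσi : ⊤ ≤ σ ⁻¹ᵁ (ProjSpace.chart n V i).1), coordsX σ i hσi = ψ := by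
    have h1 : (HomogeneousIdeal.irrelevant (grading n V)).toIdeal.map ψ = ⊤ :=
      irrelevant_map_eq_top ψ (X_mem_grading i) one_pos (by rw [hψi]; exact isUnit_one)
    have h2 := le_fromOfGlobalSections_preimage_chart ψ h1 i (by rw [hψi]; exact isUnit_one)
    exact ⟨_, h2, coordsX_fromOfGlobalSections_of_eq_one ψ h1 i hψi h2⟩
  have hideal : ∀ h', (I.comap σ).ideal ⟨⊤, h'⟩ = Ideal.span {γ ϖ} := fun h' => by
    refine (hI.comap_ideal_top σ i hσi).trans ?_
    rw [hσ]
    refine le_antisymm ?_ ?_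
    · rw [Ideal.span_le]
      rintro _ ⟨F, hF, rfl⟩
      have h1 := hI.mem_twistedSections_iff.mp hF
      have h2 : MvPolynomial.eval (fun j => u * p j) F ∈ maximalIdeal V := by
        rw [eval_mul_of_isHomogeneous p u h1.1]
        exact Ideal.mul_mem_left _ _ h1.2
      rw [hϖ, Ideal.mem_span_singleton] at h2
      obtain ⟨s, hs⟩ := h2
      refine Ideal.mem_span_singleton.mpr ⟨γ s, ?_⟩
      exact (congrArg γ hs).trans (map_mul γ _ _)
    · rw [Ideal.span_le, Set.singleton_subset_iff]
      refine Ideal.subset_span ⟨MvPolynomial.C ϖ * MvPolynomial.X i,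
        hI.C_mul_mem (MvPolynomial.isHomogeneous_X V i) hr, ?_⟩
      rw [map_mul, hψC, hψi, mul_one]
  have hnzd : γ ϖ ∈ nonZeroDivisors Γ(Spec (.of V), ⊤) := by
    rw [mem_nonZeroDivisors_iff_right]
    intro x hx
    obtain ⟨y, rfl⟩ := hγ.2 x
    rw [← map_mul] at hx
    have h1 := (map_eq_zero_iff γ hγ.1).mp hx
    rw [(mul_eq_zero.mp h1).resolve_right hϖ0, map_zero]
  obtain ⟨τ, rfl, -⟩ := hf.existsUnique_lift σ
    (isInvertibleIdeal_of_isAffine (isAffineOpen_top _) hnzd (hideal _))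
  obtain ⟨θ, hθ⟩ := hI.exists_isQuotientBy _ i hσi hnzd hideal
  -- With generator `a = ϖ` and `x_i = 1`, the quotient of `ϖ x_i²` by `a` is `1`.
  have h1 : θ (SymmetricAlgebra.ι V _
      (hI.mulC hr (MvPolynomial.X i ^ 2) (MvPolynomial.isHomogeneous_X_pow i 2))) = 1 := by
    have h2 := hθ.mul_eq
      (hI.mulC hr (MvPolynomial.X i ^ 2) (MvPolynomial.isHomogeneous_X_pow i 2))
    have h3 : ψ (MvPolynomial.C ϖ * MvPolynomial.X i ^ 2) = 1 * γ ϖ := by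
      rw [map_mul, map_pow, hψC, hψi, one_pow, mul_one, one_mul]
    rw [hσ] at h2
    have h4 := h2.trans h3
    rw [← sub_eq_zero, ← sub_mul] at h4
    exact sub_eq_zero.mp (mem_nonZeroDivisors_iff_right.mp hnzd _ h4)
  refine ⟨τ (closedPoint V), ?_, ?_⟩
  · have h2 : closedPoint V ∈ ((I.comap f).comap τ).support := by
      refine mem_support_of_ideal_eq_span (a := γ ϖ) (isAffineOpen_top _) ?_ fun h3 => ?_
      · rw [← Scheme.IdealSheafData.comap_comp]
        exact hideal _
      · have h4 : closedPoint V ∈ PrimeSpectrum.basicOpen ϖ :=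
          (basicOpen_eq_of_affine (R := .of V) ϖ).le h3
        exact h4 hr
    rw [Scheme.IdealSheafData.support_comap] at h2
    exact h2
  · have h2 : (τ ≫ φ) (closedPoint V) = φ (τ (closedPoint V)) := rfl
    rw [← h2, hI.eq_of_extends hφ₀ hφ τ hnzd hθ hideal]
    exact le_fromOfGlobalSections_preimage θ hθ.irrelevant_map (ι_mem_symGrading _) one_pos
      (by rw [h1]; exact isUnit_one) trivial

end HyperplaneSection

end

section

open IsLocalRing

/-! ### The special hyperplane section as the blow-up of the special fibre -/

lemma isInvertibleIdeal_of_forall_exists {X : Scheme.{u}} {J : X.IdealSheafData}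
    (H : ∀ x : X, ∃ (Y : Scheme.{u}) (j : Y ⟶ X) (_ : IsOpenImmersion j) (_ : IsAffine Y)
      (a : Γ(Y, ⊤)), x ∈ j.opensRange ∧ a ∈ nonZeroDivisors Γ(Y, ⊤) ∧
      (J.comap j).ideal ⟨⊤, isAffineOpen_top Y⟩ = Ideal.span {a}) : IsInvertibleIdeal J := by
  intro x
  obtain ⟨Y, j, _, _, a, hx, ha₀, ha⟩ := H x
  have hD : IsAffineOpen (j ''ᵁ ⊤) := (isAffineOpen_top Y).image_of_isOpenImmersion j
  have hle := (j.preimage_image_eq ⊤).ge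
  have h1 := comap_ideal_of_isOpenImmersion J j ⟨⊤, isAffineOpen_top Y⟩ ⟨j ''ᵁ ⊤, hD⟩ rfl hle
  have hb : Function.Bijective (j.appLE (j ''ᵁ ⊤) ⊤ hle).hom := by
    have : IsIso (j.appLE (j ''ᵁ ⊤) ⊤ hle) :=
      inferInstanceAs (IsIso (j.app _ ≫ Y.presheaf.map (eqToHom (j.preimage_image_eq _).symm).op))
    exact ConcreteCategory.bijective_of_isIso (j.appLE (j ''ᵁ ⊤) ⊤ hle)
  obtain ⟨b, rfl⟩ := hb.2 a
  refine ⟨⟨j ''ᵁ ⊤, hD⟩, ?_, b, ?_, ?_⟩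
  · obtain ⟨y, rfl⟩ := hx
    exact ⟨y, trivial, rfl⟩
  · rw [mem_nonZeroDivisors_iff_right] at ha₀ ⊢
    intro y hy
    refine (map_eq_zero_iff _ hb.1).mp (ha₀ _ ?_)
    rw [← map_mul, hy, map_zero]
  · rw [ha, ← Set.image_singleton, ← Ideal.map_span] at h1
    have h2 := congrArg (Ideal.comap (j.appLE (j ''ᵁ ⊤) ⊤ hle).hom) h1
    exact (Ideal.comap_map_of_bijective _ hb).symm.trans (h2.symm.trans
      (Ideal.comap_map_of_bijective _ hb))

lemma comap_ideal_eq_span_of_eq {Q O Z : Scheme.{u}} [IsAffine Q] [IsAffine O]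
    {I : Z.IdealSheafData} {g : O ⟶ Z} {b : Γ(O, ⊤)}
    (hb : (I.comap g).ideal ⟨⊤, isAffineOpen_top O⟩ = Ideal.span {b}) (μ : Q ⟶ O) {g' : Q ⟶ Z}
    (h : g' = μ ≫ g) :
    (I.comap g').ideal ⟨⊤, isAffineOpen_top Q⟩ = Ideal.span {μ.appTop.hom b} := by
  rw [h, Scheme.IdealSheafData.comap_comp, comap_ideal_of_isAffine, hb, Ideal.map_span,
    Set.image_singleton]

lemma IsInvertibleIdeal.comap_ideal_ι_mem_nonZeroDivisors {Y : Scheme.{u}} {J : Y.IdealSheafData}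
    (hJ : IsInvertibleIdeal J) {W : Y.affineOpens} {b : Γ(W.1.toScheme, ⊤)}
    (h : ∀ h', (J.comap W.1.ι).ideal ⟨⊤, h'⟩ = Ideal.span {b}) :
    b ∈ nonZeroDivisors Γ(W.1.toScheme, ⊤) := by
  have h1 := hJ.mem_nonZeroDivisors (ideal_eq_span_of_comap_ι h)
  have hb := ConcreteCategory.bijective_of_isIso W.1.topIso.hom
  rw [mem_nonZeroDivisors_iff_right] at h1 ⊢
  intro y hy
  refine (map_eq_zero_iff W.1.topIso.hom.hom hb.1).mp (h1 _ ?_)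
  exact (map_mul W.1.topIso.hom.hom y b).symm.trans
    ((congrArg W.1.topIso.hom.hom hy).trans (map_zero _))

section HyperplaneSection

variable {V : Type u} [CommRing V] [IsLocalRing V] {n : ℕ} {p : Fin (n + 1) → V}

/-- Modulo `b` the functions on `Y` are those on an open part of the exceptional divisor. These have
no zero divisors since the divisor is linear, and there `w r = 0`. Either `w` is nonzero, so `r =
0`, or the open part is empty, because `w` does not vanish on all of the exceptional divisor when `p
i` is a unit. -/
lemma IsQuadricModel.mem_span_of_mul_eq_mul [IsDomain V] {I : (ProjSpace n V).IdealSheafData}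
    {hI : IsPointIdeal I p} {φ₀ : (suppCompl I).toScheme ⟶ ProjModule V (twistedSections I 2)}
    (hφ₀ : IsGivenByForms (twistedSections I 2) (suppCompl I).ι φ₀)
    {ϖ : V} (hϖ : maximalIdeal V = Ideal.span {ϖ}) (hϖ0 : ϖ ≠ 0) (hr : ϖ ∈ maximalIdeal V)
    {B : Scheme.{u}} {f : B ⟶ ProjSpace n V} (hf : IsBlowup f I)
    {φ : B ⟶ ProjModule V (twistedSections I 2)} (hφ : Extends f φ₀ φ)
    (h : IsQuadricModel hI f φ) (hlin : IsLinearSubvariety ((I.comap f).subschemeι ≫ φ))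
    (ℓ : twistedSections I 1) (i : Fin (n + 1)) {Y : Scheme.{u}} [IsAffine Y] (q : Y ⟶ B)
    [IsOpenImmersion q]
    (hq : q.opensRange = φ ⁻¹ᵁ Proj.basicOpen _ (SymmetricAlgebra.ι V _ (hI.mulX ℓ i)))
    (hz : ⊤ ≤ (q ≫ φ) ⁻¹ᵁ Proj.basicOpen _ (SymmetricAlgebra.ι V _ (hI.mulX ℓ i)))
    {b w : Γ(Y, ⊤)} (hb : coords (q ≫ φ) (ι_mem_symGrading _) hz
      (SymmetricAlgebra.ι V _ (hI.mulForm ℓ ℓ.1 ℓ.2.1)) = b)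
    (hw : coords (q ≫ φ) (ι_mem_symGrading _) hz (SymmetricAlgebra.ι V _
      (hI.mulC hr (MvPolynomial.X i ^ 2) (MvPolynomial.isHomogeneous_X_pow i 2))) = w)
    {s r : Γ(Y, ⊤)} (hsr : s * b = w * r) : r ∈ Ideal.span {b} := by
  have hbI : ∀ h', (I.comap (q ≫ f)).ideal ⟨⊤, h'⟩ = Ideal.span {b} :=
    hb ▸ h.comap_ideal q ℓ i hz
  obtain ⟨ρ, hρ⟩ : ∃ ρ : pullback q (I.comap f).subschemeι ⟶ Y, ρ = pullback.fst _ _ := ⟨_, rfl⟩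
  obtain ⟨j, hjo, hj, hjq⟩ : ∃ (j : pullback q (I.comap f).subschemeι ⟶ _)
      (_ : IsOpenImmersion j), j = pullback.snd _ _ ∧
        j.opensRange = (I.comap f).subschemeι ⁻¹ᵁ q.opensRange :=
    ⟨pullback.snd _ _, inferInstance, rfl, Scheme.Hom.opensRange_pullbackSnd _ _⟩
  have hρc : IsClosedImmersion ρ := by rw [hρ]; infer_instance
  have hcond : j ≫ (I.comap f).subschemeι ≫ φ = ρ ≫ q ≫ φ := by
    rw [hj, hρ, ← Category.assoc, ← pullback.condition, Category.assoc]
  have hρker : RingHom.ker ρ.appTop.hom = Ideal.span {b} := by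
    rw [← hbI (isAffineOpen_top _), Scheme.IdealSheafData.comap_comp]
    refine (Scheme.Hom.ker_apply ρ ⟨⊤, isAffineOpen_top _⟩).symm.trans ?_
    rw [hρ, Scheme.IdealSheafData.ker_fst_of_isClosedImmersion,
      Scheme.IdealSheafData.ker_subschemeι]
  rw [← hρker, RingHom.mem_ker]
  by_cases hpi : IsUnit (p i)
  · have hjr : j.opensRange = ((I.comap f).subschemeι ≫ φ) ⁻¹ᵁ
        Proj.basicOpen _ (SymmetricAlgebra.ι V _ (hI.mulX ℓ i)) := by
      rw [hjq, hq, Scheme.Hom.comp_preimage]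
    have hz₁ : ⊤ ≤ (ρ ≫ q ≫ φ) ⁻¹ᵁ
        Proj.basicOpen _ (SymmetricAlgebra.ι V _ (hI.mulX ℓ i)) := fun y _ =>
      hz (show ρ y ∈ (⊤ : Y.Opens) from trivial)
    have hz₂ := hz₁
    rw [← hcond] at hz₂
    obtain ⟨h1, h2⟩ := hlin.noZeroDivisors (hI.mulX ℓ i)
      (hI.mulC hr (MvPolynomial.X i ^ 2) (MvPolynomial.isHomogeneous_X_pow i 2)) j hjr hz₂
    have h3 : ρ.appTop.hom w * ρ.appTop.hom r = 0 := by
      rw [← map_mul, ← hsr, map_mul]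
      have h4 : b ∈ RingHom.ker ρ.appTop.hom := hρker ▸ Ideal.mem_span_singleton_self b
      rw [RingHom.mem_ker.mp h4, mul_zero]
    refine (mul_eq_zero.mp h3).elim (fun h4 => ?_) id
    rcases h2 (((RingHom.congr_fun (coords_congr hcond (ι_mem_symGrading _) hz₂ hz₁) _).trans
      (RingHom.congr_fun (coords_comp (q ≫ φ) (ι_mem_symGrading _) hz ρ hz₁) _)).trans
      ((congrArg ρ.appTop.hom hw).trans h4)) with h5 | h5
    · exact Subsingleton.elim _ _
    · obtain ⟨y, hy, hyD⟩ := hI.exists_mem_support_mem_basicOpen hφ₀ hf hφ hϖ hϖ0 hr hpi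
      rw [← SetLike.mem_coe, ← Scheme.IdealSheafData.range_subschemeι] at hy
      obtain ⟨y, rfl⟩ := hy
      exact absurd hyD (h5 y)
  -- Here the chart misses the point: `x_i` belongs to its ideal and equals `1`, so `b` generates
  -- the unit ideal.
  · have h1 : MvPolynomial.X i ∈ twistedSections I 1 :=
      hI.mem_twistedSections_iff.mpr ⟨MvPolynomial.isHomogeneous_X V i, by
        rw [MvPolynomial.eval_X]; exact hpi⟩
    have hi := h.comp_le_chart q ℓ i hz
    have h2 : (1 : Γ(Y, ⊤)) ∈ RingHom.ker ρ.appTop.hom := by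
      rw [hρker, ← hbI (isAffineOpen_top _), hI.comap_ideal_top (q ≫ f) i hi]
      exact Ideal.subset_span ⟨_, h1, coordsX_self _ _ _⟩
    have h3 := Ideal.mul_mem_left _ r h2
    rwa [mul_one, RingHom.mem_ker] at h3

section Hyperplane

variable {P : Spec (.of (ResidueField V)) ⟶ ProjSpace n (ResidueField V)}
  {hI : IsPointIdeal (idealOfPoint P) p}

lemma coords_mulC_eq_zero_of_comp_specialHyperplane_eq {ϖ : V} (hr : ϖ ∈ maximalIdeal V)
    (G : MvPolynomial (Fin (n + 1)) V) (hG : G.IsHomogeneous 2) {Y Z : Scheme.{u}}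
    {q : Y ⟶ ProjModule V (quadrics P)} (m : quadrics P)
    (hz : ⊤ ≤ q ⁻¹ᵁ Proj.basicOpen _ (SymmetricAlgebra.ι V _ m))
    (μ : Z ⟶ Y) (g : Z ⟶ ProjModule (ResidueField V) (specialQuadrics P))
    (hfac : μ ≫ q = g ≫ specialHyperplane P) :
    μ.appTop.hom (coords q (ι_mem_symGrading _) hz
      (SymmetricAlgebra.ι V _ (hI.mulC hr G hG))) = 0 := by
  have hz₁ : ⊤ ≤ (μ ≫ q) ⁻¹ᵁ Proj.basicOpen _ (SymmetricAlgebra.ι V _ m) := fun y _ =>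
    hz (show μ y ∈ (⊤ : Y.Opens) from trivial)
  have hz₂ : ⊤ ≤ (g ≫ specialHyperplane P) ⁻¹ᵁ
      Proj.basicOpen _ (SymmetricAlgebra.ι V _ m) := hfac ▸ hz₁
  have h0 : reduction P (hI.mulC hr G hG) = 0 := Subtype.ext (by
    change MvPolynomial.map (algebraMap V (ResidueField V)) (MvPolynomial.C ϖ * G) = 0
    have h2 : algebraMap V (ResidueField V) ϖ = 0 := (residue_eq_zero_iff ϖ).mpr hr
    rw [map_mul, MvPolynomial.map_C, h2, map_zero, zero_mul])
  refine Eq.trans ?_ ((coords_specialHyperplane g _ hz₂).2 _ h0)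
  exact (RingHom.congr_fun (coords_comp q (ι_mem_symGrading _) hz μ hz₁) _).symm.trans
    (RingHom.congr_fun (coords_congr hfac (ι_mem_symGrading _) hz₁ hz₂) _)

lemma exists_appTop_eq_zero_iff {Y : Scheme.{u}} [IsAffine Y] (J : Ideal Γ(Y, ⊤)) :
    ∃ (Z : Scheme.{u}) (k : Z ⟶ Y), ∀ y, k.appTop.hom y = 0 ↔ y ∈ J := by
  refine ⟨_, Spec.map (CommRingCat.ofHom (Ideal.Quotient.mk J)) ≫ Y.isoSpec.inv, fun y => ?_⟩
  rw [← Ideal.Quotient.eq_zero_iff_mem]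
  have h1 := congr($(appTop_map_isoSpec_inv (CommRingCat.ofHom (Ideal.Quotient.mk J))).hom y)
  refine (Eq.congr_left h1).trans ?_
  exact map_eq_zero_iff _ (ConcreteCategory.bijective_of_isIso (Scheme.ΓSpecIso _).inv).1

lemma appTop_eq_zero_of_comp {X Y Z : Scheme.{u}} {l : Z ⟶ X} {μ : X ⟶ Y} {k : Z ⟶ Y}
    (h : l ≫ μ = k) {x : Γ(Y, ⊤)} (hx : μ.appTop.hom x = 0) : k.appTop.hom x = 0 := by
  rw [← h, Scheme.Hom.comp_appTop]
  exact (congrArg l.appTop.hom hx).trans (map_zero _)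

/-- The closed subscheme `w = 0` maps into the special hyperplane, hence into the fibre product. A
function vanishing on the latter therefore vanishes where `w = 0`. -/
lemma IsQuadricModel.mem_span_of_appTop_eq_zero {B : Scheme.{u}} {f : B ⟶ ProjSpace n V}
    {φ : B ⟶ ProjModule V (quadrics P)} (h : IsQuadricModel hI f φ) {Y : Scheme.{u}} [IsAffine Y]
    (q : Y ⟶ B) (ℓ : twistedSections (idealOfPoint P) 1) (i : Fin (n + 1))
    (hz : ⊤ ≤ (q ≫ φ) ⁻¹ᵁ Proj.basicOpen _ (SymmetricAlgebra.ι V _ (hI.mulX ℓ i)))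
    {ϖ : V} (hϖ : maximalIdeal V = Ideal.span {ϖ}) (hr : ϖ ∈ maximalIdeal V) {w : Γ(Y, ⊤)}
    (hw : coords (q ≫ φ) (ι_mem_symGrading _) hz (SymmetricAlgebra.ι V _
      (hI.mulC hr (MvPolynomial.X i ^ 2) (MvPolynomial.isHomogeneous_X_pow i 2))) = w)
    {x : Γ(Y, ⊤)}
    (hx : (pullback.fst q (pullback.fst φ (specialHyperplane P))).appTop.hom x = 0) :
    x ∈ Ideal.span {w} := by
  obtain ⟨Z, k, hk⟩ := exists_appTop_eq_zero_iff (Ideal.span {w})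
  have hzk : ⊤ ≤ ((k ≫ q) ≫ φ) ⁻¹ᵁ
      Proj.basicOpen _ (SymmetricAlgebra.ι V _ (hI.mulX ℓ i)) := fun y _ =>
    hz (show k y ∈ (⊤ : Y.Opens) from trivial)
  have hzk' : ⊤ ≤ (k ≫ q ≫ φ) ⁻¹ᵁ
      Proj.basicOpen _ (SymmetricAlgebra.ι V _ (hI.mulX ℓ i)) := fun y _ =>
    hz (show k y ∈ (⊤ : Y.Opens) from trivial)
  have hkw := (((RingHom.congr_fun (coords_congr (Category.assoc k q φ) (ι_mem_symGrading _) hzk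
      hzk') (SymmetricAlgebra.ι V _
      (hI.mulC hr (MvPolynomial.X i ^ 2) (MvPolynomial.isHomogeneous_X_pow i 2)))).trans
      (RingHom.congr_fun (coords_comp (q ≫ φ) (ι_mem_symGrading _) hz k hzk') _)).trans
      (congrArg k.appTop.hom hw)).trans ((hk w).mpr (Ideal.mem_span_singleton_self w))
  obtain ⟨g, hg⟩ := h.exists_comp_specialHyperplane_eq (k ≫ q) ℓ i hzk hϖ hr hkw
  exact (hk x).mp (appTop_eq_zero_of_comp (pullback.lift_fst (f := q)
    (g := pullback.fst φ (specialHyperplane P)) k (pullback.lift (k ≫ q) g hg.symm)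
    (pullback.lift_fst _ _ _).symm) hx)

lemma IsQuadricModel.appTop_pullback_eq_zero_iff {B : Scheme.{u}} {f : B ⟶ ProjSpace n V}
    {φ : B ⟶ ProjModule V (quadrics P)} (h : IsQuadricModel hI f φ) {Y : Scheme.{u}} [IsAffine Y]
    (q : Y ⟶ B) (ℓ : twistedSections (idealOfPoint P) 1) (i : Fin (n + 1))
    (hz : ⊤ ≤ (q ≫ φ) ⁻¹ᵁ Proj.basicOpen _ (SymmetricAlgebra.ι V _ (hI.mulX ℓ i)))
    {ϖ : V} (hϖ : maximalIdeal V = Ideal.span {ϖ}) (hr : ϖ ∈ maximalIdeal V) {w : Γ(Y, ⊤)}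
    (hw : coords (q ≫ φ) (ι_mem_symGrading _) hz (SymmetricAlgebra.ι V _
      (hI.mulC hr (MvPolynomial.X i ^ 2) (MvPolynomial.isHomogeneous_X_pow i 2))) = w)
    (x : Γ(Y, ⊤)) :
    (pullback.fst q (pullback.fst φ (specialHyperplane P))).appTop.hom x = 0 ↔
      x ∈ Ideal.span {w} := by
  refine ⟨h.mem_span_of_appTop_eq_zero q ℓ i hz hϖ hr hw, fun hx => ?_⟩
  rw [Ideal.mem_span_singleton] at hx
  obtain ⟨r, rfl⟩ := hx
  have hfac : pullback.fst q (pullback.fst φ (specialHyperplane P)) ≫ q ≫ φ =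
      (pullback.snd _ _ ≫ pullback.snd _ _) ≫ specialHyperplane P := by
    rw [Category.assoc, ← pullback.condition, ← Category.assoc, pullback.condition,
      Category.assoc]
  have h0 := coords_mulC_eq_zero_of_comp_specialHyperplane_eq (hI := hI) hr
    (MvPolynomial.X i ^ 2) (MvPolynomial.isHomogeneous_X_pow i 2) _ hz _ _ hfac
  rw [hw] at h0
  exact (map_mul _ _ _).trans ((congrArg (· * _) h0).trans (zero_mul _))

end Hyperplane

end HyperplaneSection

section HyperplaneSectionBlowup

variable {V : Type u} [CommRing V] [IsDomain V] [IsLocalRing V] {n : ℕ} {p : Fin (n + 1) → V}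
  {P : Spec (.of (ResidueField V)) ⟶ ProjSpace n (ResidueField V)}
  {hI : IsPointIdeal (idealOfPoint P) p}

/-- On the intersection with the special hyperplane the exceptional divisor is invertible. -/
theorem IsQuadricModel.isInvertibleIdeal_pullback
    {φ₀ : (suppCompl (idealOfPoint P)).toScheme ⟶ ProjModule V (quadrics P)}
    (hφ₀ : IsGivenByForms (quadrics P) (suppCompl (idealOfPoint P)).ι φ₀)
    {ϖ : V} (hϖ : maximalIdeal V = Ideal.span {ϖ}) (hϖ0 : ϖ ≠ 0) (hr : ϖ ∈ maximalIdeal V)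
    {B : Scheme.{u}} {f : B ⟶ ProjSpace n V} (hf : IsBlowup f (idealOfPoint P))
    {φ : B ⟶ ProjModule V (quadrics P)} (hφ : Extends f φ₀ φ) [IsClosedImmersion φ]
    (h : IsQuadricModel hI f φ)
    (hlin : IsLinearSubvariety (((idealOfPoint P).comap f).subschemeι ≫ φ)) :
    IsInvertibleIdeal ((idealOfPoint P).comap (pullback.fst φ (specialHyperplane P) ≫ f)) := by
  have hcl : IsClosedImmersion (specialHyperplane P) :=
    isClosedImmersion_projModuleMap residue_surjective _ _
  refine isInvertibleIdeal_of_forall_exists fun z => ?_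
  obtain ⟨ℓ, i, hz⟩ := hI.exists_mem_basicOpen_mulX
    (φ (pullback.fst φ (specialHyperplane P) z))
  obtain ⟨O, hO⟩ : ∃ O : B.affineOpens, O.1 = φ ⁻¹ᵁ Proj.basicOpen _
      (SymmetricAlgebra.ι V _ (hI.mulX ℓ i)) :=
    ⟨⟨_, (Proj.isAffineOpen_basicOpen _ _ (ι_mem_symGrading _) one_pos).preimage φ⟩, rfl⟩
  have hzO : pullback.fst φ (specialHyperplane P) z ∈ O.1 := hO ▸ hz
  have hOle : ⊤ ≤ (O.1.ι ≫ φ) ⁻¹ᵁ Proj.basicOpen _ (SymmetricAlgebra.ι V _ (hI.mulX ℓ i)) :=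
    fun y _ => hO.le y.2
  have : IsAffine O.1.toScheme := O.2
  let c := coords (O.1.ι ≫ φ) (ι_mem_symGrading _) hOle
  let b := c (SymmetricAlgebra.ι V _ (hI.mulForm ℓ ℓ.1 ℓ.2.1))
  let T := hI.mulC hr (MvPolynomial.X i ^ 2) (MvPolynomial.isHomogeneous_X_pow i 2)
  let w := c (SymmetricAlgebra.ι V _ T)
  have hb : ∀ h', ((idealOfPoint P).comap (O.1.ι ≫ f)).ideal ⟨⊤, h'⟩ = Ideal.span {b} :=
    h.comap_ideal O.1.ι ℓ i hOle
  have hb₀ : b ∈ nonZeroDivisors Γ(O.1.toScheme, ⊤) :=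
    hf.isInvertibleIdeal.comap_ideal_ι_mem_nonZeroDivisors (by
      rw [← Scheme.IdealSheafData.comap_comp]
      exact hb)
  have hker := h.appTop_pullback_eq_zero_iff O.1.ι ℓ i hOle hϖ hr (w := w) rfl
  have hsr : ∀ s r, s * b = w * r → r ∈ Ideal.span {b} := fun s r hsr =>
    h.mem_span_of_mul_eq_mul hφ₀ hϖ hϖ0 hr hf hφ hlin ℓ i O.1.ι
      (by rw [Scheme.Opens.opensRange_ι, hO]) hOle rfl rfl hsr
  clear_value b w
  obtain ⟨μ, hμ⟩ : ∃ μ : pullback O.1.ι (pullback.fst φ (specialHyperplane P)) ⟶ O.1.toScheme,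
    μ = pullback.fst _ _ := ⟨_, rfl⟩
  have hμc : IsClosedImmersion μ := by rw [hμ]; infer_instance
  rw [← hμ] at hker
  obtain ⟨hμ₁, hμ₂⟩ := IsClosedImmersion.isAffine_surjective_of_isAffine μ
  refine ⟨_, pullback.snd O.1.ι (pullback.fst φ (specialHyperplane P)), inferInstance,
    hμ₁, μ.appTop.hom b, ?_, ?_, ?_⟩
  · rw [Scheme.Hom.opensRange_pullbackSnd, Scheme.Opens.opensRange_ι]
    exact hzO
  · rw [mem_nonZeroDivisors_iff_right]
    intro y hy
    obtain ⟨s, rfl⟩ := hμ₂ y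
    -- If `s b = w r`, then `r = b r'` by linearity of the exceptional divisor. Cancelling the
    -- nonzerodivisor `b` gives `s = w r'`, so `s` vanishes on the section.
    have h1 := (hker (s * b)).mp ((map_mul μ.appTop.hom s b).trans hy)
    rw [Ideal.mem_span_singleton] at h1
    obtain ⟨r, hr'⟩ := h1
    have h2 := hsr s r hr'
    rw [Ideal.mem_span_singleton] at h2
    obtain ⟨r', rfl⟩ := h2
    have h3 : (s - w * r') * b = 0 := by
      rw [sub_mul, hr']; ring
    have h4 := sub_eq_zero.mp (mem_nonZeroDivisors_iff_right.mp hb₀ _ h3)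
    exact (hker s).mpr (Ideal.mem_span_singleton.mpr ⟨r', h4⟩)
  · rw [← Scheme.IdealSheafData.comap_comp]
    refine comap_ideal_eq_span_of_eq (hb (isAffineOpen_top _)) μ ?_
    rw [hμ, ← Category.assoc, ← pullback.condition, Category.assoc]

/-- The intersection with the special hyperplane is the blow-up of the special fibre. -/
theorem IsQuadricModel.exists_isBlowup_pullback
    (hP : P ≫ ProjSpace.toSpec n (ResidueField V) = 𝟙 _)
    {φ₀ : (suppCompl (idealOfPoint P)).toScheme ⟶ ProjModule V (quadrics P)}
    (hφ₀ : IsGivenByForms (quadrics P) (suppCompl (idealOfPoint P)).ι φ₀)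
    {ϖ : V} (hϖ : maximalIdeal V = Ideal.span {ϖ}) (hϖ0 : ϖ ≠ 0)
    {B : Scheme.{u}} {f : B ⟶ ProjSpace n V} (hf : IsBlowup f (idealOfPoint P))
    {φ : B ⟶ ProjModule V (quadrics P)} (hφ : Extends f φ₀ φ) [IsClosedImmersion φ]
    (h : IsQuadricModel hI f φ)
    (hlin : IsLinearSubvariety (((idealOfPoint P).comap f).subschemeι ≫ φ)) :
    ∃ b : pullback φ (specialHyperplane P) ⟶ ProjSpace n (ResidueField V),
      b ≫ ProjSpace.map n V (ResidueField V) =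
        pullback.fst φ (specialHyperplane P) ≫ f ∧ IsBlowup b P.ker := by
  have hcl : IsClosedImmersion (specialHyperplane P) :=
    isClosedImmersion_projModuleMap residue_surjective _ _
  have hm := projSpaceMap_isClosedImmersion n V (S := ResidueField V) residue_surjective
  have hPc := isClosedImmersion_point P hP
  have hr : ϖ ∈ maximalIdeal V := hϖ ▸ Ideal.mem_span_singleton_self ϖ
  obtain ⟨b, hb⟩ := h.exists_comp_projSpaceMap_eq (pullback.fst φ (specialHyperplane P))
    (pullback.snd φ (specialHyperplane P)) pullback.condition.symm
  -- The ideal of `P` in `ℙⁿ_k` is the inverse image of the one in `ℙⁿ_V`, so invertibility may be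
  -- tested after composing with the closed immersion into `ℙⁿ_V`.
  have hker : ∀ {Y : Scheme.{u}} (g : Y ⟶ ProjSpace n (ResidueField V)),
      P.ker.comap g = (idealOfPoint P).comap (g ≫ ProjSpace.map n V (ResidueField V)) :=
    fun g => by
      rw [Scheme.IdealSheafData.comap_comp, idealOfPoint, comap_ker_of_mono]
  refine ⟨b, hb, ⟨?_, fun {Y} g hg => ?_⟩⟩
  · rw [hker, hb]
    exact h.isInvertibleIdeal_pullback hφ₀ hϖ hϖ0 hr hf hφ hlin
  · rw [hker] at hg
    obtain ⟨u, hu, huu⟩ := hf.existsUnique_lift _ hg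
    rw [← hu] at hg
    -- The lift to the blow-up of `ℙⁿ_V` of a morphism over the special fibre lands in the special
    -- hyperplane, and so in the section.
    obtain ⟨v, hv⟩ := hI.exists_comp_specialHyperplane_eq hφ₀ hφ u g hu.symm hg
    refine ⟨pullback.lift u v hv.symm, ?_, fun k hk => ?_⟩
    · dsimp only
      rw [← cancel_mono (ProjSpace.map n V (ResidueField V)), Category.assoc, hb,
        ← Category.assoc, pullback.lift_fst, hu]
    · have h1 : k ≫ pullback.fst φ (specialHyperplane P) = u := huu _ (by
        dsimp only
        rw [Category.assoc, ← hb, ← Category.assoc, hk])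
      rw [← cancel_mono (pullback.fst φ (specialHyperplane P)), h1, pullback.lift_fst]

end HyperplaneSectionBlowup

end

open IsLocalRing

/-! ### Assembling the statements over a discrete valuation ring -/

section DiscreteValuationRing

variable {V : Type u} [CommRing V] [IsDomain V] [IsDiscreteValuationRing V] {n : ℕ}
  {P : Spec (.of (ResidueField V)) ⟶ ProjSpace n (ResidueField V)}

/-- The morphism from the blow-up of projective space at a point of the special fibre. -/
theorem exists_closedImmersion_of_isBlowup [Infinite (ResidueField V)]
    (hP : P ≫ ProjSpace.toSpec n (ResidueField V) = 𝟙 _)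
    {φ₀ : (complPoint P).toScheme ⟶ ProjModule V (quadrics P)}
    (hφ₀ : IsGivenByForms (quadrics P) (complPoint P).ι φ₀)
    {B : Scheme.{u}} (f : B ⟶ ProjSpace n V) (hf : IsBlowup f (idealOfPoint P)) :
    ∃ φ : B ⟶ ProjModule V (quadrics P), IsClosedImmersion φ ∧ Extends f φ₀ φ ∧
      (∀ φ' : B ⟶ ProjModule V (quadrics P), Extends f φ₀ φ' → φ' = φ) ∧
      (∃ b : pullback φ (specialHyperplane P) ⟶ ProjSpace n (ResidueField V),
        b ≫ ProjSpace.map n V (ResidueField V) =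
          pullback.fst φ (specialHyperplane P) ≫ f ∧ IsBlowup b P.ker) ∧
      IsLinearSubvariety (exceptionalDivisor f (idealOfPoint P) ≫ φ) := by
  obtain ⟨p, hI⟩ := exists_isPointIdeal P hP
  -- Projective space is treated as its own subscheme by the identity immersion. It is regular
  -- because a discrete valuation ring is.
  have hid : (idealOfPoint P).comap (𝟙 (ProjSpace n V)) = idealOfPoint P :=
    Scheme.IdealSheafData.comap_id _
  have hf' : IsBlowup f ((idealOfPoint P).comap (𝟙 _)) := by rwa [hid]
  obtain ⟨φ, -, hcl, hext, hmod, hE⟩ := hI.exists_immersion hP hφ₀ (𝟙 _)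
    (P ≫ ProjSpace.map n V (ResidueField V)) (Category.comp_id _) f hf'
  have hcl := hcl inferInstance
  have hlin := hI.isLinearSubvariety_of_isRegularLocalRing hP hφ₀
    (P ≫ ProjSpace.map n V (ResidueField V)) (Category.comp_id _) hf' hext
  rw [hid] at hlin
  rw [Category.comp_id] at hext hmod
  obtain ⟨ϖ, hϖ⟩ := IsDiscreteValuationRing.exists_irreducible V
  exact ⟨φ, hcl, hext, fun φ' h' => hext.eq hf.isInvertibleIdeal h',
    hmod.exists_isBlowup_pullback hP hφ₀ hϖ.maximalIdeal_eq hϖ.ne_zero hf hext hlin, hlin⟩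

/-- The morphism from the blow-up of a subscheme of projective space at a closed point of the
special fibre. -/
theorem exists_immersion_of_isBlowup [Infinite (ResidueField V)]
    (hP : P ≫ ProjSpace.toSpec n (ResidueField V) = 𝟙 _)
    {φ₀ : (complPoint P).toScheme ⟶ ProjModule V (quadrics P)}
    (hφ₀ : IsGivenByForms (quadrics P) (complPoint P).ι φ₀)
    {X : Scheme.{u}} (i : X ⟶ ProjSpace n V) [IsImmersion i] (κ : Spec (.of (ResidueField V)) ⟶ X)
    (hκ : κ ≫ i = P ≫ ProjSpace.map n V (ResidueField V)) {J : X.IdealSheafData}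
    (hJ : (idealOfPoint P).comap i = J) {B : Scheme.{u}} (f : B ⟶ X) (hf : IsBlowup f J) :
    ∃ φ : B ⟶ ProjModule V (quadrics P), IsImmersion φ ∧ Extends (f ≫ i) φ₀ φ ∧
      (∀ φ' : B ⟶ ProjModule V (quadrics P), Extends (f ≫ i) φ₀ φ' → φ' = φ) ∧
      (IsRegularLocalRing (X.presheaf.stalk (κ (closedPoint (ResidueField V)))) →
        IsLinearSubvariety (exceptionalDivisor f J ≫ φ)) := by
  subst hJ
  obtain ⟨p, hI⟩ := exists_isPointIdeal P hP
  obtain ⟨φ, himm, -, hext, -, hE⟩ := hI.exists_immersion hP hφ₀ i κ hκ f hf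
  refine ⟨φ, himm, hext, fun φ' h' => hext.eq ?_ h', fun hreg =>
    hI.isLinearSubvariety_of_isRegularLocalRing hP hφ₀ κ hκ hf hext⟩
  rw [Scheme.IdealSheafData.comap_comp]
  exact hf.isInvertibleIdeal

/-- A closed point of the special fibre of a subscheme of projective space, as a rational point. -/
lemma exists_point_of_isImmersion [IsAlgClosed (ResidueField V)] {X : Scheme.{u}}
    (i : X ⟶ ProjSpace n V) [IsImmersion i] (x : X) (hx : IsClosed ({x} : Set X))
    (hs : (i ≫ ProjSpace.toSpec n V) x = closedPoint V) :
    ∃ (P : Spec (.of (ResidueField V)) ⟶ ProjSpace n (ResidueField V))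
      (κ : Spec (.of (ResidueField V)) ⟶ X),
      P ≫ ProjSpace.toSpec n (ResidueField V) = 𝟙 _ ∧
      κ ≫ i = P ≫ ProjSpace.map n V (ResidueField V) ∧
      κ (closedPoint (ResidueField V)) = x ∧
      (idealOfPoint P).comap i = (X.fromSpecResidueField x).ker := by
  obtain ⟨a, ha⟩ := exists_point_of_isClosed (i ≫ ProjSpace.toSpec n V) x hx hs
  obtain ⟨P, hP, hPκ⟩ := exists_rationalPoint ((a.hom ≫ X.fromSpecResidueField x) ≫ i)
    (by rw [Category.assoc, Category.assoc, ha])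
  have hcl := isClosedImmersion_point P hP
  have hcl' := hcl
  rw [hPκ] at hcl'
  refine ⟨P, a.hom ≫ X.fromSpecResidueField x, hP, hPκ.symm, ?_, ?_⟩
  · exact (Scheme.Hom.comp_apply _ _ _).trans (Scheme.fromSpecResidueField_apply x _)
  · rw [idealOfPoint, hPκ, comap_ker_of_mono]
    exact Scheme.Hom.ker_comp_of_isIso _ _

end DiscreteValuationRing

end PointBlowup

end

theorem mainTheorem10 (V : Type u) [CommRing V] [IsDomain V] [IsDiscreteValuationRing V]
    [IsAdicComplete (IsLocalRing.maximalIdeal V) V] [IsAlgClosed (IsLocalRing.ResidueField V)]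
    (n : ℕ) :
    -- The blow-up of projective space at a point `P ∈ ℙⁿ(k)`
    (∀ P : Spec (.of (IsLocalRing.ResidueField V)) ⟶
        PointBlowup.ProjSpace n (IsLocalRing.ResidueField V),
      P ≫ PointBlowup.ProjSpace.toSpec n (IsLocalRing.ResidueField V) = 𝟙 _ →
      -- the blow-up exists
      (∃ (B : Scheme.{u}) (f : B ⟶ PointBlowup.ProjSpace n V),
        PointBlowup.IsBlowup f (PointBlowup.idealOfPoint P)) ∧
      -- the canonical morphism `φ₀ : ℙⁿ_V ∖ {P} ⟶ ℙ(Γ(ℐ_P(2)))`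
      ∃ φ₀ : (PointBlowup.complPoint P).toScheme ⟶
          PointBlowup.ProjModule V (PointBlowup.quadrics P),
        PointBlowup.IsGivenByForms (PointBlowup.quadrics P) (PointBlowup.complPoint P).ι φ₀ ∧
        ∀ (B : Scheme.{u}) (f : B ⟶ PointBlowup.ProjSpace n V),
          PointBlowup.IsBlowup f (PointBlowup.idealOfPoint P) →
          ∃ φ : B ⟶ PointBlowup.ProjModule V (PointBlowup.quadrics P),
            -- `φ` is a closed immersion, and the unique morphism extending `φ₀`
            IsClosedImmersion φ ∧
            PointBlowup.Extends f φ₀ φ ∧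
            (∀ φ' : B ⟶ PointBlowup.ProjModule V (PointBlowup.quadrics P),
              PointBlowup.Extends f φ₀ φ' → φ' = φ) ∧
            -- the intersection with `ℙ(Γ(ℐ_P(2)·𝒪))` is the blow-up of `ℙⁿ_k` at `P`
            (∃ b : pullback φ (PointBlowup.specialHyperplane P) ⟶
                PointBlowup.ProjSpace n (IsLocalRing.ResidueField V),
              b ≫ PointBlowup.ProjSpace.map n V (IsLocalRing.ResidueField V) =
                pullback.fst φ (PointBlowup.specialHyperplane P) ≫ f ∧
              PointBlowup.IsBlowup b P.ker) ∧
            -- the exceptional divisor is mapped onto a linear subvariety of `ℙ(Γ(ℐ_P(2))) ⊗ k`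
            PointBlowup.IsLinearSubvariety
              (PointBlowup.exceptionalDivisor f (PointBlowup.idealOfPoint P) ≫ φ)) ∧
    -- The blow-up of a subscheme `X` of `ℙⁿ_V` at a closed point `x` of its special fibre
    (∀ (X : Scheme.{u}) (i : X ⟶ PointBlowup.ProjSpace n V) [IsImmersion i] (x : X),
      IsClosed ({x} : Set X) →
      (i ≫ PointBlowup.ProjSpace.toSpec n V) x = IsLocalRing.closedPoint V →
      -- the blow-up exists
      (∃ (B : Scheme.{u}) (f : B ⟶ X),
        PointBlowup.IsBlowup f (X.fromSpecResidueField x).ker) ∧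
      -- `P ∈ ℙⁿ(k)` is the image of `x` and `φ₀` is as above
      ∃ P : Spec (.of (IsLocalRing.ResidueField V)) ⟶
          PointBlowup.ProjSpace n (IsLocalRing.ResidueField V),
        P ≫ PointBlowup.ProjSpace.toSpec n (IsLocalRing.ResidueField V) = 𝟙 _ ∧
        (P ≫ PointBlowup.ProjSpace.map n V (IsLocalRing.ResidueField V))
          (IsLocalRing.closedPoint (IsLocalRing.ResidueField V)) = i x ∧
        ∃ φ₀ : (PointBlowup.complPoint P).toScheme ⟶
            PointBlowup.ProjModule V (PointBlowup.quadrics P),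
          PointBlowup.IsGivenByForms (PointBlowup.quadrics P) (PointBlowup.complPoint P).ι φ₀ ∧
          ∀ (B : Scheme.{u}) (f : B ⟶ X),
            PointBlowup.IsBlowup f (X.fromSpecResidueField x).ker →
            ∃ φ : B ⟶ PointBlowup.ProjModule V (PointBlowup.quadrics P),
              IsImmersion φ ∧
              PointBlowup.Extends (f ≫ i) φ₀ φ ∧
              (∀ φ' : B ⟶ PointBlowup.ProjModule V (PointBlowup.quadrics P),
                PointBlowup.Extends (f ≫ i) φ₀ φ' → φ' = φ) ∧
              (IsRegularLocalRing (X.presheaf.stalk x) →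
                PointBlowup.IsLinearSubvariety
                  (PointBlowup.exceptionalDivisor f (X.fromSpecResidueField x).ker ≫ φ))) := by
  refine ⟨fun P hP => ?_, fun X i _ x hx hs => ?_⟩
  · obtain ⟨p, hI⟩ := PointBlowup.exists_isPointIdeal P hP
    obtain ⟨φ₀, hφ₀⟩ := hI.exists_isGivenByForms
    obtain ⟨B, f, _, hf, _⟩ := hI.exists_isBlowup_isClosedImmersion hφ₀
    exact ⟨⟨B, f, hf⟩, φ₀, hφ₀, fun B f hf =>
      PointBlowup.exists_closedImmersion_of_isBlowup hP hφ₀ f hf⟩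
  · obtain ⟨P, κ, hP, hκ, hκx, hJ⟩ := PointBlowup.exists_point_of_isImmersion i x hx hs
    obtain ⟨p, hI⟩ := PointBlowup.exists_isPointIdeal P hP
    obtain ⟨φ₀, hφ₀⟩ := hI.exists_isGivenByForms
    obtain ⟨_, _, _, _, _, _, _, B, t, _, hB⟩ := hI.exists_isBlowup_comap hφ₀ i
    refine ⟨⟨B, _, hJ ▸ hB⟩, P, hP, ?_, φ₀, hφ₀, fun B f hf => ?_⟩
    · rw [← hκ]
      exact (AlgebraicGeometry.Scheme.Hom.comp_apply _ _ _).trans (congrArg i hκx)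
    · subst hκx
      exact PointBlowup.exists_immersion_of_isBlowup hP hφ₀ i κ hκ hJ f hf
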